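/- Let $q=e^{2\pi i\tau}$, $\tau\in\mathbb{H}$, $f'=\frac{1}{2\pi i}\frac{df}{d\tau}$, and let $E_2,E_4,E_6$ be the normalized Eisenstein series and $\eta$ the Dedekind eta function. For $x,y\in\mathbb{C}$ consider the third order monic modular linear differential equation $$L_{x,y}:\qquad f'''-\tfrac12E_2f''+\bigl(\tfrac12E_2'+xE_4\bigr)f'+yE_6f=0$$ for holomorphic $f:\mathbb{H}\to\mathbb{C}$; its indicial equation is $t^3-\tfrac12t^2+xt+y=0$. **Classification ($c=4$).** Suppose $L_{x,y}$ has a solution $f=q^{-1/6}(1+m_1q+m_2q^2+\cdots)$ such that $m_1,m_2$ are nonnegative integers (in particular, if all coefficients are nonnegative integers), and suppose that all indicial roots are rational. Then $m_1\in\{16,24,28,156,178,271\}$, and $m_1$, $m_2$, $(x,y)$ and the indicial roots (with multiplicity) are one of | $m_1$ | $m_2$ | $(x,y)$ | indicial roots | |---|---|---|---| | 16 | 98 | $(-\frac1{36},\frac1{72})$ | $-\frac16,\frac16,\frac12$ | | 24 | 124 | $(-\frac1{100},\frac{91}{5400})$ | $-\frac16,\frac7{30},\frac{13}{30}$ | |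 28 | 134 | $(0,\frac1{54})$ | $-\frac16,\frac13,\frac13$ | | 156 | 6790 | $(-1,-\frac4{27})$ | $-\frac23,-\frac16,\frac43$ | | 178 | 4634 | $(-\frac{25}{36},-\frac7{72})$ | $-\frac12,-\frac16,\frac76$ | | 271 | 4076 | $(-\frac{81}{196},-\frac{533}{10584})$ | $-\frac{13}{42},-\frac16,\frac{41}{42}$ | **Modular forms.** Put $H_2(\tau)=2E_2(2\tau)-E_2(\tau)$, $\Delta_2(\tau)=\eta(2\tau)^8/\eta(\tau)^4$, $\Delta_{2A}(\tau)=\eta(\tau)^8\eta(2\tau)^8$, $I_3=1+6\sum_{n\ge1}\bigl(\sum_{d\mid n}(\frac d3)\bigr)q^n$, $\Delta_3(\tau)=\eta(3\tau)^3/\eta(\tau)$, $\Delta_{3A}(\tau)=\eta(\tau)^6\eta(3\tau)^6$, and $$\psi_1=q^{-1/60}\prod_{n>0,\ n\equiv\pm1\,(5)}(1-q^n)^{-1},\qquad \psi_2=q^{11/60}\prod_{n>0,\ n\equiv\pm2\,(5)}(1-q^n)^{-1}.$$ Then $H_2,\Delta_2$ are modular forms of weight 2 on $\Gamma(2)$;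 $I_3,\Delta_3$ are modular forms of weight 1 on $\Gamma(3)$; $\eta^4$ is a modular form of weight 2 on $\Gamma(6)$; $\Delta_{2A}$ and $\Delta_{3A}$ are cusp forms of weight 8 on $\Gamma_0(2)$ and of weight 6 on $\Gamma_0(3)$; $\psi_1,\psi_2$ are modular functions on $\Gamma(60)$. **Solutions.** In each case the following three functions form a basis of the space of solutions. * $m_1=16$: $I_3^2/\eta^4=q^{-1/6}(1+16q+98q^2+364q^3+1221q^4+\cdots)$, $I_3\Delta_3/\eta^4=q^{1/6}(1+11q+50q^2+188q^3+583q^4+\cdots)$, $\Delta_3^2/\eta^4=q^{1/2}(1+6q+27q^2+92q^3+279q^4+\cdots)$; these are modular functions on $\Gamma(6)$. * $m_1=24$: $\psi_1^{10}+14\psi_1^5\psi_2^5-\psi_2^{10}=q^{-1/6}(1+24q+124q^2+500q^3+1625q^4+4752q^5+\cdots)$, $\psi_1^3\psi_2^2(\psi_1^5+2\psi_2^5)=q^{7/30}(1+10q+44q^2+164q^3+505q^4+1414q^5+\cdots)$, $\psi_1^2\psi_2^3(\psi_1^5-\frac12\psi_2^5)=q^{13/30}(1+\frac{13}2q+30q^2+\frac{205}2q^3+314q^4+\frac{1713}2q^5+\cdots)$;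 these three series and $\psi_1^5-\psi_2^5$ have no negative coefficients. * $m_1=28$: $H_2/\eta^4=q^{-1/6}(1+28q+134q^2+568q^3+1809q^4+\cdots)$, $\Delta_2/\eta^4=q^{1/3}(1+8q+36q^2+128q^3+394q^4+\cdots)$ and the logarithmic solution $$16\Bigl(\frac{\Delta_2}{\eta^4}\int H_2\frac{dq}q-\frac{H_2}{\eta^4}\int_0^q\Delta_2\frac{dq}q\Bigr)=16(\log q)\frac{\Delta_2}{\eta^4}-q^{1/3}\Bigl(32+\frac{1664}3q+\frac{33856}{15}q^2+\cdots\Bigr),$$ where $\int H_2\frac{dq}q=\log q+\int_0^q(H_2-1)\frac{dq}q$ and $\log q=2\pi i\tau$. * $m_1=156$: $H_2\Delta_2(H_2^2+64\Delta_2^2)/\eta^{16}=q^{-1/6}(1+156q+6790q^2+142136q^3+1897233q^4+\cdots)$, $(H_2^4+384\Delta_{2A}+14304\Delta_2^4)/\eta^{16}=q^{-2/3}(1+496q+22616q^2+606656q^3+9782812q^4+\cdots)$, $\Delta_2^4/\eta^{16}=q^{4/3}(1+32q+528q^2+6016q^3+53384q^4+\cdots)$. * $m_1=178$: $I_3^2\Delta_3(I_3^3+135\Delta_3^3)/\eta^{12}=q^{-1/6}(1+178q+4634q^2+61924q^3+566277q^4+\cdots)$,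 $(I_3^6+270\Delta_{3A}+5832\Delta_3^6)/\eta^{12}=q^{-1/2}(1+318q+8514q^2+126862q^3+1269771q^4+\cdots)$, $I_3\Delta_3^5/\eta^{12}=q^{7/6}(1+23q+272q^2+2286q^3+15318q^4+\cdots)$. * $m_1=271$: series $q^{-1/6}(1+271q+4076q^2+30862q^3+\frac{5029533}{29}q^4+\cdots)$, $q^{-13/42}(1+\frac{1742}7q+\frac{188850}{49}q^2+\frac{10279088}{343}q^3+\cdots)$, $q^{41/42}(1+\frac{205}{14}q+\frac{5289}{49}q^2+\frac{5921425}{9947}q^3+\frac{186843109}{69629}q^4+\cdots)$. **Cases without a VOA.** For $m_1=28$ the space of solutions has no basis consisting of $q$-series $q^r\sum_{n\ge0}a_nq^n$ ($r,a_n\in\mathbb{C}$); hence there is no vertex operator algebra $V$ such that the characters $\sum_{n\ge0}\dim(M_{h+n})\,q^{h+n-c/24}$ of the simple $V$-modules $M$ span the space of solutions. For $m_1=271$ no solution has the form $q^r(1+a_1q+a_2q^2+\cdots)$ with $r\in\mathbb{C}$ and nonnegative integers $a_n$; hence the character $\sum_{n\ge0}\dim(V_n)\,q^{n-c/24}$ of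 a vertex operator algebra $V$ of CFT type (that is, $V=\bigoplus_{n\ge0}V_n$ and $V_0=\mathbb{C}\mathbf 1$) is never a solution. -/

import Mathlib

open UpperHalfPlane hiding I
open Complex
open scoped Real MatrixGroups CongruenceSubgroup Manifold

universe u v

noncomputable section

namespace MLDE

/-! ### Third order monic modular linear differential equations -/

/-- The derivation `(2πi)⁻¹ d/dτ = q d/dq` on functions on the upper half-plane. -/
abbrev D (f : ℍ → ℂ) : ℍ → ℂ := Derivative.normalizedDerivOfComplex f

/-- `f''' - (1/2) E₂ f'' + ((1/2) E₂' + x E₄) f' + y E₆ f`. -/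
def op (x y : ℂ) (f : ℍ → ℂ) : ℍ → ℂ := fun τ =>
  D (D (D f)) τ - 1 / 2 * EisensteinSeries.E2 τ * D (D f) τ
    + (1 / 2 * D EisensteinSeries.E2 τ + x * ModularForm.E₄ τ) * D f τ
    + y * ModularForm.E₆ τ * f τ

/-- The space of holomorphic solutions on `ℍ` of `op x y f = 0`. -/
def solutions (x y : ℂ) : Submodule ℂ (ℍ → ℂ) where
  carrier := {f | MDiff f ∧ op x y f = 0}
  zero_mem' := by
    have h0 : D (0 : ℍ → ℂ) = 0 := Derivative.normalizedDerivOfComplex_const 0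
    refine ⟨mdifferentiable_const, ?_⟩
    funext τ
    simp [op, h0]
  add_mem' := by
    rintro f g ⟨hf, hf0⟩ ⟨hg, hg0⟩
    refine ⟨hf.add hg, ?_⟩
    have hf1 := Derivative.normalizedDerivOfComplex_mdifferentiable hf
    have hg1 := Derivative.normalizedDerivOfComplex_mdifferentiable hg
    have hf2 := Derivative.normalizedDerivOfComplex_mdifferentiable hf1
    have hg2 := Derivative.normalizedDerivOfComplex_mdifferentiable hg1
    have e1 := Derivative.normalizedDerivOfComplex_add f g hf hg
    have e2 := Derivative.normalizedDerivOfComplex_add _ _ hf1 hg1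
    have e3 := Derivative.normalizedDerivOfComplex_add _ _ hf2 hg2
    funext τ
    have a := congrFun hf0 τ
    have b := congrFun hg0 τ
    simp only [op, Pi.zero_apply] at a b ⊢
    simp only [D, e1, e2, e3, Pi.add_apply] at a b ⊢
    linear_combination a + b
  smul_mem' := by
    rintro c f ⟨hf, hf0⟩
    refine ⟨hf.const_smul c, ?_⟩
    have hf1 := Derivative.normalizedDerivOfComplex_mdifferentiable hf
    have hf2 := Derivative.normalizedDerivOfComplex_mdifferentiable hf1
    have e1 := Derivative.normalizedDerivOfComplex_smul c f hf
    have e2 := Derivative.normalizedDerivOfComplex_smul c _ hf1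
    have e3 := Derivative.normalizedDerivOfComplex_smul c _ hf2
    funext τ
    have a := congrFun hf0 τ
    simp only [op, Pi.zero_apply] at a ⊢
    simp only [D, e1, e2, e3, Pi.smul_apply, smul_eq_mul] at a ⊢
    linear_combination c * a

/-- The indicial polynomial `t³ - t²/2 + x t + y` at `q = 0`. -/
def indicial (x y : ℂ) : Polynomial ℂ :=
  Polynomial.X ^ 3 - Polynomial.C (1 / 2) * Polynomial.X ^ 2
    + Polynomial.C x * Polynomial.X + Polynomial.C y

/-- The three functions form a basis of the solution space. -/
def IsBasisOfSolutions (x y : ℂ) (f : Fin 3 → ℍ → ℂ) : Prop :=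
  LinearIndependent ℂ f ∧ Submodule.span ℂ (Set.range f) = solutions x y

/-! ### `q`-expansions -/

/-- `q ^ r = exp (2πi r τ)`. -/
def qpow (r : ℂ) (τ : ℍ) : ℂ := cexp (2 * π * I * r * τ)

/-- `f = q ^ r ∑ₙ aₙ qⁿ`, convergent on all of `ℍ`. -/
def HasQExpansion (f : ℍ → ℂ) (r : ℂ) (a : ℕ → ℂ) : Prop :=
  ∀ τ : ℍ, HasSum (fun n : ℕ => a n * qpow (r + n) τ) (f τ)

/-- `f = q ^ r (l₀ + l₁ q + ⋯ + lₖ qᵏ + O(qᵏ⁺¹))`, where `l = [l₀, …, lₖ]`. -/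
def QExpansionStarts (f : ℍ → ℂ) (r : ℂ) (l : List ℂ) : Prop :=
  ∃ a : ℕ → ℂ, HasQExpansion f r a ∧ ∀ (i : ℕ) (hi : i < l.length), a i = l[i]

/-- `f = q ^ r ∑ₙ aₙ qⁿ` with real `aₙ ≥ 0`. -/
def HasNonnegQExpansion (f : ℍ → ℂ) (r : ℂ) : Prop :=
  ∃ a : ℕ → ℝ, (∀ n, 0 ≤ a n) ∧ HasQExpansion f r (fun n => (a n : ℂ))

/-- `f = q ^ r (1 + a₁ q + a₂ q² + ⋯)` for some `r`, with nonnegative integers `aₙ`. -/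
def IsOfVacuumCharacterType (f : ℍ → ℂ) : Prop :=
  ∃ (r : ℂ) (a : ℕ → ℕ), a 0 = 1 ∧ HasQExpansion f r (fun n => (a n : ℂ))

/-! ### The modular forms occurring in the solutions -/

/-- `η(kτ)`. -/
def etaMul (k : ℕ) (τ : ℍ) : ℂ := ModularForm.eta (k * (τ : ℂ))

/-- The Dedekind eta function on `ℍ`. -/
abbrev dedekindEta : ℍ → ℂ := etaMul 1

/-- `H₂(τ) = 2 E₂(2τ) - E₂(τ)`. -/
def H2 (τ : ℍ) : ℂ :=
  2 * EisensteinSeries.E2 (ofComplex (2 * (τ : ℂ))) - EisensteinSeries.E2 τ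

/-- `Δ₂(τ) = η(2τ)⁸ / η(τ)⁴`. -/
def Delta2 (τ : ℍ) : ℂ := etaMul 2 τ ^ 8 / dedekindEta τ ^ 4

/-- `Δ₂ₐ(τ) = η(τ)⁸ η(2τ)⁸`. -/
def Delta2A (τ : ℍ) : ℂ := dedekindEta τ ^ 8 * etaMul 2 τ ^ 8

/-- `I₃ = 1 + 6 ∑_{n ≥ 1} (∑_{d ∣ n} (d/3)) qⁿ`. -/
def I3 (τ : ℍ) : ℂ :=
  1 + 6 * ∑' n : ℕ, ((∑ d ∈ (n + 1).divisors, legendreSym 3 (d : ℤ) : ℤ) : ℂ) * qpow (n + 1) τ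

/-- `Δ₃(τ) = η(3τ)³ / η(τ)`. -/
def Delta3 (τ : ℍ) : ℂ := etaMul 3 τ ^ 3 / dedekindEta τ

/-- `Δ₃ₐ(τ) = η(τ)⁶ η(3τ)⁶`. -/
def Delta3A (τ : ℍ) : ℂ := dedekindEta τ ^ 6 * etaMul 3 τ ^ 6

/-- `ψ₁ = q^{-1/60} ∏_{n > 0, n ≡ ±1 mod 5} (1 - qⁿ)⁻¹`. -/
def psi1 (τ : ℍ) : ℂ :=
  qpow (-1 / 60) τ *
    (∏' n : ℕ, (1 - qpow (5 * n + 1) τ) * (1 - qpow (5 * n + 4) τ))⁻¹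

/-- `ψ₂ = q^{11/60} ∏_{n > 0, n ≡ ±2 mod 5} (1 - qⁿ)⁻¹`. -/
def psi2 (τ : ℍ) : ℂ :=
  qpow (11 / 60) τ *
    (∏' n : ℕ, (1 - qpow (5 * n + 2) τ) * (1 - qpow (5 * n + 3) τ))⁻¹

/-- For `g = c + O(q^ε)`, the primitive `∫ g dq/q = c log q + ∫₀^q (g - c) dq/q`, with
`log q = 2πiτ`; the last integral is taken along the ray from `i∞` down to `τ`. -/
def qPrimitive (c : ℂ) (g : ℍ → ℂ) (τ : ℍ) : ℂ :=
  c * (2 * π * I * τ) + 2 * π * ∫ t in Set.Ioi (0 : ℝ), (g (ofComplex (τ + t * I)) - c)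

/-- A modular function on `Γ(N)` without poles in `ℍ`: holomorphic, invariant under `Γ(N)`, and
meromorphic (that is, of at most exponential growth) at every cusp. -/
def IsModularFunction (N : ℕ) (f : ℍ → ℂ) : Prop :=
  MDiff f ∧ (∀ γ ∈ CongruenceSubgroup.Gamma N, ∀ τ : ℍ, f (γ • τ) = f τ) ∧
    ∀ γ : SL(2, ℤ), ∃ k : ℕ,
      (fun τ : ℍ => f (γ • τ)) =O[atImInfty] (fun τ : ℍ => Real.exp (2 * π * k * τ.im))

/-! ### Vertex operator algebras and their modules -/

section VOA

/-- The Borcherds identity for the modes `a₍ₙ₎` of `Y(a, z) = ∑ₙ a₍ₙ₎ z⁻ⁿ⁻¹`, acting on a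
`V`-module `M`. All sums are finite for modes that satisfy the truncation condition. -/
def BorcherdsIdentity {V : Type u} {M : Type v} [AddCommGroup V] [Module ℂ V]
    [AddCommGroup M] [Module ℂ M] (Y : V →ₗ[ℂ] ℤ → Module.End ℂ V)
    (YM : V →ₗ[ℂ] ℤ → Module.End ℂ M) : Prop :=
  ∀ (a b : V) (w : M) (m n k : ℤ),
    ∑ᶠ j : ℕ, (Ring.choose m j : ℤ) • YM (Y a (n + j) b) (m + k - j) w =
      ∑ᶠ j : ℕ, ((-1) ^ j * Ring.choose n j : ℤ) •
        (YM a (m + n - j) (YM b (k + j) w)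
          - (Int.negOnePow n : ℤ) • YM b (n + k - j) (YM a (m + j) w))

/-- A vertex operator algebra structure over `ℂ` on `V`. -/
structure VOA (V : Type u) [AddCommGroup V] [Module ℂ V] where
  /-- `Y a n` is the mode `a₍ₙ₎`. -/
  Y : V →ₗ[ℂ] ℤ → Module.End ℂ V
  /-- The vacuum vector. -/
  vac : V
  /-- The conformal vector; its modes are `L(n) = ω₍ₙ₊₁₎`. -/
  conf : V
  /-- The central charge. -/
  c : ℂ
  truncation : ∀ a b : V, ∃ N : ℤ, ∀ n ≥ N, Y a n b = 0
  vac_left : ∀ (n : ℤ) (b : V), Y vac n b = if n = -1 then b else 0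
  creation : ∀ a : V, Y a (-1) vac = a ∧ ∀ n ≥ (0 : ℤ), Y a n vac = 0
  borcherds : BorcherdsIdentity Y Y
  virasoro : ∀ (m n : ℤ) (v : V),
    Y conf (m + 1) (Y conf (n + 1) v) - Y conf (n + 1) (Y conf (m + 1) v) =
      ((m : ℂ) - n) • Y conf (m + n + 1) v
        + (if m + n = 0 then ((m : ℂ) ^ 3 - m) / 12 * c else 0) • v
  derivative : ∀ (a : V) (n : ℤ) (b : V), Y (Y conf 0 a) n b = -(n : ℂ) • Y a (n - 1) b
  grading : DirectSum.IsInternal (fun n : ℤ => Module.End.eigenspace (Y conf 1) (n : ℂ))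
  finite : ∀ n : ℤ, FiniteDimensional ℂ (Module.End.eigenspace (Y conf 1) (n : ℂ))
  bounded : ∃ N : ℤ, ∀ n < N, Module.End.eigenspace (Y conf 1) (n : ℂ) = ⊥

variable {V : Type u} [AddCommGroup V] [Module ℂ V]

/-- The homogeneous space of weight `n`. -/
def VOA.homogeneous (A : VOA V) (n : ℤ) : Submodule ℂ V :=
  Module.End.eigenspace (A.Y A.conf 1) (n : ℂ)

/-- CFT type: `V = ⨁_{n ≥ 0} Vₙ` and `V₀` is the line spanned by the vacuum. -/
def VOA.IsCFTType (A : VOA V) : Prop :=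
  (∀ n < (0 : ℤ), A.homogeneous n = ⊥) ∧ A.vac ≠ 0 ∧ A.homogeneous 0 = ℂ ∙ A.vac

/-- `f` is the character `∑_{n ≥ 0} dim(Vₙ) q^{n - c/24}` of a VOA of CFT type. -/
def VOA.IsVacuumCharacter (A : VOA V) (f : ℍ → ℂ) : Prop :=
  HasQExpansion f (-A.c / 24) (fun n => (Module.finrank ℂ (A.homogeneous n) : ℂ))

/-- A `V`-module `M = ⨁_{n ≥ 0} M_{h+n}` of conformal weight `h`, graded by finite dimensional
eigenspaces of `L(0)`, with `M_h ≠ 0`. -/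
structure VOAModule (A : VOA V) (M : Type v) [AddCommGroup M] [Module ℂ M] where
  /-- The modes of elements of `V` acting on `M`. -/
  Y : V →ₗ[ℂ] ℤ → Module.End ℂ M
  truncation : ∀ (a : V) (w : M), ∃ N : ℤ, ∀ n ≥ N, Y a n w = 0
  vac_left : ∀ (n : ℤ) (w : M), Y A.vac n w = if n = -1 then w else 0
  borcherds : BorcherdsIdentity A.Y Y
  /-- The conformal weight. -/
  h : ℂ
  grading : DirectSum.IsInternal (fun n : ℕ => Module.End.eigenspace (Y A.conf 1) (h + n))
  finite : ∀ n : ℕ, FiniteDimensional ℂ (Module.End.eigenspace (Y A.conf 1) (h + n))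
  lowest : Module.End.eigenspace (Y A.conf 1) h ≠ ⊥

/-- `M` has no submodules other than `0` and `M`. -/
def VOAModule.IsSimple {A : VOA V} {M : Type v} [AddCommGroup M] [Module ℂ M]
    (W : VOAModule A M) : Prop :=
  ∀ S : Submodule ℂ M, (∀ (a : V) (n : ℤ), ∀ w ∈ S, W.Y a n w ∈ S) → S = ⊥ ∨ S = ⊤

/-- `f` is the character `∑_{n ≥ 0} dim(M_{h+n}) q^{h + n - c/24}` of `M`. -/
def VOAModule.IsCharacter {A : VOA V} {M : Type v} [AddCommGroup M] [Module ℂ M]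
    (W : VOAModule A M) (f : ℍ → ℂ) : Prop :=
  HasQExpansion f (W.h - A.c / 24)
    (fun n => (Module.finrank ℂ (Module.End.eigenspace (W.Y A.conf 1) (W.h + n)) : ℂ))

/-- The set of characters of simple `V`-modules. A simple module is generated by any of its
nonzero vectors, so it has a copy in the universe of `V`. -/
def VOA.simpleCharacters (A : VOA V) : Set (ℍ → ℂ) :=
  {f | ∃ (M : Type u) (_ : AddCommGroup M) (_ : Module ℂ M) (W : VOAModule A M),
    W.IsSimple ∧ W.IsCharacter f}

end VOA

end MLDE

end

open MLDE

/-! A series `q ^ r ∑ aₙ qⁿ` solves the equation exactly when its coefficients satisfy a recursion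
whose diagonal term is the indicial polynomial at `r + n`. Away from resonances the leading
coefficient therefore determines the whole series, and each listed expansion is verified by
arithmetic once a solution with that exponent is known.

Classification. The three lowest orders of the recursion suffice. Order 0 says that `-1/6` is an
indicial root, so `y = x/6 + 1/54`, the other roots are `1/3 ± s` and `x = -s²`. Order 1 reads `m₁
(1/4 - s²) = 7 - 124 s²`, whence `(m₁ - 28)(m₁ - 124) = (2 s (m₁ - 124))²`. For rational `s` this is
the square of an integer, and `(m₁ - 76)² - 48²` being a square means `m₁ = 76 + u + v` with `u v =
576`. Sixteen candidates remain; order 2 is linear in `m₂` and leaves six of them.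

Bases. Cauchy data at a point embed the solutions in `ℂ³`, so three independent solutions form a
basis. For the closed formulas, `isBasisOfSolutions_of_modular` reduces everything to the behaviour
under `S`. Suppose that the span of `f₀, f₁, f₂` is stable under `S` and that the exponents are
distinct indicial roots of sum `1/2`. Then `g = op x y f` is a vector of weight 6 with the same
multipliers, one order smaller at `i∞`. Each of the determinants of `g` with two of `f` and its
first two Serre derivatives squares to a level one form of weight below 36 that is `O(q³)`, so it
vanishes; the Wronskian of `f` has a Vandermonde leading coefficient and does not. By Cramer's rule
`g = 0`.

Modularity. Identities between forms of level 2 and 3 are proved by forming norms or traces down to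
level one, where a form of weight below `12 m` that is `O(q ^ m)` is zero. The transformation of
`I₃` comes from the logarithmic derivative of the Jacobi theta function at 3-division points,
computed with the triple product. The same product turns `η ψ₁` and `η ψ₂` into theta series modulo
5, which gives the action of `S`; Klein forms give invariance under `Γ(60)`. The solutions for `m₁ =
24` are forms of degree 10 in `ψ₁, ψ₂` spanning an invariant space. Their nonnegativity rests on
that of `ψ₁⁵ - ψ₂⁵`, where negative coefficients of later factors are cancelled by the first factor
of the product for `ψ₁`.

Exceptional cases. For `m₁ = 28` the operator factors as `(D - E₂/3)(D² - E₂/6 D - E₄/18)`;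
variation of constants gives the logarithmic solution, on which `T` acts by a Jordan block, so no
basis of `q`-series exists. For `m₁ = 271` no two roots differ by an integer, so Frobenius series
form a basis, and each of the three has a nonintegral coefficient. -/

noncomputable section

namespace MLDE

open Filter Topology Finset

section

/-! ### Basic properties of `qpow` -/

/-- The nome `q = exp (2πiτ)`. -/
abbrev nome (τ : ℍ) : ℂ := qpow 1 τ

lemma qpow_add (r s : ℂ) (τ : ℍ) : qpow (r + s) τ = qpow r τ * qpow s τ := by
  simp only [qpow, ← Complex.exp_add]; ring_nf

lemma qpow_ne_zero (r : ℂ) (τ : ℍ) : qpow r τ ≠ 0 := Complex.exp_ne_zero _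

@[simp] lemma qpow_zero (τ : ℍ) : qpow 0 τ = 1 := by simp [qpow]

lemma qpow_neg (r : ℂ) (τ : ℍ) : qpow (-r) τ = (qpow r τ)⁻¹ := by
  simp only [qpow, ← Complex.exp_neg]; ring_nf

lemma qpow_nat_mul (r : ℂ) (n : ℕ) (τ : ℍ) : qpow (n * r) τ = qpow r τ ^ n := by
  simp only [qpow, ← Complex.exp_nat_mul]; ring_nf

lemma qpow_natCast (n : ℕ) (τ : ℍ) : qpow n τ = nome τ ^ n := by
  simpa using qpow_nat_mul 1 n τ

lemma qpow_add_nat (r : ℂ) (n : ℕ) (τ : ℍ) : qpow (r + n) τ = qpow r τ * nome τ ^ n := by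
  rw [qpow_add, qpow_natCast]

lemma nome_ne_zero (τ : ℍ) : nome τ ≠ 0 := qpow_ne_zero 1 τ

lemma nome_eq_qParam (τ : ℍ) : nome τ = Function.Periodic.qParam 1 τ := by
  simp [nome, qpow, Function.Periodic.qParam]

lemma norm_nome_lt_one (τ : ℍ) : ‖nome τ‖ < 1 := by
  rw [nome_eq_qParam]; exact Function.Periodic.norm_qParam_lt_one one_pos τ.2

lemma exists_nome_eq {z : ℂ} (h0 : z ≠ 0) (h1 : ‖z‖ < 1) : ∃ τ : ℍ, nome τ = z :=
  ⟨⟨Function.Periodic.invQParam 1 z,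
      Function.Periodic.im_invQParam_pos_of_norm_lt_one one_pos h1 h0⟩, by
    rw [nome_eq_qParam]; exact Function.Periodic.qParam_right_inv one_ne_zero h0⟩

lemma tendsto_nome : Tendsto nome atImInfty (𝓝 0) := by
  have := qParam_tendsto_atImInfty (h := 1) one_pos
  simpa only [← nome_eq_qParam] using this

lemma qpow_vadd_one (r : ℂ) (τ : ℍ) :
    qpow r ((1 : ℝ) +ᵥ τ) = cexp (2 * π * I * r) * qpow r τ := by
  simp only [qpow, ← Complex.exp_add, coe_vadd]; push_cast; ring_nf

lemma norm_qpow_ofReal (r : ℝ) (τ : ℍ) : ‖qpow r τ‖ = Real.exp (-2 * π * r * τ.im) := by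
  rw [qpow, Complex.norm_exp]
  congr 1
  simp [mul_re, mul_im]

lemma tendsto_qpow_of_pos {r : ℝ} (hr : 0 < r) : Tendsto (qpow r) atImInfty (𝓝 0) := by
  rw [tendsto_zero_iff_norm_tendsto_zero]
  simp only [norm_qpow_ofReal]
  have h1 : Tendsto (fun τ : ℍ => (2 * π * r) * τ.im) atImInfty atTop :=
    (tendsto_comap).const_mul_atTop (by positivity)
  refine (Real.tendsto_exp_neg_atTop_nhds_zero.comp h1).congr fun τ => ?_
  simp only [Function.comp]; ring_nf

lemma mdifferentiable_qpow (r : ℂ) : MDiff (qpow r) := by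
  rw [UpperHalfPlane.mdifferentiable_iff]
  refine DifferentiableOn.congr (f := fun z : ℂ => cexp (2 * π * I * r * z)) (by fun_prop) ?_
  intro z hz
  simp [qpow, ofComplex_apply_of_im_pos hz]

/-! ### Convergent power series in the nome -/

/-- The coefficients of a power series that converges on the open unit disc. -/
def DiscSummable (a : ℕ → ℂ) : Prop := ∀ ρ : ℝ, 0 ≤ ρ → ρ < 1 → Summable fun n => ‖a n‖ * ρ ^ n

lemma DiscSummable.summable {a : ℕ → ℂ} (h : DiscSummable a) {z : ℂ} (hz : ‖z‖ < 1) :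
    Summable fun n => a n * z ^ n := by
  refine Summable.of_norm ?_
  simpa using h ‖z‖ (norm_nonneg _) hz

lemma DiscSummable.summable_qpow {a : ℕ → ℂ} (h : DiscSummable a) (r : ℂ) (τ : ℍ) :
    Summable fun n : ℕ => a n * qpow (r + n) τ := by
  refine ((h.summable (norm_nome_lt_one τ)).mul_left (qpow r τ)).congr fun n => ?_
  rw [qpow_add_nat]; ring

lemma DiscSummable.hasQExpansion {a : ℕ → ℂ} (h : DiscSummable a) (r : ℂ) :
    HasQExpansion (fun τ => ∑' n : ℕ, a n * qpow (r + n) τ) r a :=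
  fun τ => (h.summable_qpow r τ).hasSum

namespace HasQExpansion

variable {f g : ℍ → ℂ} {r s : ℂ} {a b : ℕ → ℂ}

/-- Convergence at a point with nome `σ` between `ρ` and `1` bounds the terms there, so at radius
`ρ` they are dominated by a geometric series of ratio `ρ / σ`. -/
lemma discSummable (h : HasQExpansion f r a) : DiscSummable a := by
  intro ρ h0 h1
  obtain ⟨σ, hσ, hσ1⟩ := exists_between h1
  have hσ0 : 0 < σ := h0.trans_lt hσ
  obtain ⟨τ, hτ⟩ := exists_nome_eq (z := (σ : ℂ)) (by exact_mod_cast hσ0.ne')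
    (by simpa [abs_of_pos hσ0] using hσ1)
  have hs : Summable fun n : ℕ => a n * (σ : ℂ) ^ n := by
    refine ((h τ).summable.mul_left (qpow r τ)⁻¹).congr fun n => ?_
    rw [qpow_add_nat, hτ]
    field_simp [qpow_ne_zero]
  obtain ⟨C, hC⟩ := hs.tendsto_atTop_zero.norm.bddAbove_range
  have hC' : ∀ n, ‖a n‖ * σ ^ n ≤ C := fun n => by
    have := hC ⟨n, rfl⟩
    simpa [abs_of_pos hσ0] using this
  refine Summable.of_nonneg_of_le (fun n => by positivity) (fun n => ?_)
    ((summable_geometric_of_lt_one (r := ρ / σ) (by positivity)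
      ((div_lt_one hσ0).2 hσ)).mul_left C)
  calc ‖a n‖ * ρ ^ n = (‖a n‖ * σ ^ n) * (ρ / σ) ^ n := by
        rw [div_pow]; field_simp
    _ ≤ C * (ρ / σ) ^ n := by gcongr; exact hC' n

lemma hasSum_nome (h : HasQExpansion f r a) (τ : ℍ) :
    HasSum (fun n => a n * nome τ ^ n) (qpow (-r) τ * f τ) := by
  refine ((h τ).mul_left (qpow (-r) τ)).congr_fun ?_
  intro n
  rw [qpow_add_nat, qpow_neg]
  field_simp [qpow_ne_zero]

lemma _root_.MLDE.hasQExpansion_iff :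
    HasQExpansion f r a ↔ ∀ τ, HasSum (fun n => a n * nome τ ^ n) (qpow (-r) τ * f τ) := by
  refine ⟨fun h => h.hasSum_nome, fun h τ => ?_⟩
  have := (h τ).mul_left (qpow r τ)
  rw [qpow_neg, mul_inv_cancel_left₀ (qpow_ne_zero r τ)] at this
  refine this.congr_fun fun n => ?_
  rw [qpow_add_nat]; ring

lemma add (hf : HasQExpansion f r a) (hg : HasQExpansion g r b) :
    HasQExpansion (f + g) r (a + b) := fun τ => by
  simpa [add_mul] using (hf τ).add (hg τ)

lemma sub (hf : HasQExpansion f r a) (hg : HasQExpansion g r b) :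
    HasQExpansion (f - g) r (a - b) := fun τ => by
  simpa [sub_mul] using (hf τ).sub (hg τ)

lemma smul (c : ℂ) (hf : HasQExpansion f r a) : HasQExpansion (c • f) r (c • a) := fun τ => by
  simpa [mul_assoc] using (hf τ).mul_left c

lemma congr_coeff (hf : HasQExpansion f r a) (h : ∀ n, a n = b n) : HasQExpansion f r b := by
  rwa [← funext h]

lemma congr_exponent (hf : HasQExpansion f r a) (h : r = s) : HasQExpansion f s a := h ▸ hf

lemma zero (r : ℂ) : HasQExpansion 0 r 0 := fun τ => by simp [hasSum_zero]

lemma mul (hf : HasQExpansion f r a) (hg : HasQExpansion g s b) :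
    HasQExpansion (f * g) (r + s) (fun n => ∑ p ∈ antidiagonal n, a p.1 * b p.2) := by
  rw [hasQExpansion_iff]
  intro τ
  have ha := hf.hasSum_nome τ
  have hb := hg.hasSum_nome τ
  have hna : Summable fun n => ‖a n * nome τ ^ n‖ := by
    simpa using hf.discSummable _ (norm_nonneg _) (norm_nome_lt_one τ)
  have hnb : Summable fun n => ‖b n * nome τ ^ n‖ := by
    simpa using hg.discSummable _ (norm_nonneg _) (norm_nome_lt_one τ)
  have h1 := tsum_mul_tsum_eq_tsum_sum_antidiagonal_of_summable_norm hna hnb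
  have h2 := (summable_norm_sum_mul_antidiagonal_of_summable_norm hna hnb).of_norm.hasSum
  rw [← h1, ha.tsum_eq, hb.tsum_eq] at h2
  have e : qpow (-(r + s)) τ * (f * g) τ = qpow (-r) τ * f τ * (qpow (-s) τ * g τ) := by
    rw [neg_add, qpow_add, Pi.mul_apply]; ring
  rw [e]
  refine h2.congr_fun fun n => ?_
  rw [Finset.sum_mul]
  refine Finset.sum_congr rfl fun p hp => ?_
  rw [← mem_antidiagonal.1 hp, pow_add]; ring

/-- Drop a vanishing leading coefficient. -/
lemma shift (hf : HasQExpansion f r a) (h0 : a 0 = 0) :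
    HasQExpansion f (r + 1) (fun n => a (n + 1)) := fun τ => by
  have := (hasSum_nat_add_iff' 1).2 (hf τ)
  simp only [range_one, sum_singleton, h0, zero_mul, sub_zero] at this
  refine this.congr_fun fun n => ?_
  push_cast; ring_nf

/-- Prepend a vanishing coefficient. -/
lemma unshift (hf : HasQExpansion f r a) :
    HasQExpansion f (r - 1) (fun n => Nat.casesOn n 0 a) := fun τ => by
  rw [← hasSum_nat_add_iff' 1]
  have h0 : f τ - ∑ i ∈ range 1, (Nat.casesOn i 0 a : ℂ) * qpow (r - 1 + i) τ = f τ := by simp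
  rw [h0]
  refine (hf τ).congr_fun fun n => ?_
  push_cast; ring_nf

lemma tendsto (hf : HasQExpansion f r a) :
    Tendsto (fun τ => qpow (-r) τ * f τ) atImInfty (𝓝 (a 0)) := by
  have h1 : (fun τ => qpow (-r) τ * f τ) = fun τ => ∑' n, a n * nome τ ^ n :=
    funext fun τ => (hf.hasSum_nome τ).tsum_eq.symm
  have h2 : a 0 = ∑' n, a n * (0 : ℂ) ^ n := by
    rw [tsum_eq_single 0]
    · simp
    · intro n hn; simp [hn]
  rw [h1, h2]
  -- Near `i∞` the nome has absolute value below `1/2`, so absolute convergence at radius `1/2`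
  -- dominates.
  refine tendsto_tsum_of_dominated_convergence (bound := fun n => ‖a n‖ * (1 / 2 : ℝ) ^ n)
    (hf.discSummable _ (by norm_num) (by norm_num)) (fun n => ?_) ?_
  · exact (tendsto_nome.pow n).const_mul _
  · filter_upwards [tendsto_nome.eventually (Metric.ball_mem_nhds (0 : ℂ)
      (by norm_num : (0 : ℝ) < 1 / 2))] with τ hτ n
    rw [norm_mul, norm_pow]
    gcongr
    exact (mem_ball_zero_iff.1 hτ).le

/-- The leading coefficient is a limit at `i∞`, hence zero; dropping it raises the exponent by one
and lowers the index. The induction must therefore range over all exponents and coefficient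
sequences. -/
lemma coeff_eq_zero (hf : HasQExpansion 0 r a) (n : ℕ) : a n = 0 := by
  induction n using Nat.strong_induction_on generalizing r a with
  | _ n ih =>
    have h0 : a 0 = 0 := by
      have := hf.tendsto
      simp only [Pi.zero_apply, mul_zero] at this
      exact tendsto_nhds_unique this tendsto_const_nhds
    cases n with
    | zero => exact h0
    | succ m => exact ih m (Nat.lt_succ_self m) (hf.shift h0)

lemma coeff_unique (hf : HasQExpansion f r a) (hg : HasQExpansion f r b) : a = b := by
  funext n
  have := (hf.sub hg).congr_coeff (fun _ => rfl)
  rw [sub_self] at this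
  exact sub_eq_zero.1 (this.coeff_eq_zero n)

/-- All terms have the same multiplier because exponents differ by integers. So every `q`-series is
an eigenvector of `T`, which is what fails in the logarithmic case. -/
lemma vadd_one (hf : HasQExpansion f r a) (τ : ℍ) :
    f ((1 : ℝ) +ᵥ τ) = cexp (2 * π * I * r) * f τ := by
  refine (hf ((1 : ℝ) +ᵥ τ)).unique (((hf τ).mul_left _).congr_fun fun n => ?_)
  rw [qpow_vadd_one, mul_add, Complex.exp_add,
    show 2 * π * I * (n : ℂ) = n * (2 * π * I) by ring, Complex.exp_nat_mul_two_pi_mul_I]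
  ring

end HasQExpansion

/-- Termwise differentiation of `q`-series. -/
lemma DiscSummable.hasDerivAt {a : ℕ → ℂ} (ha : DiscSummable a) (r : ℂ) {z : ℂ} (hz : 0 < z.im) :
    DifferentiableAt ℂ (fun w => ∑' n : ℕ, a n * cexp (2 * π * I * (r + n) * w)) z ∧
    HasSum (fun n : ℕ => a n * (2 * π * I * (r + n)) * cexp (2 * π * I * (r + n) * z))
      (deriv (fun w => ∑' n : ℕ, a n * cexp (2 * π * I * (r + n) * w)) z) := by
  obtain ⟨δ, hδ0, hδ⟩ := exists_between hz
  set R := ‖z‖ + 1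
  -- Height above `δ` keeps the nome below `ρ < 1`; the ball is needed because for complex `r` the
  -- factor `q ^ r` is only bounded on bounded sets.
  set U : Set ℂ := {w | δ < w.im} ∩ Metric.ball 0 R with hU
  have hUo : IsOpen U := (isOpen_lt continuous_const Complex.continuous_im).inter Metric.isOpen_ball
  have hzU : z ∈ U := ⟨hδ, by simp [R]⟩
  set ρ : ℝ := Real.exp (-2 * π * δ)
  have hρ : ρ < 1 := by
    rw [Real.exp_lt_one_iff]; nlinarith [Real.pi_pos]
  set C : ℝ := Real.exp (2 * π * ‖r‖ * R)
  have hbound : ∀ (n : ℕ) (w : ℂ), w ∈ U →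
      ‖a n * cexp (2 * π * I * (r + n) * w)‖ ≤ C * (‖a n‖ * ρ ^ n) := by
    intro n w hw
    have e : cexp (2 * π * I * (r + n) * w) = cexp (2 * π * I * r * w) * cexp (2 * π * I * w) ^ n := by
      rw [← Complex.exp_nat_mul, ← Complex.exp_add]; ring_nf
    have h1 : ‖cexp (2 * π * I * r * w)‖ ≤ C := by
      rw [Complex.norm_exp]
      refine Real.exp_le_exp.2 ((Complex.re_le_norm _).trans ?_)
      have hw2 : ‖w‖ ≤ R := (mem_ball_zero_iff.1 hw.2).le
      simp only [norm_mul, Complex.norm_ofNat, norm_real, norm_I, mul_one, Real.norm_eq_abs,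
        abs_of_pos Real.pi_pos]
      gcongr
    have h2 : ‖cexp (2 * π * I * w)‖ ≤ ρ := by
      rw [Complex.norm_exp]
      refine Real.exp_le_exp.2 ?_
      have : (2 * π * I * w).re = -2 * π * w.im := by simp [mul_re, mul_im]
      rw [this]
      have := hw.1
      simp only [Set.mem_ofPred_eq] at this
      nlinarith [Real.pi_pos]
    rw [e, norm_mul, norm_mul, norm_pow]
    calc ‖a n‖ * (‖cexp (2 * π * I * r * w)‖ * ‖cexp (2 * π * I * w)‖ ^ n)
        ≤ ‖a n‖ * (C * ρ ^ n) := by gcongr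
      _ = _ := by ring
  have hsum : Summable fun n => C * (‖a n‖ * ρ ^ n) := (ha ρ (Real.exp_pos _).le hρ).mul_left C
  have hd : ∀ n : ℕ, DifferentiableOn ℂ (fun w => a n * cexp (2 * π * I * (r + n) * w)) U :=
    fun n => by fun_prop
  refine ⟨(differentiableOn_tsum_of_summable_norm hsum hd hUo hbound).differentiableAt
    (hUo.mem_nhds hzU), ?_⟩
  refine (hasSum_deriv_of_summable_norm hsum hd hUo hbound hzU).congr_fun fun n => ?_
  have : HasDerivAt (fun w => a n * cexp (2 * π * I * (r + n) * w))
      (a n * (cexp (2 * π * I * (r + n) * z) * (2 * π * I * (r + n) * 1))) z :=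
    (((hasDerivAt_id z).const_mul _).cexp).const_mul _
  rw [this.deriv]; ring

namespace HasQExpansion

variable {f g : ℍ → ℂ} {r s : ℂ} {a b : ℕ → ℂ}

lemma eventuallyEq (hf : HasQExpansion f r a) (τ : ℍ) :
    f ∘ ofComplex =ᶠ[𝓝 (τ : ℂ)] fun w => ∑' n : ℕ, a n * cexp (2 * π * I * (r + n) * w) := by
  filter_upwards [isOpen_upperHalfPlaneSet.mem_nhds τ.2] with w hw
  have := (hf ⟨w, hw⟩).tsum_eq
  rw [Function.comp, ofComplex_apply_of_im_pos hw, ← this]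
  rfl

lemma mdifferentiable (hf : HasQExpansion f r a) : MDiff f := fun τ => by
  rw [UpperHalfPlane.mdifferentiableAt_iff]
  exact (hf.discSummable.hasDerivAt r τ.2).1.congr_of_eventuallyEq (hf.eventuallyEq τ)

lemma D (hf : HasQExpansion f r a) : HasQExpansion (MLDE.D f) r (fun n => (r + n) * a n) := fun τ => by
  have h := (hf.discSummable.hasDerivAt r τ.2).2
  rw [← (hf.eventuallyEq τ).deriv_eq] at h
  have h2 := h.mul_left (2 * π * I)⁻¹
  refine h2.congr_fun fun n => ?_
  simp only [qpow]
  field_simp [Complex.two_pi_I_ne_zero]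

end HasQExpansion

lemma periodic_comp_ofComplex_of_vadd {f : ℍ → ℂ} (h : ∀ τ : ℍ, f ((1 : ℝ) +ᵥ τ) = f τ) :
    Function.Periodic (f ∘ ofComplex) (1 : ℝ) := by
  intro w
  by_cases hw : 0 < w.im
  · have hw' : 0 < (w + (1 : ℝ)).im := by simpa using hw
    simp only [Function.comp, ofComplex_apply_of_im_pos hw, ofComplex_apply_of_im_pos hw']
    rw [← h ⟨w, hw⟩]
    congr 1
    ext1
    simp [add_comm]
  -- Off the upper half-plane `ofComplex` takes one default value, so both sides agree there.
  · have hw' : ¬ 0 < (w + (1 : ℝ)).im := by simpa using hw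
    simp only [Function.comp, ofComplex_apply_of_im_nonpos (not_lt.1 hw),
      ofComplex_apply_of_im_nonpos (not_lt.1 hw')]

/-- A holomorphic function with the translation behaviour of `q ^ r` that is bounded relative to
`q ^ r` at `i∞` has a `q`-expansion. -/
lemma exists_hasQExpansion_of_bounded {f : ℍ → ℂ} {r : ℂ} (hf : MDiff f)
    (hT : ∀ τ : ℍ, f ((1 : ℝ) +ᵥ τ) = cexp (2 * π * I * r) * f τ)
    (hb : IsBoundedAtImInfty fun τ => qpow (-r) τ * f τ) : ∃ a, HasQExpansion f r a := by
  set g : ℍ → ℂ := fun τ => qpow (-r) τ * f τ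
  have hper : ∀ τ : ℍ, g ((1 : ℝ) +ᵥ τ) = g τ := by
    intro τ
    simp only [g, qpow_vadd_one, hT]
    have : cexp (2 * π * I * -r) * cexp (2 * π * I * r) = 1 := by
      rw [← Complex.exp_add]; simp
    linear_combination (qpow (-r) τ * f τ) * this
  have hg : MDiff g := (mdifferentiable_qpow (-r)).mul hf
  have := fun τ => hasSum_qExpansion one_pos (periodic_comp_ofComplex_of_vadd hper) hg hb τ
  refine ⟨fun n => (qExpansion 1 g).coeff n, hasQExpansion_iff.2 fun τ => ?_⟩
  simpa only [nome_eq_qParam, smul_eq_mul] using this τ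

/-- This yields expansions of eta quotients from their translation behaviour and a limit alone,
without expanding any product. -/
lemma exists_hasQExpansion_of_tendsto {f : ℍ → ℂ} {r L : ℂ} (hf : MDiff f)
    (hT : ∀ τ : ℍ, f ((1 : ℝ) +ᵥ τ) = cexp (2 * π * I * r) * f τ)
    (hL : Tendsto (fun τ => qpow (-r) τ * f τ) atImInfty (𝓝 L)) :
    ∃ a, HasQExpansion f r a ∧ a 0 = L := by
  obtain ⟨a, ha⟩ := exists_hasQExpansion_of_bounded hf hT (hL.isBigO_one ℝ)
  exact ⟨a, ha, tendsto_nhds_unique ha.tendsto hL⟩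

end

section

/-! ### The differential operator on `q`-series -/

/-- The coefficients of `1 + c ∑ₙ σₖ(n) qⁿ`. -/
def eisCoeff (c : ℂ) (k n : ℕ) : ℂ := if n = 0 then 1 else c * ArithmeticFunction.sigma k n

lemma eisCoeff_zero (c : ℂ) (k : ℕ) : eisCoeff c k 0 = 1 := by simp [eisCoeff]

lemma sigma_two (k : ℕ) : ArithmeticFunction.sigma k 2 = 1 + 2 ^ k := by
  rw [ArithmeticFunction.sigma_apply, show Nat.divisors 2 = {1, 2} by decide]; simp

lemma sigma_three (k : ℕ) : ArithmeticFunction.sigma k 3 = 1 + 3 ^ k := by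
  rw [ArithmeticFunction.sigma_apply, show Nat.divisors 3 = {1, 3} by decide]; simp

lemma sigma_four (k : ℕ) : ArithmeticFunction.sigma k 4 = 1 + (2 ^ k + 4 ^ k) := by
  rw [ArithmeticFunction.sigma_apply, show Nat.divisors 4 = {1, 2, 4} by decide]; simp

lemma sigma_five (k : ℕ) : ArithmeticFunction.sigma k 5 = 1 + 5 ^ k := by
  rw [ArithmeticFunction.sigma_apply, show Nat.divisors 5 = {1, 5} by decide]; simp

lemma eisCoeff_one (c : ℂ) (k : ℕ) : eisCoeff c k 1 = c := by simp [eisCoeff]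

lemma eisCoeff_two (c : ℂ) (k : ℕ) : eisCoeff c k 2 = c * (1 + 2 ^ k) := by
  simp [eisCoeff, sigma_two]

lemma eisCoeff_three (c : ℂ) (k : ℕ) : eisCoeff c k 3 = c * (1 + 3 ^ k) := by
  simp [eisCoeff, sigma_three]

lemma eisCoeff_four (c : ℂ) (k : ℕ) : eisCoeff c k 4 = c * (1 + (2 ^ k + 4 ^ k)) := by
  simp [eisCoeff, sigma_four]

lemma eisCoeff_five (c : ℂ) (k : ℕ) : eisCoeff c k 5 = c * (1 + 5 ^ k) := by
  simp [eisCoeff, sigma_five]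

/-- Polynomial growth is all that the convergence of Frobenius series needs. The hypothesis on `c`
covers the constant term `1`. -/
lemma norm_eisCoeff_le (c : ℂ) (hc : 1 ≤ ‖c‖) (k n : ℕ) :
    ‖eisCoeff c k n‖ ≤ ‖c‖ * ((n : ℝ) + 1) ^ (k + 1) := by
  unfold eisCoeff
  split_ifs with h
  · simp [h, hc]
  · rw [norm_mul, Complex.norm_natCast]
    gcongr
    calc ((ArithmeticFunction.sigma k n : ℕ) : ℝ) ≤ ((n ^ (k + 1) : ℕ) : ℝ) := by
          exact_mod_cast ArithmeticFunction.sigma_le_pow_succ k n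
      _ ≤ ((n : ℝ) + 1) ^ (k + 1) := by
          push_cast; gcongr; linarith

lemma hasQExpansion_E2 : HasQExpansion EisensteinSeries.E2 0 (eisCoeff (-24) 1) := by
  rw [hasQExpansion_iff]
  intro τ
  have := EisensteinSeries.hasSum_qExpansion_E2 τ
  simp only [neg_zero, qpow_zero, one_mul]
  refine this.congr_fun fun n => ?_
  simp [eisCoeff, nome, qpow]

lemma hasQExpansion_E (k : ℕ) (hk : 3 ≤ k) (hk2 : Even k) :
    HasQExpansion (ModularForm.E hk) 0 (eisCoeff (-(2 * k / bernoulli k : ℂ)) (k - 1)) := by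
  rw [hasQExpansion_iff]
  intro τ
  have := ModularForm.hasSum_qExpansion (ModularForm.E hk) one_pos
    one_mem_strictPeriods_SL τ
  simp only [neg_zero, qpow_zero, one_mul]
  refine this.congr_fun fun n => ?_
  rw [EisensteinSeries.E_qExpansion_coeff hk hk2, nome_eq_qParam]
  simp [eisCoeff]

lemma hasQExpansion_E4 : HasQExpansion ModularForm.E₄ 0 (eisCoeff 240 3) := by
  have := hasQExpansion_E 4 (by norm_num) ⟨2, rfl⟩
  have hb : bernoulli 4 = -1 / 30 := by decide +kernel
  rw [hb] at this
  norm_num at this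
  exact this

lemma hasQExpansion_E6 : HasQExpansion ModularForm.E₆ 0 (eisCoeff (-504) 5) := by
  have := hasQExpansion_E 6 (by norm_num) ⟨3, rfl⟩
  have hb : bernoulli 6 = 1 / 42 := by decide +kernel
  rw [hb] at this
  norm_num at this
  exact this

/-- The coefficient with which the coefficient of `q ^ (r + j)` in `f` contributes to the
coefficient of `q ^ (r + i + j)` in `op x y f`, apart from the contribution of `f'''`. -/
def opKernel (x y r : ℂ) (i j : ℕ) : ℂ :=
  -(1 / 2) * eisCoeff (-24) 1 i * (r + j) ^ 2
    + (1 / 2 * i * eisCoeff (-24) 1 i + x * eisCoeff 240 3 i) * (r + j)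
    + y * eisCoeff (-504) 5 i

/-- The coefficients of `op x y f` for `f = q ^ r ∑ₙ aₙ qⁿ`. -/
def opCoeff (x y r : ℂ) (a : ℕ → ℂ) (n : ℕ) : ℂ :=
  (r + n) ^ 3 * a n + ∑ p ∈ antidiagonal n, opKernel x y r p.1 p.2 * a p.2

/-- The terms with `i = 0` combine with the third derivative to the indicial polynomial at `r + n`.
So the equation in degree `n` determines `a n` from earlier coefficients unless `r + n` is an
indicial root. -/
lemma opCoeff_eq (x y r : ℂ) (a : ℕ → ℂ) (n : ℕ) :
    opCoeff x y r a n = ((r + n) ^ 3 - 1 / 2 * (r + n) ^ 2 + x * (r + n) + y) * a n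
      + ∑ i ∈ range n, opKernel x y r (i + 1) (n - (i + 1)) * a (n - (i + 1)) := by
  rw [opCoeff, Finset.Nat.sum_antidiagonal_eq_sum_range_succ
    (fun i j => opKernel x y r i j * a j), sum_range_succ']
  simp only [opKernel, eisCoeff_zero, Nat.sub_zero, Nat.cast_zero]
  ring

lemma HasQExpansion.op {f : ℍ → ℂ} {r : ℂ} {a : ℕ → ℂ} (x y : ℂ) (hf : HasQExpansion f r a) :
    HasQExpansion (MLDE.op x y f) r (opCoeff x y r a) := by
  have h1 := hf.D
  have h2 := h1.D
  have h3 := h2.D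
  have t1 := ((hasQExpansion_E2.mul h2).smul (-(1 / 2))).congr_exponent (zero_add r)
  have t2 := (((hasQExpansion_E2.D.smul (1 / 2)).add (hasQExpansion_E4.smul x)).mul
    h1).congr_exponent (zero_add r)
  have t3 := ((hasQExpansion_E6.mul hf).smul y).congr_exponent (zero_add r)
  have e : MLDE.op x y f = MLDE.D (MLDE.D (MLDE.D f))
      + (-(1 / 2) : ℂ) • (EisensteinSeries.E2 * MLDE.D (MLDE.D f))
      + ((1 / 2 : ℂ) • MLDE.D EisensteinSeries.E2 + x • ⇑ModularForm.E₄) * MLDE.D f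
      + y • (⇑ModularForm.E₆ * f) := by
    funext τ
    simp only [MLDE.op, Pi.add_apply, Pi.smul_apply, Pi.mul_apply, smul_eq_mul]
    ring
  rw [e]
  refine (((h3.add t1).add t2).add t3).congr_coeff fun n => ?_
  simp only [opCoeff, Pi.add_apply, Pi.smul_apply, smul_eq_mul, Finset.mul_sum]
  rw [add_assoc, add_assoc, ← Finset.sum_add_distrib, ← Finset.sum_add_distrib]
  congr 1
  · ring
  · refine Finset.sum_congr rfl fun p _ => ?_
    simp only [opKernel]
    ring

lemma HasQExpansion.opCoeff_eq_zero {f : ℍ → ℂ} {r x y : ℂ} {a : ℕ → ℂ} (hf : HasQExpansion f r a)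
    (h : f ∈ solutions x y) (n : ℕ) : opCoeff x y r a n = 0 := by
  have := hf.op x y
  rw [h.2] at this
  exact this.coeff_eq_zero n

lemma HasQExpansion.mem_solutions {f : ℍ → ℂ} {r x y : ℂ} {a : ℕ → ℂ} (hf : HasQExpansion f r a)
    (h : ∀ n, opCoeff x y r a n = 0) : f ∈ solutions x y := by
  refine ⟨hf.mdifferentiable, ?_⟩
  have := hf.op x y
  rw [funext h] at this
  exact funext fun τ => by simpa using (this τ).unique (by simp [hasSum_zero])

/-! ### The solution space has dimension at most three -/

lemma analyticAt_comp_ofComplex {g : ℍ → ℂ} (hg : MDiff g) (τ : ℍ) :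
    AnalyticAt ℂ (g ∘ ofComplex) τ :=
  (UpperHalfPlane.mdifferentiable_iff.1 hg).analyticAt (isOpen_upperHalfPlaneSet.mem_nhds τ.2)

lemma analyticOrderAt_D_add_one {g : ℍ → ℂ} (hg : MDiff g) {τ : ℍ} (h0 : g τ = 0) :
    analyticOrderAt (D g ∘ ofComplex) τ + 1 = analyticOrderAt (g ∘ ofComplex) τ := by
  have hA := analyticAt_comp_ofComplex hg τ
  have h1 : D g ∘ ofComplex =ᶠ[𝓝 (τ : ℂ)] (fun _ => (2 * π * I)⁻¹) * deriv (g ∘ ofComplex) := by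
    filter_upwards [isOpen_upperHalfPlaneSet.mem_nhds τ.2] with w hw
    simp [Derivative.normalizedDerivOfComplex, ofComplex_apply_of_im_pos hw]
  rw [analyticOrderAt_congr h1, analyticOrderAt_mul analyticAt_const hA.deriv]
  have h2 : analyticOrderAt (fun _ : ℂ => (2 * π * I)⁻¹) (τ : ℂ) = 0 := by
    rw [analyticAt_const.analyticOrderAt_eq_zero]
    exact inv_ne_zero Complex.two_pi_I_ne_zero
  have h3 := hA.analyticOrderAt_deriv_add_one
  simp only [Function.comp_apply, ofComplex_apply, h0, sub_zero] at h3
  rw [h2, zero_add, h3]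
  rfl

lemma eq_zero_of_eventuallyEq_zero {g : ℍ → ℂ} (hg : MDiff g) {τ : ℍ}
    (h : g ∘ ofComplex =ᶠ[𝓝 (τ : ℂ)] 0) : g = 0 := by
  have := (UpperHalfPlane.mdifferentiable_iff.1 hg).analyticOnNhd isOpen_upperHalfPlaneSet
  have h2 := this.eqOn_zero_of_preconnected_of_eventuallyEq_zero
    (convex_halfSpace_im_gt 0).isPreconnected τ.2 h
  funext w
  simpa using h2 w.2

lemma le_analyticOrderAt_mul {e g : ℍ → ℂ} (he : MDiff e) (hg : MDiff g) (τ : ℍ) :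
    analyticOrderAt (g ∘ ofComplex) τ ≤ analyticOrderAt ((e * g) ∘ ofComplex) τ := by
  have : (e * g) ∘ ofComplex = (e ∘ ofComplex) * (g ∘ ofComplex) := rfl
  rw [this, analyticOrderAt_mul (analyticAt_comp_ofComplex he τ) (analyticAt_comp_ofComplex hg τ)]
  exact le_add_self

/-- Uniqueness for the Cauchy problem by orders of vanishing. At a common zero each derivation
lowers the order by one, so `f'''` has smaller order than `f''`; but the equation expresses `f'''`
by `f'', f', f`, whose orders are at least that of `f''`. Hence the orders are infinite, and the
identity theorem applies. -/
lemma eq_zero_of_mem_solutions {x y : ℂ} {f : ℍ → ℂ} (hf : f ∈ solutions x y) {τ : ℍ}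
    (h0 : f τ = 0) (h1 : D f τ = 0) (h2 : D (D f) τ = 0) : f = 0 := by
  have m0 := hf.1
  have m1 := Derivative.normalizedDerivOfComplex_mdifferentiable m0
  have m2 := Derivative.normalizedDerivOfComplex_mdifferentiable m1
  have mE2 : MDiff EisensteinSeries.E2 := hasQExpansion_E2.mdifferentiable
  have mE4 : MDiff ⇑ModularForm.E₄ := hasQExpansion_E4.mdifferentiable
  have mE6 : MDiff ⇑ModularForm.E₆ := hasQExpansion_E6.mdifferentiable
  have mDE2 := Derivative.normalizedDerivOfComplex_mdifferentiable mE2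
  have o0 := analyticOrderAt_D_add_one m0 h0
  have o1 := analyticOrderAt_D_add_one m1 h1
  have o2 := analyticOrderAt_D_add_one m2 h2
  set A : ℍ → ℂ := (-(1 / 2) : ℂ) • EisensteinSeries.E2
  set B : ℍ → ℂ := (1 / 2 : ℂ) • D EisensteinSeries.E2 + x • ⇑ModularForm.E₄
  set C : ℍ → ℂ := y • ⇑ModularForm.E₆
  have e : D (D (D f)) = -(A * D (D f) + B * D f + C * f) := by
    funext τ
    have := congrFun hf.2 τ
    simp only [op, Pi.zero_apply] at this
    simp only [A, B, C, Pi.neg_apply, Pi.add_apply, Pi.smul_apply, Pi.mul_apply, smul_eq_mul]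
    linear_combination this
  have l2 := le_analyticOrderAt_mul (e := A) (mE2.const_smul _) m2 τ
  have l1 := le_analyticOrderAt_mul (e := B)
    ((mDE2.const_smul (1 / 2 : ℂ)).add (mE4.const_smul x)) m1 τ
  have l0 := le_analyticOrderAt_mul (e := C) (mE6.const_smul _) m0 τ
  have key : analyticOrderAt (D (D f) ∘ ofComplex) τ ≤ analyticOrderAt (D (D (D f)) ∘ ofComplex) τ := by
    rw [e]
    have e' : (-(A * D (D f) + B * D f + C * f)) ∘ ofComplex
      = -(((A * D (D f)) ∘ ofComplex + (B * D f) ∘ ofComplex) + (C * f) ∘ ofComplex) := rfl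
    rw [e', analyticOrderAt_neg]
    refine le_trans ?_ le_analyticOrderAt_add
    refine le_min (le_trans (le_min l2 ?_) le_analyticOrderAt_add) ?_
    · exact (le_self_add.trans o1.le).trans l1
    · exact ((le_self_add.trans o1.le).trans (le_self_add.trans o0.le)).trans l0
  have htop : analyticOrderAt (D (D (D f)) ∘ ofComplex) τ = ⊤ := by
    by_contra hne
    rw [← o2] at key
    exact absurd key (not_le.2 (ENat.lt_add_one_iff hne |>.2 le_rfl))
  rw [htop, top_add] at o2
  rw [← o2, top_add] at o1
  rw [← o1, top_add] at o0
  exact eq_zero_of_eventuallyEq_zero m0 (analyticOrderAt_eq_top.1 o0.symm)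

/-- The Cauchy data of a solution at a point. -/
def cauchyData (x y : ℂ) (τ : ℍ) : solutions x y →ₗ[ℂ] (Fin 3 → ℂ) where
  toFun f := ![(f : ℍ → ℂ) τ, D f τ, D (D f) τ]
  map_add' := by
    rintro ⟨f, hf⟩ ⟨g, hg⟩
    have e1 := Derivative.normalizedDerivOfComplex_add f g hf.1 hg.1
    have e2 := Derivative.normalizedDerivOfComplex_add _ _
      (Derivative.normalizedDerivOfComplex_mdifferentiable hf.1)
      (Derivative.normalizedDerivOfComplex_mdifferentiable hg.1)
    funext i
    fin_cases i
    · rfl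
    · exact congrFun e1 τ
    · change D (D (f + g)) τ = D (D f) τ + D (D g) τ
      simp only [D, e1, e2, Pi.add_apply]
  map_smul' := by
    rintro c ⟨f, hf⟩
    have e1 := Derivative.normalizedDerivOfComplex_smul c f hf.1
    have e2 := Derivative.normalizedDerivOfComplex_smul c _
      (Derivative.normalizedDerivOfComplex_mdifferentiable hf.1)
    funext i
    fin_cases i
    · rfl
    · exact congrFun e1 τ
    · change D (D (c • f)) τ = c • D (D f) τ
      simp only [D, e1, e2, Pi.smul_apply]

lemma cauchyData_injective (x y : ℂ) (τ : ℍ) : Function.Injective (cauchyData x y τ) := by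
  rw [← LinearMap.ker_eq_bot, LinearMap.ker_eq_bot']
  intro f hf
  exact Subtype.ext (eq_zero_of_mem_solutions f.2 (congrFun hf 0) (congrFun hf 1) (congrFun hf 2))

instance (x y : ℂ) : FiniteDimensional ℂ (solutions x y) :=
  FiniteDimensional.of_injective _ (cauchyData_injective x y UpperHalfPlane.I)

lemma finrank_solutions_le (x y : ℂ) : Module.finrank ℂ (solutions x y) ≤ 3 := by
  simpa using LinearMap.finrank_le_finrank_of_injective (cauchyData_injective x y UpperHalfPlane.I)

/-- Thanks to the upper bound on the dimension, no general existence theorem for solutions is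
required. -/
lemma isBasisOfSolutions_of_linearIndependent {x y : ℂ} {f : Fin 3 → ℍ → ℂ}
    (hf : ∀ i, f i ∈ solutions x y) (hi : LinearIndependent ℂ f) : IsBasisOfSolutions x y f := by
  refine ⟨hi, Submodule.eq_of_le_of_finrank_le ?_ ?_⟩
  · rw [Submodule.span_le]
    rintro _ ⟨i, rfl⟩
    exact hf i
  · rw [finrank_span_eq_card hi]
    simpa using finrank_solutions_le x y

end

section

/-! ### Solving the recursion -/

lemma opKernel_one (x y r : ℂ) (j : ℕ) : opKernel x y r 1 j =
    12 * (r + j) ^ 2 + (-12 + 240 * x) * (r + j) - 504 * y := by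
  simp only [opKernel, eisCoeff_one]; push_cast; ring

lemma opKernel_two (x y r : ℂ) (j : ℕ) : opKernel x y r 2 j =
    36 * (r + j) ^ 2 + (-72 + 2160 * x) * (r + j) - 16632 * y := by
  simp only [opKernel, eisCoeff_two]; push_cast; ring

lemma opKernel_three (x y r : ℂ) (j : ℕ) : opKernel x y r 3 j =
    48 * (r + j) ^ 2 + (-144 + 6720 * x) * (r + j) - 122976 * y := by
  simp only [opKernel, eisCoeff_three]; push_cast; ring

lemma opKernel_four (x y r : ℂ) (j : ℕ) : opKernel x y r 4 j =
    84 * (r + j) ^ 2 + (-336 + 17520 * x) * (r + j) - 532728 * y := by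
  simp only [opKernel, eisCoeff_four]; push_cast; ring

lemma opKernel_five (x y r : ℂ) (j : ℕ) : opKernel x y r 5 j =
    72 * (r + j) ^ 2 + (-360 + 30240 * x) * (r + j) - 1575504 * y := by
  simp only [opKernel, eisCoeff_five]; push_cast; ring

/-- The value of the indicial polynomial. -/
def ind (x y t : ℂ) : ℂ := t ^ 3 - 1 / 2 * t ^ 2 + x * t + y

lemma opCoeff_zero (x y r : ℂ) (a : ℕ → ℂ) : opCoeff x y r a 0 = ind x y r * a 0 := by
  simp [opCoeff_eq, ind]

lemma coeff_eq_of_opCoeff {x y r : ℂ} {a b : ℕ → ℂ} {n : ℕ} (ha : opCoeff x y r a n = 0)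
    (hb : opCoeff x y r b n = 0) (h : ∀ k < n, a k = b k) (hn : ind x y (r + n) ≠ 0) :
    a n = b n := by
  rw [opCoeff_eq] at ha hb
  have : ∑ i ∈ range n, opKernel x y r (i + 1) (n - (i + 1)) * a (n - (i + 1))
      = ∑ i ∈ range n, opKernel x y r (i + 1) (n - (i + 1)) * b (n - (i + 1)) := by
    refine Finset.sum_congr rfl fun i hi => ?_
    rw [h _ (by have := Finset.mem_range.1 hi; omega)]
  rw [this] at ha
  refine mul_left_cancel₀ hn ?_
  simp only [ind]
  linear_combination ha - hb

/-- The coefficients of a solution agree with a given list as long as the list satisfies the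
recursion and there is no resonance. -/
lemma HasQExpansion.coeff_eq_getD {x y r : ℂ} {f : ℍ → ℂ} {a : ℕ → ℂ} (hf : HasQExpansion f r a)
    (hs : f ∈ solutions x y) (l : List ℂ) (h0 : a 0 = l.getD 0 0)
    (H : ∀ n < l.length, n ≠ 0 → ind x y (r + n) ≠ 0 ∧ opCoeff x y r (fun k => l.getD k 0) n = 0)
    (n : ℕ) (hn : n < l.length) : a n = l.getD n 0 := by
  induction n using Nat.strong_induction_on with
  | _ n ih =>
    rcases eq_or_ne n 0 with rfl | hn0
    · exact h0
    · exact coeff_eq_of_opCoeff (b := fun k => l.getD k 0) (hf.opCoeff_eq_zero hs n) (H n hn hn0).2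
        (fun k hk => ih k hk (hk.trans hn)) (H n hn hn0).1

lemma HasQExpansion.qExpansionStarts {x y r : ℂ} {f : ℍ → ℂ} {a : ℕ → ℂ}
    (hf : HasQExpansion f r a)
    (hs : f ∈ solutions x y) (l : List ℂ) (h0 : a 0 = l.getD 0 0)
    (H : ∀ n < l.length, n ≠ 0 → ind x y (r + n) ≠ 0 ∧
      opCoeff x y r (fun k => l.getD k 0) n = 0) : QExpansionStarts f r l :=
  ⟨a, hf, fun i hi => by
    rw [hf.coeff_eq_getD hs l h0 H i hi, List.getD_eq_getElem _ _ hi]⟩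

/-! ### Convergent Frobenius solutions -/

/-- The Frobenius recursion. -/
def frobenius (x y r : ℂ) : ℕ → ℂ
  | 0 => 1
  | (n + 1) => -(∑ k : Fin (n + 1), opKernel x y r (n + 1 - k) k * frobenius x y r k)
      / ind x y (r + (n + 1 : ℕ))
  decreasing_by exact k.2

lemma sum_range_opKernel (x y r : ℂ) (a : ℕ → ℂ) (n : ℕ) :
    ∑ i ∈ range n, opKernel x y r (i + 1) (n - (i + 1)) * a (n - (i + 1))
      = ∑ k ∈ range n, opKernel x y r (n - k) k * a k := by
  rw [← Finset.sum_range_reflect]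
  refine Finset.sum_congr rfl fun i hi => ?_
  have := Finset.mem_range.1 hi
  congr 2 <;> omega

lemma opCoeff_frobenius {x y r : ℂ} (h0 : ind x y r = 0) (h : ∀ n : ℕ, ind x y (r + (n + 1 : ℕ)) ≠ 0)
    (n : ℕ) : opCoeff x y r (frobenius x y r) n = 0 := by
  cases n with
  | zero => rw [opCoeff_zero, h0, zero_mul]
  | succ n =>
    rw [opCoeff_eq, sum_range_opKernel, frobenius, Finset.sum_range]
    have := h n
    rw [ind] at this
    rw [ind, mul_div_cancel₀ _ this]
    ring

/-- The degree 2 in `j` is what matters: the indicial polynomial that the recursion divides by grows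
cubically (`le_norm_ind`). The degree in `i` is harmless against `ρ ^ i`. -/
lemma norm_opKernel_le (x y r : ℂ) : ∃ K : ℝ, 0 ≤ K ∧ ∀ i j : ℕ,
    ‖opKernel x y r i j‖ ≤ K * (((i : ℝ) + 1) ^ 6 * ((j : ℝ) + 1) ^ 2) := by
  refine ⟨12 * (‖r‖ + 1) ^ 2 + (12 + 240 * ‖x‖) * (‖r‖ + 1) + 504 * ‖y‖, by positivity,
    fun i j => ?_⟩
  have e2 := norm_eisCoeff_le (-24) (by norm_num) 1 i
  have e4 := norm_eisCoeff_le 240 (by norm_num) 3 i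
  have e6 := norm_eisCoeff_le (-504) (by norm_num) 5 i
  simp only [norm_neg, Complex.norm_ofNat] at e2 e4 e6
  set I : ℝ := (i : ℝ) + 1
  set J : ℝ := (j : ℝ) + 1
  have hI : 1 ≤ I := by simp [I]
  have hJ : 1 ≤ J := by simp [J]
  have hs : ‖r + j‖ ≤ (‖r‖ + 1) * J := by
    refine (norm_add_le _ _).trans ?_
    rw [Complex.norm_natCast]
    have : (j : ℝ) = J - 1 := by simp [J]
    nlinarith [norm_nonneg r]
  have p1 : I ^ 2 ≤ I ^ 6 := pow_le_pow_right₀ hI (by norm_num)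
  have p2 : I ^ 4 ≤ I ^ 6 := pow_le_pow_right₀ hI (by norm_num)
  have p3 : I ^ 3 ≤ I ^ 6 := pow_le_pow_right₀ hI (by norm_num)
  have q1 : J ≤ J ^ 2 := by nlinarith
  have q0 : 1 ≤ J ^ 2 := by nlinarith
  have hi : ‖(i : ℂ)‖ ≤ I := by rw [Complex.norm_natCast]; simp [I]
  have t1 : ‖-(1 / 2) * eisCoeff (-24) 1 i * (r + j) ^ 2‖
      ≤ 12 * (‖r‖ + 1) ^ 2 * (I ^ 6 * J ^ 2) := by
    rw [norm_mul, norm_mul, norm_pow]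
    calc ‖(-(1 / 2) : ℂ)‖ * ‖eisCoeff (-24) 1 i‖ * ‖r + j‖ ^ 2
        ≤ (1 / 2) * (24 * I ^ 6) * ((‖r‖ + 1) * J) ^ 2 := by
          gcongr
          · norm_num
          · exact e2.trans (by gcongr)
      _ = _ := by ring
  have t2 : ‖(1 / 2 * i * eisCoeff (-24) 1 i + x * eisCoeff 240 3 i) * (r + j)‖
      ≤ (12 + 240 * ‖x‖) * (‖r‖ + 1) * (I ^ 6 * J ^ 2) := by
    rw [norm_mul]
    have : ‖1 / 2 * i * eisCoeff (-24) 1 i + x * eisCoeff 240 3 i‖ ≤ (12 + 240 * ‖x‖) * I ^ 6 := by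
      refine (norm_add_le _ _).trans ?_
      rw [norm_mul, norm_mul, norm_mul]
      calc ‖(1 / 2 : ℂ)‖ * ‖(i : ℂ)‖ * ‖eisCoeff (-24) 1 i‖ + ‖x‖ * ‖eisCoeff 240 3 i‖
          ≤ (1 / 2) * I * (24 * I ^ 2) + ‖x‖ * (240 * I ^ 6) := by
            gcongr
            · norm_num
            · exact e4.trans (by gcongr)
        _ = 12 * I ^ 3 + 240 * ‖x‖ * I ^ 6 := by ring
        _ ≤ 12 * I ^ 6 + 240 * ‖x‖ * I ^ 6 := by gcongr
        _ = _ := by ring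
    calc _ ≤ ((12 + 240 * ‖x‖) * I ^ 6) * ((‖r‖ + 1) * J ^ 2) := by
          refine mul_le_mul this (hs.trans (by gcongr)) (norm_nonneg _) (by positivity)
      _ = _ := by ring
  have t3 : ‖y * eisCoeff (-504) 5 i‖ ≤ 504 * ‖y‖ * (I ^ 6 * J ^ 2) := by
    rw [norm_mul]
    calc ‖y‖ * ‖eisCoeff (-504) 5 i‖ ≤ ‖y‖ * (504 * I ^ 6 * 1) := by
          rw [mul_one]; gcongr
      _ ≤ ‖y‖ * (504 * I ^ 6 * J ^ 2) := by gcongr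
      _ = _ := by ring
  rw [opKernel]
  refine (norm_add₃_le).trans ((add_le_add (add_le_add t1 t2) t3).trans (le_of_eq ?_))
  ring

lemma le_norm_ind (x y r : ℂ) : ∃ C : ℝ, 0 ≤ C ∧ ∀ n : ℕ, 1 ≤ n →
    (n : ℝ) ^ 3 - C * (n : ℝ) ^ 2 ≤ ‖ind x y (r + n)‖ := by
  refine ⟨‖3 * r - 1 / 2‖ + ‖3 * r ^ 2 - r + x‖ + ‖ind x y r‖, by positivity, fun n hn => ?_⟩
  have hn' : (1 : ℝ) ≤ n := by exact_mod_cast hn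
  have e : ind x y (r + n) = (n : ℂ) ^ 3 - (-((3 * r - 1 / 2) * (n : ℂ) ^ 2
      + (3 * r ^ 2 - r + x) * n + ind x y r)) := by
    simp only [ind]; ring
  rw [e]
  refine le_trans ?_ (norm_sub_norm_le _ _)
  rw [norm_pow, Complex.norm_natCast, norm_neg]
  refine sub_le_sub_left ?_ _
  refine (norm_add₃_le).trans ?_
  rw [norm_mul, norm_mul, norm_pow, Complex.norm_natCast]
  have : (n : ℝ) ≤ n ^ 2 := by nlinarith
  have h1 : (1 : ℝ) ≤ n ^ 2 := by nlinarith
  nlinarith [norm_nonneg (3 * r ^ 2 - r + x), norm_nonneg (ind x y r)]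

/-- For each `ρ < 1` the products `‖aₙ‖ ρ ^ n` are bounded by a constant `M`. If `M` works below
`n`, the recursion gives `‖ind (r + n)‖ ‖aₙ‖ ρ ^ n ≤ K S n² M` with `S = ∑ (i + 1)⁶ ρ ^ i`, while
`‖ind (r + n)‖ ≥ n² (K S + 1)` once `n > C + K S + 1`; so `M` works for `n`. Smaller indices are
absorbed by taking `M` to be a sum over them. Resonances are harmless here: division by zero gives
zero, and there are none for large `n`. -/
lemma discSummable_frobenius (x y r : ℂ) : DiscSummable (frobenius x y r) := by
  suffices H : ∀ ρ : ℝ, 0 < ρ → ρ < 1 → ∃ M, ∀ n, ‖frobenius x y r n‖ * ρ ^ n ≤ M by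
    intro ρ h0 h1
    obtain ⟨σ, hσ, hσ1⟩ := exists_between h1
    have hσ0 : 0 < σ := h0.trans_lt hσ
    obtain ⟨M, hM⟩ := H σ hσ0 hσ1
    refine Summable.of_nonneg_of_le (fun n => by positivity) (fun n => ?_)
      ((summable_geometric_of_lt_one (r := ρ / σ) (by positivity)
        ((div_lt_one hσ0).2 hσ)).mul_left M)
    calc ‖frobenius x y r n‖ * ρ ^ n = (‖frobenius x y r n‖ * σ ^ n) * (ρ / σ) ^ n := by
          rw [div_pow]; field_simp
      _ ≤ M * (ρ / σ) ^ n := by gcongr; exact hM n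
  intro ρ h0 h1
  set a := frobenius x y r
  obtain ⟨K, hK0, hK⟩ := norm_opKernel_le x y r
  obtain ⟨C, hC0, hC⟩ := le_norm_ind x y r
  have hsum : Summable fun i : ℕ => ((i : ℝ) + 1) ^ 6 * ρ ^ i := by
    have h6 := (summable_nat_add_iff 1).2 (summable_pow_mul_geometric_of_norm_lt_one 6
      (r := ρ) (by rwa [Real.norm_of_nonneg h0.le]))
    refine (h6.mul_left ρ⁻¹).congr fun i => ?_
    push_cast
    rw [pow_succ ρ]
    field_simp
  set S := ∑' i : ℕ, ((i : ℝ) + 1) ^ 6 * ρ ^ i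
  have hS0 : 0 ≤ S := tsum_nonneg fun i => by positivity
  obtain ⟨N, hN⟩ := exists_nat_gt (C + K * S + 1)
  set M := ∑ k ∈ range (N + 1), ‖a k‖ * ρ ^ k
  have hM0 : 0 ≤ M := Finset.sum_nonneg fun i _ => by positivity
  refine ⟨M, fun n => ?_⟩
  induction n using Nat.strong_induction_on with
  | _ n ih =>
    by_cases hn : n < N + 1
    · exact Finset.single_le_sum (f := fun k => ‖a k‖ * ρ ^ k) (fun i _ => by positivity)
        (Finset.mem_range.2 hn)
    · push Not at hn
      obtain ⟨m, rfl⟩ : ∃ m, n = m + 1 := ⟨n - 1, by omega⟩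
      have hm : C + K * S + 1 < ((m + 1 : ℕ) : ℝ) := hN.trans_le (by exact_mod_cast (by omega))
      have hind := hC (m + 1) (by omega)
      set n' : ℝ := ((m + 1 : ℕ) : ℝ)
      have hn1 : 1 ≤ n' := by simp [n']
      have hpos : n' ^ 2 * (K * S + 1) ≤ ‖ind x y (r + (m + 1 : ℕ))‖ := by
        refine le_trans ?_ hind
        nlinarith [sq_nonneg n', mul_nonneg hK0 hS0]
      have hpos' : 0 < ‖ind x y (r + (m + 1 : ℕ))‖ :=
        lt_of_lt_of_le (by positivity) hpos
      have hrec : ‖ind x y (r + (m + 1 : ℕ))‖ * ‖a (m + 1)‖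
          ≤ ∑ k ∈ range (m + 1), ‖opKernel x y r (m + 1 - k) k‖ * ‖a k‖ := by
        have : ind x y (r + (m + 1 : ℕ)) * a (m + 1)
            = -∑ k : Fin (m + 1), opKernel x y r (m + 1 - k) k * a k := by
          simp only [a]
          rw [frobenius, mul_div_cancel₀ _ (norm_pos_iff.1 hpos')]
        rw [← norm_mul, this, norm_neg, Finset.sum_range]
        refine (norm_sum_le _ _).trans (le_of_eq ?_)
        simp only [norm_mul]
      have hterm : ∀ k ∈ range (m + 1), ‖opKernel x y r (m + 1 - k) k‖ * ‖a k‖ * ρ ^ (m + 1)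
          ≤ K * n' ^ 2 * M * (((m + 1 - k : ℕ) + 1 : ℝ) ^ 6 * ρ ^ (m + 1 - k)) := by
        intro k hk
        have hk' := Finset.mem_range.1 hk
        have hsplit : ρ ^ (m + 1) = ρ ^ (m + 1 - k) * ρ ^ k := by
          rw [← pow_add]; congr 1; omega
        have hkn : ((k : ℝ) + 1) ≤ n' := by
          simp only [n']; exact_mod_cast hk'
        calc _ = ‖opKernel x y r (m + 1 - k) k‖ * ρ ^ (m + 1 - k) * (‖a k‖ * ρ ^ k) := by
              rw [hsplit]; ring
          _ ≤ (K * ((((m + 1 - k : ℕ) : ℝ) + 1) ^ 6 * n' ^ 2)) * ρ ^ (m + 1 - k) * M := by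
              gcongr
              · refine (hK _ _).trans ?_
                gcongr
              · exact ih k hk'
          _ = _ := by ring
      have hsumle : ∑ k ∈ range (m + 1), (((m + 1 - k : ℕ) + 1 : ℝ) ^ 6 * ρ ^ (m + 1 - k)) ≤ S := by
        have h1 : ∑ k ∈ range (m + 1), (((m + 1 - k : ℕ) + 1 : ℝ) ^ 6 * ρ ^ (m + 1 - k))
            = ∑ i ∈ range (m + 1), (((i + 1 : ℕ) : ℝ) + 1) ^ 6 * ρ ^ (i + 1) := by
          rw [← Finset.sum_range_reflect]
          refine Finset.sum_congr rfl fun i hi => ?_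
          have := Finset.mem_range.1 hi
          rw [show m + 1 - (m + 1 - 1 - i) = i + 1 by omega]
        rw [h1]
        have h2 := hsum.sum_le_tsum (range (m + 2)) (fun i _ => by positivity)
        rw [Finset.sum_range_succ'] at h2
        refine le_trans ?_ h2
        simp
      have hfin : ‖ind x y (r + (m + 1 : ℕ))‖ * (‖a (m + 1)‖ * ρ ^ (m + 1)) ≤ K * n' ^ 2 * M * S := by
        rw [← mul_assoc]
        calc _ ≤ (∑ k ∈ range (m + 1), ‖opKernel x y r (m + 1 - k) k‖ * ‖a k‖) * ρ ^ (m + 1) := by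
              gcongr
          _ ≤ K * n' ^ 2 * M * ∑ k ∈ range (m + 1),
              (((m + 1 - k : ℕ) + 1 : ℝ) ^ 6 * ρ ^ (m + 1 - k)) := by
              rw [Finset.sum_mul, Finset.mul_sum]
              exact Finset.sum_le_sum hterm
          _ ≤ _ := by gcongr
      by_contra! hlt
      have : n' ^ 2 * (K * S + 1) * M < n' ^ 2 * (K * S + 1) * (‖a (m + 1)‖ * ρ ^ (m + 1)) :=
        mul_lt_mul_of_pos_left hlt (by positivity)
      have h3 : n' ^ 2 * (K * S + 1) * (‖a (m + 1)‖ * ρ ^ (m + 1))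
          ≤ ‖ind x y (r + (m + 1 : ℕ))‖ * (‖a (m + 1)‖ * ρ ^ (m + 1)) := by gcongr
      nlinarith [mul_nonneg (sq_nonneg n') hM0]

/-- In the absence of resonances, an indicial root is the exponent of a convergent solution. -/
lemma exists_frobenius_solution {x y r : ℂ} (h0 : ind x y r = 0)
    (h : ∀ n : ℕ, ind x y (r + (n + 1 : ℕ)) ≠ 0) :
    ∃ f ∈ solutions x y, ∃ a, HasQExpansion f r a ∧ a 0 = 1 := by
  have := (discSummable_frobenius x y r).hasQExpansion r
  exact ⟨_, this.mem_solutions (opCoeff_frobenius h0 h), _, this, by rw [frobenius]⟩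

end

section

/-! ### The classification -/

lemma mem_roots_indicial (x y t : ℂ) : t ∈ (indicial x y).roots ↔ ind x y t = 0 := by
  have hne : indicial x y ≠ 0 := by
    intro h
    have := congrArg (fun p => Polynomial.coeff p 3) h
    simp [indicial] at this
  rw [Polynomial.mem_roots hne, Polynomial.IsRoot.def]
  simp [indicial, ind]

lemma roots_indicial {x y : ℂ} (a b c : ℂ) (h1 : a + b + c = 1 / 2) (h2 : a * b + a * c + b * c = x)
    (h3 : -(a * b * c) = y) : (indicial x y).roots = {a, b, c} := by
  have : indicial x y = (Multiset.map (fun t => Polynomial.X - Polynomial.C t) {a, b, c}).prod := by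
    simp only [indicial, ← h1, ← h2, ← h3, Multiset.insert_eq_cons, Multiset.map_cons,
      Multiset.map_singleton, Multiset.prod_cons, Multiset.prod_singleton, Polynomial.C_add,
      Polynomial.C_mul, Polynomial.C_neg]
    ring
  rw [this, Polynomial.roots_multiset_prod_X_sub_C]

/-- If `(m - 28) (m - 124)` is a square then `m = 76 + u + v` with `u v = 576`. -/
lemma exists_mul_eq_of_isSquare {m w : ℤ} (h : w ^ 2 = (m - 28) * (m - 124)) :
    ∃ u v : ℤ, u * v = 576 ∧ m = 76 + u + v := by
  -- The equation says `(m - 76 - w)(m - 76 + w) = 48² = 4 · 576`. The two factors have the same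
  -- parity, so both are even and halving them gives `u` and `v`.
  have hpar : (m - 76 - w) % 2 = 0 := by
    have h' : (m - 76 - w) * (m - 76 + w) = 2304 := by linear_combination -h
    rcases Int.emod_two_eq_zero_or_one (m - 76 - w) with h0 | h1
    · exact h0
    · have h2 : (m - 76 + w) % 2 = 1 := by omega
      have := Int.mul_emod (m - 76 - w) (m - 76 + w) 2
      rw [h', h1, h2] at this
      norm_num at this
  obtain ⟨u, hu⟩ := Int.dvd_of_emod_eq_zero hpar
  refine ⟨u, m - 76 - u, ?_, by ring⟩
  have : w = m - 76 - 2 * u := by linarith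
  subst this
  nlinarith

/-- Negative factorizations of 576 produce the values up to 28, positive ones those from 124 on. -/
lemma mem_of_mul_eq {m u v : ℤ} (hm : 0 ≤ m) (h : u * v = 576) (hmuv : m = 76 + u + v) :
    m ∈ ({3, 16, 24, 26, 28, 124, 126, 128, 136, 149, 156, 178, 224, 271, 366, 653} : Finset ℤ) := by
  have hu : u.natAbs ∈ Nat.divisors 576 := by
    rw [Nat.mem_divisors]
    exact ⟨by simpa using Int.natAbs_dvd_natAbs.2 (Dvd.intro v h), by norm_num⟩
  have hd : Nat.divisors 576 = {1, 2, 3, 4, 6, 8, 9, 12, 16, 18, 24, 32, 36, 48, 64, 72, 96, 144,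
      192, 288, 576} := by decide +kernel
  rw [hd] at hu
  simp only [Finset.mem_insert, Finset.mem_singleton] at hu ⊢
  have huv : u = u.natAbs ∨ u = -u.natAbs := Int.natAbs_eq u
  rcases hu with hu | hu | hu | hu | hu | hu | hu | hu | hu | hu | hu | hu | hu | hu | hu | hu |
    hu | hu | hu | hu | hu <;> rw [hu] at huv <;> rcases huv with rfl | rfl <;>
    push_cast at h hmuv <;> omega

/-- The relation rearranges to `4 s² (m - 124) = m - 28`; multiplying by `m - 124` exhibits a
rational square, and an integer that is a rational square is the square of an integer. -/
lemma sq_mul_eq_of_coeffs {m : ℕ} {s : ℚ} (h : (m : ℂ) * (1 / 4 + -(s : ℂ) ^ 2) = 7 + 124 * -(s : ℂ) ^ 2) :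
    ∃ w : ℤ, w ^ 2 = ((m : ℤ) - 28) * (m - 124) := by
  have hq : (m : ℚ) * (1 / 4 + -s ^ 2) = 7 + 124 * -s ^ 2 := by
    have : ((m * (1 / 4 + -s ^ 2) : ℚ) : ℂ) = ((7 + 124 * -s ^ 2 : ℚ) : ℂ) := by
      push_cast; linear_combination h
    exact_mod_cast this
  have hsq : (2 * s * (m - 124)) ^ 2 = (((m : ℤ) - 28) * (m - 124) : ℤ) := by
    push_cast
    linear_combination -4 * (m - 124 : ℚ) * hq
  have : IsSquare ((((m : ℤ) - 28) * (m - 124) : ℤ) : ℚ) := ⟨2 * s * (m - 124), by rw [← hsq]; ring⟩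
  rw [Rat.isSquare_intCast_iff] at this
  obtain ⟨w, hw⟩ := this
  exact ⟨w, by rw [hw]; ring⟩

theorem classification (x y : ℂ) (f : ℍ → ℂ) (a : ℕ → ℂ) (hf : f ∈ solutions x y)
    (ha : HasQExpansion f (-1 / 6) a) (a0 : a 0 = 1) (h1 : ∃ m₁ : ℕ, a 1 = m₁)
    (h2 : ∃ m₂ : ℕ, a 2 = m₂) (hr : ∀ t ∈ (indicial x y).roots, ∃ r : ℚ, t = r) :
    (a 1 = 16 ∧ a 2 = 98 ∧ x = -1 / 36 ∧ y = 1 / 72 ∧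
        (indicial x y).roots = {-1 / 6, 1 / 6, 1 / 2}) ∨
    (a 1 = 24 ∧ a 2 = 124 ∧ x = -1 / 100 ∧ y = 91 / 5400 ∧
        (indicial x y).roots = {-1 / 6, 7 / 30, 13 / 30}) ∨
    (a 1 = 28 ∧ a 2 = 134 ∧ x = 0 ∧ y = 1 / 54 ∧
        (indicial x y).roots = {-1 / 6, 1 / 3, 1 / 3}) ∨
    (a 1 = 156 ∧ a 2 = 6790 ∧ x = -1 ∧ y = -4 / 27 ∧
        (indicial x y).roots = {-2 / 3, -1 / 6, 4 / 3}) ∨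
    (a 1 = 178 ∧ a 2 = 4634 ∧ x = -25 / 36 ∧ y = -7 / 72 ∧
        (indicial x y).roots = {-1 / 2, -1 / 6, 7 / 6}) ∨
    (a 1 = 271 ∧ a 2 = 4076 ∧ x = -81 / 196 ∧ y = -533 / 10584 ∧
        (indicial x y).roots = {-13 / 42, -1 / 6, 41 / 42}) := by
  obtain ⟨m, hm⟩ := h1
  obtain ⟨k, hk⟩ := h2
  have c0 := ha.opCoeff_eq_zero hf 0
  have c1 := ha.opCoeff_eq_zero hf 1
  have c2 := ha.opCoeff_eq_zero hf 2
  rw [opCoeff_zero, a0, mul_one, ind] at c0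
  have hy : y = x / 6 + 1 / 54 := by linear_combination c0
  simp only [opCoeff_eq, sum_range_succ, range_zero, sum_empty, opKernel_one, opKernel_two, a0, hm, hk,
    Nat.reduceAdd, Nat.reduceSub, hy] at c1 c2
  push_cast at c1 c2
  have e1 : (m : ℂ) * (1 / 4 + x) = 7 + 124 * x := by linear_combination c1
  have e2 : (k : ℂ) * (9 / 2 + 2 * x) + m * (116 * x - 11) =
      (3132 * x + 295) := by linear_combination c2
  -- The quadratic is the cofactor of `t + 1/6` in the indicial polynomial; its roots are `1/3 ± s`
  -- with `x = -s²`.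
  obtain ⟨t, ht⟩ : ∃ t : ℂ, t ^ 2 - 2 / 3 * t + (x + 1 / 9) = 0 := by
    obtain ⟨z, hz⟩ := IsAlgClosed.exists_eq_mul_self (-x)
    exact ⟨1 / 3 + z, by linear_combination -hz⟩
  obtain ⟨r, rfl⟩ := hr t ((mem_roots_indicial x y t).2 (by
    rw [ind, hy]; linear_combination (t + 1 / 6) * ht))
  have hx : x = -((r - 1 / 3 : ℚ) : ℂ) ^ 2 := by push_cast; linear_combination ht
  obtain ⟨w, hw⟩ := sq_mul_eq_of_coeffs (m := m) (s := r - 1 / 3) (by rw [← hx]; exact e1)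
  obtain ⟨p, p', hp, hpm⟩ := exists_mul_eq_of_isSquare hw
  have hmem := mem_of_mul_eq (Int.natCast_nonneg m) hp hpm
  clear hw hp hpm ht hr c0 c1 c2 hf ha
  simp only [Finset.mem_insert, Finset.mem_singleton] at hmem
  -- Unless `m₁ = 124`, where `x` cancels and a contradiction is left, the equation of order 1 fixes
  -- `x = v`; the equation of order 2 then reads `m₂ c = d`.
  have solve : ∀ (n : ℕ) (v c d : ℂ), (m : ℤ) = n → (n : ℂ) ≠ 124 → n * (1 / 4 + v) = 7 + 124 * v →
      (9 / 2 + 2 * v) = c → 3132 * v + 295 - n * (116 * v - 11) = d →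
      (m : ℂ) = n ∧ x = v ∧ (k : ℂ) * c = d := by
    intro n v c d hmn hn hv hc hd
    have hmn' : m = n := by exact_mod_cast hmn
    subst hmn'
    have hxv : x = v := by
      refine mul_left_cancel₀ (sub_ne_zero.2 hn) ?_
      linear_combination e1 - hv
    subst hxv
    exact ⟨rfl, rfl, by rw [← hc, ← hd]; linear_combination e2⟩
  rcases hmem with h | h | h | h | h | h | h | h | h | h | h | h | h | h | h | h
  · obtain ⟨hm', hx', hk'⟩ := solve 3 (-25 / 484) (532 / 121) (22288 / 121) h (by norm_num) (by norm_num) (by norm_num)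
      (by norm_num)
    exfalso
    have : 19 * (k : ℂ) = 796 := by linear_combination (121 / 28) * hk'
    have : 19 * (k : ℕ) = 796 := by exact_mod_cast this
    omega
  · obtain ⟨hm', hx', hk'⟩ := solve 16 (-1 / 36) (40 / 9) (3920 / 9) h (by norm_num) (by norm_num) (by norm_num)
      (by norm_num)
    have hy' : y = (1 / 72) := by rw [hy, hx']; norm_num
    have hk2 : (k : ℂ) = 98 := by linear_combination (9 / 40) * hk'
    refine Or.inl ?_
    refine ⟨by rw [hm, hm']; norm_num, by rw [hk, hk2], hx'.trans (by norm_num), hy'.trans (by norm_num), ?_⟩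
    exact roots_indicial (-1 / 6) (1 / 6) (1 / 2) (by norm_num) (by rw [hx']; norm_num) (by rw [hy']; norm_num)
  · obtain ⟨hm', hx', hk'⟩ := solve 24 (-1 / 100) (112 / 25) (13888 / 25) h (by norm_num) (by norm_num) (by norm_num)
      (by norm_num)
    have hy' : y = (91 / 5400) := by rw [hy, hx']; norm_num
    have hk2 : (k : ℂ) = 124 := by linear_combination (25 / 112) * hk'
    refine Or.inr ?_; refine Or.inl ?_
    refine ⟨by rw [hm, hm']; norm_num, by rw [hk, hk2], hx'.trans (by norm_num), hy'.trans (by norm_num), ?_⟩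
    exact roots_indicial (-1 / 6) (7 / 30) (13 / 30) (by norm_num) (by rw [hx']; norm_num) (by rw [hy']; norm_num)
  · obtain ⟨hm', hx', hk'⟩ := solve 26 (-1 / 196) (220 / 49) (28440 / 49) h (by norm_num) (by norm_num) (by norm_num)
      (by norm_num)
    exfalso
    have : 11 * (k : ℂ) = 1422 := by linear_combination (49 / 20) * hk'
    have : 11 * (k : ℕ) = 1422 := by exact_mod_cast this
    omega
  · obtain ⟨hm', hx', hk'⟩ := solve 28 (0) (9 / 2) (603) h (by norm_num) (by norm_num) (by norm_num)
      (by norm_num)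
    have hy' : y = (1 / 54) := by rw [hy, hx']; norm_num
    have hk2 : (k : ℂ) = 134 := by linear_combination (2 / 9) * hk'
    refine Or.inr ?_; refine Or.inr ?_; refine Or.inl ?_
    refine ⟨by rw [hm, hm']; norm_num, by rw [hk, hk2], hx'.trans (by norm_num), hy'.trans (by norm_num), ?_⟩
    exact roots_indicial (-1 / 6) (1 / 3) (1 / 3) (by norm_num) (by rw [hx']; norm_num) (by rw [hy']; norm_num)
  · have hm' : (m : ℂ) = 124 := by exact_mod_cast h
    rw [hm'] at e1
    exfalso
    have : (24 : ℂ) = 0 := by linear_combination e1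
    norm_num at this
  · obtain ⟨hm', hx', hk'⟩ := solve 126 (-49 / 4) (-20) (142360) h (by norm_num) (by norm_num) (by norm_num)
      (by norm_num)
    exfalso
    have : (k : ℂ) + 7118 = 0 := by linear_combination (-1 / 20) * hk'
    have : (k : ℕ) + 7118 = 0 := by exact_mod_cast this
    omega
  · obtain ⟨hm', hx', hk'⟩ := solve 128 (-25 / 4) (-8) (74928) h (by norm_num) (by norm_num) (by norm_num)
      (by norm_num)
    exfalso
    have : (k : ℂ) + 9366 = 0 := by linear_combination (-1 / 8) * hk'
    have : (k : ℕ) + 9366 = 0 := by exact_mod_cast this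
    omega
  -- A resonance: `-1/6 + 2` is an indicial root, so the coefficient of `m₂` is zero, but the other
  -- side is not.
  · obtain ⟨hm', hx', hk'⟩ := solve 136 (-9 / 4) (0) (30240) h (by norm_num) (by norm_num) (by norm_num)
      (by norm_num)
    exfalso
    norm_num at hk'
  · obtain ⟨hm', hx', hk'⟩ := solve 149 (-121 / 100) (52 / 25) (476448 / 25) h (by norm_num) (by norm_num) (by norm_num)
      (by norm_num)
    exfalso
    have : 13 * (k : ℂ) = 119112 := by linear_combination (25 / 4) * hk'
    have : 13 * (k : ℕ) = 119112 := by exact_mod_cast this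
    omega
  · obtain ⟨hm', hx', hk'⟩ := solve 156 (-1) (5 / 2) (16975) h (by norm_num) (by norm_num) (by norm_num)
      (by norm_num)
    have hy' : y = (-4 / 27) := by rw [hy, hx']; norm_num
    have hk2 : (k : ℂ) = 6790 := by linear_combination (2 / 5) * hk'
    refine Or.inr ?_; refine Or.inr ?_; refine Or.inr ?_; refine Or.inl ?_
    refine ⟨by rw [hm, hm']; norm_num, by rw [hk, hk2], hx'.trans (by norm_num), hy'.trans (by norm_num), ?_⟩
    exact roots_indicial (-2 / 3) (-1 / 6) (4 / 3) (by norm_num) (by rw [hx']; norm_num) (by rw [hy']; norm_num)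
  · obtain ⟨hm', hx', hk'⟩ := solve 178 (-25 / 36) (28 / 9) (129752 / 9) h (by norm_num) (by norm_num) (by norm_num)
      (by norm_num)
    have hy' : y = (-7 / 72) := by rw [hy, hx']; norm_num
    have hk2 : (k : ℂ) = 4634 := by linear_combination (9 / 28) * hk'
    refine Or.inr ?_; refine Or.inr ?_; refine Or.inr ?_; refine Or.inr ?_; refine Or.inl ?_
    refine ⟨by rw [hm, hm']; norm_num, by rw [hk, hk2], hx'.trans (by norm_num), hy'.trans (by norm_num), ?_⟩
    exact roots_indicial (-1 / 2) (-1 / 6) (7 / 6) (by norm_num) (by rw [hx']; norm_num) (by rw [hy']; norm_num)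
  · obtain ⟨hm', hx', hk'⟩ := solve 224 (-49 / 100) (88 / 25) (348912 / 25) h (by norm_num) (by norm_num) (by norm_num)
      (by norm_num)
    exfalso
    have : 11 * (k : ℂ) = 43614 := by linear_combination (25 / 8) * hk'
    have : 11 * (k : ℕ) = 43614 := by exact_mod_cast this
    omega
  · obtain ⟨hm', hx', hk'⟩ := solve 271 (-81 / 196) (180 / 49) (733680 / 49) h (by norm_num) (by norm_num) (by norm_num)
      (by norm_num)
    have hy' : y = (-533 / 10584) := by rw [hy, hx']; norm_num
    have hk2 : (k : ℂ) = 4076 := by linear_combination (49 / 180) * hk'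
    refine Or.inr ?_; refine Or.inr ?_; refine Or.inr ?_; refine Or.inr ?_; refine Or.inr ?_;
    refine ⟨by rw [hm, hm']; norm_num, by rw [hk, hk2], hx'.trans (by norm_num), hy'.trans (by norm_num), ?_⟩
    exact roots_indicial (-13 / 42) (-1 / 6) (41 / 42) (by norm_num) (by rw [hx']; norm_num) (by rw [hy']; norm_num)
  · obtain ⟨hm', hx', hk'⟩ := solve 366 (-169 / 484) (460 / 121) (2184280 / 121) h (by norm_num) (by norm_num) (by norm_num)
      (by norm_num)
    exfalso
    have : 23 * (k : ℂ) = 109214 := by linear_combination (121 / 20) * hk'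
    have : 23 * (k : ℕ) = 109214 := by exact_mod_cast this
    omega
  · obtain ⟨hm', hx', hk'⟩ := solve 653 (-625 / 2116) (2068 / 529) (15302112 / 529) h (by norm_num) (by norm_num) (by norm_num)
      (by norm_num)
    exfalso
    have : 517 * (k : ℂ) = 3825528 := by linear_combination (529 / 4) * hk'
    have : 517 * (k : ℕ) = 3825528 := by exact_mod_cast this
    omega

end

section

/-! ### The case of logarithmic-free solutions with a non-integral expansion -/

/-- Series with distinct real exponents and nonzero leading coefficients are linearly
independent. -/
lemma linearIndependent_of_hasQExpansion {ι : Type*} [Finite ι] {f : ι → ℍ → ℂ} {r : ι → ℝ}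
    {a : ι → ℕ → ℂ} (hf : ∀ i, HasQExpansion (f i) (r i) (a i)) (h0 : ∀ i, a i 0 ≠ 0)
    (hr : Function.Injective r) : LinearIndependent ℂ f := by
  classical
  have := Fintype.ofFinite ι
  rw [Fintype.linearIndependent_iff]
  intro c hc
  by_contra! H
  -- Take the smallest exponent that occurs with a nonzero coefficient. After multiplication of the
  -- relation by `q ^ (-rᵢ)` only this term survives at `i∞`.
  obtain ⟨i, hi, hmin⟩ := Finset.exists_min_image (univ.filter fun i => c i ≠ 0) r
    (by obtain ⟨i, hi⟩ := H; exact ⟨i, by simpa using hi⟩)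
  have key : Tendsto (fun τ => ∑ j, c j * (qpow (-(r i : ℂ)) τ * f j τ)) atImInfty
      (𝓝 (∑ j, if j = i then c i * a i 0 else 0)) := by
    refine tendsto_finsetSum _ fun j _ => ?_
    split_ifs with hj
    · subst hj; exact (hf j).tendsto.const_mul _
    · by_cases hcj : c j = 0
      · simp [hcj]
      have hlt : r i < r j := lt_of_le_of_ne (hmin j (by simpa using hcj)) fun h => hj (hr h).symm
      have h1 := (tendsto_qpow_of_pos (sub_pos.2 hlt)).mul (hf j).tendsto
      rw [zero_mul] at h1
      have := h1.const_mul (c j)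
      rw [mul_zero] at this
      refine this.congr fun τ => ?_
      rw [← mul_assoc (qpow _ _), ← qpow_add]
      congr 4; push_cast; ring
  rw [Finset.sum_ite_eq' univ i, if_pos (mem_univ i)] at key
  have hz : (fun τ => ∑ j, c j * (qpow (-(r i : ℂ)) τ * f j τ)) = fun _ => 0 := by
    funext τ
    have := congrFun hc τ
    simp only [Finset.sum_apply, Pi.smul_apply, smul_eq_mul, Pi.zero_apply] at this
    rw [← mul_zero (qpow (-(r i : ℂ)) τ), ← this, Finset.mul_sum]
    exact Finset.sum_congr rfl fun j _ => by ring
  rw [hz] at key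
  have := tendsto_nhds_unique key tendsto_const_nhds
  exact mul_ne_zero (by simpa using hi) (h0 i) this

lemma ind_eq {x y : ℂ} (a b c : ℂ) (h1 : a + b + c = 1 / 2) (h2 : a * b + a * c + b * c = x)
    (h3 : -(a * b * c) = y) (t : ℂ) : ind x y t = (t - a) * (t - b) * (t - c) := by
  rw [ind, ← h2, ← h3]; linear_combination (t ^ 2) * h1

lemma natCast_mul_ne {n : ℕ} {p q : ℕ} (h : ¬ p ∣ q) : (n : ℂ) * p ≠ q := by
  intro h'
  exact h ⟨n, by rw [mul_comm]; exact_mod_cast h'.symm⟩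

lemma ind_nonintegral (t : ℂ) : ind (-81 / 196) (-533 / 10584) t =
    (t - (-1 / 6)) * (t - (-13 / 42)) * (t - 41 / 42) :=
  ind_eq _ _ _ (by norm_num) (by norm_num) (by norm_num) t

/-- The value `0` that `getD` returns beyond the list is irrelevant, since the equation in degree
`n` only involves coefficients of index at most `n`. -/
lemma nonintegral_recursion₀ : ∀ n < [1, 271, 4076, 30862, (5029533 / 29 : ℂ)].length, n ≠ 0 →
    ind (-81 / 196) (-533 / 10584) (-1 / 6 + n) ≠ 0 ∧ opCoeff (-81 / 196) (-533 / 10584) (-1 / 6)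
      (fun k => [1, 271, 4076, 30862, (5029533 / 29 : ℂ)].getD k 0) n = 0 := by
  intro n hn h0
  simp only [List.length_cons, List.length_nil] at hn
  interval_cases n <;> simp [opCoeff_eq, sum_range_succ, opKernel_one, opKernel_two,
    opKernel_three, opKernel_four, ind] at h0 ⊢ <;> norm_num

lemma nonintegral_recursion₁ : ∀ n < [1, 1742 / 7, 188850 / 49, (10279088 / 343 : ℂ)].length, n ≠ 0 →
    ind (-81 / 196) (-533 / 10584) (-13 / 42 + n) ≠ 0 ∧ opCoeff (-81 / 196) (-533 / 10584) (-13 / 42)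
      (fun k => [1, 1742 / 7, 188850 / 49, (10279088 / 343 : ℂ)].getD k 0) n = 0 := by
  intro n hn h0
  simp only [List.length_cons, List.length_nil] at hn
  interval_cases n <;> simp [opCoeff_eq, sum_range_succ, opKernel_one, opKernel_two,
    opKernel_three, ind] at h0 ⊢ <;> norm_num

lemma nonintegral_recursion₂ :
    ∀ n < [1, 205 / 14, 5289 / 49, 5921425 / 9947, (186843109 / 69629 : ℂ)].length, n ≠ 0 →
    ind (-81 / 196) (-533 / 10584) (41 / 42 + n) ≠ 0 ∧ opCoeff (-81 / 196) (-533 / 10584) (41 / 42)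
      (fun k => [1, 205 / 14, 5289 / 49, 5921425 / 9947, (186843109 / 69629 : ℂ)].getD k 0) n = 0 := by
  intro n hn h0
  simp only [List.length_cons, List.length_nil] at hn
  interval_cases n <;> simp [opCoeff_eq, sum_range_succ, opKernel_one, opKernel_two,
    opKernel_three, opKernel_four, ind] at h0 ⊢ <;> norm_num

/-- The roots are `-7/42`, `-13/42` and `41/42`. Their differences `6/42`, `48/42`, `54/42` are not
integers, so every root carries a Frobenius series. -/
theorem exists_basis_nonintegral :
    ∃ f : Fin 3 → ℍ → ℂ, IsBasisOfSolutions (-81 / 196) (-533 / 10584) f ∧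
        QExpansionStarts (f 0) (-1 / 6) [1, 271, 4076, 30862, 5029533 / 29] ∧
        QExpansionStarts (f 1) (-13 / 42) [1, 1742 / 7, 188850 / 49, 10279088 / 343] ∧
        QExpansionStarts (f 2) (41 / 42)
          [1, 205 / 14, 5289 / 49, 5921425 / 9947, 186843109 / 69629] := by
  have ne : ∀ (n : ℕ) (s d : ℕ), ¬ d ∣ s → ((n : ℂ) + 1) * d ≠ s := fun n s d h => by
    exact_mod_cast natCast_mul_ne (n := n + 1) h
  have pos : ∀ n p : ℕ, ((n : ℂ) + 1) * 42 + p ≠ 0 := fun n p => by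
    exact_mod_cast (by positivity : (n + 1) * 42 + p ≠ 0)
  obtain ⟨f, hf, a, ha, a0⟩ := exists_frobenius_solution (x := -81 / 196) (y := -533 / 10584)
    (r := -1 / 6) (by norm_num [ind]) (fun n => by
      rw [ind_nonintegral]; push_cast
      refine mul_ne_zero (mul_ne_zero ?_ ?_) ?_ <;> intro h
      · exact pos n 0 (by push_cast; linear_combination 42 * h)
      · exact pos n 6 (by push_cast; linear_combination 42 * h)
      · exact ne n 48 42 (by norm_num) (by push_cast; linear_combination 42 * h))
  obtain ⟨g, hg, b, hb, b0⟩ := exists_frobenius_solution (x := -81 / 196) (y := -533 / 10584)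
    (r := -13 / 42) (by norm_num [ind]) (fun n => by
      rw [ind_nonintegral]; push_cast
      refine mul_ne_zero (mul_ne_zero ?_ ?_) ?_ <;> intro h
      · exact ne n 6 42 (by norm_num) (by push_cast; linear_combination 42 * h)
      · exact pos n 0 (by push_cast; linear_combination 42 * h)
      · exact ne n 54 42 (by norm_num) (by push_cast; linear_combination 42 * h))
  obtain ⟨u, hu, c, hc, c0⟩ := exists_frobenius_solution (x := -81 / 196) (y := -533 / 10584)
    (r := 41 / 42) (by norm_num [ind]) (fun n => by
      rw [ind_nonintegral]; push_cast
      refine mul_ne_zero (mul_ne_zero ?_ ?_) ?_ <;> intro h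
      · exact pos n 48 (by push_cast; linear_combination 42 * h)
      · exact pos n 54 (by push_cast; linear_combination 42 * h)
      · exact pos n 0 (by push_cast; linear_combination 42 * h))
  refine ⟨![f, g, u], isBasisOfSolutions_of_linearIndependent ?_
    (linearIndependent_of_hasQExpansion (r := ![-1 / 6, -13 / 42, 41 / 42]) (a := ![a, b, c])
      ?_ ?_ ?_), ha.qExpansionStarts hf _ a0 nonintegral_recursion₀,
      hb.qExpansionStarts hg _ b0 nonintegral_recursion₁,
      hc.qExpansionStarts hu _ c0 nonintegral_recursion₂⟩
  · intro i; fin_cases i <;> assumption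
  · intro i; fin_cases i
    · exact ha.congr_exponent (by norm_num)
    · exact hb.congr_exponent (by norm_num)
    · exact hc.congr_exponent (by norm_num)
  · intro i; fin_cases i
    · exact (a0.trans_ne one_ne_zero :)
    · exact (b0.trans_ne one_ne_zero :)
    · exact (c0.trans_ne one_ne_zero :)
  · intro i j h; fin_cases i <;> fin_cases j <;> first | rfl | (exfalso; revert h; norm_num)

/-- The exponent must be an indicial root, and leading coefficient 1 then fixes the series. The
three series have the nonintegral coefficients `5029533/29`, `1742/7` and `205/14`. -/
theorem not_isOfVacuumCharacterType_nonintegral {f : ℍ → ℂ}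
    (hf : f ∈ solutions (-81 / 196) (-533 / 10584)) : ¬ IsOfVacuumCharacterType f := by
  rintro ⟨r, a, a0, ha⟩
  have h := ha.opCoeff_eq_zero hf 0
  rw [opCoeff_zero, a0, Nat.cast_one, mul_one, ind_nonintegral] at h
  rcases mul_eq_zero.1 h with h | h
  · rcases mul_eq_zero.1 h with h | h
    · rw [sub_eq_zero.1 h] at ha
      have := ha.coeff_eq_getD hf [1, 271, 4076, 30862, 5029533 / 29] (by simp [a0])
        nonintegral_recursion₀ 4 (by norm_num)
      simp at this
      exact natCast_mul_ne (n := a 4) (p := 29) (q := 5029533) (by norm_num)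
        (by rw [this]; norm_num)
    · rw [sub_eq_zero.1 h] at ha
      have := ha.coeff_eq_getD hf [1, 1742 / 7, 188850 / 49, 10279088 / 343] (by simp [a0])
        nonintegral_recursion₁ 1 (by norm_num)
      simp at this
      exact natCast_mul_ne (n := a 1) (p := 7) (q := 1742) (by norm_num)
        (by rw [this]; norm_num)
  · rw [sub_eq_zero.1 h] at ha
    have := ha.coeff_eq_getD hf [1, 205 / 14, 5289 / 49, 5921425 / 9947, 186843109 / 69629]
      (by simp [a0]) nonintegral_recursion₂ 1 (by norm_num)
    simp at this
    exact natCast_mul_ne (n := a 1) (p := 14) (q := 205) (by norm_num)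
      (by rw [this]; norm_num)

lemma VOA.IsVacuumCharacter.isOfVacuumCharacterType {V : Type u} [AddCommGroup V] [Module ℂ V]
    {A : VOA V} (hA : A.IsCFTType) {f : ℍ → ℂ} (hf : A.IsVacuumCharacter f) :
    IsOfVacuumCharacterType f := by
  refine ⟨_, fun n => Module.finrank ℂ (A.homogeneous n), ?_, hf⟩
  change Module.finrank ℂ (A.homogeneous 0) = 1
  rw [hA.2.2, finrank_span_singleton hA.2.1]

end

section

/-! ### Generators of the modular group -/

open ModularGroup ModularForm
open scoped ModularForm

lemma slash_S_apply (f : ℍ → ℂ) (k : ℤ) (τ : ℍ) :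
    (f ∣[k] S) τ = f (S • τ) * (τ : ℂ) ^ (-k) := by
  rw [SL_slash_apply, denom_S]

lemma slash_T_apply (f : ℍ → ℂ) (k : ℤ) (τ : ℍ) : (f ∣[k] T) τ = f ((1 : ℝ) +ᵥ τ) := by
  rw [SL_slash_apply, modular_T_smul, ModularGroup.denom_apply]
  simp [T]

/-- A property that is stable under `S` and `T` is stable under the modular group. -/
lemma slash_induction {P : (ℍ → ℂ) → Prop} {k : ℤ} (hS : ∀ f, P f → P (f ∣[k] S))
    (hT : ∀ f, P f → P (f ∣[k] T)) (γ : SL(2, ℤ)) : ∀ f, P f → P (f ∣[k] γ) := by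
  have hmem : γ ∈ Subgroup.closure ({S, T} : Set SL(2, ℤ)) := by
    rw [SpecialLinearGroup.SL2Z_generators]; trivial
  -- The property is only known to be stable under `S` and `T`, so the inverses are written as
  -- positive words, by means of `S⁴ = 1` and `(S T)⁶ = 1`.
  have hSi : S⁻¹ = S * S * S := by decide
  have hTi : T⁻¹ = S * T * (S * T) * (S * T) * (S * T) * (S * T) * S := by decide
  induction hmem using Subgroup.closure_induction_right with
  | one => intro f hf; simpa using hf
  | mul_right x y hx hy ih =>
    intro f hf
    rw [SlashAction.slash_mul]
    rcases hy with rfl | rfl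
    · exact hS _ (ih f hf)
    · exact hT _ (ih f hf)
  | mul_inv_cancel x y hx hy ih =>
    intro f hf
    rw [SlashAction.slash_mul]
    rcases hy with rfl | rfl
    · rw [hSi]; simp only [SlashAction.slash_mul]
      exact hS _ (hS _ (hS _ (ih f hf)))
    · rw [hTi]; simp only [SlashAction.slash_mul]
      exact hS _ (hT _ (hS _ (hT _ (hS _ (hT _ (hS _ (hT _ (hS _ (hT _ (hS _ (ih f hf)))))))))))

/-- The level one form attached to a function invariant under `S` and `T`. -/
def levelOneForm {k : ℤ} (f : ℍ → ℂ) (hf : MDiff f) (hS : f ∣[k] S = f) (hT : f ∣[k] T = f)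
    (hb : IsBoundedAtImInfty f) : ModularForm 𝒮ℒ k where
  toFun := f
  slash_action_eq' := by
    rintro _ ⟨γ, rfl⟩
    exact slash_induction (P := fun g => g = f) (fun g hg => by rw [hg, hS])
      (fun g hg => by rw [hg, hT]) γ f rfl
  holo' := hf
  bdd_at_cusps' := by
    intro c hc
    rw [OnePoint.isBoundedAt_iff_forall_SL2Z hc]
    intro γ _
    have : f ∣[k] γ = f := slash_induction (P := fun g => g = f) (fun g hg => by rw [hg, hS])
      (fun g hg => by rw [hg, hT]) γ f rfl
    rw [this]; exact hb

/-- If a product of holomorphic functions vanishes, then one of them does. -/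
lemma eq_zero_or_eq_zero_of_mul {f g : ℍ → ℂ} (hf : MDiff f) (hg : MDiff g)
    (h : ∀ τ, f τ * g τ = 0) : f = 0 ∨ g = 0 := by
  by_contra! H
  obtain ⟨τ, hτ⟩ := Function.ne_iff.1 H.2
  refine H.1 (eq_zero_of_eventuallyEq_zero hf (τ := τ) ?_)
  have hc : ContinuousAt (g ∘ ofComplex) τ := (analyticAt_comp_ofComplex hg τ).continuousAt
  filter_upwards [hc.eventually_ne (by simpa using hτ)] with w hw
  exact (mul_eq_zero.1 (h (ofComplex w))).resolve_right hw

/-! ### The Dedekind eta function -/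

lemma coe_vadd_one (τ : ℍ) : (((1 : ℝ) +ᵥ τ : ℍ) : ℂ) = τ + 1 := by
  simp [add_comm]

lemma tendsto_tprod_one_sub_pow :
    Tendsto (fun z : ℂ => ∏' n : ℕ, (1 - z ^ (n + 1))) (𝓝 0) (𝓝 1) := by
  have := (differentiableOn_tprod_one_sub_pow.differentiableAt
    (Metric.isOpen_ball.mem_nhds (Metric.mem_ball_self one_pos))).continuousAt.tendsto
  simpa using this

lemma eta_eq (τ : ℍ) : ModularForm.eta τ = qpow (1 / 24) τ * ∏' n : ℕ, (1 - nome τ ^ (n + 1)) := by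
  unfold ModularForm.eta
  congr 1
  · simp only [Function.Periodic.qParam, qpow]; congr 1; push_cast; ring
  · simp [eta_q, nome_eq_qParam]

lemma dedekindEta_apply (τ : ℍ) : dedekindEta τ = ModularForm.eta τ := by simp [etaMul]

lemma dedekindEta_ne_zero (τ : ℍ) : dedekindEta τ ≠ 0 := by
  rw [dedekindEta_apply]; exact eta_ne_zero τ.2

lemma discriminant_eq (τ : ℍ) : discriminant τ = dedekindEta τ ^ 24 := by
  rw [dedekindEta_apply]; rfl

lemma mdifferentiable_dedekindEta : MDiff dedekindEta := by
  rw [UpperHalfPlane.mdifferentiable_iff]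
  intro z hz
  refine (DifferentiableAt.congr_of_eventuallyEq (f := ModularForm.eta)
    (differentiableAt_eta_of_mem_upperHalfPlaneSet hz) ?_).differentiableWithinAt
  filter_upwards [isOpen_upperHalfPlaneSet.mem_nhds hz] with w hw
  simp [dedekindEta_apply, ofComplex_apply_of_im_pos hw]

lemma exists_hasQExpansion_dedekindEta : ∃ a, HasQExpansion dedekindEta (1 / 24) a ∧ a 0 = 1 := by
  refine exists_hasQExpansion_of_tendsto mdifferentiable_dedekindEta (fun τ => ?_) ?_
  · have : nome ((1 : ℝ) +ᵥ τ) = nome τ := by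
      rw [nome, qpow_vadd_one, mul_one, Complex.exp_two_pi_mul_I, one_mul]
    rw [dedekindEta_apply, dedekindEta_apply, eta_eq, eta_eq, this, qpow_vadd_one, mul_assoc]
  · refine (tendsto_tprod_one_sub_pow.comp tendsto_nome).congr fun τ => ?_
    rw [dedekindEta_apply, eta_eq, ← mul_assoc, ← qpow_add]
    simp

lemma tendsto_dedekindEta : Tendsto (fun τ => qpow (-(1 / 24)) τ * dedekindEta τ) atImInfty (𝓝 1) := by
  obtain ⟨a, ha, a0⟩ := exists_hasQExpansion_dedekindEta
  exact a0 ▸ ha.tendsto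

end

section

open ModularGroup ModularForm
open scoped ModularForm

/-! ### Ramanujan's formula for the derivative of `E₂` -/

lemma E2_slash_S : EisensteinSeries.E2 ∣[(2 : ℤ)] S =
    fun τ : ℍ => EisensteinSeries.E2 τ + 6 / (π * I) * (τ : ℂ)⁻¹ := by
  have h := EisensteinSeries.E2_slash_action S
  rw [h]
  funext τ
  have hp : (π : ℂ) ≠ 0 := by exact_mod_cast Real.pi_ne_zero
  simp only [EisensteinSeries.D2_S, Pi.sub_apply, Pi.smul_apply, smul_eq_mul, riemannZeta_two]
  field_simp
  ring_nf
  simp only [I_sq]; ring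

lemma D_inv_coe (τ : ℍ) : D (fun τ : ℍ => (τ : ℂ)⁻¹) τ = -(2 * π * I)⁻¹ * ((τ : ℂ) ^ 2)⁻¹ := by
  have h : (fun τ : ℍ => (τ : ℂ)⁻¹) ∘ ofComplex =ᶠ[𝓝 (τ : ℂ)] fun w => w⁻¹ := by
    filter_upwards [isOpen_upperHalfPlaneSet.mem_nhds τ.2] with w hw
    simp [ofComplex_apply_of_im_pos hw]
  simp only [D, Derivative.normalizedDerivOfComplex, h.deriv_eq, deriv_inv]
  ring

lemma mdifferentiable_inv_coe : MDiff (fun τ : ℍ => (τ : ℂ)⁻¹) := by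
  rw [UpperHalfPlane.mdifferentiable_iff]
  intro z hz
  have hz0 : z ≠ 0 := by rintro rfl; simp at hz
  refine (DifferentiableAt.congr_of_eventuallyEq (f := fun w => w⁻¹)
    (differentiableAt_inv hz0) ?_).differentiableWithinAt
  filter_upwards [isOpen_upperHalfPlaneSet.mem_nhds hz] with w hw
  simp [ofComplex_apply_of_im_pos hw]

lemma exists_smul_eq_E4 (F : ModularForm 𝒮ℒ 4) : ∃ c : ℂ, c • ModularForm.E₄ = F := by
  refine exists_smul_eq_of_finrank_eq_one (by
    rw [Module.finrank, ModularForm.levelOne_weight_four_rank_one]; simp) ?_ F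
  intro h
  have := hasQExpansion_E4
  rw [h] at this
  simpa [eisCoeff_zero] using this.coeff_eq_zero 0

lemma tendsto_E4 : Tendsto ModularForm.E₄ atImInfty (𝓝 1) := by
  simpa [eisCoeff_zero] using hasQExpansion_E4.tendsto

lemma tendsto_E6 : Tendsto ModularForm.E₆ atImInfty (𝓝 1) := by
  simpa [eisCoeff_zero] using hasQExpansion_E6.tendsto

lemma tendsto_E2 : Tendsto EisensteinSeries.E2 atImInfty (𝓝 1) := by
  simpa [eisCoeff_zero] using hasQExpansion_E2.tendsto

/-- The anomalies of `E₂'` and of `E₂² / 12` under `S` cancel, so their difference is a level one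
form of weight 4. Such forms are multiples of `E₄`, and the constant term gives the factor `-1/12`.
-/
lemma D_E2 (τ : ℍ) : D EisensteinSeries.E2 τ =
    (EisensteinSeries.E2 τ ^ 2 - ModularForm.E₄ τ) / 12 := by
  set R : ℍ → ℂ := D EisensteinSeries.E2 - (1 / 12 : ℂ) • (EisensteinSeries.E2 * EisensteinSeries.E2)
    with hRdef
  have hE := hasQExpansion_E2
  have hR : MDiff R := hE.D.mdifferentiable.sub
    ((hE.mdifferentiable.mul hE.mdifferentiable).const_smul _)
  have hT : R ∣[(4 : ℤ)] T = R := by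
    funext τ
    rw [slash_T_apply]
    simp only [hRdef, Pi.sub_apply, Pi.smul_apply, Pi.mul_apply, hE.vadd_one, hE.D.vadd_one]
    simp
  have hS : R ∣[(4 : ℤ)] S = R := by
    funext τ
    have h1 := congrFun (Derivative.normalizedDerivOfComplex_SL_slash (k := 2) hE.mdifferentiable
      (γ := S)) τ
    have hsum : EisensteinSeries.E2 ∣[(2 : ℤ)] S =
        EisensteinSeries.E2 + (6 / (π * I)) • fun τ : ℍ => (τ : ℂ)⁻¹ := E2_slash_S
    have h2 := congrFun (mul_slash_SL2 2 2 S EisensteinSeries.E2 EisensteinSeries.E2) τ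
    have h3 : (R ∣[(4 : ℤ)] S) τ = (D EisensteinSeries.E2 ∣[(2 + 2 : ℤ)] S) τ - 1 / 12 *
        ((EisensteinSeries.E2 * EisensteinSeries.E2) ∣[(2 + 2 : ℤ)] S) τ := by
      simp only [slash_S_apply, hRdef, Pi.sub_apply, Pi.smul_apply, smul_eq_mul]
      norm_num
      ring
    rw [h3, h2]
    rw [hsum, Derivative.normalizedDerivOfComplex_add _ _ hE.mdifferentiable
      (mdifferentiable_inv_coe.const_smul _), Derivative.normalizedDerivOfComplex_smul _ _
      mdifferentiable_inv_coe, ← hsum] at h1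
    simp only [Pi.add_apply, Pi.smul_apply, smul_eq_mul, Pi.sub_apply, Pi.mul_apply] at h1 ⊢
    have h4 := D_inv_coe τ
    simp only [D] at h4
    have h5 : (S 1 0 : ℤ) = 1 := by simp [S]
    rw [h4, denom_S, h5] at h1
    have e : (D EisensteinSeries.E2 ∣[(2 + 2 : ℤ)] S) τ = D EisensteinSeries.E2 τ +
        6 / (π * I) * (-(2 * π * I)⁻¹ * ((τ : ℂ) ^ 2)⁻¹) + ((2 : ℤ) : ℂ) * (2 * π * I)⁻¹ *
          (((1 : ℤ) : ℂ) / τ) * (EisensteinSeries.E2 ∣[(2 : ℤ)] S) τ := by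
      linear_combination -h1
    rw [e, hsum]
    simp only [hRdef, Pi.add_apply, Pi.sub_apply, Pi.mul_apply, Pi.smul_apply, smul_eq_mul]
    have hp : (π : ℂ) ≠ 0 := by exact_mod_cast Real.pi_ne_zero
    have ht := τ.ne_zero
    push_cast
    field_simp
    ring
  have hlim : Tendsto R atImInfty (𝓝 (-1 / 12)) := by
    have h1 := hE.D.tendsto
    have h2 := (tendsto_E2.mul tendsto_E2).const_mul (1 / 12)
    have := h1.sub h2
    simp only [eisCoeff_zero] at this
    convert this using 2
    · simp [hRdef]
    · norm_num
  obtain ⟨c, hc⟩ := exists_smul_eq_E4 (levelOneForm R hR hS hT (hlim.isBigO_one ℝ))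
  have hc' : ∀ τ, c * ModularForm.E₄ τ = R τ := fun τ => by
    have := congrArg (fun F : ModularForm 𝒮ℒ 4 => F τ) hc
    exact this
  have hcv : c = -1 / 12 := by
    have := tendsto_E4.const_mul c
    rw [funext hc', mul_one] at this
    exact tendsto_nhds_unique this hlim
  have := hc' τ
  simp only [hcv, hRdef, Pi.sub_apply, Pi.smul_apply, Pi.mul_apply, smul_eq_mul] at this
  linear_combination -this

/-! ### Vector-valued modular forms of rank three -/

/-- Three functions of weight `k` that transform under `S` by the matrix `M` and under `T` by the
scalars `exp (2πi rᵢ)`, and are `O(q ^ rᵢ)` at `i∞`. -/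
structure IsVector (k : ℤ) (M : Matrix (Fin 3) (Fin 3) ℂ) (r : Fin 3 → ℝ) (v : Fin 3 → ℍ → ℂ) :
    Prop where
  mdiff : ∀ i, MDiff (v i)
  slash_S : ∀ i, v i ∣[k] S = ∑ j, M i j • v j
  slash_T : ∀ i, v i ∣[k] T = cexp (2 * π * I * r i) • v i
  tendsto : ∀ i, ∃ L, Tendsto (fun τ => qpow (-(r i : ℂ)) τ * v i τ) atImInfty (𝓝 L)

lemma serreDerivative_sum (k : ℂ) (c : Fin 3 → ℂ) {v : Fin 3 → ℍ → ℂ} (hv : ∀ i, MDiff (v i)) :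
    Derivative.serreDerivative k (∑ j, c j • v j) = ∑ j, c j • Derivative.serreDerivative k (v j) := by
  simp only [Fin.sum_univ_three]
  have h := fun i => (hv i).const_smul (c i)
  rw [Derivative.serreDerivative_add _ _ _ ((h 0).add (h 1)) (h 2),
    Derivative.serreDerivative_add _ _ _ (h 0) (h 1),
    Derivative.serreDerivative_smul _ _ _ (hv 0), Derivative.serreDerivative_smul _ _ _ (hv 1),
    Derivative.serreDerivative_smul _ _ _ (hv 2)]

variable {k l : ℤ} {M : Matrix (Fin 3) (Fin 3) ℂ} {r : Fin 3 → ℝ} {u v w : Fin 3 → ℍ → ℂ}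

lemma IsVector.exists_hasQExpansion (h : IsVector k M r v) (i : Fin 3) :
    ∃ a, HasQExpansion (v i) (r i) a := by
  obtain ⟨L, hL⟩ := h.tendsto i
  obtain ⟨a, ha, -⟩ := exists_hasQExpansion_of_tendsto (h.mdiff i) (fun τ => by
    rw [← slash_T_apply (v i) k, h.slash_T i]; rfl) hL
  exact ⟨a, ha⟩

/-- Serre derivatives commute with the slash action up to raising the weight by two, so the matrix,
the exponents and the order at `i∞` persist. -/
lemma IsVector.serreDerivative (h : IsVector k M r v) :
    IsVector (k + 2) M r (fun i => Derivative.serreDerivative k (v i)) where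
  mdiff i := Derivative.serreDerivative_mdifferentiable _ (h.mdiff i)
  slash_S i := by
    rw [Derivative.serreDerivative_slash_equivariant (h.mdiff i), h.slash_S i,
      serreDerivative_sum _ _ h.mdiff]
  slash_T i := by
    rw [Derivative.serreDerivative_slash_equivariant (h.mdiff i), h.slash_T i,
      Derivative.serreDerivative_smul _ _ _ (h.mdiff i)]
  tendsto i := by
    obtain ⟨a, ha⟩ := h.exists_hasQExpansion i
    have h1 := ha.D.tendsto
    have h2 := (hasQExpansion_E2.tendsto.mul ha.tendsto).const_mul ((k : ℂ) * 12⁻¹)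
    refine ⟨_, (h1.sub h2).congr fun τ => ?_⟩
    simp
    ring

lemma IsVector.add (hv : IsVector k M r v) (hw : IsVector k M r w) :
    IsVector k M r (fun i => v i + w i) where
  mdiff i := (hv.mdiff i).add (hw.mdiff i)
  slash_S i := by
    rw [SlashAction.add_slash, hv.slash_S, hw.slash_S, ← Finset.sum_add_distrib]
    simp only [smul_add]
  slash_T i := by rw [SlashAction.add_slash, hv.slash_T, hw.slash_T, smul_add]
  tendsto i := by
    obtain ⟨L, hL⟩ := hv.tendsto i
    obtain ⟨L', hL'⟩ := hw.tendsto i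
    exact ⟨_, (hL.add hL').congr fun τ => by simp [mul_add]⟩

lemma IsVector.mul_levelOne (hv : IsVector k M r v) {e : ℍ → ℂ} (he : MDiff e)
    (heS : e ∣[l] S = e) (heT : e ∣[l] T = e) {L : ℂ} (heL : Tendsto e atImInfty (𝓝 L)) :
    IsVector (l + k) M r (fun i => e * v i) where
  mdiff i := he.mul (hv.mdiff i)
  slash_S i := by
    rw [mul_slash_SL2, heS, hv.slash_S, Finset.mul_sum]
    simp only [mul_smul_comm]
  slash_T i := by rw [mul_slash_SL2, heT, hv.slash_T, mul_smul_comm]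
  tendsto i := by
    obtain ⟨L', hL'⟩ := hv.tendsto i
    exact ⟨_, (heL.mul hL').congr fun τ => by simp; ring⟩

/-- The determinant of three vectors of functions. -/
def det3 (u v w : Fin 3 → ℍ → ℂ) : ℍ → ℂ :=
  u 0 * (v 1 * w 2 - v 2 * w 1) - u 1 * (v 0 * w 2 - v 2 * w 0) + u 2 * (v 0 * w 1 - v 1 * w 0)

end

section

open ModularGroup ModularForm
open scoped ModularForm

/-! ### The vanishing criterion and the modular Wronskian argument -/

lemma slash_S_eq_smul_iff {f g : ℍ → ℂ} {k : ℤ} :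
    f ∣[k] S = g ↔ ∀ τ : ℍ, f (S • τ) = (τ : ℂ) ^ k * g τ := by
  rw [funext_iff]
  refine forall_congr' fun τ => ?_
  rw [slash_S_apply, zpow_neg, ← div_eq_mul_inv, div_eq_iff (zpow_ne_zero _ τ.ne_zero), mul_comm]

lemma slash_T_eq_iff {f g : ℍ → ℂ} {k : ℤ} :
    f ∣[k] T = g ↔ ∀ τ : ℍ, f ((1 : ℝ) +ᵥ τ) = g τ := by
  rw [funext_iff]
  exact forall_congr' fun τ => by rw [slash_T_apply]

lemma discriminant_S (τ : ℍ) : discriminant (S • τ) = (τ : ℂ) ^ 12 * discriminant τ :=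
  slash_S_eq_smul_iff.1 discriminant_S_invariant τ

lemma discriminant_T (τ : ℍ) : discriminant ((1 : ℝ) +ᵥ τ) = discriminant τ :=
  slash_T_eq_iff.1 discriminant_T_invariant τ

lemma mdifferentiable_pow {f : ℍ → ℂ} (hf : MDiff f) (n : ℕ) : MDiff (f ^ n) := by
  induction n with
  | zero => rw [pow_zero]; exact mdifferentiable_const
  | succ n ih => rw [pow_succ]; exact ih.mul hf

lemma discriminant_eq_pow : discriminant = dedekindEta ^ 24 := funext discriminant_eq

lemma mdifferentiable_discriminant : MDiff discriminant := by
  rw [discriminant_eq_pow]; exact mdifferentiable_pow mdifferentiable_dedekindEta 24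

lemma tendsto_discriminant :
    Tendsto (fun τ => qpow (-1) τ * discriminant τ) atImInfty (𝓝 1) := by
  have := tendsto_dedekindEta.pow 24
  rw [one_pow] at this
  refine this.congr fun τ => ?_
  rw [discriminant_eq, mul_pow, ← qpow_nat_mul]
  norm_num

/-- A holomorphic form of weight `k` and level one that is `O(q ^ m)` with `12 m > k` vanishes. -/
lemma eq_zero_of_weight_lt {k : ℤ} {m : ℕ} {d : ℍ → ℂ} {L : ℂ} (hd : MDiff d) (hS : d ∣[k] S = d)
    (hT : d ∣[k] T = d) (hL : Tendsto (fun τ => qpow (-(m : ℂ)) τ * d τ) atImInfty (𝓝 L))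
    (hk : k < 12 * m) : d = 0 := by
  -- Division by `Δ ^ m` keeps the function bounded at `i∞` and makes its weight negative, and there
  -- are no nonzero level one forms of negative weight.
  set F : ℍ → ℂ := d / discriminant ^ m with hF
  have hne : ∀ τ, (discriminant ^ m) τ ≠ 0 := fun τ => pow_ne_zero _ (discriminant_ne_zero τ)
  have hFd : MDiff F := hd.div (mdifferentiable_pow mdifferentiable_discriminant m) hne
  have hFS : F ∣[k - 12 * m] S = F := slash_S_eq_smul_iff.2 fun τ => by
    have h1 := slash_S_eq_smul_iff.1 hS τ
    simp only [hF, Pi.div_apply, Pi.pow_apply, h1, discriminant_S, mul_pow]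
    rw [zpow_sub₀ τ.ne_zero, zpow_mul, zpow_natCast]
    have : ((τ : ℂ) ^ (12 : ℤ)) = (τ : ℂ) ^ 12 := by norm_cast
    rw [this]
    exact (div_mul_div_comm _ _ _ _).symm
  have hFT : F ∣[k - 12 * m] T = F := slash_T_eq_iff.2 fun τ => by
    have h1 := slash_T_eq_iff.1 hT τ
    simp only [hF, Pi.div_apply, Pi.pow_apply, h1, discriminant_T]
  have hlim : Tendsto F atImInfty (𝓝 (L / 1 ^ m)) := by
    refine (hL.div (tendsto_discriminant.pow m) (by simp)).congr fun τ => ?_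
    have h0 := qpow_ne_zero (-1) τ
    have h1 : qpow (-(m : ℂ)) τ = qpow (-1) τ ^ m := by rw [← qpow_nat_mul]; simp
    simp only [hF, Pi.div_apply, Pi.pow_apply, h1, mul_pow]
    exact mul_div_mul_left _ _ (pow_ne_zero _ h0)
  have h0 := ModularFormClass.levelOne_neg_weight_eq_zero (by omega)
    (levelOneForm F hFd hFS hFT (hlim.isBigO_one ℝ))
  have h0' : F = 0 := h0
  funext τ
  have := congrFun h0' τ
  simpa [hF, discriminant_ne_zero τ] using this

variable {k l m : ℤ} {M : Matrix (Fin 3) (Fin 3) ℂ} {r : Fin 3 → ℝ} {u v w : Fin 3 → ℍ → ℂ}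

lemma IsVector.apply_S (h : IsVector k M r v) (i : Fin 3) (τ : ℍ) :
    v i (S • τ) = (τ : ℂ) ^ k * ∑ j, M i j * v j τ := by
  rw [slash_S_eq_smul_iff.1 (h.slash_S i) τ]
  simp

lemma IsVector.apply_T (h : IsVector k M r v) (i : Fin 3) (τ : ℍ) :
    v i ((1 : ℝ) +ᵥ τ) = cexp (2 * π * I * r i) * v i τ :=
  slash_T_eq_iff.1 (h.slash_T i) τ

lemma mdifferentiable_det3 (hu : ∀ i, MDiff (u i)) (hv : ∀ i, MDiff (v i))
    (hw : ∀ i, MDiff (w i)) : MDiff (det3 u v w) :=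
  (((hu 0).mul (((hv 1).mul (hw 2)).sub ((hv 2).mul (hw 1)))).sub
    ((hu 1).mul (((hv 0).mul (hw 2)).sub ((hv 2).mul (hw 0))))).add
    ((hu 2).mul (((hv 0).mul (hw 1)).sub ((hv 1).mul (hw 0))))

lemma det3_apply (τ : ℍ) : det3 u v w τ =
    u 0 τ * (v 1 τ * w 2 τ - v 2 τ * w 1 τ) - u 1 τ * (v 0 τ * w 2 τ - v 2 τ * w 0 τ)
      + u 2 τ * (v 0 τ * w 1 τ - v 1 τ * w 0 τ) := rfl

lemma tendsto_det3 {s : ℂ} (hs : (r 0 : ℂ) + r 1 + r 2 = s) (n : ℂ) {a b c : Fin 3 → ℂ}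
    (hu : ∀ i, Tendsto (fun τ => qpow (-(r i : ℂ)) τ * u i τ) atImInfty (𝓝 (a i)))
    (hv : ∀ i, Tendsto (fun τ => qpow (-(r i : ℂ)) τ * v i τ) atImInfty (𝓝 (b i)))
    (hw : ∀ i, Tendsto (fun τ => qpow (-(r i + n : ℂ)) τ * w i τ) atImInfty (𝓝 (c i))) :
    Tendsto (fun τ => qpow (-(s + n)) τ * det3 u v w τ) atImInfty
      (𝓝 (a 0 * (b 1 * c 2 - b 2 * c 1) - a 1 * (b 0 * c 2 - b 2 * c 0)
        + a 2 * (b 0 * c 1 - b 1 * c 0))) := by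
  refine ((((hu 0).mul (((hv 1).mul (hw 2)).sub ((hv 2).mul (hw 1)))).sub
    ((hu 1).mul (((hv 0).mul (hw 2)).sub ((hv 2).mul (hw 0))))).add
    ((hu 2).mul (((hv 0).mul (hw 1)).sub ((hv 1).mul (hw 0))))).congr fun τ => ?_
  have : qpow (-(s + n)) τ = qpow (-(r 0 : ℂ)) τ * qpow (-(r 1 : ℂ)) τ * qpow (-(r 2 : ℂ)) τ
      * qpow (-n) τ := by
    rw [← qpow_add, ← qpow_add, ← qpow_add, ← hs]; congr 1; ring
  have h2 : ∀ i, qpow (-(r i + n : ℂ)) τ = qpow (-(r i : ℂ)) τ * qpow (-n) τ := fun i => by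
    rw [← qpow_add]; congr 1; ring
  rw [this, det3_apply, h2, h2, h2]
  ring

/-- A determinant of vector-valued forms that is too small at `i∞` vanishes. -/
lemma IsVector.det3_eq_zero (hu : IsVector k M r u) (hv : IsVector l M r v)
    (hw : IsVector m M r w) (hM : M.det ^ 2 = 1) (hr : r 0 + r 1 + r 2 = 1 / 2)
    (hw' : ∀ i, ∃ L, Tendsto (fun τ => qpow (-(r i + 1 : ℂ)) τ * w i τ) atImInfty (𝓝 L))
    (hk : k + l + m < 18) : det3 u v w = 0 := by
  have hr' : (r 0 : ℂ) + r 1 + r 2 = 1 / 2 := by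
    rw [← Complex.ofReal_add, ← Complex.ofReal_add, hr]; norm_num
  choose a ha using hu.tendsto
  choose b hb using hv.tendsto
  choose c hc using hw'
  have hlim := tendsto_det3 hr' 1 ha hb hc
  have hd := mdifferentiable_det3 hu.mdiff hv.mdiff hw.mdiff
  -- The determinant transforms by `det M` under `S` and by `exp (πi) = -1` under `T`. Its square
  -- has trivial character, weight below 36, and is `O(q³)`, since the exponents add up to `1/2 +
  -- 1`.
  have hsq : det3 u v w * det3 u v w = 0 := by
    refine eq_zero_of_weight_lt (k := 2 * (k + l + m)) (m := 3) (hd.mul hd)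
      (slash_S_eq_smul_iff.2 fun τ => ?_) (slash_T_eq_iff.2 fun τ => ?_)
      ((hlim.mul hlim).congr fun τ => ?_) (by push_cast; omega)
    · have hdet : det3 u v w (S • τ) = (τ : ℂ) ^ (k + l + m) * M.det * det3 u v w τ := by
        rw [det3_apply, det3_apply]
        simp only [hu.apply_S, hv.apply_S, hw.apply_S, Fin.sum_univ_three, Matrix.det_fin_three]
        rw [zpow_add₀ τ.ne_zero, zpow_add₀ τ.ne_zero]
        ring
      rw [Pi.mul_apply, Pi.mul_apply, hdet, two_mul, zpow_add₀ τ.ne_zero (k + l + m)]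
      linear_combination ((τ : ℂ) ^ (k + l + m) * (τ : ℂ) ^ (k + l + m) * det3 u v w τ ^ 2) * hM
    · have hdet : det3 u v w ((1 : ℝ) +ᵥ τ) = cexp (2 * π * I * (1 / 2)) * det3 u v w τ := by
        rw [← hr', mul_add, mul_add, Complex.exp_add, Complex.exp_add, det3_apply, det3_apply]
        simp only [hu.apply_T, hv.apply_T, hw.apply_T]
        ring
      have : cexp (2 * π * I * (1 / 2)) = -1 := by
        rw [show 2 * π * I * (1 / 2) = (π : ℂ) * I by ring, Complex.exp_pi_mul_I]
      rw [Pi.mul_apply, Pi.mul_apply, hdet, this]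
      ring
    · rw [Pi.mul_apply, show -((3 : ℕ) : ℂ) = -(1 / 2 + 1) + -(1 / 2 + 1) by norm_num, qpow_add]
      ring
  rcases eq_zero_or_eq_zero_of_mul hd hd (fun τ => congrFun hsq τ) with h | h <;> exact h

/-- The operator in terms of Serre derivatives. -/
lemma op_eq (x y : ℂ) {f : ℍ → ℂ} (hf : MDiff f) :
    op x y f = Derivative.serreDerivative 4 (Derivative.serreDerivative 2
      (Derivative.serreDerivative 0 f)) + (x - 1 / 18) • (ModularForm.E₄ *
        Derivative.serreDerivative 0 f) + y • (ModularForm.E₆ * f) := by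
  have h0 : Derivative.serreDerivative 0 f = D f := by
    funext τ; simp
  have h1 := Derivative.normalizedDerivOfComplex_mdifferentiable hf
  have h2 := Derivative.normalizedDerivOfComplex_mdifferentiable h1
  have hE := hasQExpansion_E2.mdifferentiable
  have h3 : Derivative.serreDerivative 2 (D f) =
      D (D f) - (1 / 6 : ℂ) • (EisensteinSeries.E2 * D f) := by
    funext τ; simp; ring
  have h4 : D (D (D f) - (1 / 6 : ℂ) • (EisensteinSeries.E2 * D f)) =
      D (D (D f)) - (1 / 6 : ℂ) • (D EisensteinSeries.E2 * D f + EisensteinSeries.E2 * D (D f)) := by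
    rw [D, Derivative.normalizedDerivOfComplex_sub _ _ h2 ((hE.mul h1).const_smul _),
      Derivative.normalizedDerivOfComplex_smul _ _ (hE.mul h1),
      Derivative.normalizedDerivOfComplex_mul _ _ hE h1]
  rw [h0, h3]
  funext τ
  have h5 := congrFun h4 τ
  simp only [Pi.add_apply, Pi.smul_apply, Pi.mul_apply, smul_eq_mul, Pi.sub_apply] at h5
  simp only [op, Pi.add_apply, Pi.smul_apply, Pi.mul_apply, smul_eq_mul,
    Derivative.serreDerivative_apply, Pi.sub_apply, h5, D_E2]
  ring

lemma E4_slash (γ : SL(2, ℤ)) : (ModularForm.E₄ : ℍ → ℂ) ∣[(4 : ℤ)] γ = ModularForm.E₄ :=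
  SlashInvariantFormClass.slash_action_eq ModularForm.E₄ _ ⟨γ, rfl⟩

lemma E6_slash (γ : SL(2, ℤ)) : (ModularForm.E₆ : ℍ → ℂ) ∣[(6 : ℤ)] γ = ModularForm.E₆ :=
  SlashInvariantFormClass.slash_action_eq ModularForm.E₆ _ ⟨γ, rfl⟩

lemma IsVector.smul (hv : IsVector k M r v) (c : ℂ) : IsVector k M r (fun i => c • v i) where
  mdiff i := (hv.mdiff i).const_smul c
  slash_S i := by
    rw [ModularForm.SL_smul_slash, hv.slash_S, Finset.smul_sum]
    exact Finset.sum_congr rfl fun j _ => smul_comm _ _ _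
  slash_T i := by rw [ModularForm.SL_smul_slash, hv.slash_T, smul_comm]
  tendsto i := by
    obtain ⟨L, hL⟩ := hv.tendsto i
    exact ⟨_, (hL.const_mul c).congr fun τ => by simp; ring⟩

lemma IsVector.op (x y : ℂ) (hv : IsVector 0 M r v) : IsVector 6 M r (fun i => op x y (v i)) := by
  have h1 := hv.serreDerivative
  have h2 := h1.serreDerivative
  have h3 := h2.serreDerivative
  have h4 := (h1.mul_levelOne hasQExpansion_E4.mdifferentiable (E4_slash S) (E4_slash T)
    tendsto_E4).smul (x - 1 / 18)
  have h6 := (hv.mul_levelOne hasQExpansion_E6.mdifferentiable (E6_slash S) (E6_slash T)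
    tendsto_E6).smul y
  have := (h3.add h4).add h6
  refine (funext fun i => ?_ : (fun i => MLDE.op x y (v i)) = _) ▸ this
  rw [op_eq x y (hv.mdiff i)]
  norm_num

/-- Three functions whose span is stable under `S`, with distinct exponents of sum `1 / 2` that are
roots of the indicial polynomial, form a basis of the space of solutions. -/
theorem isBasisOfSolutions_of_modular {x y : ℂ} {f : Fin 3 → ℍ → ℂ} {a : Fin 3 → ℕ → ℂ}
    (hf : ∀ i, HasQExpansion (f i) (r i) (a i)) (h0 : ∀ i, a i 0 ≠ 0) (hr : Function.Injective r)
    (hsum : r 0 + r 1 + r 2 = 1 / 2) (hind : ∀ i, ind x y (r i) = 0)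
    (hS : ∀ i τ, f i (S • τ) = ∑ j, M i j * f j τ) : IsBasisOfSolutions x y f := by
  have hli := linearIndependent_of_hasQExpansion hf h0 hr
  refine isBasisOfSolutions_of_linearIndependent ?_ hli
  have hv : IsVector 0 M r f :=
    { mdiff i := (hf i).mdifferentiable
      slash_S i := slash_S_eq_smul_iff.2 fun τ => by rw [hS i]; simp
      slash_T i := slash_T_eq_iff.2 fun τ => by rw [(hf i).vadd_one]; rfl
      tendsto i := ⟨_, (hf i).tendsto⟩ }
  -- `S²` acts trivially on `ℍ` and the functions are independent, so `M² = 1`.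
  have hMM : M * M = 1 := by
    ext i j
    have hSS : ∀ τ : ℍ, S • S • τ = τ := fun τ => by
      rw [← mul_smul, show S * S = -1 by decide, ModularGroup.SL_neg_smul, one_smul]
    have key : ∑ j, ((M * M) i j - (1 : Matrix (Fin 3) (Fin 3) ℂ) i j) • f j = 0 := by
      funext τ
      have h1 := hS i (S • τ)
      rw [hSS] at h1
      simp only [hS, Fin.sum_univ_three] at h1
      simp only [Matrix.mul_apply, Matrix.one_apply, Fin.sum_univ_three, Pi.add_apply,
        Pi.smul_apply, smul_eq_mul, Pi.zero_apply]
      fin_cases i <;> simp at h1 ⊢ <;> linear_combination -h1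
    exact sub_eq_zero.1 (Fintype.linearIndependent_iff.1 hli _ key j)
  have hdet : M.det ^ 2 = 1 := by
    rw [sq, ← Matrix.det_mul, hMM, Matrix.det_one]
  have h1 := hv.serreDerivative
  have h2 := h1.serreDerivative
  have h6 := hv.op x y
  set v1 : Fin 3 → ℍ → ℂ := fun i => Derivative.serreDerivative ((0 : ℤ) : ℂ) (f i) with hv1
  set v2 : Fin 3 → ℍ → ℂ := fun i => Derivative.serreDerivative ((0 + 2 : ℤ) : ℂ) (v1 i) with hv2
  set g : Fin 3 → ℍ → ℂ := fun i => MLDE.op x y (f i) with hg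
  -- The leading coefficient of `g i` is the indicial polynomial at its root `r i` times `a i 0`, so
  -- the exponent rises by one.
  have hsmall : ∀ i, ∃ L, Tendsto (fun τ => qpow (-(r i + 1 : ℂ)) τ * g i τ) atImInfty (𝓝 L) := by
    intro i
    have := ((hf i).op x y).shift (by rw [opCoeff_zero, hind, zero_mul])
    exact ⟨_, this.tendsto⟩
  -- The total weights are `0 + 2 + 6`, `0 + 4 + 6` and `2 + 4 + 6`, all below 18.
  have e1 : det3 f v1 g = 0 := hv.det3_eq_zero h1 h6 hdet hsum hsmall (by norm_num)
  have e2 : det3 f v2 g = 0 := hv.det3_eq_zero h2 h6 hdet hsum hsmall (by norm_num)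
  have e3 : det3 v1 v2 g = 0 := h1.det3_eq_zero h2 h6 hdet hsum hsmall (by norm_num)
  -- The leading coefficient of the Wronskian is the product of the leading coefficients with the
  -- Vandermonde determinant of the exponents.
  have hW : det3 f v1 v2 ≠ 0 := by
    intro hW
    have hlim1 : ∀ i, Tendsto (fun τ => qpow (-(r i : ℂ)) τ * v1 i τ) atImInfty
        (𝓝 (r i * a i 0)) := by
      intro i
      have := (hf i).D.tendsto
      simp only [Nat.cast_zero, add_zero] at this
      refine this.congr fun τ => ?_
      simp [hv1]
    have hlim2 : ∀ i, Tendsto (fun τ => qpow (-(r i + 0 : ℂ)) τ * v2 i τ) atImInfty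
        (𝓝 (r i * (r i * a i 0) - 1 / 6 * (1 * (r i * a i 0)))) := by
      intro i
      have h := (hf i).D.D.tendsto.sub ((tendsto_E2.mul (hlim1 i)).const_mul (1 / 6))
      simp only [Nat.cast_zero, add_zero] at h
      refine h.congr fun τ => ?_
      simp [hv2, hv1]
      ring
    have hr' : (r 0 : ℂ) + r 1 + r 2 = 1 / 2 := by
      rw [← Complex.ofReal_add, ← Complex.ofReal_add, hsum]; norm_num
    have hlim := tendsto_det3 hr' 0 (fun i => (hf i).tendsto) hlim1 hlim2
    rw [hW] at hlim
    simp only [Pi.zero_apply, mul_zero] at hlim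
    have := tendsto_nhds_unique hlim tendsto_const_nhds
    have hne : ∀ i j, i ≠ j → (r i : ℂ) - r j ≠ 0 := fun i j hij h =>
      hij (hr (by exact_mod_cast sub_eq_zero.1 h))
    have hprod : a 0 0 * a 1 0 * a 2 0 * (((r 1 : ℂ) - r 0) * (r 2 - r 0) * (r 2 - r 1)) = 0 := by
      rw [← this]; ring
    exact (mul_ne_zero (mul_ne_zero (mul_ne_zero (h0 0) (h0 1)) (h0 2))
      (mul_ne_zero (mul_ne_zero (hne 1 0 (by decide)) (hne 2 0 (by decide)))
        (hne 2 1 (by decide)))) hprod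
  intro i
  refine ⟨hv.mdiff i, ?_⟩
  refine (eq_zero_or_eq_zero_of_mul (mdifferentiable_det3 hv.mdiff h1.mdiff h2.mdiff) (h6.mdiff i)
    fun τ => ?_).resolve_left hW
  have E1 := congrFun e1 τ
  have E2 := congrFun e2 τ
  have E3 := congrFun e3 τ
  rw [det3_apply] at E1 E2 E3 ⊢
  simp only [Pi.zero_apply] at E1 E2 E3
  -- Cramer's rule for the four vectors `f, v1, v2, g` in dimension three: `W gᵢ` is a combination
  -- of the three vanishing determinants with coefficients `fᵢ, v1ᵢ, v2ᵢ`.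
  change _ * g i τ = 0
  fin_cases i <;> simp only [Fin.zero_eta, Fin.mk_one, Fin.reduceFinMk]
  · linear_combination f 0 τ * E3 - v1 0 τ * E2 + v2 0 τ * E1
  · linear_combination f 1 τ * E3 - v1 1 τ * E2 + v2 1 τ * E1
  · linear_combination f 2 τ * E3 - v1 2 τ * E2 + v2 2 τ * E1

end

section

open ModularGroup ModularForm
open scoped ModularForm

/-! ### Rescaling the variable -/

/-- `c τ`, for positive real `c`. -/
def scale (c : ℝ) (τ : ℍ) : ℍ := ofComplex (c * (τ : ℂ))

lemma coe_scale {c : ℝ} (hc : 0 < c) (τ : ℍ) : (scale c τ : ℂ) = c * τ := by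
  rw [scale, ofComplex_apply_of_im_pos]
  simpa using mul_pos hc τ.im_pos

lemma scale_im {c : ℝ} (hc : 0 < c) (τ : ℍ) : (scale c τ).im = c * τ.im := by
  have := congrArg Complex.im (coe_scale hc τ)
  simpa using this

lemma coe_S_smul (τ : ℍ) : ((S • τ : ℍ) : ℂ) = -(τ : ℂ)⁻¹ := by
  rw [modular_S_smul]; simp

lemma scale_S {c : ℝ} (hc : 0 < c) (τ : ℍ) : scale c (S • τ) = S • scale c⁻¹ τ := by
  ext1
  rw [coe_scale hc, coe_S_smul, coe_S_smul, coe_scale (inv_pos.2 hc)]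
  push_cast
  rw [mul_inv, inv_inv]; ring

lemma scale_vadd {c : ℝ} (hc : 0 < c) (x : ℝ) (τ : ℍ) : scale c (x +ᵥ τ) = (c * x) +ᵥ scale c τ := by
  ext1
  rw [coe_scale hc, coe_vadd, coe_vadd, coe_scale hc]
  push_cast; ring

lemma scale_scale {c d : ℝ} (hc : 0 < c) (hd : 0 < d) (τ : ℍ) :
    scale c (scale d τ) = scale (c * d) τ := by
  ext1
  rw [coe_scale hc, coe_scale hd, coe_scale (mul_pos hc hd)]
  push_cast; ring

lemma scale_one (τ : ℍ) : scale 1 τ = τ := by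
  ext1; rw [coe_scale one_pos]; simp

lemma qpow_scale {c : ℝ} (hc : 0 < c) (r : ℂ) (τ : ℍ) : qpow r (scale c τ) = qpow (c * r) τ := by
  simp only [qpow, coe_scale hc]; congr 1; ring

lemma tendsto_scale {c : ℝ} (hc : 0 < c) : Tendsto (scale c) atImInfty atImInfty := by
  rw [atImInfty, tendsto_comap_iff]
  have : UpperHalfPlane.im ∘ scale c = fun τ => c * τ.im := funext fun τ => scale_im hc τ
  rw [this]
  exact tendsto_comap.const_mul_atTop hc

lemma comp_scale_eventuallyEq (c : ℝ) (f : ℍ → ℂ) (τ : ℍ) :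
    (f ∘ scale c) ∘ ofComplex =ᶠ[𝓝 (τ : ℂ)] fun w => (f ∘ ofComplex) (c * w) := by
  filter_upwards [isOpen_upperHalfPlaneSet.mem_nhds τ.2] with w hw
  simp [scale, ofComplex_apply_of_im_pos hw]

lemma hasDerivAt_comp_scale {c : ℝ} (hc : 0 < c) {f : ℍ → ℂ} (hf : MDiff f) (τ : ℍ) :
    HasDerivAt ((f ∘ scale c) ∘ ofComplex) (deriv (f ∘ ofComplex) (scale c τ) * c) τ := by
  have h1 : HasDerivAt (f ∘ ofComplex) (deriv (f ∘ ofComplex) (scale c τ)) (c * (τ : ℂ)) := by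
    rw [← coe_scale hc]
    exact (analyticAt_comp_ofComplex hf (scale c τ)).differentiableAt.hasDerivAt
  have h2 : HasDerivAt (fun w : ℂ => (c : ℂ) * w) c (τ : ℂ) := by
    simpa using (hasDerivAt_id (τ : ℂ)).const_mul (c : ℂ)
  exact (h1.comp (τ : ℂ) h2).congr_of_eventuallyEq (comp_scale_eventuallyEq c f τ)

lemma mdifferentiable_comp_scale {c : ℝ} (hc : 0 < c) {f : ℍ → ℂ} (hf : MDiff f) :
    MDiff (f ∘ scale c) := fun τ =>
  UpperHalfPlane.mdifferentiableAt_iff.2 (hasDerivAt_comp_scale hc hf τ).differentiableAt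

lemma D_comp_scale {c : ℝ} (hc : 0 < c) {f : ℍ → ℂ} (hf : MDiff f) (τ : ℍ) :
    D (f ∘ scale c) τ = c * D f (scale c τ) := by
  simp only [D, Derivative.normalizedDerivOfComplex, (hasDerivAt_comp_scale hc hf τ).deriv]
  ring

/-- Substitution of `q ^ N` for `q`. -/
lemma HasQExpansion.comp_scale {f : ℍ → ℂ} {r : ℂ} {a : ℕ → ℂ} (hf : HasQExpansion f r a) {N : ℕ}
    (hN : 0 < N) : HasQExpansion (f ∘ scale N) (N * r)
      (fun n => if N ∣ n then a (n / N) else 0) := fun τ => by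
  have hc : (0 : ℝ) < N := by exact_mod_cast hN
  have hinj : Function.Injective (fun n : ℕ => N * n) := fun m n h => Nat.eq_of_mul_eq_mul_left hN h
  refine (hinj.hasSum_iff (fun n hn => ?_)).1 ((hf (scale N τ)).congr_fun fun n => ?_)
  · beta_reduce
    rw [if_neg, zero_mul]
    rintro ⟨k, rfl⟩
    exact hn ⟨k, rfl⟩
  · simp only [Function.comp_apply, dvd_mul_right, if_true, Nat.mul_div_cancel_left _ hN,
      qpow_scale hc]
    congr 2; push_cast; ring

/-- An improvement of the exponent when the leading coefficient vanishes. -/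
lemma exists_hasQExpansion_of_tendsto_zero {f : ℍ → ℂ} {r : ℂ} (hf : MDiff f)
    (hT : ∀ τ : ℍ, f ((1 : ℝ) +ᵥ τ) = cexp (2 * π * I * r) * f τ)
    (hL : Tendsto (fun τ => qpow (-r) τ * f τ) atImInfty (𝓝 0)) :
    ∃ a, HasQExpansion f (r + 1) a := by
  obtain ⟨a, ha, a0⟩ := exists_hasQExpansion_of_tendsto hf hT hL
  exact ⟨_, ha.shift a0⟩

/-! ### Transformation of eta quotients -/

lemma etaMul_eq {N : ℕ} (hN : 0 < N) (τ : ℍ) : etaMul N τ = dedekindEta (scale N τ) := by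
  rw [dedekindEta_apply, coe_scale (by exact_mod_cast hN), etaMul]; simp

/-- Squaring removes the branch of the square root from the transformation law. -/
lemma dedekindEta_S_sq (τ : ℍ) : dedekindEta (S • τ) ^ 2 = -I * τ * dedekindEta τ ^ 2 := by
  have h := eta_comp_eq_csqrt_I_inv τ.2
  rw [dedekindEta_apply, dedekindEta_apply, coe_S_smul]
  have e : -1 / (τ : ℂ) = -(τ : ℂ)⁻¹ := by ring
  simp only [Function.comp_apply, Pi.smul_apply, Pi.mul_apply, smul_eq_mul, e] at h
  have hs : ∀ z : ℂ, Complex.sqrt z ^ 2 = z := fun z => by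
    rw [Complex.sqrt, ← Complex.cpow_nat_mul]; simp
  rw [h, mul_pow, mul_pow, inv_pow, hs, hs]
  simp
  ring

lemma dedekindEta_T (τ : ℍ) : dedekindEta ((1 : ℝ) +ᵥ τ) = cexp (2 * π * I * (1 / 24)) * dedekindEta τ := by
  obtain ⟨a, ha, -⟩ := exists_hasQExpansion_dedekindEta
  exact ha.vadd_one τ

lemma dedekindEta_S_pow_four (τ : ℍ) : dedekindEta (S • τ) ^ 4 = -τ ^ 2 * dedekindEta τ ^ 4 := by
  rw [show 4 = 2 * 2 by rfl, pow_mul, pow_mul, dedekindEta_S_sq, mul_pow, mul_pow, neg_sq, I_sq]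
  ring

lemma dedekindEta_S_pow_eight (τ : ℍ) : dedekindEta (S • τ) ^ 8 = τ ^ 4 * dedekindEta τ ^ 8 := by
  rw [show 8 = 4 * 2 by rfl, pow_mul, pow_mul, dedekindEta_S_pow_four]
  ring

lemma D_dedekindEta (τ : ℍ) : D dedekindEta τ = EisensteinSeries.E2 τ / 24 * dedekindEta τ := by
  have h := logDeriv_eta_eq_E2 τ
  have he : dedekindEta ∘ ofComplex =ᶠ[𝓝 (τ : ℂ)] ModularForm.eta := by
    filter_upwards [isOpen_upperHalfPlaneSet.mem_nhds τ.2] with w hw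
    simp [dedekindEta_apply, ofComplex_apply_of_im_pos hw]
  rw [logDeriv_apply, div_eq_iff (eta_ne_zero τ.2)] at h
  simp only [D, Derivative.normalizedDerivOfComplex, he.deriv_eq, h, dedekindEta_apply]
  have hp : (π : ℂ) ≠ 0 := by exact_mod_cast Real.pi_ne_zero
  field_simp
  ring

lemma D_pow {f : ℍ → ℂ} (hf : MDiff f) {g : ℍ → ℂ} (h : ∀ τ, D f τ = g τ * f τ) (n : ℕ) (τ : ℍ) :
    D (f ^ n) τ = n * g τ * f τ ^ n := by
  have := congrFun (Derivative.normalizedDerivOfComplex_pow f n hf) τ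
  rw [D, this]
  cases n with
  | zero => simp
  | succ n =>
    have h := h τ
    simp only [D] at h
    simp [h, pow_succ]
    ring

end

section

open ModularGroup ModularForm
open scoped ModularForm

/-! ### Level two -/

lemma tendsto_of_eq {α : Type*} {F : Filter α} {f g : α → ℂ} {a b : ℂ} (h : Tendsto f F (𝓝 a))
    (hfg : ∀ x, f x = g x) (hab : a = b) : Tendsto g F (𝓝 b) :=
  hab ▸ h.congr hfg

lemma tendsto_vadd (x : ℝ) : Tendsto (fun τ : ℍ => x +ᵥ τ) atImInfty atImInfty := by
  rw [atImInfty, tendsto_comap_iff]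
  have : UpperHalfPlane.im ∘ (fun τ : ℍ => x +ᵥ τ) = UpperHalfPlane.im := by
    funext τ; simp
  rw [this]
  exact tendsto_comap

lemma slash_T_inv {f : ℍ → ℂ} {k : ℤ} (h : f ∣[k] T = f) : f ∣[k] T⁻¹ = f := by
  conv_lhs => rw [← h, ← SlashAction.slash_mul, mul_inv_cancel, SlashAction.slash_one]

/-- The relation `S T S = T⁻¹ S T⁻¹` closes the orbit `f, f|S, f|ST`, one function for each coset of
`Γ₀(2)`. -/
lemma slash_T_slash_S {f g : ℍ → ℂ} {k : ℤ} (hT : f ∣[k] T = f) (hS : f ∣[k] S = g)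
    (hTT : (g ∣[k] T) ∣[k] T = g) : (g ∣[k] T) ∣[k] S = g ∣[k] T := by
  have e : S * (T * S) = T⁻¹ * S * T⁻¹ := by decide
  rw [← hS, ← SlashAction.slash_mul, ← SlashAction.slash_mul, e]
  simp only [SlashAction.slash_mul]
  rw [slash_T_inv hT, hS]
  conv_lhs => rw [← hTT, ← SlashAction.slash_mul, mul_inv_cancel, SlashAction.slash_one]

/-- A function of weight zero on `Γ₀(2)` with limits at the cusps, one of which is zero,
vanishes. -/
lemma eq_zero_of_conj_two {f g : ℍ → ℂ} {L L' : ℂ} (hf : MDiff f) (hg : MDiff g)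
    (hT : f ∣[(0 : ℤ)] T = f) (hS : f ∣[(0 : ℤ)] S = g) (hSS : g ∣[(0 : ℤ)] S = f)
    (hTT : (g ∣[(0 : ℤ)] T) ∣[(0 : ℤ)] T = g) (hL : Tendsto f atImInfty (𝓝 L))
    (hL' : Tendsto g atImInfty (𝓝 L')) (h0 : L * L' = 0) : f = 0 := by
  set g' := g ∣[(0 : ℤ)] T with hg'
  have hST := slash_T_slash_S hT hS hTT
  have hg'd : MDiff g' := hg.slash 0 _
  have hL'' : Tendsto g' atImInfty (𝓝 L') := by
    refine (hL'.comp (tendsto_vadd 1)).congr fun τ => ?_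
    rw [hg', slash_T_apply]; rfl
  have hfg := hf.mul hg
  have hTN : (f * g * g') ∣[(0 : ℤ)] T = f * g * g' := by
    have h := mul_slash_SL2 0 0 T (f * g) g'
    have h' := mul_slash_SL2 0 0 T f g
    rw [add_zero] at h h'
    rw [h, h', hT, hTT, ← hg']
    ring
  -- The norm to level one has weight zero and vanishes at `i∞`, because one of the two limits is
  -- zero.
  have hN : f * g * g' = 0 := by
    have hlim := (hL.mul hL').mul hL''
    rw [h0, zero_mul] at hlim
    obtain ⟨a, ha⟩ := exists_hasQExpansion_of_tendsto_zero (r := 0) (hfg.mul hg'd)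
      (fun τ => by rw [← slash_T_apply (f * g * g') 0, hTN]; simp) (hlim.congr fun τ => by simp)
    refine eq_zero_of_weight_lt (k := 0) (m := 1) (hfg.mul hg'd) ?_ hTN
      (by simpa using ha.tendsto) (by norm_num)
    have h := mul_slash_SL2 0 0 S (f * g) g'
    have h' := mul_slash_SL2 0 0 S f g
    rw [add_zero] at h h'
    rw [h, h', hS, hSS, hST]
    ring
  rcases eq_zero_or_eq_zero_of_mul hfg hg'd (congrFun hN) with h | h
  · rcases eq_zero_or_eq_zero_of_mul hf hg (congrFun h) with h | h
    · exact h
    · rw [← hSS, h, SlashAction.zero_slash]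
  · rw [← hSS, ← hTT, h, SlashAction.zero_slash, SlashAction.zero_slash]

lemma H2_eq (τ : ℍ) : H2 τ = 2 * EisensteinSeries.E2 (scale 2 τ) - EisensteinSeries.E2 τ := by
  simp [H2, scale]

lemma hasQExpansion_H2 : HasQExpansion H2 0 (fun n =>
    2 * (if 2 ∣ n then eisCoeff (-24) 1 (n / 2) else 0) - eisCoeff (-24) 1 n) := by
  have h := ((hasQExpansion_E2.comp_scale two_pos).congr_exponent (mul_zero _)).smul 2
  have := h.sub hasQExpansion_E2
  refine (funext fun τ => ?_ : H2 = _) ▸ this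
  simp [H2_eq]

lemma mdifferentiable_H2 : MDiff H2 := hasQExpansion_H2.mdifferentiable

lemma H2_T (τ : ℍ) : H2 ((1 : ℝ) +ᵥ τ) = H2 τ := by
  rw [hasQExpansion_H2.vadd_one]; simp

lemma tendsto_H2 : Tendsto H2 atImInfty (𝓝 1) := by
  have := hasQExpansion_H2.tendsto
  simp [eisCoeff_zero] at this
  convert this using 2
  norm_num

lemma E2_S (τ : ℍ) : EisensteinSeries.E2 (S • τ) =
    τ ^ 2 * (EisensteinSeries.E2 τ + 6 / (π * I) * (τ : ℂ)⁻¹) :=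
  slash_S_eq_smul_iff.1 E2_slash_S τ

/-- The transform of `H₂` under `S`. -/
def H2S (τ : ℍ) : ℂ := -(1 / 2) * H2 (scale 2⁻¹ τ)

lemma H2_S (τ : ℍ) : H2 (S • τ) = τ ^ 2 * H2S τ := by
  rw [H2S, H2_eq, H2_eq, scale_S two_pos, E2_S, E2_S, scale_scale two_pos (by norm_num),
    mul_inv_cancel₀ two_ne_zero, scale_one, coe_scale (by norm_num)]
  push_cast
  have := τ.ne_zero
  field_simp
  ring

lemma H2S_S (τ : ℍ) : H2S (S • τ) = τ ^ 2 * H2 τ := by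
  rw [H2S, scale_S (by norm_num), H2_S, H2S, inv_inv, scale_scale (by norm_num) two_pos,
    inv_mul_cancel₀ two_ne_zero, scale_one, coe_scale two_pos]
  push_cast
  ring

lemma vadd_one_vadd_one (τ : ℍ) : (1 : ℝ) +ᵥ ((1 : ℝ) +ᵥ τ) = (2 : ℝ) +ᵥ τ := by
  rw [vadd_vadd]; norm_num

lemma H2S_TT (τ : ℍ) : H2S ((1 : ℝ) +ᵥ ((1 : ℝ) +ᵥ τ)) = H2S τ := by
  rw [H2S, H2S, vadd_one_vadd_one, scale_vadd (by norm_num), inv_mul_cancel₀ two_ne_zero, H2_T]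

lemma mdifferentiable_H2S : MDiff H2S :=
  (mdifferentiable_comp_scale (by norm_num) mdifferentiable_H2).const_smul (-(1 / 2) : ℂ)

lemma tendsto_H2S : Tendsto H2S atImInfty (𝓝 (-1 / 2)) := by
  have := (tendsto_H2.comp (tendsto_scale (c := 2⁻¹) (by norm_num))).const_mul (-(1 / 2))
  exact tendsto_of_eq this (fun τ => rfl) (by norm_num)

lemma H2_slash_S : H2 ∣[(2 : ℤ)] S = H2S := slash_S_eq_smul_iff.2 fun τ => by
  rw [H2_S]; norm_cast
lemma H2S_slash_S : H2S ∣[(2 : ℤ)] S = H2 := slash_S_eq_smul_iff.2 fun τ => by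
  rw [H2S_S]; norm_cast
lemma H2_slash_T : H2 ∣[(2 : ℤ)] T = H2 := slash_T_eq_iff.2 H2_T
lemma H2S_slash_T_T : (H2S ∣[(2 : ℤ)] T) ∣[(2 : ℤ)] T = H2S := by
  funext τ
  rw [slash_T_apply, slash_T_apply, H2S_TT]

/-- The trace of `H₂` to level one has weight 2 and constant term `1 - 1/2 - 1/2 = 0`, so it
vanishes. -/
lemma H2_slash_sum : H2 + H2S + H2S ∣[(2 : ℤ)] T = 0 := by
  have hd : MDiff (H2 + H2S + H2S ∣[(2 : ℤ)] T) :=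
    (mdifferentiable_H2.add mdifferentiable_H2S).add (mdifferentiable_H2S.slash 2 _)
  have hlim := (tendsto_H2.add tendsto_H2S).add (tendsto_H2S.comp (tendsto_vadd 1))
  have hT : (H2 + H2S + H2S ∣[(2 : ℤ)] T) ∣[(2 : ℤ)] T = H2 + H2S + H2S ∣[(2 : ℤ)] T := by
    rw [SlashAction.add_slash, SlashAction.add_slash, H2_slash_T, H2S_slash_T_T]; abel
  obtain ⟨a, ha⟩ := exists_hasQExpansion_of_tendsto_zero (r := 0) hd
    (fun τ => by rw [← slash_T_apply (H2 + H2S + _) 2, hT]; simp) (tendsto_of_eq hlim (fun τ => by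
      simp [slash_T_apply]) (by norm_num))
  refine eq_zero_of_weight_lt (k := 2) (m := 1) hd ?_ hT (by simpa using ha.tendsto) (by norm_num)
  rw [SlashAction.add_slash, SlashAction.add_slash, H2_slash_S, H2S_slash_S,
    slash_T_slash_S H2_slash_T H2_slash_S H2S_slash_T_T]
  abel

lemma H2S_T (τ : ℍ) : H2S ((1 : ℝ) +ᵥ τ) = -H2 τ - H2S τ := by
  have := congrFun H2_slash_sum τ
  simp only [Pi.add_apply, slash_T_apply, Pi.zero_apply] at this
  linear_combination this

lemma Delta2_eq (τ : ℍ) : Delta2 τ = dedekindEta (scale 2 τ) ^ 8 / dedekindEta τ ^ 4 := by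
  rw [Delta2, etaMul_eq two_pos]; norm_num

lemma Delta2_ne_zero (τ : ℍ) : Delta2 τ ≠ 0 := by
  rw [Delta2_eq]
  exact div_ne_zero (pow_ne_zero _ (dedekindEta_ne_zero _)) (pow_ne_zero _ (dedekindEta_ne_zero _))

lemma mdifferentiable_Delta2 : MDiff Delta2 := by
  rw [funext Delta2_eq]
  exact (mdifferentiable_pow (mdifferentiable_comp_scale two_pos mdifferentiable_dedekindEta) 8).div
    (mdifferentiable_pow mdifferentiable_dedekindEta 4)
    fun τ => pow_ne_zero _ (dedekindEta_ne_zero _)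

lemma tendsto_dedekindEta_scale {c : ℝ} (hc : 0 < c) :
    Tendsto (fun τ => qpow (-(c / 24)) τ * dedekindEta (scale c τ)) atImInfty (𝓝 1) := by
  refine (tendsto_dedekindEta.comp (tendsto_scale hc)).congr fun τ => ?_
  simp only [Function.comp_apply, qpow_scale hc]
  congr 2; ring

lemma tendsto_Delta2 : Tendsto (fun τ => qpow (-(1 / 2)) τ * Delta2 τ) atImInfty (𝓝 1) := by
  have := ((tendsto_dedekindEta_scale two_pos).pow 8).div (tendsto_dedekindEta.pow 4) (by simp)
  simp only [one_pow, div_one] at this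
  refine this.congr fun τ => ?_
  simp only [Pi.div_apply]
  rw [Delta2_eq, mul_pow, mul_pow, ← qpow_nat_mul, ← qpow_nat_mul, mul_div_mul_comm, div_eq_mul_inv,
    ← qpow_neg, ← qpow_add]
  congr 2
  push_cast; ring

/-- The transform of `Δ₂` under `S`. -/
def Delta2S (τ : ℍ) : ℂ := -(1 / 16) * (dedekindEta (scale 2⁻¹ τ) ^ 8 / dedekindEta τ ^ 4)

lemma Delta2_S (τ : ℍ) : Delta2 (S • τ) = τ ^ 2 * Delta2S τ := by
  have h0 := dedekindEta_ne_zero τ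
  have := τ.ne_zero
  rw [Delta2_eq, Delta2S, scale_S two_pos, dedekindEta_S_pow_eight, dedekindEta_S_pow_four,
    coe_scale (by norm_num)]
  push_cast
  field_simp
  norm_num
  ring

lemma tendsto_Delta2S : Tendsto Delta2S atImInfty (𝓝 (-1 / 16)) := by
  have := (((tendsto_dedekindEta_scale (c := 2⁻¹) (by norm_num)).pow 8).div
    (tendsto_dedekindEta.pow 4) (by simp)).const_mul (-(1 / 16))
  simp only [one_pow, div_one] at this
  refine tendsto_of_eq this (fun τ => ?_) (by norm_num)
  simp only [Pi.div_apply]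
  rw [Delta2S, mul_pow, mul_pow, ← qpow_nat_mul, ← qpow_nat_mul, mul_div_mul_comm,
    div_eq_mul_inv (qpow _ _), ← qpow_neg, ← qpow_add]
  norm_num

end

/-! ### Level two: relations and derivatives of `H₂` and `Δ₂` -/

section

open ModularGroup ModularForm
open scoped ModularForm

lemma slash_zero_S_apply (f : ℍ → ℂ) (τ : ℍ) : (f ∣[(0 : ℤ)] S) τ = f (S • τ) := by
  rw [slash_S_apply]; simp

lemma S_smul_S_smul (τ : ℍ) : S • S • τ = τ := by
  rw [← mul_smul, show S * S = -1 by decide, ModularGroup.SL_neg_smul, one_smul]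

lemma dedekindEta_T_pow (n : ℕ) (τ : ℍ) :
    dedekindEta ((1 : ℝ) +ᵥ τ) ^ n = cexp (2 * π * I * (n / 24)) * dedekindEta τ ^ n := by
  rw [dedekindEta_T, mul_pow, ← Complex.exp_nat_mul]
  congr 2; ring

lemma exp_two_pi_mul_half : cexp (2 * π * I * (1 / 2)) = -1 := by
  rw [show 2 * π * I * (1 / 2) = (π : ℂ) * I by ring, Complex.exp_pi_mul_I]

lemma dedekindEta_TT (τ : ℍ) : dedekindEta ((2 : ℝ) +ᵥ τ) = cexp (2 * π * I * (1 / 12)) * dedekindEta τ := by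
  rw [← vadd_one_vadd_one, dedekindEta_T, dedekindEta_T, ← mul_assoc, ← Complex.exp_add]
  congr 2; ring

lemma Delta2_T (τ : ℍ) : Delta2 ((1 : ℝ) +ᵥ τ) = -Delta2 τ := by
  rw [Delta2_eq, Delta2_eq, scale_vadd two_pos, mul_one, dedekindEta_TT, dedekindEta_T_pow, mul_pow,
    ← Complex.exp_nat_mul, mul_div_mul_comm, ← Complex.exp_sub,
    show ((8 : ℕ) : ℂ) * (2 * π * I * (1 / 12)) - 2 * π * I * ((4 : ℕ) / 24) = 2 * π * I * (1 / 2) by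
      push_cast; ring, exp_two_pi_mul_half]
  ring

lemma Delta2S_TT (τ : ℍ) : Delta2S ((1 : ℝ) +ᵥ ((1 : ℝ) +ᵥ τ)) = Delta2S τ := by
  rw [vadd_one_vadd_one, Delta2S, Delta2S, scale_vadd (by norm_num), inv_mul_cancel₀ two_ne_zero,
    dedekindEta_T_pow, dedekindEta_TT, mul_pow, ← Complex.exp_nat_mul, mul_div_mul_comm,
    ← Complex.exp_sub,
    show 2 * π * I * ((8 : ℕ) / 24) - ((4 : ℕ) : ℂ) * (2 * π * I * (1 / 12)) = 0 by
      push_cast; ring, Complex.exp_zero, one_mul]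

lemma Delta2S_S (τ : ℍ) : Delta2S (S • τ) = τ ^ 2 * Delta2 τ := by
  have h := Delta2_S (S • τ)
  rw [S_smul_S_smul, coe_S_smul] at h
  have := τ.ne_zero
  rw [h]; field_simp

lemma Delta2S_ne_zero (τ : ℍ) : Delta2S τ ≠ 0 := by
  intro h
  have := Delta2_S τ
  rw [h, mul_zero] at this
  exact Delta2_ne_zero _ this

lemma mdifferentiable_Delta2S : MDiff Delta2S :=
  ((mdifferentiable_pow (mdifferentiable_comp_scale (by norm_num) mdifferentiable_dedekindEta) 8).div
    (mdifferentiable_pow mdifferentiable_dedekindEta 4)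
    fun τ => pow_ne_zero _ (dedekindEta_ne_zero _)).const_smul (-(1 / 16) : ℂ)

lemma exists_hasQExpansion_Delta2 : ∃ a, HasQExpansion Delta2 (1 / 2) a ∧ a 0 = 1 :=
  exists_hasQExpansion_of_tendsto mdifferentiable_Delta2
    (fun τ => by rw [Delta2_T, exp_two_pi_mul_half]; ring) tendsto_Delta2

lemma tendsto_Delta2_zero : Tendsto Delta2 atImInfty (𝓝 0) := by
  have := (tendsto_qpow_of_pos (r := 1 / 2) (by norm_num)).mul tendsto_Delta2
  refine tendsto_of_eq this (fun τ => ?_) (by simp)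
  rw [← mul_assoc, ← qpow_add]
  push_cast; simp

/-- The transformation of `H₂` under `S` in terms of `H₂` and `Δ₂`. -/
lemma H2S_eq (τ : ℍ) : H2S τ = -(H2 τ + 24 * Delta2 τ) / 2 := by
  -- The numerator changes sign under `T`, as does `Δ₂`, so the quotient is a function on `Γ₀(2)`.
  -- The constant is its value at the cusp 0, `(1/2 - 2) / (-1/16) = 24`.
  set f : ℍ → ℂ := (-H2 - (2 : ℂ) • H2S) / Delta2 - fun _ => 24 with hf
  set g : ℍ → ℂ := (-H2S - (2 : ℂ) • H2) / Delta2S - fun _ => 24 with hg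
  have hnum : MDiff (-H2 - (2 : ℂ) • H2S) :=
    mdifferentiable_H2.neg.sub (mdifferentiable_H2S.const_smul _)
  have hf0 : f = 0 := by
    have hlim : ∃ L, Tendsto f atImInfty (𝓝 L) := by
      have hnl : Tendsto (-H2 - (2 : ℂ) • H2S) atImInfty (𝓝 0) :=
        tendsto_of_eq (tendsto_H2.neg.sub (tendsto_H2S.const_mul 2)) (fun τ => by simp)
          (by norm_num)
      -- Its exponents lie in `1/2 + ℤ`. A limit at `i∞` excludes those below `-1/2`, the limit zero
      -- also `-1/2` itself, so the expansion starts at `1/2`, like that of `Δ₂`.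
      obtain ⟨a, ha⟩ := exists_hasQExpansion_of_tendsto_zero (r := -(1 / 2)) hnum (fun τ => by
        simp only [Pi.sub_apply, Pi.neg_apply, Pi.smul_apply, smul_eq_mul, H2_T, H2S_T]
        rw [mul_neg, Complex.exp_neg, exp_two_pi_mul_half]
        norm_num; ring) (by
          have := (tendsto_qpow_of_pos (r := 1 / 2) (by norm_num)).mul hnl
          exact tendsto_of_eq this (fun τ => by push_cast; simp) (by simp))
      have h1 := (ha.tendsto.div tendsto_Delta2 one_ne_zero).sub_const 24
      refine ⟨_, h1.congr fun τ => ?_⟩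
      simp only [Pi.div_apply, hf, Pi.sub_apply]
      rw [show (-(-(1 / 2) + 1) : ℂ) = -(1 / 2) by norm_num, mul_div_mul_left _ _ (qpow_ne_zero _ _)]
    obtain ⟨L, hL⟩ := hlim
    refine eq_zero_of_conj_two (g := g) (L' := 0) ?_ ?_ ?_ ?_ ?_ ?_ hL ?_ (mul_zero _)
    · exact (hnum.div mdifferentiable_Delta2 Delta2_ne_zero).sub mdifferentiable_const
    · exact ((mdifferentiable_H2S.neg.sub (mdifferentiable_H2.const_smul _)).div
        mdifferentiable_Delta2S Delta2S_ne_zero).sub mdifferentiable_const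
    · funext τ
      have := Delta2_ne_zero τ
      simp only [slash_T_apply, hf, Pi.sub_apply, Pi.div_apply, Pi.neg_apply, Pi.smul_apply,
        smul_eq_mul, H2_T, H2S_T, Delta2_T]
      field_simp
      ring
    · funext τ
      have := Delta2S_ne_zero τ
      have := τ.ne_zero
      simp only [slash_zero_S_apply, hf, hg, Pi.sub_apply, Pi.div_apply, Pi.neg_apply,
        Pi.smul_apply, smul_eq_mul, H2_S, H2S_S, Delta2_S]
      field_simp
    · funext τ
      have := Delta2_ne_zero τ
      have := τ.ne_zero
      simp only [slash_zero_S_apply, hf, hg, Pi.sub_apply, Pi.div_apply, Pi.neg_apply,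
        Pi.smul_apply, smul_eq_mul, H2_S, H2S_S, Delta2S_S]
      field_simp
    · funext τ
      simp only [slash_T_apply, hg, Pi.sub_apply, Pi.div_apply, Pi.neg_apply,
        Pi.smul_apply, smul_eq_mul, H2_T, H2S_TT, Delta2S_TT]
    · have := ((tendsto_H2S.neg.sub (tendsto_H2.const_mul 2)).div tendsto_Delta2S
        (by norm_num)).sub_const 24
      exact tendsto_of_eq this (fun τ => by simp [hg]) (by norm_num)
  have := congrFun hf0 τ
  have h0 := Delta2_ne_zero τ
  simp only [hf, Pi.sub_apply, Pi.div_apply, Pi.neg_apply, Pi.smul_apply, smul_eq_mul,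
    Pi.zero_apply, sub_eq_zero, div_eq_iff h0] at this
  linear_combination (-1 / 2) * this

lemma H2_S' (τ : ℍ) : H2 (S • τ) = τ ^ 2 * (-(H2 τ + 24 * Delta2 τ) / 2) := by
  rw [H2_S, H2S_eq]

lemma Delta2S_eq (τ : ℍ) : Delta2S τ = -(H2 τ - 8 * Delta2 τ) / 16 := by
  have h1 := H2S_S τ
  rw [H2S_eq, H2_S', Delta2_S] at h1
  have h0 := pow_ne_zero 2 τ.ne_zero
  refine mul_left_cancel₀ h0 ?_
  linear_combination (-1 / 12) * h1

lemma Delta2_S' (τ : ℍ) : Delta2 (S • τ) = τ ^ 2 * (-(H2 τ - 8 * Delta2 τ) / 16) := by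
  rw [Delta2_S, Delta2S_eq]

/-- A function of level one and weight less than twelve that vanishes at `i∞` is zero. -/
lemma eq_zero_of_tendsto_zero {k : ℤ} {d : ℍ → ℂ} (hd : MDiff d)
    (hS : ∀ τ : ℍ, d (S • τ) = (τ : ℂ) ^ k * d τ) (hT : ∀ τ : ℍ, d ((1 : ℝ) +ᵥ τ) = d τ)
    (h0 : Tendsto d atImInfty (𝓝 0)) (hk : k < 12) : d = 0 := by
  obtain ⟨a, ha⟩ := exists_hasQExpansion_of_tendsto_zero (r := 0) hd
    (fun τ => by rw [hT]; simp) (h0.congr fun τ => by simp)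
  exact eq_zero_of_weight_lt (m := 1) hd (slash_S_eq_smul_iff.2 hS) (slash_T_eq_iff.2 hT)
    (by simpa using ha.tendsto) (by simpa using hk)

lemma E4_S (τ : ℍ) : ModularForm.E₄ (S • τ) = (τ : ℂ) ^ 4 * ModularForm.E₄ τ := by
  exact_mod_cast slash_S_eq_smul_iff.1 (E4_slash S) τ

lemma E4_T (τ : ℍ) : ModularForm.E₄ ((1 : ℝ) +ᵥ τ) = ModularForm.E₄ τ :=
  slash_T_eq_iff.1 (E4_slash T) τ

/-- By the substitution formulas for `S`, the right side is a form of level one; the difference has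
weight 4 and no constant term. -/
lemma E4_eq (τ : ℍ) : ModularForm.E₄ τ = H2 τ ^ 2 + 192 * Delta2 τ ^ 2 := by
  have h : (ModularForm.E₄ : ℍ → ℂ) - H2 ^ 2 - (192 : ℂ) • Delta2 ^ 2 = 0 := by
    refine eq_zero_of_tendsto_zero (k := 4) ?_ (fun τ => ?_) (fun τ => ?_) ?_ (by norm_num)
    · exact (hasQExpansion_E4.mdifferentiable.sub (mdifferentiable_pow mdifferentiable_H2 2)).sub
        ((mdifferentiable_pow mdifferentiable_Delta2 2).const_smul _)
    · simp only [Pi.sub_apply, Pi.smul_apply, Pi.pow_apply, smul_eq_mul, E4_S, H2_S', Delta2_S']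
      norm_cast
      ring
    · simp only [Pi.sub_apply, Pi.smul_apply, Pi.pow_apply, smul_eq_mul, E4_T, H2_T, Delta2_T]
      ring
    · refine tendsto_of_eq ((tendsto_E4.sub (tendsto_H2.pow 2)).sub
        ((tendsto_Delta2_zero.pow 2).const_mul 192)) (fun τ => rfl) (by norm_num)
  have := congrFun h τ
  simp only [Pi.sub_apply, Pi.smul_apply, Pi.pow_apply, smul_eq_mul, Pi.zero_apply] at this
  linear_combination this

/-- Both sides change sign under `T` and have the same factor under `S`, so their quotient is of
weight zero and level one, with limit 1. -/
lemma dedekindEta_pow_twelve (τ : ℍ) :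
    dedekindEta τ ^ 12 = Delta2 τ * (H2 τ ^ 2 - 64 * Delta2 τ ^ 2) := by
  have hη : ∀ τ, (dedekindEta ^ 12) τ ≠ 0 := fun τ => pow_ne_zero _ (dedekindEta_ne_zero τ)
  have h : (Delta2 * (H2 ^ 2 - (64 : ℂ) • Delta2 ^ 2)) / dedekindEta ^ 12 - (fun _ => 1) = 0 := by
    refine eq_zero_of_tendsto_zero (k := 0) ?_ (fun τ => ?_) (fun τ => ?_) ?_ (by norm_num)
    · exact ((mdifferentiable_Delta2.mul ((mdifferentiable_pow mdifferentiable_H2 2).sub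
        ((mdifferentiable_pow mdifferentiable_Delta2 2).const_smul _))).div
        (mdifferentiable_pow mdifferentiable_dedekindEta 12) hη).sub mdifferentiable_const
    · have h0 := dedekindEta_ne_zero τ
      have h1 := τ.ne_zero
      have : dedekindEta (S • τ) ^ 12 = -τ ^ 6 * dedekindEta τ ^ 12 := by
        rw [show 12 = 4 * 3 by rfl, pow_mul, pow_mul, dedekindEta_S_pow_four]; ring
      simp only [Pi.sub_apply, Pi.smul_apply, Pi.pow_apply, smul_eq_mul, H2_S', Delta2_S',
        Pi.mul_apply, Pi.div_apply, this]
      field_simp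
      ring
    · simp only [Pi.sub_apply, Pi.smul_apply, Pi.pow_apply, smul_eq_mul, H2_T, Delta2_T,
        Pi.mul_apply, Pi.div_apply, dedekindEta_T_pow]
      rw [show 2 * π * I * (((12 : ℕ) : ℂ) / 24) = 2 * π * I * (1 / 2) by push_cast; ring,
        exp_two_pi_mul_half]
      have h0 := dedekindEta_ne_zero τ
      field_simp
    · have h1 := ((tendsto_Delta2.mul ((tendsto_H2.pow 2).sub
        ((tendsto_Delta2_zero.pow 2).const_mul 64))).div (tendsto_dedekindEta.pow 12)
        (by simp)).sub_const 1
      refine tendsto_of_eq h1 (fun τ => ?_) (by norm_num)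
      simp only [Pi.sub_apply, Pi.smul_apply, Pi.pow_apply, smul_eq_mul, Pi.mul_apply, Pi.div_apply,
        mul_pow, ← qpow_nat_mul]
      rw [show ((12 : ℕ) : ℂ) * -(1 / 24) = -(1 / 2) by push_cast; ring, mul_assoc,
        mul_div_mul_left _ _ (qpow_ne_zero _ _)]
  have := congrFun h τ
  simp only [Pi.sub_apply, Pi.smul_apply, Pi.pow_apply, smul_eq_mul, Pi.mul_apply, Pi.div_apply,
    Pi.zero_apply, sub_eq_zero, div_eq_iff (pow_ne_zero 12 (dedekindEta_ne_zero τ))] at this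
  linear_combination -this

lemma D_Delta2 (τ : ℍ) : D Delta2 τ = (H2 τ / 3 + EisensteinSeries.E2 τ / 6) * Delta2 τ := by
  have h1 : MDiff (dedekindEta ∘ scale 2) :=
    mdifferentiable_comp_scale two_pos mdifferentiable_dedekindEta
  have e1 := D_pow h1 (g := fun τ => EisensteinSeries.E2 (scale 2 τ) / 12) (fun τ => by
    rw [D_comp_scale two_pos mdifferentiable_dedekindEta, D_dedekindEta]
    push_cast; simp only [Function.comp_apply]; ring) 8 τ
  have e2 := D_pow mdifferentiable_dedekindEta D_dedekindEta 4 τ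
  have hprod : Delta2 * dedekindEta ^ 4 = (dedekindEta ∘ scale 2) ^ 8 := by
    funext τ
    have := dedekindEta_ne_zero τ
    simp only [Pi.mul_apply, Pi.pow_apply, Delta2_eq, Function.comp_apply]
    field_simp
  have e3 := congrFun (Derivative.normalizedDerivOfComplex_mul _ _ mdifferentiable_Delta2
    (mdifferentiable_pow mdifferentiable_dedekindEta 4)) τ
  rw [hprod] at e3
  simp only [D] at e1 e2
  rw [e1] at e3
  simp only [Pi.add_apply, Pi.mul_apply, Pi.pow_apply, e2] at e3
  have e4 := congrFun hprod τ
  simp only [Pi.mul_apply, Pi.pow_apply] at e4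
  have hne := pow_ne_zero 4 (dedekindEta_ne_zero τ)
  refine mul_right_cancel₀ hne ?_
  rw [H2_eq]
  simp only [D]
  push_cast at e3 ⊢
  linear_combination -e3 - 2 / 3 * EisensteinSeries.E2 (scale 2 τ) * e4

/-- The defect `N` of the identity satisfies `N|S = -N/2` in weight 4. Since `S²` acts trivially in
even weight, `N = N/4`, so `N = 0`; no growth argument is needed. -/
lemma D_H2 (τ : ℍ) : D H2 τ =
    EisensteinSeries.E2 τ / 6 * H2 τ + (192 * Delta2 τ ^ 2 - H2 τ ^ 2) / 6 := by
  set N : ℍ → ℂ := fun τ => D H2 τ - EisensteinSeries.E2 τ / 6 * H2 τ -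
    (192 * Delta2 τ ^ 2 - H2 τ ^ 2) / 6 with hN
  have hNS : ∀ τ : ℍ, N (S • τ) = τ ^ 4 * (-(1 / 2) * N τ) := by
    intro τ
    have h := congrFun (Derivative.serreDerivative_slash_equivariant (k := 2) mdifferentiable_H2
      (γ := S)) τ
    have hH : H2 ∣[(2 : ℤ)] S = (-(1 / 2) : ℂ) • (H2 + (24 : ℂ) • Delta2) := by
      rw [H2_slash_S]; funext τ
      simp only [H2S_eq, Pi.smul_apply, Pi.add_apply, smul_eq_mul]; ring
    rw [hH, Derivative.serreDerivative_smul _ _ _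
      (mdifferentiable_H2.add (mdifferentiable_Delta2.const_smul _)),
      Derivative.serreDerivative_add _ _ _ mdifferentiable_H2 (mdifferentiable_Delta2.const_smul _),
      Derivative.serreDerivative_smul _ _ _ mdifferentiable_Delta2, slash_S_apply] at h
    simp only [Derivative.serreDerivative_apply, Pi.smul_apply, Pi.add_apply, smul_eq_mul] at h
    have hD := D_Delta2 τ
    simp only [D] at hD
    rw [hD, zpow_neg, ← div_eq_mul_inv, div_eq_iff (zpow_ne_zero _ τ.ne_zero)] at h
    rw [show (2 + 2 : ℤ) = ((4 : ℕ) : ℤ) by norm_num, zpow_natCast] at h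
    push_cast at h
    simp only [hN, D]
    have h' : Derivative.normalizedDerivOfComplex H2 (S • τ) = EisensteinSeries.E2 (S • τ) / 6 *
        H2 (S • τ) + -(1 / 2) * (Derivative.normalizedDerivOfComplex H2 τ -
          EisensteinSeries.E2 τ / 6 * H2 τ + 8 * H2 τ * Delta2 τ) * τ ^ 4 := by
      linear_combination h
    rw [h', H2_S', Delta2_S']
    ring
  have h := hNS (S • τ)
  have h0 := τ.ne_zero
  rw [S_smul_S_smul, hNS, coe_S_smul] at h
  have : N τ = 0 := by
    field_simp at h
    linear_combination (1 / 3) * h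
  simp only [hN] at this
  linear_combination this

end

section

open ModularGroup ModularForm
open scoped ModularForm

/-! ### Modular forms from permuted families -/

/-- Reduction modulo `N`. -/
def redMod (N : ℕ) (γ : SL(2, ℤ)) : Matrix (Fin 2) (Fin 2) (ZMod N) :=
  (Matrix.SpecialLinearGroup.map (Int.castRingHom (ZMod N)) γ : Matrix _ _ _)

lemma redMod_mul (N : ℕ) (γ δ : SL(2, ℤ)) : redMod N (γ * δ) = redMod N γ * redMod N δ := by
  simp [redMod]

lemma redMod_one (N : ℕ) : redMod N 1 = 1 := by simp [redMod]

open Matrix in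
/-- A family indexed by row vectors modulo `N` that is permuted by `S` and `T` is permuted by the
modular group. -/
lemma slash_family {N : ℕ} {k : ℤ} {ℓ : (Fin 2 → ZMod N) → ℍ → ℂ}
    (hS : ∀ v, ℓ v ∣[k] S = ℓ (v ᵥ* redMod N S)) (hT : ∀ v, ℓ v ∣[k] T = ℓ (v ᵥ* redMod N T))
    (γ : SL(2, ℤ)) : ∀ v, ℓ v ∣[k] γ = ℓ (v ᵥ* redMod N γ) := by
  have hmem : γ ∈ Subgroup.closure ({S, T} : Set SL(2, ℤ)) := by
    rw [SpecialLinearGroup.SL2Z_generators]; trivial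
  induction hmem using Subgroup.closure_induction with
  | mem x hx =>
    rcases hx with rfl | rfl
    · exact hS
    · exact hT
  | one => intro v; simp [redMod_one]
  | mul x y _ _ hx hy =>
    intro v
    rw [SlashAction.slash_mul, hx, hy, redMod_mul, vecMul_vecMul]
  | inv x _ hx =>
    intro v
    have h := hx (v ᵥ* redMod N x⁻¹)
    rw [vecMul_vecMul, ← redMod_mul, inv_mul_cancel, redMod_one, vecMul_one] at h
    rw [← h, ← SlashAction.slash_mul, mul_inv_cancel, SlashAction.slash_one]

lemma redMod_eq_one {N : ℕ} {γ : SL(2, ℤ)} (h : γ ∈ CongruenceSubgroup.Gamma N) :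
    redMod N γ = 1 := by
  rw [CongruenceSubgroup.Gamma_mem'] at h
  rw [redMod, h]; rfl

lemma isCusp_SL_of_isCusp {Γ : Subgroup SL(2, ℤ)} {c : OnePoint ℝ}
    (hc : IsCusp c (Γ.map (Matrix.SpecialLinearGroup.mapGL ℝ))) : IsCusp c 𝒮ℒ :=
  hc.mono (by rintro _ ⟨γ, -, rfl⟩; exact ⟨γ, rfl⟩)

lemma exists_modularForm {Γ : Subgroup SL(2, ℤ)} {k : ℤ} {f : ℍ → ℂ} (hf : MDiff f)
    (hΓ : ∀ γ ∈ Γ, f ∣[k] γ = f) (hb : ∀ γ : SL(2, ℤ), IsBoundedAtImInfty (f ∣[k] γ)) :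
    ∃ F : ModularForm Γ k, ⇑F = f :=
  ⟨{ toFun := f
     slash_action_eq' := by rintro _ ⟨γ, hγ, rfl⟩; exact hΓ γ hγ
     holo' := hf
     bdd_at_cusps' := fun hc => by
      rw [OnePoint.isBoundedAt_iff_forall_SL2Z (isCusp_SL_of_isCusp hc)]
      exact fun γ _ => hb γ }, rfl⟩

lemma exists_cuspForm {Γ : Subgroup SL(2, ℤ)} {k : ℤ} {f : ℍ → ℂ} (hf : MDiff f)
    (hΓ : ∀ γ ∈ Γ, f ∣[k] γ = f) (hb : ∀ γ : SL(2, ℤ), IsZeroAtImInfty (f ∣[k] γ)) :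
    ∃ F : CuspForm Γ k, ⇑F = f :=
  ⟨{ toFun := f
     slash_action_eq' := by rintro _ ⟨γ, hγ, rfl⟩; exact hΓ γ hγ
     holo' := hf
     zero_at_cusps' := fun hc => by
      rw [OnePoint.isZeroAt_iff_forall_SL2Z (isCusp_SL_of_isCusp hc)]
      exact fun γ _ => hb γ }, rfl⟩

/-- The orbit of a function on `Γ₀(2)`. -/
def familyTwo (k : ℤ) (f g : ℍ → ℂ) (v : Fin 2 → ZMod 2) : ℍ → ℂ :=
  if v = ![0, 1] then f else if v = ![1, 0] then g else if v = ![1, 1] then g ∣[k] T else 0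

/-- The cosets of `Γ₀(2)` are labelled by the bottom row modulo 2: `(0,1)` for `1`, `(1,0)` for `S`,
`(1,1)` for `S T`. Right multiplication permutes these rows, so `Γ(2)` fixes every member, and each
conjugate of `f` is again a member whose behaviour at `i∞` is known. -/
lemma familyTwo_slash {k : ℤ} {f g : ℍ → ℂ} (hT : f ∣[k] T = f) (hS : f ∣[k] S = g)
    (hSS : g ∣[k] S = f) (hTT : (g ∣[k] T) ∣[k] T = g) (γ : SL(2, ℤ)) (v : Fin 2 → ZMod 2) :
    familyTwo k f g v ∣[k] γ = familyTwo k f g (Matrix.vecMul v (redMod 2 γ)) := by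
  have hST := slash_T_slash_S hT hS hTT
  have hv : ∀ v : Fin 2 → ZMod 2, v = 0 ∨ v = ![0, 1] ∨ v = ![1, 0] ∨ v = ![1, 1] := by decide
  refine slash_family (fun v => ?_) (fun v => ?_) γ v
  · rcases hv v with rfl | rfl | rfl | rfl
    · rw [Matrix.zero_vecMul, familyTwo, if_neg (by decide), if_neg (by decide), if_neg (by decide),
        SlashAction.zero_slash]
    · rw [show Matrix.vecMul ![0, 1] (redMod 2 S) = ![1, 0] by decide]; simp [familyTwo, hS]
    · rw [show Matrix.vecMul ![1, 0] (redMod 2 S) = ![0, 1] by decide]; simp [familyTwo, hSS]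
    · rw [show Matrix.vecMul ![1, 1] (redMod 2 S) = ![1, 1] by decide]; simp [familyTwo, hST]
  · rcases hv v with rfl | rfl | rfl | rfl
    · rw [Matrix.zero_vecMul, familyTwo, if_neg (by decide), if_neg (by decide), if_neg (by decide),
        SlashAction.zero_slash]
    · rw [show Matrix.vecMul ![0, 1] (redMod 2 T) = ![0, 1] by decide]; simp [familyTwo, hT]
    · rw [show Matrix.vecMul ![1, 0] (redMod 2 T) = ![1, 1] by decide]; simp [familyTwo]
    · rw [show Matrix.vecMul ![1, 1] (redMod 2 T) = ![1, 0] by decide]; simp [familyTwo, hTT]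

lemma familyTwo_cases {k : ℤ} {f g : ℍ → ℂ} {P : (ℍ → ℂ) → Prop} (h0 : P 0) (hf : P f) (hg : P g)
    (hgT : P (g ∣[k] T)) (v : Fin 2 → ZMod 2) : P (familyTwo k f g v) := by
  unfold familyTwo
  split_ifs <;> assumption

lemma familyTwo_zero_one (k : ℤ) (f g : ℍ → ℂ) : familyTwo k f g ![0, 1] = f := by
  simp [familyTwo]

lemma H2_slash (γ : SL(2, ℤ)) (v : Fin 2 → ZMod 2) : familyTwo 2 H2 H2S v ∣[(2 : ℤ)] γ =
    familyTwo 2 H2 H2S (Matrix.vecMul v (redMod 2 γ)) :=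
  familyTwo_slash H2_slash_T H2_slash_S H2S_slash_S H2S_slash_T_T γ v

lemma isBoundedAtImInfty_familyTwo_H2 (v : Fin 2 → ZMod 2) :
    IsBoundedAtImInfty (familyTwo 2 H2 H2S v) := by
  refine familyTwo_cases (P := IsBoundedAtImInfty) ?_ (tendsto_H2.isBigO_one ℝ)
    (tendsto_H2S.isBigO_one ℝ) ?_ v
  · exact (tendsto_const_nhds (x := (0 : ℂ))).isBigO_one ℝ
  · have := (tendsto_H2S.comp (tendsto_vadd 1)).isBigO_one ℝ
    rwa [show H2S ∘ (fun τ : ℍ => (1 : ℝ) +ᵥ τ) = H2S ∣[(2 : ℤ)] T from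
      funext fun τ => (slash_T_apply _ _ _).symm] at this

theorem exists_modularForm_H2 : ∃ F : ModularForm Γ(2) 2, ⇑F = H2 := by
  refine exists_modularForm mdifferentiable_H2 (fun γ hγ => ?_) fun γ => ?_
  · have := H2_slash γ ![0, 1]
    rwa [redMod_eq_one hγ, Matrix.vecMul_one, familyTwo_zero_one] at this
  · have := H2_slash γ ![0, 1]
    rw [familyTwo_zero_one] at this
    rw [this]
    exact isBoundedAtImInfty_familyTwo_H2 _

/-- As a difference of conjugates of `H₂`, the function `Δ₂` inherits both invariance under `Γ(2)`
and boundedness at the cusps. -/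
lemma Delta2_eq_family : Delta2 = (1 / 24 : ℂ) • (familyTwo 2 H2 H2S ![1, 1] -
    familyTwo 2 H2 H2S ![1, 0]) := by
  funext τ
  have h1 : familyTwo 2 H2 H2S ![1, 1] = H2S ∣[(2 : ℤ)] T := by simp [familyTwo]
  have h2 : familyTwo 2 H2 H2S ![1, 0] = H2S := by simp [familyTwo]
  rw [h1, h2]
  simp only [Pi.smul_apply, Pi.sub_apply, slash_T_apply, smul_eq_mul, H2S_eq, H2_T, Delta2_T]
  ring

lemma Delta2_slash (γ : SL(2, ℤ)) : Delta2 ∣[(2 : ℤ)] γ = (1 / 24 : ℂ) •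
    (familyTwo 2 H2 H2S (Matrix.vecMul ![1, 1] (redMod 2 γ)) -
      familyTwo 2 H2 H2S (Matrix.vecMul ![1, 0] (redMod 2 γ))) := by
  conv_lhs => rw [Delta2_eq_family]
  rw [SL_smul_slash, sub_eq_add_neg, SlashAction.add_slash, SlashAction.neg_slash, H2_slash, H2_slash,
    ← sub_eq_add_neg]

theorem exists_modularForm_Delta2 : ∃ F : ModularForm Γ(2) 2, ⇑F = Delta2 := by
  refine exists_modularForm mdifferentiable_Delta2 (fun γ hγ => ?_) fun γ => ?_
  · rw [Delta2_slash, redMod_eq_one hγ, Matrix.vecMul_one, Matrix.vecMul_one, ← Delta2_eq_family]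
  · rw [Delta2_slash]
    have := (isBoundedAtImInfty_familyTwo_H2 (Matrix.vecMul ![1, 1] (redMod 2 γ))).sub
      (isBoundedAtImInfty_familyTwo_H2 (Matrix.vecMul ![1, 0] (redMod 2 γ)))
    exact Asymptotics.IsBigO.const_smul_left this _

lemma Delta2A_eq (τ : ℍ) : Delta2A τ = dedekindEta τ ^ 12 * Delta2 τ := by
  have := dedekindEta_ne_zero τ
  rw [Delta2A, Delta2]
  field_simp

lemma Delta2A_eq' (τ : ℍ) : Delta2A τ = Delta2 τ ^ 2 * (H2 τ ^ 2 - 64 * Delta2 τ ^ 2) := by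
  rw [Delta2A_eq, dedekindEta_pow_twelve]; ring

lemma dedekindEta_S_pow_twelve (τ : ℍ) : dedekindEta (S • τ) ^ 12 = -τ ^ 6 * dedekindEta τ ^ 12 := by
  rw [show 12 = 4 * 3 by rfl, pow_mul, pow_mul, dedekindEta_S_pow_four]; ring

lemma dedekindEta_T_pow_twelve (τ : ℍ) : dedekindEta ((1 : ℝ) +ᵥ τ) ^ 12 = -dedekindEta τ ^ 12 := by
  rw [dedekindEta_T_pow, show 2 * π * I * (((12 : ℕ) : ℂ) / 24) = 2 * π * I * (1 / 2) by
    push_cast; ring, exp_two_pi_mul_half]; ring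

lemma tendsto_dedekindEta_zero : Tendsto dedekindEta atImInfty (𝓝 0) := by
  have := (tendsto_qpow_of_pos (r := 1 / 24) (by norm_num)).mul tendsto_dedekindEta
  refine tendsto_of_eq this (fun τ => ?_) (by simp)
  rw [← mul_assoc, ← qpow_add]
  push_cast; simp

theorem exists_cuspForm_Delta2A :
    ∃ F : CuspForm (CongruenceSubgroup.Gamma0 2) 8, ⇑F = Delta2A := by
  set g : ℍ → ℂ := fun τ => -(dedekindEta τ ^ 12 * Delta2S τ) with hg
  have hS : Delta2A ∣[(8 : ℤ)] S = g := slash_S_eq_smul_iff.2 fun τ => by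
    rw [Delta2A_eq, dedekindEta_S_pow_twelve, Delta2_S]
    simp only [hg]
    norm_cast
    ring
  have hSS : g ∣[(8 : ℤ)] S = Delta2A := slash_S_eq_smul_iff.2 fun τ => by
    simp only [hg]
    rw [Delta2A_eq, dedekindEta_S_pow_twelve, Delta2S_S]
    norm_cast
    ring
  have hT : Delta2A ∣[(8 : ℤ)] T = Delta2A := slash_T_eq_iff.2 fun τ => by
    rw [Delta2A_eq, Delta2A_eq, dedekindEta_T_pow_twelve, Delta2_T]; ring
  have hTT : (g ∣[(8 : ℤ)] T) ∣[(8 : ℤ)] T = g := by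
    funext τ
    simp only [slash_T_apply, hg, Delta2S_TT, dedekindEta_T_pow_twelve]; ring
  have key := familyTwo_slash hT hS hSS hTT
  have hlim : Tendsto Delta2A atImInfty (𝓝 0) :=
    tendsto_of_eq ((tendsto_dedekindEta_zero.pow 12).mul tendsto_Delta2_zero)
      (fun τ => (Delta2A_eq τ).symm) (by simp)
  have hlimg : Tendsto g atImInfty (𝓝 0) :=
    tendsto_of_eq ((tendsto_dedekindEta_zero.pow 12).mul tendsto_Delta2S).neg
      (fun τ => rfl) (by simp)
  have hd : MDiff Delta2A := by
    rw [funext Delta2A_eq]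
    exact (mdifferentiable_pow mdifferentiable_dedekindEta 12).mul mdifferentiable_Delta2
  refine exists_cuspForm hd (fun γ hγ => ?_) fun γ => ?_
  · have h := key γ ![0, 1]
    rw [familyTwo_zero_one] at h
    rw [h]
    -- With lower left entry zero, determinant 1 forces the bottom row modulo 2 to be `(0,1)`.
    have hγ' : redMod 2 γ 1 0 = 0 := CongruenceSubgroup.Gamma0_mem.1 hγ
    have hdet : (redMod 2 γ).det = 1 := (Matrix.SpecialLinearGroup.map (Int.castRingHom (ZMod 2)) γ).2
    have h11 : redMod 2 γ 1 1 = 1 := by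
      rw [Matrix.det_fin_two, hγ', mul_zero, sub_zero] at hdet
      revert hdet
      generalize redMod 2 γ 0 0 = a
      generalize redMod 2 γ 1 1 = b
      revert a b; decide
    have : Matrix.vecMul ![0, 1] (redMod 2 γ) = ![0, 1] := by
      funext i
      fin_cases i <;> simp [Matrix.vecMul, dotProduct, Fin.sum_univ_two, hγ', h11]
    rw [this, familyTwo_zero_one]
  · have h := key γ ![0, 1]
    rw [familyTwo_zero_one] at h
    rw [h]
    refine familyTwo_cases (P := IsZeroAtImInfty) tendsto_const_nhds hlim hlimg ?_ _
    have := hlimg.comp (tendsto_vadd 1)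
    rwa [show g ∘ (fun τ : ℍ => (1 : ℝ) +ᵥ τ) = g ∣[(8 : ℤ)] T from
      funext fun τ => (slash_T_apply _ _ _).symm] at this

end

section

open ModularGroup ModularForm
open scoped ModularForm

/-! ### The logarithmic case -/

/-- The Serre derivative of `E₄` has weight 6 and constant term `-1/3`; adding `E₆ / 3` gives a
level one form that vanishes at `i∞`. -/
lemma D_E4 (τ : ℍ) : D ModularForm.E₄ τ =
    (EisensteinSeries.E2 τ * ModularForm.E₄ τ - ModularForm.E₆ τ) / 3 := by
  have hE := hasQExpansion_E4
  have hd := Derivative.serreDerivative_mdifferentiable (4 : ℂ) hE.mdifferentiable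
  have h0 : Derivative.serreDerivative 4 ModularForm.E₄ + (1 / 3 : ℂ) • (ModularForm.E₆ : ℍ → ℂ) = 0 := by
    have hinv : ∀ γ : SL(2, ℤ), (Derivative.serreDerivative 4 ModularForm.E₄ +
        (1 / 3 : ℂ) • (ModularForm.E₆ : ℍ → ℂ)) ∣[(6 : ℤ)] γ =
        Derivative.serreDerivative 4 ModularForm.E₄ + (1 / 3 : ℂ) • (ModularForm.E₆ : ℍ → ℂ) := by
      intro γ
      have h1 := Derivative.serreDerivative_slash_invariant (k := 4) hE.mdifferentiable (E4_slash γ)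
      rw [SlashAction.add_slash, SL_smul_slash, E6_slash]
      congr 1
    refine eq_zero_of_tendsto_zero (k := 6) (hd.add
      (hasQExpansion_E6.mdifferentiable.const_smul _)) (slash_S_eq_smul_iff.1 (hinv S))
      (slash_T_eq_iff.1 (hinv T)) ?_ (by norm_num)
    have h1 := hE.D.tendsto
    simp only [neg_zero, qpow_zero, one_mul, Nat.cast_zero, add_zero, zero_mul] at h1
    refine tendsto_of_eq ((h1.sub ((tendsto_E2.mul tendsto_E4).const_mul (4 * 12⁻¹))).add
      (tendsto_E6.const_mul (1 / 3))) (fun τ => by simp; ring) (by norm_num)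
  have := congrFun h0 τ
  simp only [Pi.add_apply, Derivative.serreDerivative_apply, Pi.smul_apply, smul_eq_mul,
    Pi.zero_apply] at this
  simp only [D]
  linear_combination this

/-- Solutions of an inhomogeneous second order equation are solutions of the third order one. -/
lemma mem_solutions_of_second_order {f c : ℍ → ℂ} (hf : MDiff f) (hc : MDiff c)
    (h : ∀ τ, D (D f) τ = EisensteinSeries.E2 τ / 6 * D f τ + ModularForm.E₄ τ / 18 * f τ + c τ)
    (hDc : ∀ τ, D c τ = EisensteinSeries.E2 τ / 3 * c τ) : f ∈ solutions 0 (1 / 54) := by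
  refine ⟨hf, funext fun τ => ?_⟩
  have hD := Derivative.normalizedDerivOfComplex_mdifferentiable hf
  have hE2 := hasQExpansion_E2.mdifferentiable
  have hE4 := hasQExpansion_E4.mdifferentiable
  -- The operator for `(0, 1/54)` factors as `(D - E₂/3) ∘ (D² - E₂/6 D - E₄/18)`; the right factor
  -- sends `f` to `c`, which the left factor annihilates.
  have h' : D (D f) = (1 / 6 : ℂ) • (EisensteinSeries.E2 * D f) +
      (1 / 18 : ℂ) • ((ModularForm.E₄ : ℍ → ℂ) * f) + c := by
    funext τ; rw [h]; simp; ring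
  have h3 : D (D (D f)) τ = (1 / 6) * (D EisensteinSeries.E2 τ * D f τ + EisensteinSeries.E2 τ *
      D (D f) τ) + 1 / 18 * (D ModularForm.E₄ τ * f τ + ModularForm.E₄ τ * D f τ) + D c τ := by
    conv_lhs => rw [h']
    rw [D, Derivative.normalizedDerivOfComplex_add _ _ (((hE2.mul hD).const_smul _).add
        ((hE4.mul hf).const_smul _)) hc,
      Derivative.normalizedDerivOfComplex_add _ _ ((hE2.mul hD).const_smul _)
        ((hE4.mul hf).const_smul _),
      Derivative.normalizedDerivOfComplex_smul _ _ (hE2.mul hD),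
      Derivative.normalizedDerivOfComplex_smul _ _ (hE4.mul hf),
      Derivative.normalizedDerivOfComplex_mul _ _ hE2 hD,
      Derivative.normalizedDerivOfComplex_mul _ _ hE4 hf]
    rfl
  rw [op, h3, h, D_E2, D_E4, hDc]
  simp only [Pi.zero_apply]
  ring

lemma dedekindEta_pow_ne_zero (n : ℕ) (τ : ℍ) : (dedekindEta ^ n) τ ≠ 0 :=
  pow_ne_zero _ (dedekindEta_ne_zero τ)

lemma D_div_eta {f : ℍ → ℂ} (hf : MDiff f) (n : ℕ) (τ : ℍ) : D (f / dedekindEta ^ n) τ =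
    (D f τ - n * (EisensteinSeries.E2 τ / 24) * f τ) / dedekindEta τ ^ n := by
  have hη := mdifferentiable_pow mdifferentiable_dedekindEta n
  have hq : MDiff (f / dedekindEta ^ n) := hf.div hη (dedekindEta_pow_ne_zero n)
  have e := congrFun (Derivative.normalizedDerivOfComplex_mul _ _ hq hη) τ
  have e2 : f / dedekindEta ^ n * dedekindEta ^ n = f := by
    funext τ; simp [dedekindEta_ne_zero τ]
  have e3 := D_pow mdifferentiable_dedekindEta D_dedekindEta n τ
  simp only [D] at e3
  rw [e2] at e
  simp only [Pi.add_apply, Pi.mul_apply, e3, Pi.div_apply, Pi.pow_apply] at e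
  have h0 := pow_ne_zero n (dedekindEta_ne_zero τ)
  rw [eq_div_iff h0]
  simp only [D]
  rw [e]
  field_simp
  ring

/-- `H₂ / η⁴`. -/
def hEta : ℍ → ℂ := H2 / dedekindEta ^ 4

/-- `Δ₂ / η⁴`. -/
def dEta : ℍ → ℂ := Delta2 / dedekindEta ^ 4

lemma mdifferentiable_hEta : MDiff hEta :=
  mdifferentiable_H2.div (mdifferentiable_pow mdifferentiable_dedekindEta 4)
    (dedekindEta_pow_ne_zero 4)

lemma mdifferentiable_dEta : MDiff dEta :=
  mdifferentiable_Delta2.div (mdifferentiable_pow mdifferentiable_dedekindEta 4)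
    (dedekindEta_pow_ne_zero 4)

lemma H2_eq_hEta (τ : ℍ) : H2 τ = dedekindEta τ ^ 4 * hEta τ := by
  simp [hEta, mul_div_cancel₀ _ (pow_ne_zero 4 (dedekindEta_ne_zero τ))]

lemma Delta2_eq_dEta (τ : ℍ) : Delta2 τ = dedekindEta τ ^ 4 * dEta τ := by
  simp [dEta, mul_div_cancel₀ _ (pow_ne_zero 4 (dedekindEta_ne_zero τ))]

/-- Division by `η⁴` cancels `E₂`: up to the factor `η⁴`, the derivatives of `hEta` and `dEta` are
quadratic polynomials in these two functions. -/
lemma D_hEta (τ : ℍ) : D hEta τ =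
    dedekindEta τ ^ 4 * ((192 * dEta τ ^ 2 - hEta τ ^ 2) / 6) := by
  have h0 := dedekindEta_ne_zero τ
  rw [hEta, D_div_eta mdifferentiable_H2, D_H2, H2_eq_hEta, Delta2_eq_dEta]
  rw [← hEta]
  field_simp
  push_cast
  ring

lemma D_dEta (τ : ℍ) : D dEta τ = dedekindEta τ ^ 4 * (hEta τ * dEta τ / 3) := by
  have h0 := dedekindEta_ne_zero τ
  rw [dEta, D_div_eta mdifferentiable_Delta2, D_Delta2, H2_eq_hEta, Delta2_eq_dEta]
  rw [← dEta]
  field_simp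
  push_cast
  ring

lemma dEta_mul_eq_one (τ : ℍ) : dEta τ * (hEta τ ^ 2 - 64 * dEta τ ^ 2) = 1 := by
  have h := dedekindEta_pow_twelve τ
  rw [H2_eq_hEta, Delta2_eq_dEta] at h
  refine mul_left_cancel₀ (pow_ne_zero 12 (dedekindEta_ne_zero τ)) ?_
  linear_combination -h

lemma D_mul_apply {f g : ℍ → ℂ} (hf : MDiff f) (hg : MDiff g) (τ : ℍ) :
    D (f * g) τ = D f τ * g τ + f τ * D g τ :=
  congrFun (Derivative.normalizedDerivOfComplex_mul f g hf hg) τ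

lemma D_sub_apply {f g : ℍ → ℂ} (hf : MDiff f) (hg : MDiff g) (τ : ℍ) :
    D (f - g) τ = D f τ - D g τ :=
  congrFun (Derivative.normalizedDerivOfComplex_sub f g hf hg) τ

lemma D_add_apply {f g : ℍ → ℂ} (hf : MDiff f) (hg : MDiff g) (τ : ℍ) :
    D (f + g) τ = D f τ + D g τ :=
  congrFun (Derivative.normalizedDerivOfComplex_add f g hf hg) τ

lemma D_smul_apply (c : ℂ) {f : ℍ → ℂ} (hf : MDiff f) (τ : ℍ) :
    D (c • f) τ = c * D f τ :=
  congrFun (Derivative.normalizedDerivOfComplex_smul c f hf) τ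

lemma D_eta_pow (n : ℕ) (τ : ℍ) :
    D (dedekindEta ^ n) τ = n * (EisensteinSeries.E2 τ / 24) * dedekindEta τ ^ n :=
  D_pow mdifferentiable_dedekindEta D_dedekindEta n τ

lemma E4_eq_eta (τ : ℍ) :
    ModularForm.E₄ τ = dedekindEta τ ^ 8 * (hEta τ ^ 2 + 192 * dEta τ ^ 2) := by
  rw [E4_eq, H2_eq_hEta, Delta2_eq_dEta]; ring

lemma D_D_hEta (τ : ℍ) : D (D hEta) τ =
    EisensteinSeries.E2 τ / 6 * D hEta τ + ModularForm.E₄ τ / 18 * hEta τ := by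
  have hη := mdifferentiable_pow mdifferentiable_dedekindEta 4
  have h : D hEta = dedekindEta ^ 4 * ((32 : ℂ) • (dEta * dEta) - (1 / 6 : ℂ) • (hEta * hEta)) := by
    funext τ
    rw [D_hEta]
    simp only [Pi.mul_apply, Pi.sub_apply, Pi.smul_apply, Pi.pow_apply, smul_eq_mul]
    ring
  have hh := mdifferentiable_hEta
  have hd := mdifferentiable_dEta
  conv_lhs => rw [h]
  rw [D_mul_apply hη (((hd.mul hd).const_smul _).sub ((hh.mul hh).const_smul _)), D_eta_pow,
    D_sub_apply ((hd.mul hd).const_smul _) ((hh.mul hh).const_smul _), D_smul_apply _ (hd.mul hd),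
    D_smul_apply _ (hh.mul hh), D_mul_apply hd hd, D_mul_apply hh hh, D_hEta, D_dEta, E4_eq_eta]
  simp only [Pi.pow_apply, Pi.sub_apply, Pi.smul_apply, Pi.mul_apply, smul_eq_mul]
  push_cast
  ring

lemma D_D_dEta (τ : ℍ) : D (D dEta) τ =
    EisensteinSeries.E2 τ / 6 * D dEta τ + ModularForm.E₄ τ / 18 * dEta τ := by
  have hη := mdifferentiable_pow mdifferentiable_dedekindEta 4
  have h : D dEta = dedekindEta ^ 4 * ((1 / 3 : ℂ) • (hEta * dEta)) := by
    funext τ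
    rw [D_dEta]
    simp only [Pi.mul_apply, Pi.smul_apply, Pi.pow_apply, smul_eq_mul]
    ring
  have hh := mdifferentiable_hEta
  have hd := mdifferentiable_dEta
  conv_lhs => rw [h]
  rw [D_mul_apply hη ((hh.mul hd).const_smul _), D_eta_pow,
    D_smul_apply _ (hh.mul hd), D_mul_apply hh hd, D_hEta, D_dEta, E4_eq_eta]
  simp only [Pi.pow_apply, Pi.smul_apply, Pi.mul_apply, smul_eq_mul]
  push_cast
  ring

lemma D_zero_apply (τ : ℍ) : D (0 : ℍ → ℂ) τ = 0 :=
  congrFun (Derivative.normalizedDerivOfComplex_const 0) τ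

lemma hEta_mem_solutions : hEta ∈ solutions 0 (1 / 54) :=
  mem_solutions_of_second_order (c := 0) mdifferentiable_hEta mdifferentiable_const
    (fun τ => by rw [D_D_hEta]; simp) (fun τ => by rw [D_zero_apply]; simp)

lemma dEta_mem_solutions : dEta ∈ solutions 0 (1 / 54) :=
  mem_solutions_of_second_order (c := 0) mdifferentiable_dEta mdifferentiable_const
    (fun τ => by rw [D_D_dEta]; simp) (fun τ => by rw [D_zero_apply]; simp)

/-- The solution built from primitives of `H₂` and `Δ₂`. -/
lemma log_mem_solutions {P Q : ℍ → ℂ} (hP : MDiff P) (hQ : MDiff Q) (hDP : ∀ τ, D P τ = H2 τ)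
    (hDQ : ∀ τ, D Q τ = Delta2 τ) :
    (16 : ℂ) • (dEta * P - hEta * Q) ∈ solutions 0 (1 / 54) := by
  have hh := mdifferentiable_hEta
  have hd := mdifferentiable_dEta
  have hh' := Derivative.normalizedDerivOfComplex_mdifferentiable hh
  have hd' := Derivative.normalizedDerivOfComplex_mdifferentiable hd
  -- Variation of constants: the terms with `P' = H₂` and `Q' = Δ₂` cancel, because `dEta H₂ = hEta
  -- Δ₂`.
  have h1 : D ((16 : ℂ) • (dEta * P - hEta * Q)) = (16 : ℂ) • (D dEta * P - D hEta * Q) := by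
    funext τ
    rw [D_smul_apply _ ((hd.mul hP).sub (hh.mul hQ)), D_sub_apply (hd.mul hP) (hh.mul hQ),
      D_mul_apply hd hP, D_mul_apply hh hQ, hDP, hDQ, H2_eq_hEta, Delta2_eq_dEta]
    simp only [Pi.sub_apply, Pi.smul_apply, Pi.mul_apply, smul_eq_mul]
    ring
  refine mem_solutions_of_second_order (c := (8 : ℂ) • dedekindEta ^ 8)
    (((hd.mul hP).sub (hh.mul hQ)).const_smul _)
    ((mdifferentiable_pow mdifferentiable_dedekindEta 8).const_smul _) (fun τ => ?_) (fun τ => ?_)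
  · rw [h1, D_smul_apply _ ((hd'.mul hP).sub (hh'.mul hQ)), D_sub_apply (hd'.mul hP) (hh'.mul hQ),
      D_mul_apply hd' hP, D_mul_apply hh' hQ, hDP, hDQ, D_D_hEta, D_D_dEta, D_hEta, D_dEta,
      H2_eq_hEta, Delta2_eq_dEta]
    simp only [Pi.sub_apply, Pi.smul_apply, Pi.mul_apply, smul_eq_mul, Pi.pow_apply, D_hEta, D_dEta]
    -- The inhomogeneity `16 (dEta' H₂ - hEta' Δ₂)` equals `8 η⁸ · dEta (hEta² - 64 dEta²) = 8 η⁸`.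
    linear_combination (8 * dedekindEta τ ^ 8) * dEta_mul_eq_one τ
  · rw [D_smul_apply _ (mdifferentiable_pow mdifferentiable_dedekindEta 8), D_eta_pow]
    simp only [Pi.smul_apply, Pi.pow_apply, smul_eq_mul]
    push_cast; ring

end

/-! ### The logarithmic case: expansions and primitives -/

section

open ModularGroup ModularForm MeasureTheory
open scoped ModularForm

lemma tendsto_div_eta {f : ℍ → ℂ} {r L : ℂ} (hf : Tendsto (fun τ => qpow (-r) τ * f τ) atImInfty (𝓝 L))
    (n : ℕ) : Tendsto (fun τ => qpow (-(r - n / 24)) τ * (f / dedekindEta ^ n) τ) atImInfty (𝓝 L) := by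
  refine tendsto_of_eq (hf.div (tendsto_dedekindEta.pow n) (by simp)) (fun τ => ?_) (by simp)
  simp only [Pi.div_apply, Pi.pow_apply, mul_pow, ← qpow_nat_mul]
  rw [mul_div_mul_comm, div_eq_mul_inv (qpow _ _), ← qpow_neg, ← qpow_add]
  congr 2; ring

lemma div_eta_T {f : ℍ → ℂ} {r : ℂ} (hf : ∀ τ : ℍ, f ((1 : ℝ) +ᵥ τ) = cexp (2 * π * I * r) * f τ)
    (n : ℕ) (τ : ℍ) : (f / dedekindEta ^ n) ((1 : ℝ) +ᵥ τ) =
      cexp (2 * π * I * (r - n / 24)) * (f / dedekindEta ^ n) τ := by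
  simp only [Pi.div_apply, Pi.pow_apply]
  rw [hf, dedekindEta_T_pow, mul_div_mul_comm, ← Complex.exp_sub]
  congr 2; ring

lemma exists_hasQExpansion_div_eta {f : ℍ → ℂ} {r : ℂ} {a : ℕ → ℂ} (hf : HasQExpansion f r a)
    (n : ℕ) : ∃ b, HasQExpansion (f / dedekindEta ^ n) (r - n / 24) b ∧ b 0 = a 0 :=
  exists_hasQExpansion_of_tendsto (hf.mdifferentiable.div
    (mdifferentiable_pow mdifferentiable_dedekindEta n) (dedekindEta_pow_ne_zero n))
    (div_eta_T hf.vadd_one n) (tendsto_div_eta hf.tendsto n)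

lemma exists_hasQExpansion_hEta : ∃ a, HasQExpansion hEta (-1 / 6) a ∧ a 0 = 1 := by
  obtain ⟨b, hb, b0⟩ := exists_hasQExpansion_div_eta hasQExpansion_H2 4
  refine ⟨b, hb.congr_exponent (by norm_num), b0.trans ?_⟩
  simp [eisCoeff_zero]; norm_num

lemma exists_hasQExpansion_dEta : ∃ a, HasQExpansion dEta (1 / 3) a ∧ a 0 = 1 := by
  obtain ⟨a, ha, a0⟩ := exists_hasQExpansion_Delta2
  obtain ⟨b, hb, b0⟩ := exists_hasQExpansion_div_eta ha 4
  exact ⟨b, hb.congr_exponent (by norm_num), b0.trans a0⟩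

lemma hEta_recursion : ∀ n < [1, 28, 134, 568, (1809 : ℂ)].length, n ≠ 0 →
    ind 0 (1 / 54) (-1 / 6 + n) ≠ 0 ∧ opCoeff 0 (1 / 54) (-1 / 6)
      (fun k => [1, 28, 134, 568, (1809 : ℂ)].getD k 0) n = 0 := by
  intro n hn h0
  simp only [List.length_cons, List.length_nil] at hn
  interval_cases n <;> simp [opCoeff_eq, sum_range_succ, opKernel_one, opKernel_two,
    opKernel_three, opKernel_four, ind] at h0 ⊢ <;> norm_num

lemma dEta_recursion : ∀ n < [1, 8, 36, 128, (394 : ℂ)].length, n ≠ 0 →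
    ind 0 (1 / 54) (1 / 3 + n) ≠ 0 ∧ opCoeff 0 (1 / 54) (1 / 3)
      (fun k => [1, 8, 36, 128, (394 : ℂ)].getD k 0) n = 0 := by
  intro n hn h0
  simp only [List.length_cons, List.length_nil] at hn
  interval_cases n <;> simp [opCoeff_eq, sum_range_succ, opKernel_one, opKernel_two,
    opKernel_three, opKernel_four, ind] at h0 ⊢ <;> norm_num

/-- Termwise integration of a `q`-series. -/
lemma HasQExpansion.qPrimitive {g : ℍ → ℂ} {s : ℝ} (hs : 0 < s) {b : ℕ → ℂ}
    (hg : HasQExpansion g s b) : HasQExpansion (qPrimitive 0 g) s (fun n => b n / (s + n)) := by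
  intro τ
  have hpos : ∀ n : ℕ, 0 < s + n := fun n => by positivity
  have hq : ∀ (n : ℕ) (t : ℝ), 0 ≤ t → qpow (s + n) (ofComplex (τ + t * I)) =
      qpow (s + n) τ * (Real.exp (-(2 * π * (s + n)) * t) : ℂ) := by
    intro n t ht
    have him : 0 < ((τ : ℂ) + t * I).im := by simp; exact add_pos_of_pos_of_nonneg τ.im_pos ht
    rw [qpow, ofComplex_apply_of_im_pos him, qpow, Complex.ofReal_exp, ← Complex.exp_add]
    congr 1
    push_cast
    linear_combination (2 * π * (s + n) * t) * I_mul_I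
  set F : ℕ → ℝ → ℂ := fun n t => b n * qpow (s + n) τ * (Real.exp (-(2 * π * (s + n)) * t) : ℂ)
    with hF
  have hπ : ∀ n : ℕ, 0 < 2 * π * (s + n) := fun n => by have := hpos n; positivity
  have hint : ∀ n : ℕ, IntegrableOn (fun t : ℝ => Real.exp (-(2 * π * (s + n)) * t)) (Set.Ioi 0) :=
    fun n => integrableOn_exp_mul_Ioi (by linarith [hπ n]) 0
  have hval : ∀ n : ℕ, ∫ t in Set.Ioi (0 : ℝ), Real.exp (-(2 * π * (s + n)) * t) =
      (2 * π * (s + n))⁻¹ := fun n => by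
    rw [integral_exp_mul_Ioi (by linarith [hπ n])]
    simp [neg_div_neg_eq]
  have hFi : ∀ n, IntegrableOn (F n) (Set.Ioi 0) := fun n => (hint n).ofReal.const_mul _
  have hnorm : ∀ n, ∫ t in Set.Ioi (0 : ℝ), ‖F n t‖ = ‖b n * qpow (s + n) τ‖ * (2 * π * (s + n))⁻¹ := by
    intro n
    rw [← hval, ← integral_const_mul]
    congr 1; funext t
    rw [hF, norm_mul, Complex.norm_real, Real.norm_of_nonneg (Real.exp_pos _).le]
  have hsum : Summable fun n => ∫ t in Set.Ioi (0 : ℝ), ‖F n t‖ := by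
    have h1 : Summable fun n => ‖b n * qpow (s + n) τ‖ := (hg τ).summable.norm
    refine Summable.of_nonneg_of_le (fun n => integral_nonneg fun t => norm_nonneg _)
      (fun n => ?_) (h1.mul_right (2 * π * s)⁻¹)
    rw [hnorm]
    have : 0 < 2 * π * s := by positivity
    gcongr
    simp
  have key := hasSum_integral_of_summable_integral_norm hFi hsum
  have hinteg : ∫ t in Set.Ioi (0 : ℝ), ∑' n, F n t =
      ∫ t in Set.Ioi (0 : ℝ), (g (ofComplex (τ + t * I)) - 0) := by
    refine setIntegral_congr_fun measurableSet_Ioi fun t ht => ?_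
    have := hg (ofComplex (τ + t * I))
    simp only [sub_zero]
    rw [← this.tsum_eq]
    refine tsum_congr fun n => ?_
    rw [hq n t (le_of_lt ht), hF]; ring
  rw [hinteg] at key
  have := key.mul_left (2 * π : ℂ)
  simp only [MLDE.qPrimitive, zero_mul, zero_add]
  refine this.congr_fun fun n => ?_
  have h1 : ∫ t in Set.Ioi (0 : ℝ), F n t = b n * qpow (s + n) τ * ((2 * π * (s + n))⁻¹ : ℝ) := by
    rw [hF]
    simp only
    rw [integral_const_mul, integral_complex_ofReal, hval]
  rw [h1]
  have h2 : (s : ℂ) + n ≠ 0 := by exact_mod_cast (hpos n).ne'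
  have hp : (π : ℂ) ≠ 0 := by exact_mod_cast Real.pi_ne_zero
  push_cast
  field_simp

lemma HasQExpansion.D_qPrimitive {g : ℍ → ℂ} {s : ℝ} (hs : 0 < s) {b : ℕ → ℂ}
    (hg : HasQExpansion g s b) (τ : ℍ) : MLDE.D (MLDE.qPrimitive 0 g) τ = g τ := by
  refine ((hg.qPrimitive hs).D τ).unique ((hg τ).congr_fun fun n => ?_)
  have h2 : (s : ℂ) + n ≠ 0 := by
    exact_mod_cast (by positivity : s + n ≠ 0)
  simp only [mul_div_cancel₀ _ h2]

lemma mdifferentiable_coe_mul (c : ℂ) : MDiff (fun τ : ℍ => c * (τ : ℂ)) := by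
  rw [UpperHalfPlane.mdifferentiable_iff]
  intro z hz
  refine (DifferentiableAt.congr_of_eventuallyEq (f := fun w => c * w)
    (by fun_prop) ?_).differentiableWithinAt
  filter_upwards [isOpen_upperHalfPlaneSet.mem_nhds hz] with w hw
  simp [ofComplex_apply_of_im_pos hw]

lemma D_coe_mul (c : ℂ) (τ : ℍ) : D (fun τ : ℍ => c * (τ : ℂ)) τ = (2 * π * I)⁻¹ * c := by
  have h : (fun τ : ℍ => c * (τ : ℂ)) ∘ ofComplex =ᶠ[𝓝 (τ : ℂ)] fun w => c * w := by
    filter_upwards [isOpen_upperHalfPlaneSet.mem_nhds τ.2] with w hw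
    simp [ofComplex_apply_of_im_pos hw]
  simp only [D, Derivative.normalizedDerivOfComplex, h.deriv_eq, deriv_const_mul_id]

lemma hasQExpansion_H2_sub_one : HasQExpansion (fun τ => H2 τ - 1) (1 : ℝ) (fun n =>
    2 * (if 2 ∣ n + 1 then eisCoeff (-24) 1 ((n + 1) / 2) else 0) - eisCoeff (-24) 1 (n + 1)) := by
  have h1 : HasQExpansion (fun _ => 1) 0 (fun n => if n = 0 then 1 else 0) := fun τ => by
    refine (hasSum_ite_eq 0 (1 : ℂ)).congr_fun fun n => ?_
    rcases eq_or_ne n 0 with rfl | h <;> simp_all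
  have h2 := hasQExpansion_H2.sub h1
  have h3 := (h2.shift (by simp [eisCoeff_zero]; norm_num)).congr_exponent
    (show (0 : ℂ) + 1 = (1 : ℝ) by norm_num)
  exact h3.congr_coeff fun n => by simp

lemma qPrimitive_H2 : qPrimitive 1 H2 =
    (fun τ : ℍ => 2 * π * I * (τ : ℂ)) + qPrimitive 0 (fun τ => H2 τ - 1) := by
  funext τ
  simp [qPrimitive]

/-- The coefficients follow from the logarithmic derivative `D_Delta2` by comparing orders 1 and 2,
without expanding the eta product. -/
lemma hasQExpansion_Delta2_real : ∃ a, HasQExpansion Delta2 (1 / 2 : ℝ) a ∧ a 0 = 1 ∧ a 1 = 4 ∧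
    a 2 = 6 := by
  obtain ⟨a, ha, a0⟩ := exists_hasQExpansion_Delta2
  have hD := ha.D
  have hE := ((hasQExpansion_H2.smul (1 / 3)).add (hasQExpansion_E2.smul (1 / 6))).mul ha
  have heq : D Delta2 = ((1 / 3 : ℂ) • H2 + (1 / 6 : ℂ) • EisensteinSeries.E2) * Delta2 := by
    funext τ; rw [D_Delta2]
    simp only [Pi.mul_apply, Pi.add_apply, Pi.smul_apply, smul_eq_mul]; ring
  rw [heq] at hD
  have hc := hD.coeff_unique (hE.congr_exponent (zero_add _))
  have h1 := congrFun hc 1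
  have h2 := congrFun hc 2
  simp [Finset.Nat.antidiagonal_succ, eisCoeff_zero, eisCoeff_one, eisCoeff_two, a0] at h1 h2
  norm_num at h1 h2
  have a1 : a 1 = 4 := by linear_combination h1
  rw [a1] at h2
  exact ⟨a, ha.congr_exponent (by norm_num), a0, a1, by linear_combination (1 / 2) * h2⟩

end

/-! ### The logarithmic solution and the absence of a basis of `q`-series -/

section

open ModularGroup ModularForm
open scoped ModularForm

/-- The logarithmic solution. -/
def logSol : ℍ → ℂ := (16 : ℂ) • (dEta * qPrimitive 1 H2 - hEta * qPrimitive 0 Delta2)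

/-- The part of the logarithmic solution without logarithm. -/
def logSolReg : ℍ → ℂ :=
  (16 : ℂ) • (dEta * qPrimitive 0 (fun τ => H2 τ - 1) - hEta * qPrimitive 0 Delta2)

lemma logSol_eq (τ : ℍ) : logSol τ = 16 * (2 * π * I * τ) * dEta τ + logSolReg τ := by
  simp only [logSol, logSolReg, qPrimitive_H2, Pi.smul_apply, Pi.sub_apply, Pi.mul_apply,
    Pi.add_apply, smul_eq_mul]
  ring

lemma logSol_mem_solutions : logSol ∈ solutions 0 (1 / 54) := by
  obtain ⟨a, ha, -⟩ := hasQExpansion_Delta2_real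
  have hP := hasQExpansion_H2_sub_one
  have h1 := mdifferentiable_coe_mul (2 * π * I)
  have h2 := (hP.qPrimitive one_pos).mdifferentiable
  refine log_mem_solutions ?_ (ha.qPrimitive (by norm_num)).mdifferentiable (fun τ => ?_)
    (ha.D_qPrimitive (by norm_num))
  · rw [qPrimitive_H2]; exact h1.add h2
  · rw [qPrimitive_H2, D_add_apply h1 h2, hP.D_qPrimitive one_pos, D_coe_mul,
      inv_mul_cancel₀ Complex.two_pi_I_ne_zero]
    ring

lemma exists_hasQExpansion_logSolReg : ∃ a, HasQExpansion logSolReg (1 / 3) a ∧ a 0 = -32 ∧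
    a 1 = -1664 / 3 ∧ a 2 = -33856 / 15 := by
  obtain ⟨d, hd, d0, d1, d2⟩ := hasQExpansion_Delta2_real
  obtain ⟨u, hu, u0⟩ := exists_hasQExpansion_hEta
  obtain ⟨v, hv, v0⟩ := exists_hasQExpansion_dEta
  have u1 := hu.coeff_eq_getD hEta_mem_solutions [1, 28, 134, 568, 1809] (by simpa) hEta_recursion
  have v1 := hv.coeff_eq_getD dEta_mem_solutions [1, 8, 36, 128, 394] (by simpa) dEta_recursion
  have hu1 := u1 1 (by simp); have hu2 := u1 2 (by simp)
  have hv1 := v1 1 (by simp); have hv2 := v1 2 (by simp)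
  simp at hu1 hu2 hv1 hv2
  have hG := hasQExpansion_H2_sub_one.qPrimitive one_pos
  have hQ := hd.qPrimitive (by norm_num)
  obtain ⟨g, hg, g0, g1⟩ : ∃ g, HasQExpansion (dEta * qPrimitive 0 (fun τ => H2 τ - 1))
      (1 / 3 + ((1 : ℝ) : ℂ)) g ∧ g 0 = 24 ∧ g 1 = 204 := by
    refine ⟨_, hv.mul hG, ?_, ?_⟩
    · simp [v0, eisCoeff_one]
    · simp [Finset.Nat.antidiagonal_succ, v0, hv1, eisCoeff_one, eisCoeff_two]; norm_num
  -- The primitive of `H₂ - 1` starts at `q`, so this product starts at `q ^ (4/3)`; a zero is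
  -- prepended to align it with the other summand, which starts at `q ^ (1/3)`.
  have e1 := hg.unshift.congr_exponent
    (show (1 / 3 + ((1 : ℝ) : ℂ) - 1) = 1 / 3 by push_cast; ring)
  have e2 := (hu.mul hQ).congr_exponent
    (show (-1 / 6 + ((1 / 2 : ℝ) : ℂ)) = 1 / 3 by push_cast; norm_num)
  refine ⟨_, (e1.sub e2).smul 16, ?_, ?_, ?_⟩
  · simp [u0, d0]; norm_num
  · simp [Finset.Nat.antidiagonal_succ, u0, d0, hu1, d1, g0]; norm_num
  · change (16 : ℂ) * (g 1 - _) = _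
    simp [Finset.Nat.antidiagonal_succ, u0, d0, hu1, d1, d2, hu2, g1]; norm_num

lemma hEta_T (τ : ℍ) : hEta ((1 : ℝ) +ᵥ τ) = cexp (2 * π * I * (-1 / 6)) * hEta τ := by
  obtain ⟨u, hu, -⟩ := exists_hasQExpansion_hEta
  exact hu.vadd_one τ

lemma dEta_T (τ : ℍ) : dEta ((1 : ℝ) +ᵥ τ) = cexp (2 * π * I * (1 / 3)) * dEta τ := by
  obtain ⟨u, hu, -⟩ := exists_hasQExpansion_dEta
  exact hu.vadd_one τ

/-- Under `T` the logarithm `log q` grows by `2πi`, so `T` acts on the span of `dEta` and `logSol`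
by a nontrivial Jordan block. -/
lemma logSol_T (τ : ℍ) : logSol ((1 : ℝ) +ᵥ τ) =
    cexp (2 * π * I * (1 / 3)) * (logSol τ + 32 * π * I * dEta τ) := by
  obtain ⟨a, ha, -⟩ := exists_hasQExpansion_logSolReg
  rw [logSol_eq, logSol_eq, dEta_T, ha.vadd_one, coe_vadd_one]
  ring

lemma dEta_ne_zero : dEta ≠ 0 := by
  intro h
  obtain ⟨v, hv, v0⟩ := exists_hasQExpansion_dEta
  rw [h] at hv
  exact one_ne_zero (v0.symm.trans (hv.coeff_eq_zero 0))

lemma linearIndependent_log : LinearIndependent ℂ ![hEta, dEta, logSol] := by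
  obtain ⟨u, hu, u0⟩ := exists_hasQExpansion_hEta
  obtain ⟨v, hv, v0⟩ := exists_hasQExpansion_dEta
  have hli : LinearIndependent ℂ ![hEta, dEta] := by
    refine linearIndependent_of_hasQExpansion (r := ![-1 / 6, 1 / 3]) (a := ![u, v]) ?_ ?_ ?_
    · intro i; fin_cases i
      · exact hu.congr_exponent (by norm_num)
      · exact hv.congr_exponent (by norm_num)
    · intro i; fin_cases i
      · exact (u0.trans_ne one_ne_zero :)
      · exact (v0.trans_ne one_ne_zero :)
    · intro i j h; fin_cases i <;> fin_cases j <;> first | rfl | (exfalso; revert h; norm_num)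
  have hpair : ∀ s t : ℂ, (∀ τ, s * hEta τ + t * dEta τ = 0) → s = 0 ∧ t = 0 := by
    intro s t h
    exact LinearIndependent.pair_iff.1 hli s t (funext h)
  rw [Fintype.linearIndependent_iff]
  intro c hc
  have hc' : ∀ τ, c 0 * hEta τ + c 1 * dEta τ + c 2 * logSol τ = 0 := by
    intro τ
    simpa [Fin.sum_univ_three] using congrFun hc τ
  set l := cexp (2 * π * I * (1 / 3))
  set m := cexp (2 * π * I * (-1 / 6)) with hm
  have hl0 : l ≠ 0 := Complex.exp_ne_zero _
  -- Since `-1/6 = 1/3 - 1/2`, the eigenvalue on `hEta` is `-l`, so `T - l` does not kill it.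
  -- Applying `T - l` to the relation removes `c 1` and replaces `logSol` by a multiple of `dEta`.
  have hml : m = -l := by
    rw [hm, show 2 * π * I * (-1 / 6) = 2 * π * I * (1 / 3) - 2 * π * I * (1 / 2) by ring,
      Complex.exp_sub, exp_two_pi_mul_half, div_neg, div_one]
  have h1 : ∀ τ, (-2 * l * c 0) * hEta τ + (32 * π * I * l * c 2) * dEta τ = 0 := by
    intro τ
    have e1 := hc' ((1 : ℝ) +ᵥ τ)
    have e2 := hc' τ
    rw [hEta_T, dEta_T, logSol_T] at e1
    change c 0 * (m * _) + c 1 * (l * _) + c 2 * (l * _) = 0 at e1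
    rw [hml] at e1
    linear_combination e1 - l * e2
  obtain ⟨e0, e2⟩ := hpair _ _ h1
  have hp : (π : ℂ) ≠ 0 := by exact_mod_cast Real.pi_ne_zero
  have c0 : c 0 = 0 := by simpa [hl0] using e0
  have c2 : c 2 = 0 := by simpa [hl0, hp] using e2
  have c1 : c 1 = 0 := (hpair 0 (c 1) fun τ => by
    have := hc' τ; rw [c0, c2] at this; linear_combination this).2
  intro i; fin_cases i <;> assumption

lemma isBasisOfSolutions_log : IsBasisOfSolutions 0 (1 / 54) ![hEta, dEta, logSol] := by
  refine isBasisOfSolutions_of_linearIndependent ?_ linearIndependent_log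
  intro i; fin_cases i
  · exact hEta_mem_solutions
  · exact dEta_mem_solutions
  · exact logSol_mem_solutions

theorem exists_basis_log : ∃ f : Fin 3 → ℍ → ℂ, IsBasisOfSolutions 0 (1 / 54) f ∧
    f 0 = H2 / dedekindEta ^ 4 ∧ f 1 = Delta2 / dedekindEta ^ 4 ∧
    f 2 = (16 : ℂ) • (Delta2 / dedekindEta ^ 4 * qPrimitive 1 H2 -
      H2 / dedekindEta ^ 4 * qPrimitive 0 Delta2) ∧
    QExpansionStarts (f 0) (-1 / 6) [1, 28, 134, 568, 1809] ∧
    QExpansionStarts (f 1) (1 / 3) [1, 8, 36, 128, 394] ∧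
    QExpansionStarts (fun τ => f 2 τ - 16 * (2 * π * I * τ) * f 1 τ) (1 / 3)
      [-32, -1664 / 3, -33856 / 15] := by
  obtain ⟨u, hu, u0⟩ := exists_hasQExpansion_hEta
  obtain ⟨v, hv, v0⟩ := exists_hasQExpansion_dEta
  obtain ⟨a, ha, a0, a1, a2⟩ := exists_hasQExpansion_logSolReg
  refine ⟨![hEta, dEta, logSol], isBasisOfSolutions_log, rfl, rfl, rfl,
    hu.qExpansionStarts hEta_mem_solutions _ u0 hEta_recursion,
    hv.qExpansionStarts dEta_mem_solutions _ v0 dEta_recursion, a, ?_, ?_⟩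
  · convert ha using 1
    funext τ
    change logSol τ - 16 * (2 * π * I * τ) * dEta τ = _
    rw [logSol_eq]; ring
  · intro i hi
    simp only [List.length_cons, List.length_nil] at hi
    interval_cases i
    · exact a0
    · exact a1
    · exact a2

/-- The translation `T` does not act diagonalizably, so there is no basis of `q`-series. -/
theorem not_exists_qSeries_basis_log : ¬ ∃ f : Fin 3 → ℍ → ℂ, IsBasisOfSolutions 0 (1 / 54) f ∧
    ∀ i, ∃ (r : ℂ) (a : ℕ → ℂ), HasQExpansion (f i) r a := by
  rintro ⟨f, ⟨hli, hspan⟩, hq⟩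
  choose r a ha using hq
  have hmem : logSol ∈ Submodule.span ℂ (Set.range f) := hspan ▸ logSol_mem_solutions
  rw [Submodule.mem_span_range_iff_exists_fun] at hmem
  obtain ⟨c, hc⟩ := hmem
  set l := cexp (2 * π * I * (1 / 3)) with hl
  set m : Fin 3 → ℂ := fun i => cexp (2 * π * I * r i) with hm
  have hlog : ∀ τ, ∑ i, c i * f i τ = logSol τ := fun τ => by
    simpa using congrFun hc τ
  have hT : ∀ i τ, f i ((1 : ℝ) +ᵥ τ) = m i * f i τ := fun i τ => (ha i).vadd_one τ
  -- `T - l` maps `logSol` to a nonzero multiple of `dEta`, and `(T - l)²` kills it. In a basis of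
  -- eigenvectors `cᵢ (mᵢ - l)² = 0` already forces `cᵢ (mᵢ - l) = 0`, which makes `dEta` vanish.
  have h1 : ∀ τ, ∑ i, c i * (m i - l) * f i τ = l * (32 * π * I) * dEta τ := by
    intro τ
    have e1 := hlog ((1 : ℝ) +ᵥ τ)
    have e2 := hlog τ
    rw [logSol_T] at e1
    simp only [hT, Fin.sum_univ_three] at e1 e2 ⊢
    linear_combination e1 - l * e2
  have h2 : ∑ i, (c i * (m i - l) ^ 2) • f i = 0 := by
    funext τ
    have e1 := h1 ((1 : ℝ) +ᵥ τ)
    have e2 := h1 τ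
    rw [dEta_T] at e1
    simp only [hT, Fin.sum_univ_three] at e1 e2
    simp only [Finset.sum_apply, Pi.smul_apply, smul_eq_mul, Fin.sum_univ_three, Pi.zero_apply]
    linear_combination e1 - l * e2
  have h3 := Fintype.linearIndependent_iff.1 hli _ h2
  refine dEta_ne_zero (funext fun τ => ?_)
  have e := h1 τ
  rw [Finset.sum_eq_zero fun i _ => by
    rcases mul_eq_zero.1 (h3 i) with h | h
    · simp [h]
    · simp [pow_eq_zero_iff two_ne_zero |>.1 h]] at e
  have hp : (π : ℂ) ≠ 0 := by exact_mod_cast Real.pi_ne_zero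
  have hl0 : l ≠ 0 := Complex.exp_ne_zero _
  simpa [hp, hl0] using e.symm

/-- A spanning set of characters contains a basis, and characters are `q`-series by definition. -/
theorem span_simpleCharacters_ne_log (V : Type u) [AddCommGroup V] [Module ℂ V] (A : VOA V) :
    Submodule.span ℂ A.simpleCharacters ≠ solutions 0 (1 / 54) := by
  intro h
  have hfin : Module.finrank ℂ (Submodule.span ℂ A.simpleCharacters) = 3 := by
    rw [h, ← isBasisOfSolutions_log.2, finrank_span_eq_card isBasisOfSolutions_log.1]; simp
  have : FiniteDimensional ℂ (Submodule.span ℂ A.simpleCharacters) := by rw [h]; infer_instance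
  obtain ⟨f, hf, hs, hli⟩ := Submodule.exists_fun_fin_finrank_span_eq ℂ A.simpleCharacters
  generalize Module.finrank ℂ (Submodule.span ℂ A.simpleCharacters) = n at *
  subst hfin
  refine not_exists_qSeries_basis_log ⟨f, ⟨hli, hs.trans h⟩, fun i => ?_⟩
  obtain ⟨M, _, _, W, -, hW⟩ := hf i
  exact ⟨_, _, hW⟩

end

/-! ### The solutions for `m₁ = 156` -/

section

open ModularGroup ModularForm
open scoped ModularForm

/-- Variant of `HasQExpansion.qExpansionStarts` that allows for resonances. -/
lemma HasQExpansion.qExpansionStarts_of_resonance {x y r : ℂ} {f : ℍ → ℂ} {a : ℕ → ℂ}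
    (hf : HasQExpansion f r a) (hs : f ∈ solutions x y) (l : List ℂ)
    (H : ∀ n < l.length, a n = l.getD n 0 ∨ ind x y (r + n) ≠ 0 ∧
      opCoeff x y r (fun k => l.getD k 0) n = 0) : QExpansionStarts f r l := by
  have key : ∀ n < l.length, a n = l.getD n 0 := by
    intro n hn
    induction n using Nat.strong_induction_on with
    | _ n ih =>
      rcases H n hn with h | h
      · exact h
      · exact coeff_eq_of_opCoeff (b := fun k => l.getD k 0) (hf.opCoeff_eq_zero hs n) h.2
          (fun k hk => ih k hk (hk.trans hn)) h.1
  exact ⟨a, hf, fun i hi => by rw [key i hi, List.getD_eq_getElem _ _ hi]⟩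

/-- The three solutions for `m₁ = 156`. -/
def basisTwo : Fin 3 → ℍ → ℂ :=
  ![H2 * Delta2 * (H2 ^ 2 + 64 * Delta2 ^ 2) / dedekindEta ^ 16,
    (H2 ^ 4 + 384 * Delta2A + 14304 * Delta2 ^ 4) / dedekindEta ^ 16,
    Delta2 ^ 4 / dedekindEta ^ 16]

lemma basisTwo_zero : basisTwo 0 = hEta * dEta * (hEta * hEta + (64 : ℂ) • (dEta * dEta)) := by
  funext τ
  have h := dedekindEta_ne_zero τ
  simp only [basisTwo, hEta, dEta, Matrix.cons_val_zero, Pi.mul_apply, Pi.add_apply, Pi.div_apply,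
    Pi.pow_apply, Pi.smul_apply, smul_eq_mul, Pi.ofNat_apply]
  field_simp

/-- Substituting `Δ₂ₐ = Δ₂² (H₂² - 64 Δ₂²)` turns the last coefficient into `14304 - 64 · 384 =
-10272`. -/
lemma basisTwo_one : basisTwo 1 = (hEta * hEta) * (hEta * hEta) +
    (384 : ℂ) • ((hEta * hEta) * (dEta * dEta)) - (10272 : ℂ) • ((dEta * dEta) * (dEta * dEta)) := by
  funext τ
  have h := dedekindEta_ne_zero τ
  simp only [basisTwo, hEta, dEta, Matrix.cons_val_one, Matrix.cons_val_zero, Pi.mul_apply,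
    Pi.add_apply, Pi.div_apply, Pi.sub_apply,
    Pi.pow_apply, Pi.smul_apply, smul_eq_mul, Pi.ofNat_apply, Delta2A_eq']
  field_simp
  ring

lemma basisTwo_two : basisTwo 2 = (dEta * dEta) * (dEta * dEta) := by
  funext τ
  have h := dedekindEta_ne_zero τ
  simp only [basisTwo, dEta, Matrix.cons_val, Pi.mul_apply, Pi.div_apply, Pi.pow_apply]
  field_simp

/-- The coefficient `a 1 2` is computed from the closed formula because `-2/3 + 2 = 4/3` is itself
an indicial root, so the recursion leaves it free. -/
lemma exists_hasQExpansion_basisTwo : ∃ a : Fin 3 → ℕ → ℂ,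
    (∀ i, HasQExpansion (basisTwo i) (((![-1 / 6, -2 / 3, 4 / 3] : Fin 3 → ℝ) i : ℝ) : ℂ) (a i)) ∧
    (∀ i, a i 0 = 1) ∧ a 1 2 = 22616 := by
  obtain ⟨u, hu, u0⟩ := exists_hasQExpansion_hEta
  obtain ⟨v, hv, v0⟩ := exists_hasQExpansion_dEta
  have u1 := hu.coeff_eq_getD hEta_mem_solutions [1, 28, 134, 568, 1809] (by simpa) hEta_recursion
  have v1 := hv.coeff_eq_getD dEta_mem_solutions [1, 8, 36, 128, 394] (by simpa) dEta_recursion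
  have hu1 := u1 1 (by simp); have hu2 := u1 2 (by simp)
  have hv1 := v1 1 (by simp); have hv2 := v1 2 (by simp)
  simp at hu1 hu2 hv1 hv2
  obtain ⟨s, hs, s0, s1, s2⟩ : ∃ s, HasQExpansion (hEta * hEta) (-1 / 3) s ∧
      s 0 = 1 ∧ s 1 = 56 ∧ s 2 = 1052 := by
    refine ⟨_, (hu.mul hu).congr_exponent (by ring), ?_, ?_, ?_⟩ <;>
    simp [Finset.Nat.antidiagonal_succ, u0, hu1, hu2] <;> norm_num
  obtain ⟨t, ht, t0, t1, t2⟩ : ∃ t, HasQExpansion (dEta * dEta) (-1 / 3) t ∧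
      t 0 = 0 ∧ t 1 = 1 ∧ t 2 = 16 := by
    refine ⟨_, (hv.mul hv).unshift.congr_exponent (by ring), rfl, ?_, ?_⟩
    · change ∑ p ∈ antidiagonal 0, v p.1 * v p.2 = _
      simp [v0]
    · change ∑ p ∈ antidiagonal 1, v p.1 * v p.2 = _
      simp [Finset.Nat.antidiagonal_succ, v0, hv1]; norm_num
  obtain ⟨a, ha, a0⟩ : ∃ a, HasQExpansion (basisTwo 0) (-1 / 6) a ∧ a 0 = 1 := by
    rw [basisTwo_zero]
    exact ⟨_, ((hu.mul hv).mul (hs.add (ht.smul 64))).congr_exponent (by norm_num),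
      by simp [u0, v0, s0, t0]⟩
  obtain ⟨b, hb, b0, b2⟩ : ∃ b, HasQExpansion (basisTwo 1) (-2 / 3) b ∧ b 0 = 1 ∧
      b 2 = 22616 := by
    rw [basisTwo_one]
    refine ⟨_, (((hs.mul hs).add ((hs.mul ht).smul 384)).sub
      ((ht.mul ht).smul 10272)).congr_exponent (by norm_num), by simp [s0, t0], ?_⟩
    simp [Finset.Nat.antidiagonal_succ, s0, s1, s2, t0, t1, t2]; norm_num
  obtain ⟨c, hc, c0⟩ : ∃ c, HasQExpansion (basisTwo 2) (4 / 3) c ∧ c 0 = 1 := by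
    rw [basisTwo_two]
    exact ⟨_, ((hv.mul hv).mul (hv.mul hv)).congr_exponent (by norm_num), by simp [v0]⟩
  refine ⟨![a, b, c], ?_, ?_, b2⟩
  · intro i; fin_cases i
    · exact ha.congr_exponent (by norm_num)
    · exact hb.congr_exponent (by norm_num)
    · exact hc.congr_exponent (by norm_num)
  · intro i; fin_cases i
    · exact a0
    · exact b0
    · exact c0

/-- The numerators are quartic forms in `H₂` and `Δ₂`, on which `S` acts by a linear substitution;
the powers of `τ` cancel against `η¹⁶`. The matrix expresses the substituted quartics in the
original three. -/
lemma basisTwo_S (i : Fin 3) (τ : ℍ) : basisTwo i (S • τ) = ∑ j,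
    (!![1 / 2, 1 / 64, -1599 / 2; 1473 / 64, 575 / 2048, 2355327 / 64;
      -1 / 2048, 1 / 65536, 449 / 2048] : Matrix (Fin 3) (Fin 3) ℂ) i j * basisTwo j τ := by
  have h := dedekindEta_ne_zero τ
  have ht := τ.ne_zero
  have e16 : dedekindEta (S • τ) ^ 16 = (τ : ℂ) ^ 8 * dedekindEta τ ^ 16 := by
    rw [show 16 = 8 * 2 by rfl, pow_mul, dedekindEta_S_pow_eight]; ring
  have f0 (τ) : basisTwo 0 τ = H2 τ * Delta2 τ * (H2 τ ^ 2 + 64 * Delta2 τ ^ 2)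
    / dedekindEta τ ^ 16 := rfl
  have f1 (τ) : basisTwo 1 τ = (H2 τ ^ 4 + 384 * (Delta2 τ ^ 2 * (H2 τ ^ 2 - 64 * Delta2 τ ^ 2))
      + 14304 * Delta2 τ ^ 4) / dedekindEta τ ^ 16 := by
    rw [← Delta2A_eq']; rfl
  have f2 (τ) : basisTwo 2 τ = Delta2 τ ^ 4 / dedekindEta τ ^ 16 := rfl
  rw [Fin.sum_univ_three]
  fin_cases i <;>
  simp only [Fin.mk_zero, Fin.mk_one, Fin.reduceFinMk, Fin.isValue, Matrix.of_apply,
    Matrix.cons_val', Matrix.cons_val_zero, Matrix.cons_val_one, Matrix.cons_val,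
    f0, f1, f2, e16, H2_S', Delta2_S'] <;> field_simp <;> ring

theorem exists_basis_levelTwo : ∃ f : Fin 3 → ℍ → ℂ, IsBasisOfSolutions (-1) (-4 / 27) f ∧
      f 0 = H2 * Delta2 * (H2 ^ 2 + 64 * Delta2 ^ 2) / dedekindEta ^ 16 ∧
      f 1 = (H2 ^ 4 + 384 * Delta2A + 14304 * Delta2 ^ 4) / dedekindEta ^ 16 ∧
      f 2 = Delta2 ^ 4 / dedekindEta ^ 16 ∧
      QExpansionStarts (f 0) (-1 / 6) [1, 156, 6790, 142136, 1897233] ∧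
      QExpansionStarts (f 1) (-2 / 3) [1, 496, 22616, 606656, 9782812] ∧
      QExpansionStarts (f 2) (4 / 3) [1, 32, 528, 6016, 53384] := by
  obtain ⟨a, ha, a0, a2⟩ := exists_hasQExpansion_basisTwo
  have hB : IsBasisOfSolutions (-1) (-4 / 27) basisTwo := by
    refine isBasisOfSolutions_of_modular ha (fun i => by simp [a0]) ?_ ?_ ?_ basisTwo_S
    · intro i j h; fin_cases i <;> fin_cases j <;> first | rfl | (exfalso; revert h; norm_num)
    · simp; norm_num
    · intro i; fin_cases i <;> norm_num [ind]
  have hs : ∀ i, basisTwo i ∈ solutions (-1) (-4 / 27) := fun i =>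
    hB.2 ▸ Submodule.subset_span ⟨i, rfl⟩
  refine ⟨basisTwo, hB, rfl, rfl, rfl, ?_, ?_, ?_⟩
  · refine ((ha 0).congr_exponent (s := -1 / 6) (by norm_num)).qExpansionStarts (hs 0) _ (a0 0) ?_
    intro n hn h0; simp only [List.length_cons, List.length_nil] at hn
    interval_cases n <;> simp [opCoeff_eq, sum_range_succ, opKernel_one, opKernel_two,
      opKernel_three, opKernel_four, ind] at h0 ⊢ <;> norm_num
  · refine ((ha 1).congr_exponent (s := -2 / 3) (by norm_num)).qExpansionStarts_of_resonance
      (hs 1) _ ?_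
    intro n hn; simp only [List.length_cons, List.length_nil] at hn
    interval_cases n
    · exact Or.inl (a0 1)
    · right; simp [opCoeff_eq, opKernel_one, ind]; norm_num
    -- The resonant index, where the recursion gives no information.
    · exact Or.inl a2
    · right; simp [opCoeff_eq, sum_range_succ, opKernel_one, opKernel_two, opKernel_three, ind]
      norm_num
    · right; simp [opCoeff_eq, sum_range_succ, opKernel_one, opKernel_two, opKernel_three,
        opKernel_four, ind]; norm_num
  · refine ((ha 2).congr_exponent (s := 4 / 3) (by simp)).qExpansionStarts (hs 2) _ (a0 2) ?_
    intro n hn h0; simp only [List.length_cons, List.length_nil] at hn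
    interval_cases n <;> simp [opCoeff_eq, sum_range_succ, opKernel_one, opKernel_two,
      opKernel_three, opKernel_four, ind] at h0 ⊢ <;> norm_num

end

section

/-! ### The Jacobi triple product -/

section TripleProduct

variable {w : ℂ}

/-- The finite product `(1 - w) ⋯ (1 - wᵐ)`. -/
def qFactorial (w : ℂ) (m : ℕ) : ℂ := ∏ k ∈ range m, (1 - w ^ (k + 1))

/-- `1 / ((1 - w) ⋯ (1 - wᵐ))`, extended by zero to negative `m`. -/
def qFactorialInv (w : ℂ) (m : ℤ) : ℂ := if 0 ≤ m then (qFactorial w m.toNat)⁻¹ else 0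

lemma one_sub_pow_ne_zero (hw : ‖w‖ < 1) (k : ℕ) : 1 - w ^ (k + 1) ≠ 0 := by
  intro h
  have h1 : ‖w ^ (k + 1)‖ = 1 := by rw [← sub_eq_zero.1 h, norm_one]
  rw [norm_pow] at h1
  exact (pow_lt_one₀ (norm_nonneg _) hw k.succ_ne_zero).ne h1

lemma qFactorial_ne_zero (hw : ‖w‖ < 1) (m : ℕ) : qFactorial w m ≠ 0 :=
  Finset.prod_ne_zero_iff.2 fun k _ => one_sub_pow_ne_zero hw k

/-- Extension by zero is the right convention: at `m = 0` the factor `1 - w ^ m` vanishes, so the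
recursion holds for all integers and sums over `ℤ` truncate by themselves. -/
lemma qFactorialInv_sub_one (hw : ‖w‖ < 1) (m : ℤ) :
    qFactorialInv w (m - 1) = (1 - w ^ m) * qFactorialInv w m := by
  rcases lt_trichotomy m 0 with h | rfl | h
  · rw [qFactorialInv, qFactorialInv, if_neg h.not_ge, if_neg (by omega), mul_zero]
  · simp [qFactorialInv]
  · obtain ⟨k, rfl⟩ : ∃ k : ℕ, m = (k + 1 : ℕ) := ⟨(m - 1).toNat, by omega⟩
    have h1 := one_sub_pow_ne_zero hw k
    have h2 := qFactorial_ne_zero hw k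
    rw [zpow_natCast]
    simp only [qFactorialInv, qFactorial] at *
    rw [if_pos (by omega), if_pos (by omega),
      show (((k + 1 : ℕ) : ℤ) - 1).toNat = k by omega, Int.toNat_natCast, prod_range_succ]
    field_simp

lemma summable_norm_mul_pow (hw : ‖w‖ < 1) (z : ℂ) : Summable fun n : ℕ => ‖z * w ^ n‖ := by
  simp_rw [norm_mul, norm_pow]
  exact (summable_geometric_of_lt_one (norm_nonneg _) hw).mul_left _

lemma multipliable_one_sub_mul_pow (hw : ‖w‖ < 1) (z : ℂ) :
    Multipliable fun n : ℕ => 1 - z * w ^ n := by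
  have h := multipliable_one_add_of_summable (f := fun n => -(z * w ^ n))
    (by simpa only [norm_neg] using summable_norm_mul_pow hw z)
  simpa only [← sub_eq_add_neg] using h

lemma tprod_one_sub_mul_pow_ne_zero (hw : ‖w‖ < 1) {z : ℂ} (hz : ∀ n : ℕ, z * w ^ n ≠ 1) :
    ∏' n : ℕ, (1 - z * w ^ n) ≠ 0 := by
  have h := tprod_one_add_ne_zero_of_summable (f := fun n : ℕ => -(z * w ^ n))
    (fun n => by rw [← sub_eq_add_neg]; exact sub_ne_zero.2 (hz n).symm)
    (by simpa only [norm_neg] using summable_norm_mul_pow hw z)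
  simpa only [← sub_eq_add_neg] using h

lemma tendsto_qFactorial (hw : ‖w‖ < 1) :
    Tendsto (qFactorial w) atTop (𝓝 (∏' n : ℕ, (1 - w * w ^ n))) := by
  refine (multipliable_one_sub_mul_pow hw w).hasProd.tendsto_prod_nat.congr fun N => ?_
  exact Finset.prod_congr rfl fun k _ => by rw [pow_succ']

lemma tprod_one_sub_pow_ne_zero (hw : ‖w‖ < 1) : ∏' n : ℕ, (1 - w * w ^ n) ≠ 0 :=
  tprod_one_sub_mul_pow_ne_zero hw fun n h => one_sub_pow_ne_zero hw n <| by
    rw [pow_succ', h, sub_self]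

lemma tendsto_qFactorialInv (hw : ‖w‖ < 1) :
    Tendsto (qFactorialInv w) atTop (𝓝 (∏' n : ℕ, (1 - w * w ^ n))⁻¹) := by
  have h1 : Tendsto Int.toNat atTop atTop := by
    refine tendsto_atTop_atTop.2 fun b => ⟨b, fun a ha => by omega⟩
  refine (((tendsto_qFactorial hw).inv₀ (tprod_one_sub_pow_ne_zero hw)).comp h1).congr' ?_
  filter_upwards [eventually_ge_atTop 0] with m hm
  simp [qFactorialInv, hm]

lemma exists_bound_qFactorial (hw : ‖w‖ < 1) : ∃ C, 0 ≤ C ∧ (∀ m, ‖qFactorial w m‖ ≤ C) ∧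
    ∀ m, ‖qFactorialInv w m‖ ≤ C := by
  obtain ⟨C₁, h1⟩ := (tendsto_qFactorial hw).norm.bddAbove_range
  obtain ⟨C₂, h2⟩ :=
    ((tendsto_qFactorial hw).inv₀ (tprod_one_sub_pow_ne_zero hw)).norm.bddAbove_range
  have h1' : ∀ m, ‖qFactorial w m‖ ≤ C₁ := fun m => h1 ⟨m, rfl⟩
  have h2' : ∀ m, ‖(qFactorial w m)⁻¹‖ ≤ C₂ := fun m => h2 ⟨m, rfl⟩
  have hC := (norm_nonneg _).trans (h1' 0)
  refine ⟨max C₁ C₂, hC.trans (le_max_left _ _), fun m => (h1' m).trans (le_max_left _ _),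
    fun m => ?_⟩
  rw [qFactorialInv]
  split_ifs
  · exact (h2' _).trans (le_max_right _ _)
  · simpa using Or.inl hC

variable {z : ℂ} {t : ℤ → ℂ}

/-- The finite form of the triple product identity. -/
lemma hasSum_finite_tripleProduct (hw : ‖w‖ < 1) (hw0 : w ≠ 0) (hz : z ≠ 0) (ht0 : t 0 = 1)
    (ht : ∀ n, t (n + 1) = -(z * w ^ (n + 1)) * t n) (N : ℕ) :
    HasSum (fun n : ℤ => qFactorial w (2 * N) * qFactorialInv w (N - n) * qFactorialInv w (N + n)
      * t n) (∏ k ∈ range N, (1 - z * w * w ^ k) * (1 - z⁻¹ * w ^ k)) := by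
  induction N with
  | zero =>
    have := hasSum_single (f := fun n : ℤ => qFactorial w (2 * 0) * qFactorialInv w (((0 : ℕ) : ℤ) - n)
      * qFactorialInv w (((0 : ℕ) : ℤ) + n) * t n) 0 (fun n hn => by
        rcases lt_or_gt_of_ne hn with h | h
        · simp [qFactorialInv, h.not_ge]
        · simp [qFactorialInv, h.not_ge])
    simpa [qFactorial, qFactorialInv, ht0] using this
  | succ N ih =>
    -- The new factor expands as `1 + w ^ (2N+1) - z w ^ (N+1) - z⁻¹ w ^ N`. The last two terms
    -- shift the summation index by one, and the recursion for `t` brings all three sums to the same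
    -- `t n`; a rational identity in `w ^ N` and `w ^ n` remains.
    have hp := ((Equiv.addRight (-1 : ℤ)).hasSum_iff.2 ih).mul_left (-(z * w ^ (N + 1)))
    have hm := ((Equiv.addRight (1 : ℤ)).hasSum_iff.2 ih).mul_left (-(z⁻¹ * w ^ N))
    have h := ((ih.mul_left (1 + w ^ (2 * N + 1))).add hp).add hm
    rw [prod_range_succ]
    rw [show ((1 - z * w * w ^ N) * (1 - z⁻¹ * w ^ N)) = (1 + w ^ (2 * N + 1)) + -(z * w ^ (N + 1))
      + -(z⁻¹ * w ^ N) by field_simp; ring, mul_comm (∏ _ ∈ range N, _),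
      add_mul, add_mul]
    refine h.congr_fun fun n => ?_
    simp only [Function.comp_apply, Equiv.coe_addRight]
    have e1 : t (n + 1) = -(z * w ^ (n + 1)) * t n := ht n
    have e2 : t (n + -1) = -(z * w ^ n)⁻¹ * t n := by
      have := ht (n + -1)
      rw [neg_add_cancel_right] at this
      rw [this]
      have := zpow_ne_zero n hw0
      field_simp
    have a1 := qFactorialInv_sub_one hw ((N : ℤ) + 1 - n)
    have a2 := qFactorialInv_sub_one hw ((N : ℤ) - n)
    have b1 := qFactorialInv_sub_one hw ((N : ℤ) + 1 + n)
    have b2 := qFactorialInv_sub_one hw ((N : ℤ) + n)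
    rw [show (N : ℤ) + 1 - n - 1 = N - n by ring] at a1
    rw [show (N : ℤ) + 1 + n - 1 = N + n by ring] at b1
    rw [show (N : ℤ) - (n + -1) = N + 1 - n by ring, show (N : ℤ) + (n + -1) = N + n - 1 by ring,
      show (N : ℤ) - (n + 1) = N - n - 1 by ring, show (N : ℤ) + (n + 1) = N + 1 + n by ring,
      e1, e2, a2, b2, a1, b1, show 2 * (N + 1) = 2 * N + 1 + 1 by ring]
    push_cast
    simp only [qFactorial, prod_range_succ]
    rw [show (N : ℤ) + 1 - n = N + (1 - n) by ring, show (N : ℤ) + 1 + n = N + (1 + n) by ring]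
    simp only [sub_eq_add_neg (N : ℤ) n, zpow_add₀ hw0, zpow_sub₀ hw0, zpow_natCast, zpow_one,
      zpow_neg, pow_succ, pow_mul']
    have hY := zpow_ne_zero n hw0
    have hX := pow_ne_zero N hw0
    field_simp
    ring_nf

/-- **Jacobi triple product identity.** -/
theorem tripleProduct (hw : ‖w‖ < 1) (hw0 : w ≠ 0) (hz : z ≠ 0) (ht0 : t 0 = 1)
    (ht : ∀ n, t (n + 1) = -(z * w ^ (n + 1)) * t n) (hs : Summable t) :
    ∑' n, t n = (∏' n : ℕ, (1 - w * w ^ n)) * ((∏' n : ℕ, (1 - z * w * w ^ n)) *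
      ∏' n : ℕ, (1 - z⁻¹ * w ^ n)) := by
  set P := ∏' n : ℕ, (1 - w * w ^ n) with hP
  have hP0 : P ≠ 0 := tprod_one_sub_pow_ne_zero hw
  obtain ⟨C, hC, hC1, hC2⟩ := exists_bound_qFactorial hw
  have hN : Tendsto (fun N : ℕ => (N : ℤ)) atTop atTop := tendsto_natCast_atTop_atTop
  -- As `N` grows, the coefficient of `t n` tends to `P · P⁻¹ · P⁻¹`, and it stays bounded by `C³`.
  have h1 : Tendsto (fun N : ℕ => ∑' n : ℤ, qFactorial w (2 * N) * qFactorialInv w (N - n) *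
      qFactorialInv w (N + n) * t n) atTop (𝓝 (∑' n, P * P⁻¹ * P⁻¹ * t n)) := by
    refine tendsto_tsum_of_dominated_convergence (bound := fun n => C * C * C * ‖t n‖)
      (hs.norm.mul_left _) (fun n => ?_) (Eventually.of_forall fun N n => ?_)
    · refine Tendsto.mul_const _ (((tendsto_qFactorial hw).comp
        (tendsto_id.const_mul_atTop' two_pos)).mul ((tendsto_qFactorialInv hw).comp
          (tendsto_atTop_add_const_right _ (-n) hN)) |>.mul ((tendsto_qFactorialInv hw).comp
          (tendsto_atTop_add_const_right _ n hN)))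
    · rw [norm_mul, norm_mul, norm_mul]
      gcongr
      · exact hC1 _
      · exact hC2 _
      · exact hC2 _
  have h2 : Tendsto (fun N : ℕ => ∑' n : ℤ, qFactorial w (2 * N) * qFactorialInv w (N - n) *
      qFactorialInv w (N + n) * t n) atTop (𝓝 ((∏' n : ℕ, (1 - z * w * w ^ n)) *
      ∏' n : ℕ, (1 - z⁻¹ * w ^ n))) := by
    refine Tendsto.congr (fun N => ((hasSum_finite_tripleProduct hw hw0 hz ht0 ht N).tsum_eq).symm) ?_
    simp_rw [prod_mul_distrib]
    exact (multipliable_one_sub_mul_pow hw _).hasProd.tendsto_prod_nat.mul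
      (multipliable_one_sub_mul_pow hw _).hasProd.tendsto_prod_nat
  rw [← tendsto_nhds_unique h1 h2, mul_inv_cancel₀ hP0, one_mul, tsum_mul_left, ← mul_assoc,
    mul_inv_cancel₀ hP0, one_mul]

end TripleProduct

/-- The product side of the theta function in terms of `z = exp (2πiu)`. -/
theorem jacobiTheta₂_eq_tprod (u : ℂ) (τ : ℍ) : jacobiTheta₂ (u + 1 / 2 + τ / 2) τ =
    (∏' n : ℕ, (1 - nome τ * nome τ ^ n)) *
      ((∏' n : ℕ, (1 - cexp (2 * π * I * u) * nome τ * nome τ ^ n)) *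
        ∏' n : ℕ, (1 - (cexp (2 * π * I * u))⁻¹ * nome τ ^ n)) := by
  refine tripleProduct (t := fun n => jacobiTheta₂_term n (u + 1 / 2 + τ / 2) τ)
    (norm_nome_lt_one τ) (qpow_ne_zero _ _) (Complex.exp_ne_zero _) ?_ (fun n => ?_)
    ((summable_jacobiTheta₂_term_iff _ _).2 τ.2)
  · simp [jacobiTheta₂_term]
  · have hpi : cexp (π * I) = -1 := Complex.exp_pi_mul_I
    -- The shift by `1/2` supplies the sign `(-1)ⁿ`, and the shift by `τ/2` turns `q ^ (n²/2)` into
    -- `q ^ (n(n+1)/2)`, as the recursion for `t` demands.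
    have e : (2 * π * I * ((n + 1 : ℤ) : ℂ) * (u + 1 / 2 + τ / 2) +
        π * I * ((n + 1 : ℤ) : ℂ) ^ 2 * τ : ℂ) = π * I + (2 * π * I * u +
          ((n + 1 : ℤ) : ℂ) * (2 * π * I * 1 * τ)) +
        (2 * π * I * n * (u + 1 / 2 + τ / 2) + π * I * n ^ 2 * τ) := by
      push_cast; ring
    simp only [jacobiTheta₂_term]
    rw [e, Complex.exp_add, Complex.exp_add, Complex.exp_add, Complex.exp_int_mul, hpi, nome, qpow]
    ring

end

section

/-! ### Lambert series and logarithmic derivatives of theta functions -/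

/-- The Lambert series `∑ₙ z wⁿ / (1 - z wⁿ)`. -/
def lambert (w z : ℂ) : ℂ := ∑' n : ℕ, z * w ^ n / (1 - z * w ^ n)

lemma summable_lambert {w : ℂ} (hw : ‖w‖ < 1) (z : ℂ) :
    Summable fun n : ℕ => z * w ^ n / (1 - z * w ^ n) := by
  have h1 : Tendsto (fun n : ℕ => z * w ^ n) atTop (𝓝 0) := by
    simpa using (tendsto_pow_atTop_nhds_zero_of_norm_lt_one hw).const_mul z
  have h2 : Tendsto (fun n : ℕ => (1 - z * w ^ n)⁻¹) atTop (𝓝 ((1 - 0)⁻¹)) :=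
    (tendsto_const_nhds.sub h1).inv₀ (by simp)
  simp_rw [div_eq_mul_inv]
  exact Summable.mul_tendsto_const (summable_norm_mul_pow hw z) (Nat.cofinite_eq_atTop ▸ h2)

lemma lambert_eq_add {w : ℂ} (hw : ‖w‖ < 1) (z : ℂ) :
    lambert w z = z / (1 - z) + lambert w (z * w) := by
  rw [lambert, (summable_lambert hw z).tsum_eq_zero_add, lambert]
  simp only [pow_zero, mul_one, pow_succ', mul_assoc]

lemma multipliableLocallyUniformlyOn_one_sub_mul_pow {w : ℂ} (hw : ‖w‖ < 1) :
    MultipliableLocallyUniformlyOn (fun (n : ℕ) z => 1 - z * w ^ n) Set.univ := by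
  use fun z => ∏' n : ℕ, (1 - z * w ^ n)
  simp_rw [sub_eq_add_neg]
  apply hasProdLocallyUniformlyOn_of_forall_compact isOpen_univ
  intro K hK hcK
  obtain ⟨R, hR⟩ := hcK.isBounded.exists_norm_le
  refine Summable.hasProdUniformlyOn_nat_one_add (u := fun n => R * ‖w‖ ^ n) 
    hcK ((summable_geometric_of_lt_one (norm_nonneg _) hw).mul_left _)
    (.of_forall fun n x hx ↦ ?_) (fun _ ↦ by fun_prop)
  rw [norm_neg, norm_mul, norm_pow]
  gcongr
  exact hR x hx

/-- The logarithmic derivative of `∏ₙ (1 - z wⁿ)` is a Lambert series. -/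
lemma hasDerivAt_tprod_one_sub {w : ℂ} (hw : ‖w‖ < 1) {z : ℂ} (hz : ∀ n : ℕ, z * w ^ n ≠ 1) :
    HasDerivAt (fun z => ∏' n : ℕ, (1 - z * w ^ n))
      ((∑' n : ℕ, -w ^ n / (1 - z * w ^ n)) * ∏' n : ℕ, (1 - z * w ^ n)) z := by
  have hM := multipliableLocallyUniformlyOn_one_sub_mul_pow hw
  have hne := tprod_one_sub_mul_pow_ne_zero hw hz
  have hd : DifferentiableAt ℂ (fun z => ∏' n : ℕ, (1 - z * w ^ n)) z :=
    (hM.hasProdLocallyUniformlyOn.differentiableOn (.of_forall fun _ ↦ by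
      simpa [Finset.prod_fn] using DifferentiableOn.finsetProd (fun _ _ ↦ by fun_prop))
      isOpen_univ).differentiableAt univ_mem
  have hl (n : ℕ) : logDeriv (fun z => 1 - z * w ^ n) z = -w ^ n / (1 - z * w ^ n) := by
    rw [logDeriv_apply]
    congr 1
    have : HasDerivAt (fun z => 1 - z * w ^ n) (-(1 * w ^ n)) z :=
      ((hasDerivAt_id z).mul_const _).const_sub 1
    simpa only [one_mul] using this.deriv
  have h := logDeriv_tprod_eq_tsum isOpen_univ (Set.mem_univ z)
    (f := fun (n : ℕ) z => 1 - z * w ^ n) (fun n => sub_ne_zero.2 (hz n).symm) (fun n => by fun_prop)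
    ?_ hM hne
  · simp_rw [hl] at h
    rw [← h, logDeriv_apply, div_mul_cancel₀ _ hne]
    exact hd.hasDerivAt
  · simp_rw [hl]
    rcases eq_or_ne z 0 with rfl | h0
    · simpa using (summable_geometric_of_norm_lt_one hw).neg
    · refine ((summable_lambert hw z).mul_left (-z⁻¹)).congr fun n => ?_
      field_simp

lemma tsum_eq_lambert (w : ℂ) {z : ℂ} :
    z * ∑' n : ℕ, -w ^ n / (1 - z * w ^ n) = -lambert w z := by
  rw [lambert, ← tsum_mul_left, ← tsum_neg]
  exact tsum_congr fun n => by ring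

/-- The logarithmic derivative of the theta function. -/
lemma jacobiTheta₂'_eq (u : ℂ) (τ : ℍ) {z : ℂ} (hz : cexp (2 * π * I * u) = z)
    (h1 : ∀ n : ℕ, z * nome τ * nome τ ^ n ≠ 1) (h2 : ∀ n : ℕ, z⁻¹ * nome τ ^ n ≠ 1) :
    jacobiTheta₂' (u + 1 / 2 + τ / 2) τ = 2 * π * I *
      (lambert (nome τ) z⁻¹ - lambert (nome τ) (z * nome τ)) *
        jacobiTheta₂ (u + 1 / 2 + τ / 2) τ := by
  have hw := norm_nome_lt_one τ
  set w := nome τ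
  have hE : HasDerivAt (fun u : ℂ => cexp (2 * π * I * u)) (z * (2 * π * I)) u := by
    have := ((hasDerivAt_id u).const_mul (2 * π * I : ℂ)).cexp
    simpa [hz] using this
  have hE' : HasDerivAt (fun u : ℂ => (cexp (2 * π * I * u))⁻¹) (-z⁻¹ * (2 * π * I)) u := by
    have hz0 : z ≠ 0 := hz ▸ Complex.exp_ne_zero _
    refine (hE.inv (Complex.exp_ne_zero _)).congr_deriv ?_
    rw [hz]; field_simp
  have hA : HasDerivAt (fun u : ℂ => ∏' n : ℕ, (1 - cexp (2 * π * I * u) * w * w ^ n)) _ u :=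
    HasDerivAt.comp u (h₂ := fun z => ∏' n : ℕ, (1 - z * w ^ n))
      (by rw [hz]; exact hasDerivAt_tprod_one_sub hw h1) (hE.mul_const w)
  have hB : HasDerivAt (fun u : ℂ => ∏' n : ℕ, (1 - (cexp (2 * π * I * u))⁻¹ * w ^ n)) _ u :=
    HasDerivAt.comp u (h₂ := fun z => ∏' n : ℕ, (1 - z * w ^ n))
      (by rw [hz]; exact hasDerivAt_tprod_one_sub hw h2) hE'
  have hC := (hA.mul hB).const_mul (∏' n : ℕ, (1 - w * w ^ n))
  have hD : HasDerivAt (fun u : ℂ => jacobiTheta₂ (u + 1 / 2 + τ / 2) τ)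
      (jacobiTheta₂' (u + 1 / 2 + τ / 2) τ) u := by
    refine ((hasDerivAt_jacobiTheta₂_fst (u + 1 / 2 + τ / 2) τ.2).comp u
      (((hasDerivAt_id u).add_const (1 / 2)).add_const ((τ : ℂ) / 2))).congr_deriv ?_
    simp
  have hD' := hD.unique (hC.congr_of_eventuallyEq (.of_forall fun u => jacobiTheta₂_eq_tprod u τ))
  rw [hD', jacobiTheta₂_eq_tprod, hz]
  have e1 := tsum_eq_lambert w (z := z * w)
  have e2 := tsum_eq_lambert w (z := z⁻¹)
  linear_combination (2 * π * I) * (∏' n : ℕ, (1 - w * w ^ n)) * (∏' n : ℕ, (1 - z * w * w ^ n)) *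
    (∏' n : ℕ, (1 - z⁻¹ * w ^ n)) * (e1 - e2)

lemma jacobiTheta₂_ne_zero (u : ℂ) (τ : ℍ) {z : ℂ} (hz : cexp (2 * π * I * u) = z)
    (h1 : ∀ n : ℕ, z * nome τ * nome τ ^ n ≠ 1) (h2 : ∀ n : ℕ, z⁻¹ * nome τ ^ n ≠ 1) :
    jacobiTheta₂ (u + 1 / 2 + τ / 2) τ ≠ 0 := by
  have hw := norm_nome_lt_one τ
  rw [jacobiTheta₂_eq_tprod, hz]
  exact mul_ne_zero (tprod_one_sub_pow_ne_zero hw) (mul_ne_zero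
    (tprod_one_sub_mul_pow_ne_zero hw h1) (tprod_one_sub_mul_pow_ne_zero hw h2))

/-! ### The Lambert series of `I₃` -/

/-- The quadratic character modulo `3`. -/
def chi3 (n : ℕ) : ℂ := (legendreSym 3 (n : ℤ) : ℤ)

lemma legendreSym_three (n : ℕ) : legendreSym 3 (n : ℤ) =
    if n % 3 = 1 then 1 else if n % 3 = 2 then -1 else 0 := by
  have h := legendreSym.mod 3 (n : ℤ)
  rw [h]
  have : ((n : ℤ) % (3 : ℕ)) = ((n % 3 : ℕ) : ℤ) := by push_cast; rfl
  rw [this]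
  have hlt := Nat.mod_lt n (show 3 > 0 by norm_num)
  interval_cases n % 3 <;> decide

lemma norm_chi3_le (n : ℕ) : ‖chi3 n‖ ≤ 1 := by
  rw [chi3, legendreSym_three]
  split_ifs <;> simp

lemma summable_double {w : ℂ} (hw : ‖w‖ < 1) {c : ℕ → ℂ} (hc : ∀ n, ‖c n‖ ≤ 1) :
    Summable fun p : ℕ × ℕ => c (p.1 + 1) * w ^ ((p.1 + 1) * (p.2 + 1)) := by
  have hg := summable_geometric_of_lt_one (norm_nonneg w) hw
  refine Summable.of_norm_bounded (hg.mul_of_nonneg hg (fun n => by positivity)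
    (fun n => by positivity)) fun p => ?_
  rw [norm_mul, norm_pow, ← pow_add]
  calc ‖c (p.1 + 1)‖ * ‖w‖ ^ ((p.1 + 1) * (p.2 + 1)) ≤ 1 * ‖w‖ ^ (p.1 + p.2) := by
        gcongr ?_ * ?_
        · exact hc _
        · exact pow_le_pow_of_le_one (norm_nonneg _) hw.le (by nlinarith)
    _ = _ := one_mul _

lemma tsum_pow_succ {z : ℂ} (hz : ‖z‖ < 1) : ∑' n : ℕ, z ^ (n + 1) = z / (1 - z) := by
  simp_rw [pow_succ']
  rw [tsum_mul_left, tsum_geometric_of_norm_lt_one hz, div_eq_mul_inv]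

lemma norm_mul_pow_lt_one {w z : ℂ} (hw : ‖w‖ < 1) (hz : ‖z‖ < 1) (n : ℕ) : ‖z * w ^ n‖ < 1 := by
  rw [norm_mul, norm_pow]
  exact (mul_le_of_le_one_right (norm_nonneg _) (pow_le_one₀ (norm_nonneg _) hw.le)).trans_lt hz

/-- Splitting a sum over `ℕ` by residue classes. -/
lemma tsum_nat_eq_sum_fin (N : ℕ) [NeZero N] {f : ℕ → ℂ} (hf : Summable f) :
    ∑' n, f n = ∑ j : Fin N, ∑' m, f (m * N + j) := by
  have e := (Nat.divModEquiv N).symm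
  rw [← ((Equiv.prodComm (Fin N) ℕ).trans (Nat.divModEquiv N).symm).tsum_eq f,
    Summable.tsum_prod, tsum_fintype]
  · rfl
  · exact ((Equiv.prodComm (Fin N) ℕ).trans (Nat.divModEquiv N).symm).summable_iff.2 hf

/-- Splitting a sum over `ℤ` by residue classes. -/
lemma tsum_int_eq_sum_fin (N : ℕ) [NeZero N] {f : ℤ → ℂ} (hf : Summable f) :
    ∑' n, f n = ∑ j : Fin N, ∑' m : ℤ, f (m * N + (j : ℕ)) := by
  rw [← ((Equiv.prodComm (Fin N) ℤ).trans (Int.divModEquiv N).symm).tsum_eq f,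
    Summable.tsum_prod, tsum_fintype]
  · rfl
  · exact ((Equiv.prodComm (Fin N) ℤ).trans (Int.divModEquiv N).symm).summable_iff.2 hf

end

/-! ### The Lambert series of `I₃` and its two evaluations -/

section

open ModularGroup ModularForm
open scoped ModularForm

/-- The double series `∑_{a, b ≥ 1} (a/3) w^{ab}`. -/
def lambertChi3 (w : ℂ) : ℂ := ∑' p : ℕ × ℕ, chi3 (p.1 + 1) * w ^ ((p.1 + 1) * (p.2 + 1))

lemma chi3_eq (n : ℕ) : chi3 n = if n % 3 = 1 then 1 else if n % 3 = 2 then -1 else 0 := by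
  rw [chi3, legendreSym_three]
  split_ifs <;> simp

lemma lambertChi3_eq_tsum_divisors {w : ℂ} (hw : ‖w‖ < 1) : lambertChi3 w =
    ∑' n : ℕ, ((∑ d ∈ (n + 1).divisors, legendreSym 3 (d : ℤ) : ℤ) : ℂ) * w ^ (n + 1) := by
  have hs := summable_double hw norm_chi3_le
  set F : ℕ+ × ℕ+ → ℂ := fun c => chi3 c.1 * w ^ (c.1 * c.2 : ℕ) with hF
  have hFe : (fun p : ℕ × ℕ => chi3 (p.1 + 1) * w ^ ((p.1 + 1) * (p.2 + 1))) =
      F ∘ (Equiv.prodCongr Equiv.pnatEquivNat Equiv.pnatEquivNat).symm := by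
    funext p; simp [hF]
  have hsF : Summable F := by rw [hFe] at hs; exact (Equiv.summable_iff _).1 hs
  have h1 : lambertChi3 w = ∑' c, F c := by
    rw [lambertChi3, hFe]; exact (Equiv.tsum_eq _ _)
  have h3 : ∑' c, F (sigmaAntidiagonalEquivProd c) = _ :=
    Summable.tsum_sigma (sigmaAntidiagonalEquivProd.summable_iff.2 hsF)
  rw [h1, ← sigmaAntidiagonalEquivProd.tsum_eq, h3, ← Equiv.pnatEquivNat.symm.tsum_eq]
  refine tsum_congr fun n => ?_
  have hn : ((Equiv.pnatEquivNat.symm n : ℕ+) : ℕ) = n + 1 := by simp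
  rw [tsum_fintype]
  have h2 : ∀ x : Nat.divisorsAntidiagonal (Equiv.pnatEquivNat.symm n),
      F (sigmaAntidiagonalEquivProd ⟨Equiv.pnatEquivNat.symm n, x⟩) =
        chi3 x.1.1 * w ^ (n + 1) := by
    intro x
    have := (Nat.mem_divisorsAntidiagonal.1 x.2).1
    simp only [hF, sigmaAntidiagonalEquivProd, divisorsAntidiagonalFactors, Equiv.coe_fn_mk,
      PNat.mk_coe, this, hn]
  simp_rw [h2]
  rw [← Finset.sum_mul]
  congr 1
  rw [Finset.sum_coe_sort _ (fun x : ℕ × ℕ => chi3 x.1), hn,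
    Nat.sum_divisorsAntidiagonal (f := fun d _ => chi3 d)]
  push_cast
  rfl

lemma I3_eq (τ : ℍ) : I3 τ = 1 + 6 * lambertChi3 (nome τ) := by
  rw [lambertChi3_eq_tsum_divisors (norm_nome_lt_one τ), I3]
  congr 2
  refine tsum_congr fun n => ?_
  rw [← qpow_natCast]; push_cast; rfl

lemma tsum_double_eq {w : ℂ} (hw : ‖w‖ < 1) : lambertChi3 w =
    ∑' n : ℕ, chi3 (n + 1) * (w ^ (n + 1) / (1 - w ^ (n + 1))) := by
  rw [lambertChi3, (summable_double hw norm_chi3_le).tsum_prod]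
  refine tsum_congr fun n => ?_
  dsimp only
  rw [tsum_mul_left, ← tsum_pow_succ]
  · simp_rw [pow_mul]
  · rw [norm_pow]; exact pow_lt_one₀ (norm_nonneg _) hw n.succ_ne_zero

lemma summable_pow_div {w : ℂ} (hw : ‖w‖ < 1) :
    Summable fun n : ℕ => chi3 (n + 1) * (w ^ (n + 1) / (1 - w ^ (n + 1))) := by
  refine Summable.of_norm_bounded ((summable_lambert hw w).norm) fun n => ?_
  rw [norm_mul, pow_succ']
  exact mul_le_of_le_one_left (norm_nonneg _) (norm_chi3_le _)

/-- Summing first over `b` gives `∑ (a/3) w ^ a / (1 - w ^ a)`. The classes `a ≡ 1, 2` modulo 3 are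
Lambert series to the base `w³`, with opposite signs. -/
lemma lambertChi3_eq_lambert {w : ℂ} (hw : ‖w‖ < 1) :
    lambertChi3 w = lambert (w ^ 3) w - lambert (w ^ 3) (w ^ 2) := by
  rw [tsum_double_eq hw, tsum_nat_eq_sum_fin 3 (summable_pow_div hw), Fin.sum_univ_three]
  have h0 (m : ℕ) : chi3 (m * 3 + ((0 : Fin 3) : ℕ) + 1) = 1 := by
    rw [chi3_eq, if_pos]; simp
  have h1 (m : ℕ) : chi3 (m * 3 + ((1 : Fin 3) : ℕ) + 1) = -1 := by
    rw [chi3_eq, if_neg, if_pos] <;> simp [add_assoc]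
  have h2 (m : ℕ) : chi3 (m * 3 + ((2 : Fin 3) : ℕ) + 1) = 0 := by
    rw [chi3_eq, if_neg, if_neg] <;> simp [add_assoc]
  simp_rw [h0, h1, h2, zero_mul, tsum_zero, neg_one_mul, tsum_neg, one_mul, lambert, ← pow_mul,
    ← pow_succ', ← pow_add]
  rw [add_zero, ← sub_eq_add_neg]
  congr 1
  · refine tsum_congr fun n => ?_
    simp only [Fin.val_zero]
    ring_nf
  · refine tsum_congr fun n => ?_
    simp only [Fin.val_one]
    ring_nf

lemma lambert_mul_self {w z : ℂ} (hw : ‖w‖ < 1) (hz : ‖z‖ = 1) :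
    lambert w (z * w) = ∑' p : ℕ × ℕ, z ^ (p.1 + 1) * w ^ ((p.1 + 1) * (p.2 + 1)) := by
  have hs : Summable fun p : ℕ × ℕ => z ^ (p.1 + 1) * w ^ ((p.1 + 1) * (p.2 + 1)) :=
    summable_double (c := fun n => z ^ n) hw (fun n => by simp [hz])
  have h := Summable.tsum_prod ((Equiv.prodComm ℕ ℕ).summable_iff.2 hs)
  simp only [Function.comp_def] at h
  rw [← (Equiv.prodComm ℕ ℕ).tsum_eq, h, lambert]
  refine tsum_congr fun n => ?_
  rw [← tsum_pow_succ (norm_mul_pow_lt_one hw (by rwa [norm_mul, hz, one_mul]) n)]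
  refine tsum_congr fun k => ?_
  simp only [Equiv.prodComm_apply, Prod.swap_prod_mk]
  rw [mul_assoc, ← pow_succ', mul_pow, ← pow_mul, mul_comm (n + 1)]

/-- For a primitive cube root of unity, `z ^ (2n) - z ^ n = (z² - z) (n/3)`: the Gauss sum identity
for the quadratic character modulo 3. -/
lemma lambert_sub_lambert {w z : ℂ} (hw : ‖w‖ < 1) (hz : z ^ 2 + z + 1 = 0) :
    lambert w (z ^ 2 * w) - lambert w (z * w) = (z ^ 2 - z) * lambertChi3 w := by
  have hz3 : z ^ 3 = 1 := by linear_combination (z - 1) * hz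
  have hn : ‖z‖ = 1 := by
    have : ‖z‖ ^ 3 = 1 := by rw [← norm_pow, hz3, norm_one]
    exact (pow_eq_one_iff_of_nonneg (norm_nonneg _) (by norm_num)).1 this
  have hn2 : ‖z ^ 2‖ = 1 := by rw [norm_pow, hn, one_pow]
  rw [lambert_mul_self hw hn, lambert_mul_self hw hn2, lambertChi3, ← tsum_mul_left,
    ← Summable.tsum_sub
      (summable_double (c := fun n => (z ^ 2) ^ n) hw (fun n => by simp [hn]))
      (summable_double (c := fun n => z ^ n) hw (fun n => by simp [hn]))]
  refine tsum_congr fun p => ?_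
  rw [← sub_mul, ← mul_assoc]
  congr 1
  have key : ∀ n : ℕ, (z ^ 2) ^ n - z ^ n = (z ^ 2 - z) * chi3 n := by
    intro n
    have hz' (k) (hk : k ^ 3 = (1 : ℂ)) : k ^ n = k ^ (n % 3) := by
      conv_lhs => rw [← Nat.div_add_mod n 3, pow_add, pow_mul, hk, one_pow, one_mul]
    rw [chi3_eq, hz' z hz3, hz' (z ^ 2) (by rw [← pow_mul, mul_comm, pow_mul, hz3, one_pow])]
    have hlt := Nat.mod_lt n (show 3 > 0 by norm_num)
    interval_cases n % 3
    · simp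
    · simp
    · simp; linear_combination z * hz3
  exact key _

end

/-! ### Theta functions at 3-division points and the transformation of `I₃` -/

section

open ModularGroup ModularForm
open scoped ModularForm

/-- The primitive cube root of unity `exp (2πi/3)`. -/
def omega3 : ℂ := cexp (2 * π * I * (1 / 3))

lemma omega3_eq : omega3 = -1 / 2 + √3 / 2 * I := by
  have h : (2 * π * I * (1 / 3) : ℂ) = ((π - π / 3 : ℝ) : ℂ) * I := by push_cast; ring
  rw [omega3, h, Complex.exp_mul_I, ← Complex.ofReal_cos, ← Complex.ofReal_sin, Real.cos_pi_sub,
    Real.sin_pi_sub, Real.cos_pi_div_three, Real.sin_pi_div_three]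
  push_cast; ring

lemma sqrt_three_sq : (√3 : ℂ) ^ 2 = 3 := by
  rw [← Complex.ofReal_pow, Real.sq_sqrt (by norm_num)]; norm_num

lemma sqrt_three_ne_zero : (√3 : ℂ) ≠ 0 := fun h => by
  have := sqrt_three_sq; rw [h] at this; norm_num at this

lemma omega3_sq : omega3 ^ 2 = -1 / 2 - √3 / 2 * I := by
  rw [omega3_eq]
  linear_combination (1 / 4 : ℂ) * √3 ^ 2 * Complex.I_sq - (1 / 4 : ℂ) * sqrt_three_sq

lemma omega3_root : omega3 ^ 2 + omega3 + 1 = 0 := by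
  rw [omega3_sq, omega3_eq]; ring

lemma omega3_pow_three : omega3 ^ 3 = 1 := by linear_combination (omega3 - 1) * omega3_root

lemma omega3_inv : omega3⁻¹ = omega3 ^ 2 := by
  refine inv_eq_of_mul_eq_one_right ?_
  rw [← pow_succ', omega3_pow_three]

lemma norm_omega3 : ‖omega3‖ = 1 := by
  have : ‖omega3‖ ^ 3 = 1 := by rw [← norm_pow, omega3_pow_three, norm_one]
  exact (pow_eq_one_iff_of_nonneg (norm_nonneg _) (by norm_num)).1 this

lemma ne_one_of_norm_lt {z : ℂ} (h : ‖z‖ < 1) : z ≠ 1 := by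
  rintro rfl; simp at h

lemma omega3_sq_ne_one : omega3 ^ 2 ≠ 1 := by
  intro h
  have h1 := omega3_root
  have h2 := omega3_pow_three
  rw [pow_succ, h, one_mul] at h2
  rw [h2] at h1; norm_num at h1

/-- At `u = 1/3` the logarithmic derivative of theta is a difference of Lambert series at cube roots
of unity. Splitting off the first term gives the constants, and the rest is the double series of
`I₃`. -/
lemma theta_third (τ : ℍ) : jacobiTheta₂ (1 / 3 + 1 / 2 + τ / 2) τ ≠ 0 ∧
    jacobiTheta₂' (1 / 3 + 1 / 2 + τ / 2) τ = 2 * π * I * (-1 / 2 - I / (2 * √3) * I3 τ) *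
      jacobiTheta₂ (1 / 3 + 1 / 2 + τ / 2) τ := by
  have hw := norm_nome_lt_one τ
  have h1 : ∀ n : ℕ, omega3 * nome τ * nome τ ^ n ≠ 1 := fun n =>
    ne_one_of_norm_lt (norm_mul_pow_lt_one hw (by rwa [norm_mul, norm_omega3, one_mul]) n)
  have h2 : ∀ n : ℕ, omega3⁻¹ * nome τ ^ n ≠ 1 := by
    intro n
    rcases n with _ | n
    · rw [pow_zero, mul_one, omega3_inv]; exact omega3_sq_ne_one
    · refine ne_one_of_norm_lt ?_
      rw [norm_mul, norm_inv, norm_omega3, inv_one, one_mul, norm_pow]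
      exact pow_lt_one₀ (norm_nonneg _) hw n.succ_ne_zero
  refine ⟨jacobiTheta₂_ne_zero _ τ rfl h1 h2, ?_⟩
  rw [jacobiTheta₂'_eq (1 / 3) τ (z := omega3) rfl h1 h2, lambert_eq_add hw, omega3_inv,
    add_sub_assoc, lambert_sub_lambert hw omega3_root, I3_eq]
  congr 2
  have h3 : omega3 ^ 2 / (1 - omega3 ^ 2) = (omega3 ^ 2 - 1) / 3 := by
    have := sub_ne_zero.2 omega3_sq_ne_one.symm
    field_simp
    linear_combination (omega3 ^ 2 - omega3 + 1) * omega3_root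
  have h4 : I / (2 * √3) = √3 * I / 6 := by
    have := sqrt_three_ne_zero
    field_simp
    linear_combination -2 * sqrt_three_sq
  rw [h3, h4, omega3_sq, omega3_eq]
  ring

/-- At `u = τ/3` the variable `exp (2πiu)` is a cube root of the nome, which produces `I₃` at `τ/3`.
The integer shift by `-1` makes this point, divided by `τ`, the point of `theta_third` for `S • τ`.
-/
lemma theta_third_tau (τ : ℍ) : jacobiTheta₂ (τ / 3 - 1 + 1 / 2 + τ / 2) τ ≠ 0 ∧
    jacobiTheta₂' (τ / 3 - 1 + 1 / 2 + τ / 2) τ = 2 * π * I *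
      (-5 / 6 - I3 (scale (1 / 3) τ) / 6) * jacobiTheta₂ (τ / 3 - 1 + 1 / 2 + τ / 2) τ := by
  have hw := norm_nome_lt_one τ
  set t := nome (scale (1 / 3) τ) with ht
  have htw : nome τ = t ^ 3 := by
    rw [ht, nome, nome, qpow_scale (by norm_num), ← qpow_nat_mul]; push_cast; norm_num
  have ht1 : ‖t‖ < 1 := norm_nome_lt_one _
  have ht0 : t ≠ 0 := qpow_ne_zero _ _
  have hz : cexp (2 * π * I * (τ / 3 - 1)) = t := by
    rw [ht, nome, qpow_scale (by norm_num), qpow, mul_sub, mul_one, Complex.exp_sub,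
      Complex.exp_two_pi_mul_I, div_one]
    congr 1; push_cast; ring
  have h1 : ∀ n : ℕ, t * nome τ * nome τ ^ n ≠ 1 := fun n =>
    ne_one_of_norm_lt (norm_mul_pow_lt_one hw (by
      simpa using norm_mul_pow_lt_one hw ht1 1) n)
  have ht2 : ‖t ^ 2‖ < 1 := by rw [norm_pow]; exact pow_lt_one₀ (norm_nonneg _) ht1 two_ne_zero
  have h2 : ∀ n : ℕ, t⁻¹ * nome τ ^ n ≠ 1 := by
    intro n
    rcases n with _ | n
    · rw [pow_zero, mul_one]; exact inv_ne_one.2 (ne_one_of_norm_lt ht1)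
    · rw [pow_succ', htw, ← mul_assoc, show t⁻¹ * t ^ 3 = t ^ 2 by field_simp, ← htw]
      exact ne_one_of_norm_lt (norm_mul_pow_lt_one hw ht2 n)
  refine ⟨jacobiTheta₂_ne_zero _ τ hz h1 h2, ?_⟩
  rw [jacobiTheta₂'_eq _ τ hz h1 h2, I3_eq, ← ht, lambertChi3_eq_lambert ht1, ← htw,
    lambert_eq_add hw t⁻¹, lambert_eq_add hw t, show t⁻¹ * nome τ = t ^ 2 by rw [htw]; field_simp]
  congr 2
  have h3 : t⁻¹ / (1 - t⁻¹) = -1 - t / (1 - t) := by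
    have := sub_ne_zero.2 (ne_one_of_norm_lt ht1)
    have := sub_ne_zero.2 (ne_one_of_norm_lt ht1).symm
    field_simp
    ring
  rw [h3]
  ring

/-- The transformation of `I₃` under `S`. -/
theorem I3_S (τ : ℍ) : I3 (S • τ) = -I * τ / √3 * I3 (scale (1 / 3) τ) := by
  have hτ := τ.ne_zero
  have h3 := sqrt_three_ne_zero
  have hpi := Complex.two_pi_I_ne_zero
  obtain ⟨n1, e1⟩ := theta_third (S • τ)
  obtain ⟨n2, e2⟩ := theta_third_tau τ
  have f1 := jacobiTheta₂_functional_equation (τ / 3 - 1 + 1 / 2 + τ / 2) τ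
  have f2 := jacobiTheta₂'_functional_equation (τ / 3 - 1 + 1 / 2 + τ / 2) τ
  have hv : ((τ : ℂ) / 3 - 1 + 1 / 2 + τ / 2) / τ = 1 / 3 + 1 / 2 + ((S • τ : ℍ) : ℂ) / 2 := by
    rw [coe_S_smul]; field_simp; ring
  have hS : (-1 : ℂ) / τ = ((S • τ : ℍ) : ℂ) := by rw [coe_S_smul]; field_simp
  rw [hv, hS] at f1 f2
  rw [e2, f1, e1] at f2
  set A := jacobiTheta₂ (1 / 3 + 1 / 2 + ((S • τ : ℍ) : ℂ) / 2) (S • τ : ℍ)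
  set B := 1 / (-I * (τ : ℂ)) ^ (1 / 2 : ℂ) * cexp (-π * I * (τ / 3 - 1 + 1 / 2 + τ / 2) ^ 2 / τ)
    with hB
  have hBA : B * A ≠ 0 := by rw [f1] at n2; exact n2
  clear_value A B
  -- The functional equations of theta and of its derivative share the nonzero factor `B * A`;
  -- cancelling it leaves a linear relation between the two logarithmic derivatives.
  have key : (2 * π * I * (B * A)) * (τ * (-5 / 6 - I3 (scale (1 / 3) τ) / 6)) =
      (2 * π * I * (B * A)) * ((-1 / 2 - I / (2 * √3) * I3 (S • τ)) -
        (τ / 3 - 1 + 1 / 2 + τ / 2)) := by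
    rw [div_mul_eq_mul_div, eq_div_iff hτ] at f2
    linear_combination f2
  have key2 := mul_left_cancel₀ (mul_ne_zero hpi hBA) key
  have h5 : I * I3 (S • τ) = √3 * τ * I3 (scale (1 / 3) τ) / 3 := by
    field_simp at key2 ⊢
    linear_combination (1 / 6 : ℂ) * key2
  have h6 : (√3 : ℂ) / 3 = 1 / √3 := by
    field_simp; exact sqrt_three_sq
  linear_combination (-I) * h5 + I3 (S • τ) * Complex.I_sq - I * τ * I3 (scale (1 / 3) τ) * h6

end

/-! ### Expansions of `I₃` and of its dissection modulo 3 -/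

section

open ModularGroup ModularForm
open scoped ModularForm

/-- The divisor sum `∑_{d ∣ n} (d/3)`. -/
def chi3Sum (n : ℕ) : ℤ := ∑ d ∈ n.divisors, legendreSym 3 (d : ℤ)

/-- A divisor of `3 n` that does not divide `n` is a multiple of 3, where the character vanishes. -/
lemma chi3Sum_three_mul {n : ℕ} (hn : n ≠ 0) : chi3Sum (3 * n) = chi3Sum n := by
  refine (Finset.sum_subset (Nat.divisors_subset_of_dvd (by omega) (Dvd.intro_left _ rfl))
    fun d hd hd' => ?_).symm
  rw [Nat.mem_divisors] at hd hd'
  have h3 : 3 ∣ d := by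
    by_contra h
    exact hd' ⟨(Nat.Coprime.symm ((Nat.prime_three.coprime_iff_not_dvd).2 h)).dvd_of_dvd_mul_left
      hd.1, hn⟩
  rw [legendreSym_three, if_neg (by omega), if_neg (by omega)]

/-- If `d e ≡ 2` modulo 3 then `(d/3) = -(e/3)`, so exchanging complementary divisors reverses the
sign of the sum. -/
lemma chi3Sum_three_mul_add_two (n : ℕ) : chi3Sum (3 * n + 2) = 0 := by
  have h : chi3Sum (3 * n + 2) = -chi3Sum (3 * n + 2) := by
    conv_lhs => rw [chi3Sum, ← Nat.sum_div_divisors]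
    rw [chi3Sum, ← Finset.sum_neg_distrib]
    refine Finset.sum_congr rfl fun d hd => ?_
    obtain ⟨e, he⟩ := Nat.dvd_of_mem_divisors hd
    have hd0 := Nat.pos_of_mem_divisors hd
    rw [he, Nat.mul_div_cancel_left _ hd0, legendreSym_three, legendreSym_three]
    have h1 : (d * e) % 3 = 2 := by omega
    rw [Nat.mul_mod] at h1
    have := Nat.mod_lt d (show 3 > 0 by norm_num)
    have := Nat.mod_lt e (show 3 > 0 by norm_num)
    interval_cases d % 3 <;> interval_cases e % 3 <;> simp_all
  omega

lemma abs_chi3Sum_le (n : ℕ) : ‖(chi3Sum n : ℂ)‖ ≤ n := by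
  rw [chi3Sum]; push_cast
  refine (norm_sum_le _ _).trans ((Finset.sum_le_sum (g := fun _ => (1 : ℝ))
    fun d _ => norm_chi3_le d).trans ?_)
  simpa using Nat.card_divisors_le_self n

/-- The coefficients of `I₃`. -/
def coeffI3 (n : ℕ) : ℂ := if n = 0 then 1 else 6 * chi3Sum n

lemma hasSum_I3 (τ : ℍ) : HasSum (fun n => coeffI3 n * nome τ ^ n) (I3 τ) := by
  have hw := norm_nome_lt_one τ
  have hs : Summable fun n : ℕ => (chi3Sum (n + 1) : ℂ) * nome τ ^ (n + 1) := by
    have h := (summable_nat_add_iff 1).2 (summable_pow_mul_geometric_of_norm_lt_one 1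
      (r := ‖nome τ‖) (by simpa using hw))
    refine Summable.of_norm_bounded h fun n => ?_
    rw [norm_mul, norm_pow, pow_one]
    gcongr
    exact abs_chi3Sum_le _
  rw [← hasSum_nat_add_iff' 1]
  have h1 : I3 τ - ∑ i ∈ range 1, coeffI3 i * nome τ ^ i =
      6 * ∑' n : ℕ, (chi3Sum (n + 1) : ℂ) * nome τ ^ (n + 1) := by
    rw [I3_eq, lambertChi3_eq_tsum_divisors hw]
    simp [coeffI3, chi3Sum]
  rw [h1]
  refine (hs.hasSum.mul_left 6).congr_fun fun n => ?_
  simp [coeffI3, mul_assoc]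

lemma hasQExpansion_I3 : HasQExpansion I3 0 coeffI3 := fun τ => by
  simpa [qpow_natCast] using hasSum_I3 τ

lemma mdifferentiable_I3 : MDiff I3 := hasQExpansion_I3.mdifferentiable

lemma tendsto_I3 : Tendsto I3 atImInfty (𝓝 1) := by
  simpa [coeffI3] using hasQExpansion_I3.tendsto

lemma I3_T (τ : ℍ) : I3 ((1 : ℝ) +ᵥ τ) = I3 τ := by
  simpa using hasQExpansion_I3.vadd_one τ

/-- The part of `I₃(τ/3)` with exponents in `1/3 + ℤ`. -/
def deltaI3 (τ : ℍ) : ℂ := (I3 (scale (1 / 3) τ) - I3 τ) / 6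

/-- In the expansion of `I₃` at `τ/3` the indices divisible by 3 reproduce `I₃` at `τ`, those
congruent to 2 vanish, and those congruent to 1 remain. -/
lemma hasQExpansion_deltaI3 : HasQExpansion deltaI3 (1 / 3) (fun n => chi3Sum (3 * n + 1)) := by
  intro τ
  set t := nome (scale (1 / 3) τ) with ht
  have htw : nome τ = t ^ 3 := by
    rw [ht, nome, nome, qpow_scale (by norm_num), ← qpow_nat_mul]; push_cast; norm_num
  have htq (m : ℕ) : qpow (1 / 3 + m) τ = t ^ (m * 3 + 1) := by
    rw [ht, nome, qpow_scale (by norm_num), ← qpow_nat_mul]; push_cast; congr 1; ring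
  have h := hasSum_I3 (scale (1 / 3) τ)
  have h0 := hasSum_I3 τ
  rw [htw] at h0
  rw [← ht] at h
  have hs : Summable fun m : ℕ => coeffI3 (m * 3 + 1) * t ^ (m * 3 + 1) :=
    h.summable.comp_injective (i := fun m : ℕ => m * 3 + 1) fun a b hab => by simpa using hab
  have h1 := tsum_nat_eq_sum_fin 3 h.summable
  rw [h.tsum_eq, Fin.sum_univ_three] at h1
  have e0 : ∑' m : ℕ, coeffI3 (m * 3 + ((0 : Fin 3) : ℕ)) * t ^ (m * 3 + ((0 : Fin 3) : ℕ)) =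
      I3 τ := by
    rw [← h0.tsum_eq]
    refine tsum_congr fun m => ?_
    simp only [Fin.val_zero, add_zero]
    rw [mul_comm m 3, pow_mul]
    congr 1
    rcases eq_or_ne m 0 with rfl | hm
    · rfl
    · rw [coeffI3, coeffI3, if_neg hm, if_neg (by omega), chi3Sum_three_mul hm]
  have e2 : ∑' m : ℕ, coeffI3 (m * 3 + ((2 : Fin 3) : ℕ)) * t ^ (m * 3 + ((2 : Fin 3) : ℕ)) = 0 := by
    refine (tsum_congr fun m => ?_).trans tsum_zero
    simp only [Fin.val_two]
    rw [mul_comm m 3, coeffI3, if_neg (by omega), chi3Sum_three_mul_add_two]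
    simp
  rw [e0, e2] at h1
  have h2 : deltaI3 τ = (∑' m : ℕ, coeffI3 (m * 3 + 1) * t ^ (m * 3 + 1)) / 6 := by
    rw [deltaI3, h1]; simp
  rw [h2]
  refine (hs.hasSum.div_const 6).congr_fun fun m => ?_
  rw [htq, coeffI3, if_neg (by omega), mul_comm m 3]
  ring

lemma mdifferentiable_deltaI3 : MDiff deltaI3 := hasQExpansion_deltaI3.mdifferentiable

lemma tendsto_deltaI3 : Tendsto (fun τ => qpow (-(1 / 3)) τ * deltaI3 τ) atImInfty (𝓝 1) := by
  have h := hasQExpansion_deltaI3.tendsto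
  simpa [chi3Sum] using h

lemma deltaI3_T (τ : ℍ) : deltaI3 ((1 : ℝ) +ᵥ τ) = omega3 * deltaI3 τ :=
  hasQExpansion_deltaI3.vadd_one τ

lemma I3_S' (τ : ℍ) : I3 (S • τ) = -I * τ / √3 * (I3 τ + 6 * deltaI3 τ) := by
  rw [I3_S, deltaI3]; ring

lemma I3_scale (τ : ℍ) : I3 (scale (1 / 3) (S • τ)) = -I * (3 * τ) / √3 * I3 τ := by
  rw [scale_S (by norm_num), I3_S, scale_scale (by norm_num) (by norm_num),
    coe_scale (by norm_num)]
  norm_num [scale_one]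

lemma deltaI3_S (τ : ℍ) : deltaI3 (S • τ) = -I * τ / √3 * ((I3 τ - 3 * deltaI3 τ) / 3) := by
  rw [deltaI3, I3_scale, I3_S']; ring

end

/-! ### Vanishing on `Γ₀(3)` and the eta quotient `Δ₃` -/

section

open ModularGroup ModularForm
open scoped ModularForm

lemma dedekindEta_vadd_nat (n : ℕ) (τ : ℍ) :
    dedekindEta ((n : ℝ) +ᵥ τ) = cexp (2 * π * I * (n / 24)) * dedekindEta τ := by
  induction n with
  | zero => simp
  | succ n ih =>
    have h : ((n + 1 : ℕ) : ℝ) +ᵥ τ = (1 : ℝ) +ᵥ ((n : ℝ) +ᵥ τ) := by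
      rw [vadd_vadd]; push_cast; rw [add_comm]
    rw [h, dedekindEta_T, ih, ← mul_assoc, ← Complex.exp_add]
    congr 2; push_cast; ring

/-- The relation `S T S = T⁻¹ S T⁻¹`. -/
lemma S_smul_vadd_S_smul (τ : ℍ) : S • ((1 : ℝ) +ᵥ S • τ) = (-1 : ℝ) +ᵥ S • ((-1 : ℝ) +ᵥ τ) := by
  ext1
  have h1 := ((-1 : ℝ) +ᵥ τ).ne_zero
  have h2 := ((1 : ℝ) +ᵥ S • τ).ne_zero
  have h3 := τ.ne_zero
  rw [coe_S_smul, coe_vadd, coe_vadd, coe_S_smul, coe_S_smul, coe_vadd]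
  rw [coe_vadd] at h1 h2
  rw [coe_S_smul] at h2
  push_cast at *
  have h4 : (τ : ℂ) - 1 ≠ 0 := fun h => h1 (by linear_combination h)
  have e1 : (1 : ℂ) + -(τ : ℂ)⁻¹ = (τ - 1) / τ := by field_simp; ring
  have e2 : (-1 : ℂ) + τ = τ - 1 := by ring
  rw [e1, e2]
  field_simp
  ring

/-- A holomorphic function of weight zero on `Γ₀(3)` that vanishes at the cusps is zero. -/
lemma eq_zero_of_conj_three {f g : ℍ → ℂ} (hf : MDiff f) (hT : ∀ τ : ℍ, f ((1 : ℝ) +ᵥ τ) = f τ)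
    (hS : ∀ τ : ℍ, f (S • τ) = g τ) (hTT : ∀ τ : ℍ, g ((3 : ℝ) +ᵥ τ) = g τ)
    (hL : Tendsto f atImInfty (𝓝 0)) (hL' : Tendsto g atImInfty (𝓝 0)) : f = 0 := by
  have hg : MDiff g := by
    rw [show g = f ∣[(0 : ℤ)] S from funext fun τ => by rw [slash_zero_S_apply, hS]]
    exact hf.slash 0 _
  set g1 : ℍ → ℂ := fun τ => g ((1 : ℝ) +ᵥ τ) with hg1
  set g2 : ℍ → ℂ := fun τ => g ((2 : ℝ) +ᵥ τ) with hg2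
  have d1 : MDiff g1 := by
    rw [show g1 = g ∣[(0 : ℤ)] T from funext fun τ => by rw [slash_T_apply]]
    exact hg.slash 0 _
  have d2 : MDiff g2 := by
    rw [show g2 = g1 ∣[(0 : ℤ)] T from funext fun τ => by
      rw [slash_T_apply, hg1, hg2]; dsimp only; rw [vadd_vadd]; norm_num]
    exact d1.slash 0 _
  have hf' : ∀ τ : ℍ, f ((-1 : ℝ) +ᵥ τ) = f τ := fun τ => by
    rw [← hT ((-1 : ℝ) +ᵥ τ), vadd_vadd]; norm_num
  have hm1 : ∀ τ : ℍ, g ((-1 : ℝ) +ᵥ τ) = g2 τ := fun τ => by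
    rw [← hTT ((-1 : ℝ) +ᵥ τ), vadd_vadd, hg2]; norm_num
  have s0 : ∀ τ : ℍ, g (S • τ) = f τ := fun τ => by rw [← hS, S_smul_S_smul]
  have s1 : ∀ τ : ℍ, g1 (S • τ) = g2 τ := fun τ => by
    rw [hg1]; dsimp only
    rw [← hS, S_smul_vadd_S_smul, hf', hS, hm1]
  have s2 : ∀ τ : ℍ, g2 (S • τ) = g1 τ := fun τ => by
    rw [← s1, S_smul_S_smul]
  have t0 : ∀ τ : ℍ, g ((1 : ℝ) +ᵥ τ) = g1 τ := fun τ => rfl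
  have t1 : ∀ τ : ℍ, g1 ((1 : ℝ) +ᵥ τ) = g2 τ := fun τ => by
    rw [hg1, hg2]; dsimp only; rw [vadd_vadd]; norm_num
  have t2 : ∀ τ : ℍ, g2 ((1 : ℝ) +ᵥ τ) = g τ := fun τ => by
    rw [← hTT, hg2]; dsimp only; rw [vadd_vadd]; norm_num
  have hl1 : Tendsto g1 atImInfty (𝓝 0) := hL'.comp (tendsto_vadd 1)
  have hl2 : Tendsto g2 atImInfty (𝓝 0) := hL'.comp (tendsto_vadd 2)
  -- The product of `c - h` over the four conjugates `h` of `f` is a function of level one with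
  -- limit `c⁴`, so it equals `c⁴`. Taking `c = f τ` makes one factor zero, whence `f τ ^ 4 = 0`.
  have key : ∀ c : ℂ,
      (fun τ => (c - f τ) * (c - g τ) * (c - g1 τ) * (c - g2 τ) - c ^ 4) = 0 := by
    intro c
    have hc (h : ℍ → ℂ) (hh : MDiff h) : MDiff (fun τ => c - h τ) := mdifferentiable_const.sub hh
    refine eq_zero_of_tendsto_zero (k := 0) ((((((hc f hf).mul (hc g hg)).mul (hc g1 d1)).mul
      (hc g2 d2))).sub mdifferentiable_const) (fun τ => ?_) (fun τ => ?_) ?_ (by norm_num)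
    · simp only [hS, s0, s1, s2]; rw [zpow_zero]; ring
    · simp only [hT, t0, t1, t2]; ring
    · have := ((((hL.const_sub c).mul (hL'.const_sub c)).mul (hl1.const_sub c)).mul
        (hl2.const_sub c)).sub_const (c ^ 4)
      refine tendsto_of_eq this (fun τ => rfl) (by ring)
  funext τ
  have := congrFun (key (f τ)) τ
  simpa using this

lemma Delta3_eq (τ : ℍ) : Delta3 τ = dedekindEta (scale 3 τ) ^ 3 / dedekindEta τ := by
  rw [Delta3, etaMul_eq three_pos]; norm_num

lemma Delta3_ne_zero (τ : ℍ) : Delta3 τ ≠ 0 := by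
  rw [Delta3_eq]
  exact div_ne_zero (pow_ne_zero _ (dedekindEta_ne_zero _)) (dedekindEta_ne_zero _)

lemma mdifferentiable_Delta3 : MDiff Delta3 := by
  rw [funext Delta3_eq]
  exact (mdifferentiable_pow (mdifferentiable_comp_scale three_pos mdifferentiable_dedekindEta) 3).div
    mdifferentiable_dedekindEta fun τ => dedekindEta_ne_zero _

lemma tendsto_Delta3 : Tendsto (fun τ => qpow (-(1 / 3)) τ * Delta3 τ) atImInfty (𝓝 1) := by
  have := ((tendsto_dedekindEta_scale three_pos).pow 3).div tendsto_dedekindEta (by simp)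
  simp only [one_pow, div_one] at this
  refine this.congr fun τ => ?_
  simp only [Pi.div_apply]
  rw [Delta3_eq, mul_pow, ← qpow_nat_mul, mul_div_mul_comm, div_eq_mul_inv,
    ← qpow_neg, ← qpow_add]
  congr 2
  push_cast; ring

lemma Delta3_T (τ : ℍ) : Delta3 ((1 : ℝ) +ᵥ τ) = omega3 * Delta3 τ := by
  have h3 := dedekindEta_vadd_nat 3 (scale 3 τ)
  rw [Delta3_eq, Delta3_eq, scale_vadd three_pos, mul_one, dedekindEta_T]
  push_cast at h3
  rw [h3, mul_pow, ← Complex.exp_nat_mul, mul_div_mul_comm, ← Complex.exp_sub, omega3]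
  congr 2
  push_cast; ring

/-- The square of the transform of `Δ₃` under `S`. -/
lemma Delta3_S_sq (τ : ℍ) : Delta3 (S • τ) ^ 2 =
    -(τ : ℂ) ^ 2 / 27 * (dedekindEta (scale (1 / 3) τ) ^ 3 / dedekindEta τ) ^ 2 := by
  have h0 := dedekindEta_ne_zero τ
  have hτ := τ.ne_zero
  have e1 := dedekindEta_S_sq (scale (1 / 3) τ)
  have e2 := dedekindEta_S_sq τ
  rw [Delta3_eq, scale_S three_pos, show (3 : ℝ)⁻¹ = 1 / 3 by norm_num, div_pow, ← pow_mul,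
    mul_comm 3 2, pow_mul, e1, e2, coe_scale (by norm_num)]
  push_cast
  field_simp
  linear_combination 27 * dedekindEta (scale (1 / 3) τ) ^ 6 * Complex.I_sq

lemma tendsto_eta_third :
    Tendsto (fun τ => dedekindEta (scale (1 / 3) τ) ^ 3 / dedekindEta τ) atImInfty (𝓝 1) := by
  have := ((tendsto_dedekindEta_scale (c := 1 / 3) (by norm_num)).pow 3).div tendsto_dedekindEta
    (by simp)
  simp only [one_pow, div_one] at this
  refine this.congr fun τ => ?_
  simp only [Pi.div_apply]
  rw [mul_pow, ← qpow_nat_mul, mul_div_mul_comm, div_eq_mul_inv, ← qpow_neg, ← qpow_add,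
    show ((3 : ℕ) : ℂ) * -(((1 / 3 : ℝ) : ℂ) / 24) + -(-(1 / 24)) = 0 by push_cast; ring, qpow_zero,
    one_mul]

/-- If a product of holomorphic functions vanishes and one of them has a nonzero limit, then the
other one vanishes. -/
lemma eq_zero_of_mul_eq_zero_of_tendsto {f g : ℍ → ℂ} {L : ℂ} (hf : MDiff f) (hg : MDiff g)
    (h : ∀ τ, f τ * g τ = 0) (hL : Tendsto g atImInfty (𝓝 L)) (hL0 : L ≠ 0) : f = 0 := by
  rcases eq_zero_or_eq_zero_of_mul hf hg h with h1 | h1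
  · exact h1
  · rw [h1] at hL
    exact absurd (tendsto_nhds_unique hL tendsto_const_nhds) hL0

/-- The quotient `h` is `T`-invariant and tends to 1. For an even power of `h` the transform under
`S` is known from `Delta3_S_sq` without choosing a square root, and it tends to 1 as well; so `h⁶ -
1` vanishes at both cusps and is zero. The limit of `h` then selects the factor `h - 1` of `h⁶ - 1`.
-/
theorem deltaI3_eq_Delta3 : deltaI3 = Delta3 := by
  set h : ℍ → ℂ := fun τ => deltaI3 τ / Delta3 τ with hh
  have hd : MDiff h := mdifferentiable_deltaI3.div mdifferentiable_Delta3 Delta3_ne_zero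
  have hlim : Tendsto h atImInfty (𝓝 1) := by
    refine tendsto_of_eq (tendsto_deltaI3.div tendsto_Delta3 one_ne_zero) (fun τ => ?_) (div_one 1)
    exact mul_div_mul_left _ _ (qpow_ne_zero _ _)
  have hhT : ∀ τ : ℍ, h ((1 : ℝ) +ᵥ τ) = h τ := fun τ => by
    rw [hh]; dsimp only
    rw [deltaI3_T, Delta3_T, mul_div_mul_left]
    exact Complex.exp_ne_zero _
  have hdelta0 : Tendsto deltaI3 atImInfty (𝓝 0) := by
    refine tendsto_of_eq ((tendsto_qpow_of_pos (r := 1 / 3) (by norm_num)).mul tendsto_deltaI3)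
      (fun τ => ?_) (zero_mul 1)
    rw [← mul_assoc, ← qpow_add]; norm_num
  set g : ℍ → ℂ := fun τ => ((I3 τ - 3 * deltaI3 τ) /
    (dedekindEta (scale (1 / 3) τ) ^ 3 / dedekindEta τ)) ^ 6 - 1 with hg
  have key : (fun τ => h τ ^ 6 - 1) = 0 := by
    refine eq_zero_of_conj_three (g := g) ((mdifferentiable_pow hd 6).sub mdifferentiable_const)
      (fun τ => by rw [hhT]) (fun τ => ?_) (fun τ => ?_) ?_ ?_
    · have e := Delta3_S_sq τ
      have hb : dedekindEta (scale (1 / 3) τ) ^ 3 / dedekindEta τ ≠ 0 :=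
        div_ne_zero (pow_ne_zero _ (dedekindEta_ne_zero _)) (dedekindEta_ne_zero _)
      rw [hh, hg]; dsimp only
      have h6 : ∀ a b : ℂ, (a / b) ^ 6 = (a ^ 2) ^ 3 / (b ^ 2) ^ 3 := fun a b => by
        rw [div_pow]; ring
      rw [h6, e, deltaI3_S]
      set B := dedekindEta (scale (1 / 3) τ) ^ 3 / dedekindEta τ
      have hτ := τ.ne_zero
      have h3 := sqrt_three_ne_zero
      have e2 : (-I * (τ : ℂ) / √3 * ((I3 τ - 3 * deltaI3 τ) / 3)) ^ 2 =
          -(τ : ℂ) ^ 2 / 27 * (I3 τ - 3 * deltaI3 τ) ^ 2 := by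
        rw [mul_pow, div_pow, sqrt_three_sq, mul_pow, neg_pow, Complex.I_sq]; ring
      rw [e2, mul_pow, mul_pow, mul_div_mul_left]
      · rw [div_pow]; ring
      · refine pow_ne_zero _ (div_ne_zero (neg_ne_zero.2 (pow_ne_zero _ hτ)) (by norm_num))
    · rw [hg]; dsimp only
      have hI : I3 ((3 : ℝ) +ᵥ τ) = I3 τ := by
        rw [show (3 : ℝ) +ᵥ τ = (1 : ℝ) +ᵥ ((1 : ℝ) +ᵥ ((1 : ℝ) +ᵥ τ)) by
          rw [vadd_vadd, vadd_vadd]; norm_num, I3_T, I3_T, I3_T]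
      have hD : deltaI3 ((3 : ℝ) +ᵥ τ) = deltaI3 τ := by
        rw [show (3 : ℝ) +ᵥ τ = (1 : ℝ) +ᵥ ((1 : ℝ) +ᵥ ((1 : ℝ) +ᵥ τ)) by
          rw [vadd_vadd, vadd_vadd]; norm_num, deltaI3_T, deltaI3_T, deltaI3_T]
        linear_combination deltaI3 τ * omega3_pow_three
      have hE : dedekindEta (scale (1 / 3) ((3 : ℝ) +ᵥ τ)) ^ 3 / dedekindEta ((3 : ℝ) +ᵥ τ) =
          dedekindEta (scale (1 / 3) τ) ^ 3 / dedekindEta τ := by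
        have h3 := dedekindEta_vadd_nat 3 τ
        push_cast at h3
        rw [scale_vadd (by norm_num), show (1 / 3 : ℝ) * 3 = 1 by norm_num, dedekindEta_T, h3,
          mul_pow, ← Complex.exp_nat_mul, mul_div_mul_comm, ← Complex.exp_sub,
          show ((3 : ℕ) : ℂ) * (2 * π * I * (1 / 24)) - 2 * π * I * (3 / 24) = 0 by push_cast; ring,
          Complex.exp_zero, one_mul]
      rw [hI, hD, hE]
    · exact tendsto_of_eq ((hlim.pow 6).sub_const 1) (fun τ => rfl) (by norm_num)
    · exact tendsto_of_eq ((((tendsto_I3.sub (hdelta0.const_mul 3)).div tendsto_eta_third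
        one_ne_zero).pow 6).sub_const 1) (fun τ => rfl) (by norm_num)
  have key' : ∀ τ, h τ ^ 6 - 1 = 0 := congrFun key
  have m3 := mdifferentiable_pow hd 3
  have m2 := mdifferentiable_pow hd 2
  have hcube : h ^ 3 - (fun _ => 1) = 0 :=
    eq_zero_of_mul_eq_zero_of_tendsto (m3.sub (mdifferentiable_const (c := (1 : ℂ))))
      (m3.add (mdifferentiable_const (c := (1 : ℂ)))) (fun τ => by
        change (h τ ^ 3 - 1) * (h τ ^ 3 + 1) = 0
        linear_combination key' τ) ((hlim.pow 3).add_const 1) (by norm_num)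
  have hone : h - (fun _ => 1) = 0 :=
    eq_zero_of_mul_eq_zero_of_tendsto (hd.sub (mdifferentiable_const (c := (1 : ℂ))))
      ((m2.add hd).add (mdifferentiable_const (c := (1 : ℂ)))) (fun τ => by
        have e : h τ ^ 3 - 1 = 0 := congrFun hcube τ
        change (h τ - 1) * (h τ ^ 2 + h τ + 1) = 0
        linear_combination e) (((hlim.pow 2).add hlim).add_const 1) (by norm_num)
  funext τ
  have : h τ - 1 = 0 := congrFun hone τ
  rw [hh] at this; dsimp only at this
  rw [sub_eq_zero, div_eq_one_iff_eq (Delta3_ne_zero τ)] at this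
  exact this

lemma hasQExpansion_Delta3 : HasQExpansion Delta3 (1 / 3) (fun n => chi3Sum (3 * n + 1)) :=
  deltaI3_eq_Delta3 ▸ hasQExpansion_deltaI3

lemma I3_S_smul (τ : ℍ) : I3 (S • τ) = -I * τ / √3 * (I3 τ + 6 * Delta3 τ) :=
  deltaI3_eq_Delta3 ▸ I3_S' τ

lemma Delta3_S_smul (τ : ℍ) : Delta3 (S • τ) = -I * τ / √3 * ((I3 τ - 3 * Delta3 τ) / 3) :=
  deltaI3_eq_Delta3 ▸ deltaI3_S τ

end

/-! ### Families of functions permuted modulo 3 -/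

section

open ModularGroup ModularForm
open scoped ModularForm

/-- The orbit of a function on `Γ₀(3)` with character `ε`. -/
def familyThree (k : ℤ) (ε : ℂ) (f g : ℍ → ℂ) (v : Fin 2 → ZMod 3) : ℍ → ℂ :=
  if v = ![0, 1] then f else if v = ![0, 2] then ε • f
  else if v = ![1, 0] then g else if v = ![1, 1] then g ∣[k] T
  else if v = ![1, 2] then (g ∣[k] T) ∣[k] T
  else if v = ![2, 0] then ε • g else if v = ![2, 2] then ε • (g ∣[k] T)
  else if v = ![2, 1] then ε • ((g ∣[k] T) ∣[k] T) else 0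

section FamilyThree

variable {k : ℤ} {ε : ℂ} {f g : ℍ → ℂ}

/-- Again `S T S = T⁻¹ S T⁻¹`; now `T⁻¹` acts on `g` as `T²`. -/
lemma slash_T_slash_S_three (hT : f ∣[k] T = f) (hS : f ∣[k] S = g)
    (hTT : ((g ∣[k] T) ∣[k] T) ∣[k] T = g) : (g ∣[k] T) ∣[k] S = (g ∣[k] T) ∣[k] T := by
  have e : S * (T * S) = T⁻¹ * S * T⁻¹ := by decide
  have h1 : (g ∣[k] T) ∣[k] S = g ∣[k] T⁻¹ := by
    rw [← hS, ← SlashAction.slash_mul, ← SlashAction.slash_mul, e]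
    simp only [SlashAction.slash_mul]
    rw [slash_T_inv hT, hS]
  rw [h1]
  conv_lhs => rw [← hTT, ← SlashAction.slash_mul, mul_inv_cancel, SlashAction.slash_one]

lemma slash_T_T_slash_S_three (hT : f ∣[k] T = f) (hS : f ∣[k] S = g)
    (hSS : g ∣[k] S = ε • f) (hTT : ((g ∣[k] T) ∣[k] T) ∣[k] T = g) :
    ((g ∣[k] T) ∣[k] T) ∣[k] S = ε • (g ∣[k] T) := by
  rw [← slash_T_slash_S_three hT hS hTT, ← SlashAction.slash_mul]
  have hneg : ∀ h : ℍ → ℂ, h ∣[k] (S * S) = (-1 : ℂ) ^ k • h := by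
    intro h
    rw [show S * S = -1 by decide]
    funext τ
    rw [SL_slash_apply, ModularGroup.denom_apply, ModularGroup.SL_neg_smul, one_smul, zpow_neg,
      ← inv_zpow, mul_comm]
    simp
  have h1 : f ∣[k] (S * S) = ε • f := by rw [SlashAction.slash_mul, hS, hSS]
  rw [hneg] at h1 ⊢
  -- `S² = -1` acts on all functions by `(-1) ^ k`, and on `f` by `ε`; the two scalars agree if `f`
  -- is nonzero.
  have h2 : ∀ h : ℍ → ℂ, ((f ≠ 0) → (-1 : ℂ) ^ k • h = ε • h) := by
    intro h hf
    obtain ⟨τ, hτ⟩ := Function.ne_iff.1 hf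
    have := congrFun h1 τ
    simp only [Pi.smul_apply, smul_eq_mul] at this
    rw [mul_right_cancel₀ hτ this]
  by_cases hf : f = 0
  · have : g = 0 := by rw [← hS, hf, SlashAction.zero_slash]
    simp [this]
  · exact h2 _ hf

/-- The members are labelled by bottom rows modulo 3, and opposite rows differ by the factor `ε`. In
odd weight `ε = -1`, which is why `I₃` and `Δ₃` need all eight nonzero rows rather than four. -/
lemma familyThree_slash (hε : ε * ε = 1) (hT : f ∣[k] T = f) (hS : f ∣[k] S = g)
    (hSS : g ∣[k] S = ε • f) (hTT : ((g ∣[k] T) ∣[k] T) ∣[k] T = g) (γ : SL(2, ℤ))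
    (v : Fin 2 → ZMod 3) :
    familyThree k ε f g v ∣[k] γ = familyThree k ε f g (Matrix.vecMul v (redMod 3 γ)) := by
  have hST := slash_T_slash_S_three hT hS hTT
  have hSTT := slash_T_T_slash_S_three hT hS hSS hTT
  have hv : ∀ v : Fin 2 → ZMod 3, v = 0 ∨ v = ![0, 1] ∨ v = ![0, 2] ∨ v = ![1, 0] ∨ v = ![1, 1] ∨
    v = ![1, 2] ∨ v = ![2, 0] ∨ v = ![2, 2] ∨ v = ![2, 1] := by decide
  have v0 : familyThree k ε f g 0 = 0 := by
    rw [familyThree]; repeat rw [if_neg (by decide)]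
  have v1 : familyThree k ε f g ![0, 1] = f := by rw [familyThree, if_pos rfl]
  have v2 : familyThree k ε f g ![0, 2] = ε • f := by
    rw [familyThree, if_neg (by decide), if_pos rfl]
  have v3 : familyThree k ε f g ![1, 0] = g := by
    rw [familyThree]; repeat rw [if_neg (by decide)]
    rw [if_pos rfl]
  have v4 : familyThree k ε f g ![1, 1] = g ∣[k] T := by
    rw [familyThree]; repeat rw [if_neg (by decide)]
    rw [if_pos rfl]
  have v5 : familyThree k ε f g ![1, 2] = (g ∣[k] T) ∣[k] T := by
    rw [familyThree]; repeat rw [if_neg (by decide)]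
    rw [if_pos rfl]
  have v6 : familyThree k ε f g ![2, 0] = ε • g := by
    rw [familyThree]; repeat rw [if_neg (by decide)]
    rw [if_pos rfl]
  have v7 : familyThree k ε f g ![2, 2] = ε • (g ∣[k] T) := by
    rw [familyThree]; repeat rw [if_neg (by decide)]
    rw [if_pos rfl]
  have v8 : familyThree k ε f g ![2, 1] = ε • ((g ∣[k] T) ∣[k] T) := by
    rw [familyThree]; repeat rw [if_neg (by decide)]
    rw [if_pos rfl]
  have hεε : ∀ h : ℍ → ℂ, ε • ε • h = h := fun h => by rw [smul_smul, hε, one_smul]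
  refine slash_family (fun v => ?_) (fun v => ?_) γ v
  · rcases hv v with rfl | rfl | rfl | rfl | rfl | rfl | rfl | rfl | rfl
    · rw [Matrix.zero_vecMul, v0, SlashAction.zero_slash]
    · rw [show Matrix.vecMul ![0, 1] (redMod 3 S) = ![1, 0] by decide, v1, v3, hS]
    · rw [show Matrix.vecMul ![0, 2] (redMod 3 S) = ![2, 0] by decide, v2, v6, SL_smul_slash, hS]
    · rw [show Matrix.vecMul ![1, 0] (redMod 3 S) = ![0, 2] by decide, v3, v2, hSS]
    · rw [show Matrix.vecMul ![1, 1] (redMod 3 S) = ![1, 2] by decide, v4, v5, hST]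
    · rw [show Matrix.vecMul ![1, 2] (redMod 3 S) = ![2, 2] by decide, v5, v7, hSTT]
    · rw [show Matrix.vecMul ![2, 0] (redMod 3 S) = ![0, 1] by decide, v6, v1, SL_smul_slash, hSS,
        hεε]
    · rw [show Matrix.vecMul ![2, 2] (redMod 3 S) = ![2, 1] by decide, v7, v8, SL_smul_slash, hST]
    · rw [show Matrix.vecMul ![2, 1] (redMod 3 S) = ![1, 1] by decide, v8, v4, SL_smul_slash, hSTT,
        hεε]
  · rcases hv v with rfl | rfl | rfl | rfl | rfl | rfl | rfl | rfl | rfl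
    · rw [Matrix.zero_vecMul, v0, SlashAction.zero_slash]
    · rw [show Matrix.vecMul ![0, 1] (redMod 3 T) = ![0, 1] by decide, v1, hT]
    · rw [show Matrix.vecMul ![0, 2] (redMod 3 T) = ![0, 2] by decide, v2, SL_smul_slash, hT]
    · rw [show Matrix.vecMul ![1, 0] (redMod 3 T) = ![1, 1] by decide, v3, v4]
    · rw [show Matrix.vecMul ![1, 1] (redMod 3 T) = ![1, 2] by decide, v4, v5]
    · rw [show Matrix.vecMul ![1, 2] (redMod 3 T) = ![1, 0] by decide, v5, v3, hTT]
    · rw [show Matrix.vecMul ![2, 0] (redMod 3 T) = ![2, 2] by decide, v6, v7, SL_smul_slash]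
    · rw [show Matrix.vecMul ![2, 2] (redMod 3 T) = ![2, 1] by decide, v7, v8, SL_smul_slash]
    · rw [show Matrix.vecMul ![2, 1] (redMod 3 T) = ![2, 0] by decide, v8, v6, SL_smul_slash, hTT]

lemma familyThree_cases {P : (ℍ → ℂ) → Prop} (h0 : P 0) (hf : P f) (hg : P g)
    (hT : ∀ h, P h → P (h ∣[k] T)) (hε : ∀ h, P h → P (ε • h)) (v : Fin 2 → ZMod 3) :
    P (familyThree k ε f g v) := by
  unfold familyThree
  split_ifs
  exacts [hf, hε _ hf, hg, hT _ hg, hT _ (hT _ hg), hε _ hg, hε _ (hT _ hg), hε _ (hT _ (hT _ hg)),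
    h0]

lemma familyThree_zero_one : familyThree k ε f g ![0, 1] = f := by simp [familyThree]

end FamilyThree

lemma isBoundedAtImInfty_slash_T {f : ℍ → ℂ} {k : ℤ} (h : IsBoundedAtImInfty f) :
    IsBoundedAtImInfty (f ∣[k] T) := by
  rw [show f ∣[k] T = f ∘ (fun τ : ℍ => (1 : ℝ) +ᵥ τ) from funext fun τ => slash_T_apply _ _ _]
  exact h.comp_tendsto (tendsto_vadd 1)

/-! ### `I₃` and `Δ₃` as modular forms -/

/-- The transform of `I₃` under `S`. -/
def I3S (τ : ℍ) : ℂ := -I / √3 * (I3 τ + 6 * Delta3 τ)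

lemma I3_slash_S : I3 ∣[(1 : ℤ)] S = I3S := slash_S_eq_smul_iff.2 fun τ => by
  rw [I3_S_smul, I3S, zpow_one]; ring

lemma I3_slash_T : I3 ∣[(1 : ℤ)] T = I3 := slash_T_eq_iff.2 I3_T

lemma I_div_sqrt_three_sq : (-I / √3 : ℂ) ^ 2 = -1 / 3 := by
  rw [div_pow, neg_sq, Complex.I_sq, sqrt_three_sq]

lemma I3S_slash_S : I3S ∣[(1 : ℤ)] S = (-1 : ℂ) • I3 := by
  funext τ
  rw [slash_S_apply, I3S, I3_S_smul, Delta3_S_smul]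
  have := τ.ne_zero
  simp only [Pi.smul_apply, smul_eq_mul, zpow_neg, zpow_one]
  field_simp
  linear_combination 9 * I3 τ * Complex.I_sq + 3 * I3 τ * sqrt_three_sq

lemma I3S_slash_T : I3S ∣[(1 : ℤ)] T = fun τ => -I / √3 * (I3 τ + 6 * omega3 * Delta3 τ) := by
  funext τ
  rw [slash_T_apply, I3S, I3_T, Delta3_T]; ring

lemma I3S_slash_T_T :
    ((I3S ∣[(1 : ℤ)] T) ∣[(1 : ℤ)] T) = fun τ => -I / √3 * (I3 τ + 6 * omega3 ^ 2 * Delta3 τ) := by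
  funext τ
  rw [slash_T_apply, I3S_slash_T]; dsimp only; rw [I3_T, Delta3_T]; ring

lemma I3S_slash_T_T_T : ((I3S ∣[(1 : ℤ)] T) ∣[(1 : ℤ)] T) ∣[(1 : ℤ)] T = I3S := by
  funext τ
  rw [slash_T_apply, I3S_slash_T_T]; dsimp only; rw [I3_T, Delta3_T, I3S]
  linear_combination (-I / √3 * 6 * Delta3 τ) * omega3_pow_three

lemma I3_slash (γ : SL(2, ℤ)) (v : Fin 2 → ZMod 3) : familyThree 1 (-1) I3 I3S v ∣[(1 : ℤ)] γ =
    familyThree 1 (-1) I3 I3S (Matrix.vecMul v (redMod 3 γ)) :=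
  familyThree_slash (by norm_num) I3_slash_T I3_slash_S I3S_slash_S I3S_slash_T_T_T γ v

lemma tendsto_Delta3_zero : Tendsto Delta3 atImInfty (𝓝 0) := by
  refine tendsto_of_eq ((tendsto_qpow_of_pos (r := 1 / 3) (by norm_num)).mul tendsto_Delta3)
    (fun τ => ?_) (zero_mul 1)
  rw [← mul_assoc, ← qpow_add]; norm_num

lemma tendsto_I3S : Tendsto I3S atImInfty (𝓝 (-I / √3 * (1 + 6 * 0))) :=
  (tendsto_I3.add (tendsto_Delta3_zero.const_mul 6)).const_mul _

lemma isBoundedAtImInfty_family_I3 (v : Fin 2 → ZMod 3) :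
    IsBoundedAtImInfty (familyThree 1 (-1) I3 I3S v) :=
  familyThree_cases (P := IsBoundedAtImInfty)
    ((tendsto_const_nhds (x := (0 : ℂ))).isBigO_one ℝ) (tendsto_I3.isBigO_one ℝ)
    (tendsto_I3S.isBigO_one ℝ) (fun _ h => isBoundedAtImInfty_slash_T h)
    (fun _ h => Asymptotics.IsBigO.const_smul_left h _) v

lemma I3_slash_of_mem {γ : SL(2, ℤ)} (hγ : γ ∈ Γ(3)) : I3 ∣[(1 : ℤ)] γ = I3 := by
  have := I3_slash γ ![0, 1]
  rwa [redMod_eq_one hγ, Matrix.vecMul_one, familyThree_zero_one] at this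

theorem exists_modularForm_I3 : ∃ F : ModularForm Γ(3) 1, ⇑F = I3 := by
  refine exists_modularForm mdifferentiable_I3 (fun γ hγ => I3_slash_of_mem hγ) fun γ => ?_
  have := I3_slash γ ![0, 1]
  rw [familyThree_zero_one] at this
  rw [this]
  exact isBoundedAtImInfty_family_I3 _

/-- The factor expressing `Δ₃` through the orbit of `I₃`. -/
def factorThree : ℂ := (-I / √3 * (6 * (omega3 - 1)))⁻¹

lemma Delta3_eq_family : Delta3 = factorThree • (familyThree 1 (-1) I3 I3S ![1, 1] -
    familyThree 1 (-1) I3 I3S ![1, 0]) := by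
  funext τ
  have h1 : familyThree 1 (-1) I3 I3S ![1, 1] = I3S ∣[(1 : ℤ)] T := by
    rw [familyThree]; repeat rw [if_neg (by decide)]
    rw [if_pos rfl]
  have h2 : familyThree 1 (-1) I3 I3S ![1, 0] = I3S := by
    rw [familyThree]; repeat rw [if_neg (by decide)]
    rw [if_pos rfl]
  have hω : omega3 - 1 ≠ 0 := fun h => omega3_sq_ne_one (by rw [sub_eq_zero.1 h, one_pow])
  have hne : -I / √3 * (6 * (omega3 - 1)) ≠ 0 :=
    mul_ne_zero (div_ne_zero (neg_ne_zero.2 Complex.I_ne_zero) sqrt_three_ne_zero)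
      (mul_ne_zero (by norm_num) hω)
  rw [h1, h2, I3S_slash_T]
  simp only [Pi.smul_apply, Pi.sub_apply, smul_eq_mul, I3S, factorThree]
  rw [eq_inv_mul_iff_mul_eq₀ hne]
  ring

lemma Delta3_slash (γ : SL(2, ℤ)) : Delta3 ∣[(1 : ℤ)] γ = factorThree •
    (familyThree 1 (-1) I3 I3S (Matrix.vecMul ![1, 1] (redMod 3 γ)) -
      familyThree 1 (-1) I3 I3S (Matrix.vecMul ![1, 0] (redMod 3 γ))) := by
  conv_lhs => rw [Delta3_eq_family]
  rw [SL_smul_slash, sub_eq_add_neg, SlashAction.add_slash, SlashAction.neg_slash, I3_slash, I3_slash,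
    ← sub_eq_add_neg]

lemma Delta3_slash_of_mem {γ : SL(2, ℤ)} (hγ : γ ∈ Γ(3)) : Delta3 ∣[(1 : ℤ)] γ = Delta3 := by
  rw [Delta3_slash, redMod_eq_one hγ, Matrix.vecMul_one, Matrix.vecMul_one, ← Delta3_eq_family]

theorem exists_modularForm_Delta3 : ∃ F : ModularForm Γ(3) 1, ⇑F = Delta3 := by
  refine exists_modularForm mdifferentiable_Delta3 (fun γ hγ => Delta3_slash_of_mem hγ) fun γ => ?_
  rw [Delta3_slash]
  have := (isBoundedAtImInfty_family_I3 (Matrix.vecMul ![1, 1] (redMod 3 γ))).sub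
    (isBoundedAtImInfty_family_I3 (Matrix.vecMul ![1, 0] (redMod 3 γ)))
  exact Asymptotics.IsBigO.const_smul_left this _

lemma Delta3A_eq (τ : ℍ) : Delta3A τ = dedekindEta τ ^ 8 * Delta3 τ ^ 2 := by
  have := dedekindEta_ne_zero τ
  rw [Delta3A, Delta3]
  field_simp

lemma dedekindEta_T_pow_eight (τ : ℍ) :
    dedekindEta ((1 : ℝ) +ᵥ τ) ^ 8 = omega3 * dedekindEta τ ^ 8 := by
  rw [dedekindEta_T_pow, omega3]; congr 2; push_cast; ring

theorem exists_cuspForm_Delta3A :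
    ∃ F : CuspForm (CongruenceSubgroup.Gamma0 3) 6, ⇑F = Delta3A := by
  set g : ℍ → ℂ := fun τ => -(1 / 27) * (dedekindEta τ ^ 8 * (I3 τ - 3 * Delta3 τ) ^ 2) with hg
  have h27 : ∀ t x : ℂ, (-I * t / √3 * x) ^ 2 = -t ^ 2 / 3 * x ^ 2 := fun t x => by
    rw [show -I * t / √3 * x = (-I / √3) * (t * x) by ring, mul_pow, I_div_sqrt_three_sq]; ring
  have hS : Delta3A ∣[(6 : ℤ)] S = g := slash_S_eq_smul_iff.2 fun τ => by
    rw [Delta3A_eq, dedekindEta_S_pow_eight, Delta3_S_smul, h27]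
    simp only [hg]
    norm_cast
    ring
  have hSS : g ∣[(6 : ℤ)] S = (1 : ℂ) • Delta3A := slash_S_eq_smul_iff.2 fun τ => by
    simp only [hg]
    rw [dedekindEta_S_pow_eight, I3_S_smul, Delta3_S_smul,
      show -I * τ / √3 * (I3 τ + 6 * Delta3 τ) - 3 * (-I * τ / √3 * ((I3 τ - 3 * Delta3 τ) / 3)) =
        -I * τ / √3 * (9 * Delta3 τ) by ring, h27, one_smul, Delta3A_eq]
    norm_cast
    ring
  have hT : Delta3A ∣[(6 : ℤ)] T = Delta3A := slash_T_eq_iff.2 fun τ => by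
    rw [Delta3A_eq, Delta3A_eq, dedekindEta_T_pow_eight, Delta3_T]
    linear_combination dedekindEta τ ^ 8 * Delta3 τ ^ 2 * omega3_pow_three
  have hTT : ((g ∣[(6 : ℤ)] T) ∣[(6 : ℤ)] T) ∣[(6 : ℤ)] T = g := by
    funext τ
    simp only [slash_T_apply, hg, dedekindEta_T_pow_eight, I3_T, Delta3_T]
    have e : omega3 * (omega3 * (omega3 * Delta3 τ)) = Delta3 τ := by
      linear_combination Delta3 τ * omega3_pow_three
    rw [e]
    linear_combination (-(1 / 27) * (dedekindEta τ ^ 8 * (I3 τ - 3 * Delta3 τ) ^ 2)) *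
      omega3_pow_three
  have key := familyThree_slash (one_mul 1) hT hS hSS hTT
  have hlim : Tendsto Delta3A atImInfty (𝓝 0) :=
    tendsto_of_eq ((tendsto_dedekindEta_zero.pow 8).mul (tendsto_Delta3_zero.pow 2))
      (fun τ => (Delta3A_eq τ).symm) (by simp)
  have hlimg : Tendsto g atImInfty (𝓝 0) :=
    tendsto_of_eq (((tendsto_dedekindEta_zero.pow 8).mul
      ((tendsto_I3.sub (tendsto_Delta3_zero.const_mul 3)).pow 2)).const_mul (-(1 / 27)))
      (fun τ => rfl) (by simp)
  have hd : MDiff Delta3A := by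
    rw [funext Delta3A_eq]
    exact (mdifferentiable_pow mdifferentiable_dedekindEta 8).mul
      (mdifferentiable_pow mdifferentiable_Delta3 2)
  refine exists_cuspForm hd (fun γ hγ => ?_) fun γ => ?_
  · have h := key γ ![0, 1]
    rw [familyThree_zero_one] at h
    rw [h]
    have hγ' : redMod 3 γ 1 0 = 0 := CongruenceSubgroup.Gamma0_mem.1 hγ
    have hdet : (redMod 3 γ).det = 1 := (Matrix.SpecialLinearGroup.map (Int.castRingHom (ZMod 3)) γ).2
    -- The bottom row is `(0, ±1)`, and in weight 6 the sign is harmless because `ε = 1`.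
    have h11 : redMod 3 γ 1 1 = 1 ∨ redMod 3 γ 1 1 = 2 := by
      rw [Matrix.det_fin_two, hγ', mul_zero, sub_zero] at hdet
      revert hdet
      generalize redMod 3 γ 0 0 = a
      generalize redMod 3 γ 1 1 = b
      revert a b; decide
    rcases h11 with h11 | h11
    · have : Matrix.vecMul ![0, 1] (redMod 3 γ) = ![0, 1] := by
        funext i
        fin_cases i <;> simp [Matrix.vecMul, dotProduct, Fin.sum_univ_two, hγ', h11]
      rw [this, familyThree_zero_one]
    · have : Matrix.vecMul ![0, 1] (redMod 3 γ) = ![0, 2] := by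
        funext i
        fin_cases i <;> simp [Matrix.vecMul, dotProduct, Fin.sum_univ_two, hγ', h11]
      rw [this, familyThree, if_neg (by decide), if_pos rfl, one_smul]
  · have h := key γ ![0, 1]
    rw [familyThree_zero_one] at h
    rw [h]
    refine familyThree_cases (P := IsZeroAtImInfty) tendsto_const_nhds hlim hlimg (fun f hf => ?_)
      (fun f hf => by rwa [one_smul]) _
    rw [show f ∣[(6 : ℤ)] T = f ∘ (fun τ : ℍ => (1 : ℝ) +ᵥ τ) from
      funext fun τ => (slash_T_apply _ _ _)]
    exact hf.comp (tendsto_vadd 1)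

end

section

open ModularGroup ModularForm
open scoped ModularForm

/-! ### Characters of powers of the eta function -/

lemma det_redMod (N : ℕ) (γ : SL(2, ℤ)) : (redMod N γ).det = 1 :=
  (Matrix.SpecialLinearGroup.map (Int.castRingHom (ZMod N)) γ).2

lemma redMod_S (N : ℕ) : redMod N S = !![0, -1; 1, 0] := by
  ext i j; fin_cases i <;> fin_cases j <;> simp [redMod, coe_S]

lemma redMod_T (N : ℕ) : redMod N T = !![1, 1; 0, 1] := by
  ext i j; fin_cases i <;> fin_cases j <;> simp [redMod, coe_T]

/-- A function on which `S` and `T` act by scalars transforms under the modular group by any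
function of the residue class that is compatible with these scalars. -/
lemma slash_character {N : ℕ} {k : ℤ} {f : ℍ → ℂ} {s t : ℂ}
    {F : Matrix (Fin 2) (Fin 2) (ZMod N) → ℂ} (hs : s ≠ 0) (ht : t ≠ 0)
    (hS : f ∣[k] S = s • f) (hT : f ∣[k] T = t • f) (h1 : F 1 = 1)
    (FS : ∀ A, A.det = 1 → F (A * redMod N S) = F A * s)
    (FT : ∀ A, A.det = 1 → F (A * redMod N T) = F A * t) (γ : SL(2, ℤ)) :
    f ∣[k] γ = F (redMod N γ) • f := by
  have hmem : γ ∈ Subgroup.closure ({S, T} : Set SL(2, ℤ)) := by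
    rw [SpecialLinearGroup.SL2Z_generators]; trivial
  have key : ∀ y ∈ ({S, T} : Set SL(2, ℤ)), ∃ c : ℂ, c ≠ 0 ∧ f ∣[k] y = c • f ∧
      ∀ A, A.det = 1 → F (A * redMod N y) = F A * c := by
    rintro y (rfl | rfl)
    · exact ⟨s, hs, hS, FS⟩
    · exact ⟨t, ht, hT, FT⟩
  induction hmem using Subgroup.closure_induction_right with
  | one => rw [SlashAction.slash_one, redMod_one, h1, one_smul]
  | mul_right x _ y hy ih =>
    obtain ⟨c, -, hc, hF⟩ := key y hy
    rw [SlashAction.slash_mul, ih, SL_smul_slash, hc, redMod_mul, hF _ (det_redMod N x), smul_smul]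
  | mul_inv_cancel x _ y hy ih =>
    obtain ⟨c, hc0, hc, hF⟩ := key y hy
    have h2 := hF (redMod N (x * y⁻¹)) (det_redMod N _)
    rw [← redMod_mul, inv_mul_cancel_right] at h2
    have h3 : f ∣[k] y⁻¹ = c⁻¹ • f := by
      have : (c⁻¹ • f) ∣[k] y = f := by rw [SL_smul_slash, hc, smul_smul, inv_mul_cancel₀ hc0, one_smul]
      conv_lhs => rw [← this, ← SlashAction.slash_mul, mul_inv_cancel, SlashAction.slash_one]
    rw [SlashAction.slash_mul, ih, SL_smul_slash, h3, smul_smul, h2, mul_assoc,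
      mul_inv_cancel₀ hc0, mul_one]

/-- The character `ζ ^ e` on matrices modulo `N`. -/
def charMod {N : ℕ} (ζ : ℂ) (e : ZMod N → ZMod N → ZMod N → ZMod N → ZMod N)
    (A : Matrix (Fin 2) (Fin 2) (ZMod N)) : ℂ := ζ ^ (e (A 0 0) (A 0 1) (A 1 0) (A 1 1)).val

lemma pow_val_add {N : ℕ} [NeZero N] {ζ : ℂ} (hζ : ζ ^ N = 1) (m n : ZMod N) :
    ζ ^ (m + n).val = ζ ^ m.val * ζ ^ n.val := by
  rw [ZMod.val_add, ← pow_add]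
  conv_rhs => rw [← Nat.div_add_mod (m.val + n.val) N, pow_add, pow_mul, hζ, one_pow, one_mul]

/-- If the multiplier of `f` is given by an explicit exponent `e` in the entries modulo `N`, it is
trivial on `Γ(N)`. The equations `eS` and `eT` state compatibility with right multiplication by `S`
and `T`; they concern finitely many residues. -/
lemma slash_eq_self_of_character {N : ℕ} [NeZero N] {k : ℤ} {f : ℍ → ℂ} {ζ : ℂ} (hζ : ζ ^ N = 1)
    (e : ZMod N → ZMod N → ZMod N → ZMod N → ZMod N) (s t : ZMod N)
    (hS : f ∣[k] S = ζ ^ s.val • f) (hT : f ∣[k] T = ζ ^ t.val • f) (h1 : e 1 0 0 1 = 0)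
    (eS : ∀ a b c d : ZMod N, a * d - b * c = 1 → e b (-a) d (-c) = e a b c d + s)
    (eT : ∀ a b c d : ZMod N, a * d - b * c = 1 → e a (a + b) c (c + d) = e a b c d + t)
    {γ : SL(2, ℤ)} (hγ : γ ∈ CongruenceSubgroup.Gamma N) : f ∣[k] γ = f := by
  have hζ0 : ζ ≠ 0 := by
    rintro rfl
    rw [zero_pow (NeZero.ne N)] at hζ
    exact zero_ne_one hζ
  have h := slash_character (F := charMod ζ e) (pow_ne_zero _ hζ0) (pow_ne_zero _ hζ0) hS hT
    (by simp [charMod, h1]) (fun A hA => ?_) (fun A hA => ?_) γ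
  · rw [h, redMod_eq_one hγ]
    simp [charMod, h1]
  · rw [Matrix.det_fin_two] at hA
    have := eS _ _ _ _ hA
    rw [charMod, charMod, ← pow_val_add hζ, ← this]
    simp [redMod_S, Matrix.mul_apply, Fin.sum_univ_two]
  · rw [Matrix.det_fin_two] at hA
    have := eT _ _ _ _ hA
    rw [charMod, charMod, ← pow_val_add hζ, ← this]
    simp [redMod_T, Matrix.mul_apply, Fin.sum_univ_two]

lemma eta_pow_eight_slash {γ : SL(2, ℤ)} (hγ : γ ∈ Γ(3)) :
    (dedekindEta ^ 8) ∣[(4 : ℤ)] γ = dedekindEta ^ 8 := by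
  -- In weight 4, `S` fixes `η⁸` and `T` multiplies it by `omega3`; hence the exponents `0` and `1`.
  refine slash_eq_self_of_character omega3_pow_three
    (fun a b c d => (1 - c ^ 2) * (b * d) + c * (a + d)) 0 1 ?_ ?_ (by decide) (by decide)
    (by decide) hγ
  · refine slash_S_eq_smul_iff.2 fun τ => ?_
    simp only [Pi.pow_apply, Pi.smul_apply, smul_eq_mul]
    rw [dedekindEta_S_pow_eight]
    norm_cast
    simp
  · funext τ
    rw [slash_T_apply]
    have := dedekindEta_T_pow_eight τ
    simpa [ZMod.val_one] using this

lemma eta_pow_six_slash {γ : SL(2, ℤ)} (hγ : γ ∈ Γ(4)) :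
    (dedekindEta ^ 6) ∣[(3 : ℤ)] γ = dedekindEta ^ 6 := by
  refine slash_eq_self_of_character Complex.I_pow_four
    (fun a b c d => (1 - c ^ 2) * (b * d - (c - 1) * d + c - 1) + c * (a + d + 1)) 1 1
    ?_ ?_ (by decide) (by decide) (by decide) hγ
  · refine slash_S_eq_smul_iff.2 fun τ => ?_
    have h : dedekindEta (S • τ) ^ 6 = (-I * τ * dedekindEta τ ^ 2) ^ 3 := by
      rw [show 6 = 2 * 3 by rfl, pow_mul, dedekindEta_S_sq]
    simp only [Pi.pow_apply, Pi.smul_apply, smul_eq_mul, h]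
    norm_cast
    rw [show ((1 : ZMod 4)).val = 1 by decide]
    linear_combination (-(τ : ℂ) ^ 3 * dedekindEta τ ^ 6 * I) * Complex.I_sq
  · funext τ
    rw [slash_T_apply]
    simp only [Pi.pow_apply, Pi.smul_apply, smul_eq_mul]
    rw [dedekindEta_T_pow, show ((1 : ZMod 4)).val = 1 by decide, pow_one,
      show 2 * π * I * (((6 : ℕ) : ℂ) / 24) = π / 2 * I by push_cast; ring, Complex.exp_pi_div_two_mul_I]

lemma eta_pow_twelve_slash {γ : SL(2, ℤ)} (hγ : γ ∈ Γ(2)) :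
    (dedekindEta ^ 12) ∣[(6 : ℤ)] γ = dedekindEta ^ 12 := by
  refine slash_eq_self_of_character (ζ := -1) (by norm_num)
    (fun a b c d => a + d + b * c + b + c) 1 1 ?_ ?_ (by decide) (by decide) (by decide) hγ
  · refine slash_S_eq_smul_iff.2 fun τ => ?_
    simp only [Pi.pow_apply, Pi.smul_apply, smul_eq_mul]
    rw [dedekindEta_S_pow_twelve]
    norm_cast
    simp [ZMod.val_one]
  · funext τ
    rw [slash_T_apply]
    have := dedekindEta_T_pow_twelve τ
    simpa [ZMod.val_one] using this

lemma Gamma_le {M N : ℕ} (h : M ∣ N) {γ : SL(2, ℤ)} (hγ : γ ∈ CongruenceSubgroup.Gamma N) :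
    γ ∈ CongruenceSubgroup.Gamma M := by
  rw [CongruenceSubgroup.Gamma_mem] at hγ ⊢
  have key : ∀ a b : ℤ, (a : ZMod N) = b → (a : ZMod M) = b := fun a b hab => by
    rw [ZMod.intCast_eq_intCast_iff] at hab ⊢
    exact hab.of_dvd (by exact_mod_cast h)
  obtain ⟨h1, h2, h3, h4⟩ := hγ
  exact ⟨by simpa using key _ 1 (by simpa using h1), by simpa using key _ 0 (by simpa using h2),
    by simpa using key _ 0 (by simpa using h3), by simpa using key _ 1 (by simpa using h4)⟩

/-- This reaches lower powers of eta by division: `η⁴ = η¹² / η⁸` is invariant under `Γ(2) ∩ Γ(3)`,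
which contains `Γ(6)`, and `η² = η⁸ / η⁶` under `Γ(3) ∩ Γ(4)`, which contains `Γ(12)`. -/
lemma slash_eq_of_mul {k l m : ℤ} {f g h : ℍ → ℂ} {γ : SL(2, ℤ)} (hm : k + l = m)
    (hfg : f * g = h) (hg : g ∣[l] γ = g) (hh : h ∣[m] γ = h) (hg0 : ∀ τ, g τ ≠ 0) :
    f ∣[k] γ = f := by
  subst hm hfg
  rw [mul_slash_SL2, hg] at hh
  funext τ
  exact mul_right_cancel₀ (hg0 τ) (congrFun hh τ)

lemma eta_pow_four_slash {γ : SL(2, ℤ)} (hγ : γ ∈ Γ(6)) :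
    (dedekindEta ^ 4) ∣[(2 : ℤ)] γ = dedekindEta ^ 4 :=
  slash_eq_of_mul (g := dedekindEta ^ 8) (h := dedekindEta ^ 12) (l := 4) (m := 6) (by norm_num)
    (by rw [← pow_add]) (eta_pow_eight_slash (Gamma_le (by norm_num) hγ))
    (eta_pow_twelve_slash (Gamma_le (by norm_num) hγ))
    (fun τ => pow_ne_zero 8 (dedekindEta_ne_zero τ))

lemma eta_sq_slash {γ : SL(2, ℤ)} (hγ : γ ∈ Γ(12)) :
    (dedekindEta ^ 2) ∣[(1 : ℤ)] γ = dedekindEta ^ 2 :=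
  slash_eq_of_mul (g := dedekindEta ^ 6) (h := dedekindEta ^ 8) (l := 3) (m := 4) (by norm_num)
    (by rw [← pow_add]) (eta_pow_six_slash (Gamma_le (by norm_num) hγ))
    (eta_pow_eight_slash (Gamma_le (by norm_num) hγ)) (fun τ => pow_ne_zero 6 (dedekindEta_ne_zero τ))

end

section

open ModularGroup ModularForm
open scoped ModularForm

/-! ### Modular functions -/

section

variable {n : ℕ} {f : Fin n → ℍ → ℂ} {r : Fin n → ℝ} {a : Fin n → ℕ → ℂ}
  {M : Matrix (Fin n) (Fin n) ℂ}

lemma slash_mem_span (hf : ∀ i, HasQExpansion (f i) (r i) (a i))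
    (hS : ∀ i τ, f i (S • τ) = ∑ j, M i j * f j τ) (γ : SL(2, ℤ)) {g : ℍ → ℂ}
    (hg : g ∈ Submodule.span ℂ (Set.range f)) :
    g ∣[(0 : ℤ)] γ ∈ Submodule.span ℂ (Set.range f) := by
  have key : ∀ δ : SL(2, ℤ), (∀ i, f i ∣[(0 : ℤ)] δ ∈ Submodule.span ℂ (Set.range f)) →
      ∀ g ∈ Submodule.span ℂ (Set.range f), g ∣[(0 : ℤ)] δ ∈ Submodule.span ℂ (Set.range f) := by
    intro δ hδ g hg
    induction hg using Submodule.span_induction with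
    | mem x hx => obtain ⟨i, rfl⟩ := hx; exact hδ i
    | zero => rw [SlashAction.zero_slash]; exact Submodule.zero_mem _
    | add x y _ _ hx hy => rw [SlashAction.add_slash]; exact Submodule.add_mem _ hx hy
    | smul c x _ hx => rw [SL_smul_slash]; exact Submodule.smul_mem _ _ hx
  refine slash_induction (P := fun g => g ∈ Submodule.span ℂ (Set.range f)) (key S fun i => ?_)
    (key T fun i => ?_) γ g hg
  · have : f i ∣[(0 : ℤ)] S = ∑ j, M i j • f j := by
      funext τ
      rw [slash_S_apply, hS]; simp
    rw [this]
    exact Submodule.sum_mem _ fun j _ => Submodule.smul_mem _ _ (Submodule.subset_span ⟨j, rfl⟩)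
  · have : f i ∣[(0 : ℤ)] T = cexp (2 * π * I * r i) • f i := by
      funext τ
      rw [slash_T_apply, (hf i).vadd_one]; rfl
    rw [this]
    exact Submodule.smul_mem _ _ (Submodule.subset_span ⟨i, rfl⟩)

lemma exists_isBigO_exp_of_mem_span (hf : ∀ i, HasQExpansion (f i) (r i) (a i)) {g : ℍ → ℂ}
    (hg : g ∈ Submodule.span ℂ (Set.range f)) :
    ∃ k : ℕ, g =O[atImInfty] (fun τ : ℍ => Real.exp (2 * π * k * τ.im)) := by
  have mono : ∀ k l : ℕ, k ≤ l → (fun τ : ℍ => Real.exp (2 * π * k * τ.im)) =O[atImInfty]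
      (fun τ : ℍ => Real.exp (2 * π * l * τ.im)) := fun k l hkl =>
    Asymptotics.IsBigO.of_bound 1 (Eventually.of_forall fun τ => by
      rw [one_mul, Real.norm_of_nonneg (Real.exp_nonneg _), Real.norm_of_nonneg (Real.exp_nonneg _)]
      have := τ.im_pos
      gcongr)
  induction hg using Submodule.span_induction with
  | mem x hx =>
    obtain ⟨i, rfl⟩ := hx
    refine ⟨⌈-r i⌉₊, ?_⟩
    have h2 : (fun τ : ℍ => qpow (r i) τ) =O[atImInfty]
        (fun τ : ℍ => Real.exp (2 * π * ⌈-r i⌉₊ * τ.im)) :=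
      Asymptotics.IsBigO.of_bound 1 (Eventually.of_forall fun τ => by
        rw [one_mul, Real.norm_of_nonneg (Real.exp_nonneg _), norm_qpow_ofReal]
        have h3 := Nat.le_ceil (-r i)
        have := τ.im_pos
        rw [show -2 * π * r i * τ.im = 2 * π * (-r i) * τ.im by ring]
        gcongr)
    refine (h2.mul ((hf i).tendsto.isBigO_one ℝ)).congr (fun τ => ?_) fun τ => mul_one _
    rw [← mul_assoc, ← qpow_add]
    simp
  | zero => exact ⟨0, Asymptotics.isBigO_zero _ _⟩
  | add x y _ _ hx hy =>
    obtain ⟨k, hk⟩ := hx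
    obtain ⟨l, hl⟩ := hy
    exact ⟨max k l, (hk.trans (mono _ _ (le_max_left _ _))).add
      (hl.trans (mono _ _ (le_max_right _ _)))⟩
  | smul c x _ hx =>
    obtain ⟨k, hk⟩ := hx
    exact ⟨k, hk.const_smul_left c⟩

/-- Growth at all cusps comes for free: the span is stable under the modular group, so each
conjugate is a combination of `q`-series, whose growth at `i∞` is read off from the exponents. -/
theorem isModularFunction_of_hasQExpansion {N : ℕ} (hf : ∀ i, HasQExpansion (f i) (r i) (a i))
    (hS : ∀ i τ, f i (S • τ) = ∑ j, M i j * f j τ)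
    (hN : ∀ γ ∈ CongruenceSubgroup.Gamma N, ∀ i τ, f i (γ • τ) = f i τ) (i : Fin n) :
    IsModularFunction N (f i) := by
  refine ⟨(hf i).mdifferentiable, fun γ hγ τ => hN γ hγ i τ, fun γ => ?_⟩
  have : (fun τ : ℍ => f i (γ • τ)) = f i ∣[(0 : ℤ)] γ := by
    funext τ
    rw [SL_slash_apply]; simp
  rw [this]
  exact exists_isBigO_exp_of_mem_span hf
    (slash_mem_span hf hS γ (Submodule.subset_span ⟨i, rfl⟩))

end

theorem exists_modularForm_eta_pow_four :
    ∃ F : ModularForm Γ(6) 2, ⇑F = dedekindEta ^ 4 := by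
  have h0 : IsBoundedAtImInfty (dedekindEta ^ 4) :=
    (tendsto_dedekindEta_zero.pow 4).isBigO_one ℝ
  refine exists_modularForm (mdifferentiable_pow mdifferentiable_dedekindEta 4)
    (fun γ hγ => eta_pow_four_slash hγ) fun γ => ?_
  have key : ∃ c : ℂ, (dedekindEta ^ 4) ∣[(2 : ℤ)] γ = c • dedekindEta ^ 4 := by
    refine slash_induction (k := 2) (P := fun g => ∃ c : ℂ, g = c • dedekindEta ^ 4)
      (fun g ⟨c, hc⟩ => ⟨-c, slash_S_eq_smul_iff.2 fun τ => ?_⟩)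
      (fun g ⟨c, hc⟩ => ⟨c * cexp (2 * π * I * ((4 : ℕ) / 24)), ?_⟩) γ (dedekindEta ^ 4)
      ⟨1, (one_smul _ _).symm⟩
    · simp only [hc, Pi.pow_apply, Pi.smul_apply, smul_eq_mul]
      rw [dedekindEta_S_pow_four]
      norm_cast
      ring
    · funext τ
      rw [slash_T_apply]
      simp only [hc, Pi.pow_apply, Pi.smul_apply, smul_eq_mul]
      rw [dedekindEta_T_pow]
      ring
  obtain ⟨c, hc⟩ := key
  rw [hc]
  exact Asymptotics.IsBigO.const_smul_left h0 c

end

section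

open ModularGroup ModularForm
open scoped ModularForm

/-! ### The solutions of level three -/

/-- `I₃ / η²`. -/
def iEta : ℍ → ℂ := I3 / dedekindEta ^ 2

/-- `Δ₃ / η²`. -/
def eEta : ℍ → ℂ := Delta3 / dedekindEta ^ 2

/-- `f = q ^ r (1 + a₁ q + ⋯)`. -/
def HasMonicQExpansion (f : ℍ → ℂ) (r : ℂ) : Prop := ∃ a, HasQExpansion f r a ∧ a 0 = 1

lemma HasMonicQExpansion.congr_exponent {f : ℍ → ℂ} {r s : ℂ} (h : HasMonicQExpansion f r)
    (hs : r = s) : HasMonicQExpansion f s := hs ▸ h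

lemma HasMonicQExpansion.mul {f g : ℍ → ℂ} {r s : ℂ} (hf : HasMonicQExpansion f r)
    (hg : HasMonicQExpansion g s) : HasMonicQExpansion (f * g) (r + s) := by
  obtain ⟨a, ha, a0⟩ := hf
  obtain ⟨b, hb, b0⟩ := hg
  exact ⟨_, ha.mul hb, by simp [a0, b0]⟩

lemma HasMonicQExpansion.pow {f : ℍ → ℂ} {r : ℂ} (hf : HasMonicQExpansion f r) {n : ℕ}
    (hn : n ≠ 0) : HasMonicQExpansion (f ^ n) (n * r) := by
  induction n using Nat.strong_induction_on with
  | _ n ih =>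
    match n, hn with
    | 1, _ => simpa using hf
    | n + 2, _ =>
      rw [pow_succ]
      exact ((ih (n + 1) (by omega) (by omega)).mul hf).congr_exponent (by push_cast; ring)

/-- The exponent of `g` exceeds that of `f` by the positive integer `k + 1`, so the leading term is
untouched. -/
lemma HasMonicQExpansion.add_smul {f g : ℍ → ℂ} {r s : ℂ} (hf : HasMonicQExpansion f r)
    (hg : HasMonicQExpansion g s) (k : ℕ) (hs : s = r + (k + 1)) (c : ℂ) :
    HasMonicQExpansion (f + c • g) r := by
  obtain ⟨a, ha, a0⟩ := hf
  obtain ⟨b, hb, -⟩ := hg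
  subst hs
  have : ∃ b', HasQExpansion g r b' ∧ b' 0 = 0 := by
    induction k generalizing b with
    | zero => exact ⟨_, hb.unshift.congr_exponent (by push_cast; ring), rfl⟩
    | succ k ih => exact ih _ (hb.unshift.congr_exponent (by push_cast; ring))
  obtain ⟨b', hb', b0⟩ := this
  exact ⟨_, ha.add (hb'.smul c), by simp [a0, b0]⟩

lemma exists_hasQExpansion_family {n : ℕ} {f : Fin n → ℍ → ℂ} {r : Fin n → ℝ}
    (h : ∀ i, HasMonicQExpansion (f i) (r i)) : ∃ a : Fin n → ℕ → ℂ,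
      (∀ i, HasQExpansion (f i) (r i) (a i)) ∧ ∀ i, a i 0 = 1 := by
  choose a ha using h
  exact ⟨a, fun i => (ha i).1, fun i => (ha i).2⟩

lemma hasMonicQExpansion_iEta : HasMonicQExpansion iEta (-1 / 12) := by
  obtain ⟨b, hb, b0⟩ := exists_hasQExpansion_div_eta hasQExpansion_I3 2
  exact ⟨b, hb.congr_exponent (by norm_num), by rw [b0]; simp [coeffI3]⟩

lemma hasMonicQExpansion_eEta : HasMonicQExpansion eEta (1 / 4) := by
  obtain ⟨b, hb, b0⟩ := exists_hasQExpansion_div_eta hasQExpansion_Delta3 2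
  exact ⟨b, hb.congr_exponent (by norm_num), by rw [b0]; simp [chi3Sum]⟩

/-- The three solutions for `m₁ = 16`. -/
def basisThree : Fin 3 → ℍ → ℂ :=
  ![I3 ^ 2 / dedekindEta ^ 4, I3 * Delta3 / dedekindEta ^ 4, Delta3 ^ 2 / dedekindEta ^ 4]

lemma hasMonicQExpansion_basisThree (i : Fin 3) :
    HasMonicQExpansion (basisThree i) (((![-1 / 6, 1 / 6, 1 / 2] : Fin 3 → ℝ) i : ℝ) : ℂ) := by
  have hu := hasMonicQExpansion_iEta
  have hv := hasMonicQExpansion_eEta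
  have e0 : basisThree 0 = iEta * iEta := by
    funext τ
    have h := dedekindEta_ne_zero τ
    simp only [basisThree, iEta, Matrix.cons_val_zero, Pi.mul_apply, Pi.div_apply, Pi.pow_apply]
    field_simp
  have e1 : basisThree 1 = iEta * eEta := by
    funext τ
    have h := dedekindEta_ne_zero τ
    simp only [basisThree, iEta, eEta, Matrix.cons_val_one, Matrix.cons_val_zero, Pi.mul_apply,
      Pi.div_apply, Pi.pow_apply]
    field_simp
  have e2 : basisThree 2 = eEta * eEta := by
    funext τ
    have h := dedekindEta_ne_zero τ
    simp only [basisThree, eEta, Matrix.cons_val, Pi.mul_apply, Pi.div_apply, Pi.pow_apply]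
    field_simp
  fin_cases i
  · exact e0 ▸ (hu.mul hu).congr_exponent (by norm_num)
  · exact e1 ▸ (hu.mul hv).congr_exponent (by norm_num)
  · exact e2 ▸ (hv.mul hv).congr_exponent (by norm_num)

lemma neg_I_mul_div_sqrt_three_sq (t : ℂ) : (-I * t / √3) ^ 2 = -t ^ 2 / 3 := by
  rw [show -I * t / √3 = (-I / √3) * t by ring, mul_pow, I_div_sqrt_three_sq]; ring

/-- The numerators are the quadratic monomials in `I₃` and `Δ₃`, so the matrix is the symmetric
square of the linear action of `S`; the square root of 3 enters only through its square. -/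
lemma basisThree_S (i : Fin 3) (τ : ℍ) : basisThree i (S • τ) = ∑ j,
    (!![1 / 3, 4, 12; 1 / 9, 1 / 3, -2; 1 / 27, -2 / 9, 1 / 3] : Matrix (Fin 3) (Fin 3) ℂ) i j *
      basisThree j τ := by
  have h := dedekindEta_ne_zero τ
  have ht := τ.ne_zero
  have f0 (τ) : basisThree 0 τ = I3 τ ^ 2 / dedekindEta τ ^ 4 := rfl
  have f1 (τ) : basisThree 1 τ = I3 τ * Delta3 τ / dedekindEta τ ^ 4 := rfl
  have f2 (τ) : basisThree 2 τ = Delta3 τ ^ 2 / dedekindEta τ ^ 4 := rfl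
  have h3 := neg_I_mul_div_sqrt_three_sq τ
  have g0 : I3 (S • τ) ^ 2 = -τ ^ 2 / 3 * (I3 τ + 6 * Delta3 τ) ^ 2 := by
    rw [I3_S_smul, mul_pow, h3]
  have g1 : I3 (S • τ) * Delta3 (S • τ) =
      -τ ^ 2 / 3 * ((I3 τ + 6 * Delta3 τ) * ((I3 τ - 3 * Delta3 τ) / 3)) := by
    rw [I3_S_smul, Delta3_S_smul, ← h3]; ring
  have g2 : Delta3 (S • τ) ^ 2 = -τ ^ 2 / 3 * ((I3 τ - 3 * Delta3 τ) / 3) ^ 2 := by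
    rw [Delta3_S_smul, mul_pow, h3]
  rw [Fin.sum_univ_three]
  fin_cases i <;>
  simp only [Fin.mk_zero, Fin.mk_one, Fin.reduceFinMk, Fin.isValue, Matrix.of_apply,
    Matrix.cons_val', Matrix.cons_val_zero, Matrix.cons_val_one, Matrix.cons_val,
    f0, f1, f2, dedekindEta_S_pow_four, g0, g1, g2] <;> field_simp <;> ring

lemma apply_smul_div_of_slash {k : ℤ} {f g : ℍ → ℂ} {γ : SL(2, ℤ)} (hf : f ∣[k] γ = f)
    (hg : g ∣[k] γ = g) (τ : ℍ) : f (γ • τ) / g (γ • τ) = f τ / g τ := by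
  have h1 := congrFun hf τ
  have h2 := congrFun hg τ
  rw [SL_slash_apply] at h1 h2
  rw [← h1, ← h2, mul_div_mul_right]
  exact zpow_ne_zero _ (denom_ne_zero _ _)

lemma basisThree_smul {γ : SL(2, ℤ)} (hγ : γ ∈ Γ(6)) (i : Fin 3) (τ : ℍ) :
    basisThree i (γ • τ) = basisThree i τ := by
  have h3 : γ ∈ Γ(3) := Gamma_le (by norm_num) hγ
  have hI := I3_slash_of_mem h3
  have hD := Delta3_slash_of_mem h3
  have hη := eta_pow_four_slash hγ
  have mul : ∀ f g : ℍ → ℂ, f ∣[(1 : ℤ)] γ = f → g ∣[(1 : ℤ)] γ = g →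
      (f * g) ∣[(2 : ℤ)] γ = f * g := fun f g hf hg => by
    have := mul_slash_SL2 1 1 γ f g
    rw [hf, hg] at this
    exact this
  fin_cases i
  · change (I3 ^ 2) (γ • τ) / _ = (I3 ^ 2) τ / _
    rw [sq]
    exact apply_smul_div_of_slash (mul _ _ hI hI) hη τ
  · exact apply_smul_div_of_slash (mul _ _ hI hD) hη τ
  · change (Delta3 ^ 2) (γ • τ) / _ = (Delta3 ^ 2) τ / _
    rw [sq]
    exact apply_smul_div_of_slash (mul _ _ hD hD) hη τ

theorem exists_basis_levelThree_sixteen : ∃ f : Fin 3 → ℍ → ℂ,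
      IsBasisOfSolutions (-1 / 36) (1 / 72) f ∧
      f 0 = I3 ^ 2 / dedekindEta ^ 4 ∧ f 1 = I3 * Delta3 / dedekindEta ^ 4 ∧
      f 2 = Delta3 ^ 2 / dedekindEta ^ 4 ∧
      QExpansionStarts (f 0) (-1 / 6) [1, 16, 98, 364, 1221] ∧
      QExpansionStarts (f 1) (1 / 6) [1, 11, 50, 188, 583] ∧
      QExpansionStarts (f 2) (1 / 2) [1, 6, 27, 92, 279] ∧
      ∀ i, IsModularFunction 6 (f i) := by
  obtain ⟨a, ha, a0⟩ := exists_hasQExpansion_family hasMonicQExpansion_basisThree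
  have hB : IsBasisOfSolutions (-1 / 36) (1 / 72) basisThree := by
    refine isBasisOfSolutions_of_modular ha (fun i => by simp [a0]) ?_ ?_ ?_ basisThree_S
    · intro i j h; fin_cases i <;> fin_cases j <;> first | rfl | (exfalso; revert h; norm_num)
    · simp; norm_num
    · intro i; fin_cases i <;> norm_num [ind]
  have hs : ∀ i, basisThree i ∈ solutions (-1 / 36) (1 / 72) := fun i =>
    hB.2 ▸ Submodule.subset_span ⟨i, rfl⟩
  refine ⟨basisThree, hB, rfl, rfl, rfl, ?_, ?_, ?_,
    isModularFunction_of_hasQExpansion ha basisThree_S fun γ hγ i τ => basisThree_smul hγ i τ⟩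
  · refine ((ha 0).congr_exponent (s := -1 / 6) (by norm_num)).qExpansionStarts (hs 0) _ (a0 0) ?_
    intro n hn h0; simp only [List.length_cons, List.length_nil] at hn
    interval_cases n <;> simp [opCoeff_eq, sum_range_succ, opKernel_one, opKernel_two,
      opKernel_three, opKernel_four, ind] at h0 ⊢ <;> norm_num
  · refine ((ha 1).congr_exponent (s := 1 / 6) (by norm_num)).qExpansionStarts (hs 1) _ (a0 1) ?_
    intro n hn h0; simp only [List.length_cons, List.length_nil] at hn
    interval_cases n <;> simp [opCoeff_eq, sum_range_succ, opKernel_one, opKernel_two,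
      opKernel_three, opKernel_four, ind] at h0 ⊢ <;> norm_num
  · refine ((ha 2).congr_exponent (s := 1 / 2) (by simp)).qExpansionStarts (hs 2) _ (a0 2) ?_
    intro n hn h0; simp only [List.length_cons, List.length_nil] at hn
    interval_cases n <;> simp [opCoeff_eq, sum_range_succ, opKernel_one, opKernel_two,
      opKernel_three, opKernel_four, ind] at h0 ⊢ <;> norm_num

/-! ### The third power relation and the solutions for `m₁ = 178` -/

/-- Both sides have weight 4 and multiplier `omega3` under `T`. Their quotient is of level one and
weight zero with limit 1. -/
lemma dedekindEta_pow_eight_eq (τ : ℍ) :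
    dedekindEta τ ^ 8 = Delta3 τ * (I3 τ ^ 3 - 27 * Delta3 τ ^ 3) := by
  set g : ℍ → ℂ := Delta3 * (I3 ^ 3 - (27 : ℂ) • Delta3 ^ 3) with hg
  have hη8 : ∀ τ, (dedekindEta ^ 8) τ ≠ 0 := fun τ => pow_ne_zero 8 (dedekindEta_ne_zero τ)
  have hgd : MDiff g := mdifferentiable_Delta3.mul ((mdifferentiable_pow mdifferentiable_I3 3).sub
    ((mdifferentiable_pow mdifferentiable_Delta3 3).const_smul _))
  have hd : MDiff (g / dedekindEta ^ 8 - 1 : ℍ → ℂ) :=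
    (hgd.div (mdifferentiable_pow mdifferentiable_dedekindEta 8) hη8).sub mdifferentiable_const
  have hzero : g / dedekindEta ^ 8 - 1 = 0 := by
    refine eq_zero_of_tendsto_zero (k := 0) hd (fun τ => ?_) (fun τ => ?_) ?_ (by norm_num)
    · have h4 : (-I * (τ : ℂ) / √3) ^ 4 = τ ^ 4 / 9 := by
        rw [show 4 = 2 * 2 by rfl, pow_mul, neg_I_mul_div_sqrt_three_sq]; ring
      have hgS : g (S • τ) = τ ^ 4 * g τ := by
        simp only [hg, Pi.mul_apply, Pi.sub_apply, Pi.smul_apply, Pi.pow_apply, smul_eq_mul,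
          I3_S_smul, Delta3_S_smul]
        linear_combination ((I3 τ - 3 * Delta3 τ) / 3 * ((I3 τ + 6 * Delta3 τ) ^ 3 -
          (I3 τ - 3 * Delta3 τ) ^ 3)) * h4
      have ht := τ.ne_zero
      simp only [Pi.sub_apply, Pi.div_apply, Pi.one_apply, hgS, Pi.pow_apply,
        dedekindEta_S_pow_eight, zpow_zero, one_mul]
      rw [mul_div_mul_left _ _ (pow_ne_zero 4 ht)]
    · have hgT : g ((1 : ℝ) +ᵥ τ) = omega3 * g τ := by
        simp only [hg, Pi.mul_apply, Pi.sub_apply, Pi.smul_apply, Pi.pow_apply, smul_eq_mul,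
          I3_T, Delta3_T]
        linear_combination (-27 * omega3 * Delta3 τ ^ 4) * omega3_pow_three
      simp only [Pi.sub_apply, Pi.div_apply, Pi.one_apply, hgT, Pi.pow_apply,
        dedekindEta_T_pow_eight]
      rw [mul_div_mul_left]
      intro h
      have := omega3_pow_three
      simp [h] at this
    · have h1 := (tendsto_Delta3.mul ((tendsto_I3.pow 3).sub
        ((tendsto_Delta3_zero.pow 3).const_mul 27))).div (tendsto_dedekindEta.pow 8) (by simp)
      refine tendsto_of_eq (h1.sub_const 1) (fun τ => ?_) (by norm_num)
      simp only [hg, Pi.mul_apply, Pi.sub_apply, Pi.div_apply, Pi.smul_apply, Pi.pow_apply,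
        smul_eq_mul, Pi.one_apply, mul_pow, ← qpow_nat_mul]
      rw [mul_assoc, mul_div_mul_comm, div_eq_mul_inv (qpow _ _), ← qpow_neg, ← qpow_add]
      norm_num
  have := congrFun hzero τ
  simp only [Pi.sub_apply, Pi.div_apply, Pi.one_apply, Pi.zero_apply, sub_eq_zero] at this
  rw [div_eq_one_iff_eq (hη8 τ)] at this
  simpa [hg] using this.symm

lemma Delta3A_eq_mul (τ : ℍ) : Delta3A τ = Delta3 τ ^ 3 * (I3 τ ^ 3 - 27 * Delta3 τ ^ 3) := by
  rw [Delta3A_eq, dedekindEta_pow_eight_eq]; ring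

/-- The three solutions for `m₁ = 178`. -/
def basisThreeSextic : Fin 3 → ℍ → ℂ :=
  ![I3 ^ 2 * Delta3 * (I3 ^ 3 + 135 * Delta3 ^ 3) / dedekindEta ^ 12,
    (I3 ^ 6 + 270 * Delta3A + 5832 * Delta3 ^ 6) / dedekindEta ^ 12,
    I3 * Delta3 ^ 5 / dedekindEta ^ 12]

lemma hasMonicQExpansion_basisThreeSextic (i : Fin 3) : HasMonicQExpansion (basisThreeSextic i)
    (((![-1 / 6, -1 / 2, 7 / 6] : Fin 3 → ℝ) i : ℝ) : ℂ) := by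
  have hu := hasMonicQExpansion_iEta
  have hv := hasMonicQExpansion_eEta
  have e0 : basisThreeSextic 0 = iEta ^ 2 * eEta * (iEta ^ 3 + (135 : ℂ) • eEta ^ 3) := by
    funext τ
    have h := dedekindEta_ne_zero τ
    simp only [basisThreeSextic, iEta, eEta, Matrix.cons_val_zero, Pi.mul_apply, Pi.add_apply,
      Pi.smul_apply, Pi.div_apply, Pi.pow_apply, Pi.ofNat_apply, smul_eq_mul]
    field_simp
  -- After `Δ₃ₐ` is expressed by `I₃` and `Δ₃`, the last coefficient becomes `5832 - 27 · 270 =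
  -- -1458`.
  have e1 : basisThreeSextic 1 = iEta ^ 6 + (270 : ℂ) • (iEta ^ 3 * eEta ^ 3) +
      (-1458 : ℂ) • eEta ^ 6 := by
    funext τ
    have h := dedekindEta_ne_zero τ
    simp only [basisThreeSextic, iEta, eEta, Matrix.cons_val_one, Matrix.cons_val_zero,
      Pi.mul_apply, Pi.add_apply, Pi.smul_apply, Pi.div_apply, Pi.pow_apply, Pi.ofNat_apply,
      smul_eq_mul, Delta3A_eq_mul]
    field_simp
    ring
  have e2 : basisThreeSextic 2 = iEta * eEta ^ 5 := by
    funext τ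
    have h := dedekindEta_ne_zero τ
    simp only [basisThreeSextic, iEta, eEta, Matrix.cons_val, Pi.mul_apply, Pi.div_apply,
      Pi.pow_apply]
    field_simp
  have u3 := hu.pow (n := 3) (by norm_num)
  have v3 := hv.pow (n := 3) (by norm_num)
  fin_cases i
  · exact e0 ▸ (((hu.pow (n := 2) (by norm_num)).mul hv).mul
      (u3.add_smul v3 0 (by norm_num) 135)).congr_exponent (by norm_num)
  · exact e1 ▸ ((((hu.pow (n := 6) (by norm_num)).add_smul (u3.mul v3) 0 (by norm_num) 270).add_smul
      (hv.pow (n := 6) (by norm_num)) 1 (by norm_num) (-1458))).congr_exponent (by norm_num)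
  · exact e2 ▸ (hu.mul (hv.pow (n := 5) (by norm_num))).congr_exponent (by norm_num)

lemma basisThreeSextic_S (i : Fin 3) (τ : ℍ) : basisThreeSextic i (S • τ) = ∑ j,
    (!![1 / 3, 2 / 27, -324; 6, 1 / 3, 2916; -1 / 729, 1 / 6561, 1 / 3] :
      Matrix (Fin 3) (Fin 3) ℂ) i j * basisThreeSextic j τ := by
  have h := dedekindEta_ne_zero τ
  have ht := τ.ne_zero
  have f0 (τ) : basisThreeSextic 0 τ =
    (I3 τ ^ 2 * Delta3 τ * (I3 τ ^ 3 + 135 * Delta3 τ ^ 3)) / dedekindEta τ ^ 12 := rfl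
  have f1 (τ) : basisThreeSextic 1 τ = (I3 τ ^ 6 + 270 * (Delta3 τ ^ 3 *
      (I3 τ ^ 3 - 27 * Delta3 τ ^ 3)) + 5832 * Delta3 τ ^ 6) / dedekindEta τ ^ 12 := by
    rw [← Delta3A_eq_mul]; rfl
  have f2 (τ) : basisThreeSextic 2 τ = (I3 τ * Delta3 τ ^ 5) / dedekindEta τ ^ 12 := rfl
  -- Writing `τ⁶ = -27 w⁶` removes `I` and `√3`, leaving a rational identity.
  obtain ⟨w, hw⟩ : ∃ w, w = -I * (τ : ℂ) / √3 := ⟨_, rfl⟩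
  have h6 : w ^ 6 = -τ ^ 6 / 27 := by
    rw [hw, show 6 = 2 * 3 by rfl, pow_mul, neg_I_mul_div_sqrt_three_sq]; ring
  have hw6 : (τ : ℂ) ^ 6 = -27 * w ^ 6 := by rw [h6]; ring
  have hw0 : w ≠ 0 := by
    rintro rfl
    rw [zero_pow (by norm_num)] at h6
    exact pow_ne_zero 6 ht (by linear_combination 27 * h6)
  rw [Fin.sum_univ_three]
  fin_cases i <;>
  simp only [Fin.mk_zero, Fin.mk_one, Fin.reduceFinMk, Fin.isValue, Matrix.of_apply,
    Matrix.cons_val', Matrix.cons_val_zero, Matrix.cons_val_one, Matrix.cons_val,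
    f0, f1, f2, dedekindEta_S_pow_twelve, hw6, I3_S_smul, Delta3_S_smul, ← hw] <;>
  field_simp <;> ring

theorem exists_basis_levelThree : ∃ f : Fin 3 → ℍ → ℂ, IsBasisOfSolutions (-25 / 36) (-7 / 72) f ∧
      f 0 = I3 ^ 2 * Delta3 * (I3 ^ 3 + 135 * Delta3 ^ 3) / dedekindEta ^ 12 ∧
      f 1 = (I3 ^ 6 + 270 * Delta3A + 5832 * Delta3 ^ 6) / dedekindEta ^ 12 ∧
      f 2 = I3 * Delta3 ^ 5 / dedekindEta ^ 12 ∧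
      QExpansionStarts (f 0) (-1 / 6) [1, 178, 4634, 61924, 566277] ∧
      QExpansionStarts (f 1) (-1 / 2) [1, 318, 8514, 126862, 1269771] ∧
      QExpansionStarts (f 2) (7 / 6) [1, 23, 272, 2286, 15318] := by
  obtain ⟨a, ha, a0⟩ := exists_hasQExpansion_family hasMonicQExpansion_basisThreeSextic
  have hB : IsBasisOfSolutions (-25 / 36) (-7 / 72) basisThreeSextic := by
    refine isBasisOfSolutions_of_modular ha (fun i => by simp [a0]) ?_ ?_ ?_ basisThreeSextic_S
    · intro i j h; fin_cases i <;> fin_cases j <;> first | rfl | (exfalso; revert h; norm_num)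
    · simp; norm_num
    · intro i; fin_cases i <;> norm_num [ind]
  have hs : ∀ i, basisThreeSextic i ∈ solutions (-25 / 36) (-7 / 72) := fun i =>
    hB.2 ▸ Submodule.subset_span ⟨i, rfl⟩
  refine ⟨basisThreeSextic, hB, rfl, rfl, rfl, ?_, ?_, ?_⟩
  · refine ((ha 0).congr_exponent (s := -1 / 6) (by norm_num)).qExpansionStarts (hs 0) _ (a0 0) ?_
    intro n hn h0; simp only [List.length_cons, List.length_nil] at hn
    interval_cases n <;> simp [opCoeff_eq, sum_range_succ, opKernel_one, opKernel_two,
      opKernel_three, opKernel_four, ind] at h0 ⊢ <;> norm_num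
  · refine ((ha 1).congr_exponent (s := -1 / 2) (by norm_num)).qExpansionStarts (hs 1) _ (a0 1) ?_
    intro n hn h0; simp only [List.length_cons, List.length_nil] at hn
    interval_cases n <;> simp [opCoeff_eq, sum_range_succ, opKernel_one, opKernel_two,
      opKernel_three, opKernel_four, ind] at h0 ⊢ <;> norm_num
  · refine ((ha 2).congr_exponent (s := 7 / 6) (by simp)).qExpansionStarts (hs 2) _ (a0 2) ?_
    intro n hn h0; simp only [List.length_cons, List.length_nil] at hn
    interval_cases n <;> simp [opCoeff_eq, sum_range_succ, opKernel_one, opKernel_two,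
      opKernel_three, opKernel_four, ind] at h0 ⊢ <;> norm_num

end

section

open ModularGroup ModularForm
open scoped ModularForm

/-! ### Klein forms -/

/-- Since `-I τ` lies in the right half-plane, the principal logarithms of `I` and of `-I τ` add up
to that of `τ`, which fixes the branch as in the theta functional equation. -/
lemma dedekindEta_S (τ : ℍ) : dedekindEta (S • τ) = (-I * τ : ℂ) ^ (1 / 2 : ℂ) * dedekindEta τ := by
  have h := eta_comp_eq_csqrt_I_inv τ.2
  rw [dedekindEta_apply, dedekindEta_apply, coe_S_smul]
  have e : -1 / (τ : ℂ) = -(τ : ℂ)⁻¹ := by ring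
  simp only [Function.comp_apply, Pi.smul_apply, Pi.mul_apply, smul_eq_mul, e] at h
  have hne : -I * (τ : ℂ) ≠ 0 := mul_ne_zero (neg_ne_zero.2 Complex.I_ne_zero) τ.ne_zero
  have hre : 0 < (-I * (τ : ℂ)).re := by simpa using τ.im_pos
  have harg := abs_lt.1 (Complex.abs_arg_lt_pi_div_two_iff.2 (Or.inl hre))
  have hlog : Complex.log τ = Complex.log I + Complex.log (-I * τ) := by
    rw [← Complex.log_mul Complex.I_ne_zero hne, ← mul_assoc]
    · simp
    · rw [Complex.arg_I]
      constructor <;> linarith [Real.pi_pos]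
  have hs : (Complex.sqrt I)⁻¹ * Complex.sqrt τ = (-I * τ : ℂ) ^ (1 / 2 : ℂ) := by
    rw [Complex.sqrt, Complex.sqrt, Complex.cpow_def_of_ne_zero Complex.I_ne_zero,
      Complex.cpow_def_of_ne_zero τ.ne_zero, Complex.cpow_def_of_ne_zero hne, hlog,
      ← Complex.exp_neg, ← Complex.exp_add]
    congr 1; ring
  rw [h, ← mul_assoc, hs]

/-- The Klein form `𝔨_a`, up to a constant. -/
def klein (a : Fin 2 → ℝ) (τ : ℍ) : ℂ :=
  cexp (π * I * (a 0 * (a 0 * τ + a 1) + (a 0 * τ + a 1) + 1 / 2 + τ / 4)) *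
    jacobiTheta₂ (a 0 * τ + a 1 + 1 / 2 + τ / 2) τ / dedekindEta τ ^ 3

lemma klein_slash_S (a : Fin 2 → ℝ) : klein a ∣[(-1 : ℤ)] S = klein ![a 1, -a 0] := by
  refine slash_S_eq_smul_iff.2 fun τ => ?_
  have ht := τ.ne_zero
  have hη := dedekindEta_ne_zero τ
  obtain ⟨w, hw⟩ : ∃ w : ℂ, w = a 1 * τ - a 0 := ⟨_, rfl⟩
  have hne : -I * (τ : ℂ) ≠ 0 := mul_ne_zero (neg_ne_zero.2 Complex.I_ne_zero) ht
  obtain ⟨s, hs⟩ : ∃ s : ℂ, s = (-I * τ : ℂ) ^ (1 / 2 : ℂ) := ⟨_, rfl⟩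
  have hs2 : s ^ 2 = -I * τ := by rw [hs, ← Complex.cpow_nat_mul]; simp
  have hs0 : s ≠ 0 := by rintro rfl; simp at hs2; exact hne (by simpa using hs2)
  -- With `-1/2` in place of `1/2` the argument divided by `τ` is exactly the one belonging to `S •
  -- τ`; periodicity in the argument makes up for the change.
  have fe := jacobiTheta₂_functional_equation (w - 1 / 2 + τ / 2) τ
  have hper : jacobiTheta₂ (w - 1 / 2 + τ / 2) τ = jacobiTheta₂ (w + 1 / 2 + τ / 2) τ := by
    rw [← jacobiTheta₂_add_left]; congr 1; ring
  rw [hper, ← hs] at fe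
  have e1 : (w - 1 / 2 + τ / 2) / τ = a 0 * ((S • τ : ℍ) : ℂ) + a 1 + 1 / 2 + ((S • τ : ℍ) : ℂ) / 2 := by
    rw [coe_S_smul, hw]; field_simp; ring
  have e2 : -1 / (τ : ℂ) = ((S • τ : ℍ) : ℂ) := by rw [coe_S_smul]; ring
  rw [e1, e2] at fe
  have fe' : jacobiTheta₂ (a 0 * ((S • τ : ℍ) : ℂ) + a 1 + 1 / 2 + ((S • τ : ℍ) : ℂ) / 2)
      ((S • τ : ℍ) : ℂ) = s * cexp (π * I * (w - 1 / 2 + τ / 2) ^ 2 / τ) *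
        jacobiTheta₂ (w + 1 / 2 + τ / 2) τ := by
    rw [fe, show -π * I * (w - 1 / 2 + τ / 2) ^ 2 / τ = -(π * I * (w - 1 / 2 + τ / 2) ^ 2 / τ) by ring,
      Complex.exp_neg]
    field_simp
  rw [klein, klein, fe', dedekindEta_S, ← hs]
  simp only [Matrix.cons_val_zero, Matrix.cons_val_one, ofReal_neg]
  have e3 : (a 1 : ℂ) * τ + -a 0 = w := by rw [hw]; ring
  rw [e3]
  have hI : cexp (π * I * (1 / 2)) = I := by
    rw [show (π * I * (1 / 2) : ℂ) = π / 2 * I by ring, Complex.exp_pi_div_two_mul_I]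
  have e4 : cexp (π * I * (a 1 * w + w + 1 / 2 + τ / 4)) =
      cexp (π * I * (a 0 * (a 0 * ((S • τ : ℍ) : ℂ) + a 1) + (a 0 * ((S • τ : ℍ) : ℂ) + a 1) + 1 / 2 +
        ((S • τ : ℍ) : ℂ) / 4)) * cexp (π * I * (w - 1 / 2 + τ / 2) ^ 2 / τ) *
          cexp (π * I * (1 / 2)) := by
    rw [← Complex.exp_add, ← Complex.exp_add, coe_S_smul, hw]
    congr 1
    field_simp
    ring
  rw [e4, hI, zpow_neg, zpow_one]
  generalize cexp (π * I * (w - 1 / 2 + τ / 2) ^ 2 / τ) = E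
  generalize cexp (π * I * (a 0 * (a 0 * ((S • τ : ℍ) : ℂ) + a 1) +
    (a 0 * ((S • τ : ℍ) : ℂ) + a 1) + 1 / 2 + ((S • τ : ℍ) : ℂ) / 4)) = E'
  generalize jacobiTheta₂ (w + 1 / 2 + τ / 2) τ = J
  field_simp
  linear_combination (-J * E * E' * I) * hs2 + (J * E * E' * τ) * Complex.I_sq

lemma klein_slash_T (a : Fin 2 → ℝ) : klein a ∣[(-1 : ℤ)] T = klein ![a 0, a 0 + a 1] := by
  refine slash_T_eq_iff.2 fun τ => ?_
  have h1 : jacobiTheta₂ (a 0 * (τ + 1) + a 1 + 1 / 2 + (τ + 1) / 2) (τ + 1) =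
      jacobiTheta₂ (a 0 * τ + (a 0 + a 1) + 1 / 2 + τ / 2) τ := by
    refine tsum_congr fun n => ?_
    rw [jacobiTheta₂_term, jacobiTheta₂_term, Complex.exp_eq_exp_iff_exists_int]
    -- The exponents differ by `πi n (n + 1)`, a multiple of `2πi`.
    obtain ⟨m, hm⟩ := (Int.even_mul_succ_self n).two_dvd
    refine ⟨m, ?_⟩
    have hm' : (n : ℂ) * (n + 1) = 2 * m := by exact_mod_cast hm
    linear_combination (π * I) * hm'
  rw [klein, klein, coe_vadd_one, h1]
  simp only [Matrix.cons_val_zero, Matrix.cons_val_one, ofReal_add]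
  rw [dedekindEta_T_pow, show (2 * π * I * (((3 : ℕ) : ℂ) / 24)) = π * I * (1 / 4) by push_cast; ring,
    show (π * I * (a 0 * (a 0 * (τ + 1) + a 1) + (a 0 * (τ + 1) + a 1) + 1 / 2 + (τ + 1) / 4) : ℂ) =
      π * I * (1 / 4) + π * I * (a 0 * (a 0 * τ + (a 0 + a 1)) + (a 0 * τ + (a 0 + a 1)) + 1 / 2 +
        τ / 4) by ring, Complex.exp_add, mul_assoc, mul_div_mul_left _ _ (Complex.exp_ne_zero _)]

/-- An integral matrix as a real one. -/
def realMat (γ : SL(2, ℤ)) : Matrix (Fin 2) (Fin 2) ℝ :=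
  (γ : Matrix (Fin 2) (Fin 2) ℤ).map (Int.castRingHom ℝ)

lemma realMat_mul (γ δ : SL(2, ℤ)) : realMat (γ * δ) = realMat γ * realMat δ := by
  rw [realMat, Matrix.SpecialLinearGroup.coe_mul, Matrix.map_mul]; rfl

lemma realMat_one : realMat 1 = 1 := by simp [realMat]

open Matrix in
lemma klein_slash (γ : SL(2, ℤ)) :
    ∀ a, klein a ∣[(-1 : ℤ)] γ = klein (a ᵥ* realMat γ) := by
  have hmem : γ ∈ Subgroup.closure ({S, T} : Set SL(2, ℤ)) := by
    rw [SpecialLinearGroup.SL2Z_generators]; trivial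
  induction hmem using Subgroup.closure_induction with
  | mem x hx =>
    intro a
    rcases hx with rfl | rfl
    · rw [klein_slash_S]; congr 1
      funext i; fin_cases i <;> simp [realMat, coe_S, Matrix.vecMul, dotProduct, Fin.sum_univ_two]
    · rw [klein_slash_T]; congr 1
      funext i; fin_cases i <;> simp [realMat, coe_T, Matrix.vecMul, dotProduct, Fin.sum_univ_two]
  | one => intro v; simp [realMat_one]
  | mul x y _ _ hx hy =>
    intro v
    rw [SlashAction.slash_mul, hx, hy, realMat_mul, vecMul_vecMul]
  | inv x _ hx =>
    intro v
    have h := hx (v ᵥ* realMat x⁻¹)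
    rw [vecMul_vecMul, ← realMat_mul, inv_mul_cancel, realMat_one, vecMul_one] at h
    rw [← h, ← SlashAction.slash_mul, mul_inv_cancel, SlashAction.slash_one]

lemma klein_add_int_right (x y : ℝ) (l : ℤ) (τ : ℍ) :
    klein ![x, y + l] τ = cexp (π * I * ((x + 1) * l)) * klein ![x, y] τ := by
  have hp : Function.Periodic (fun z => jacobiTheta₂ z τ) 1 := fun z => jacobiTheta₂_add_left z τ
  have h := hp.int_mul l (x * τ + y + 1 / 2 + τ / 2)
  simp only [mul_one] at h
  rw [klein, klein]
  simp only [Matrix.cons_val_zero, Matrix.cons_val_one, ofReal_add, ofReal_intCast]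
  rw [show (x * τ + (y + l) + 1 / 2 + τ / 2 : ℂ) = x * τ + y + 1 / 2 + τ / 2 + l by ring, h,
    ← mul_div_assoc, ← mul_assoc, ← Complex.exp_add]
  congr 3; ring

lemma klein_add_one_left (x y : ℝ) (τ : ℍ) :
    klein ![x + 1, y] τ = cexp (-(π * I * (y + 1))) * klein ![x, y] τ := by
  have h := jacobiTheta₂_add_left' (x * τ + y + 1 / 2 + τ / 2) τ
  rw [klein, klein]
  simp only [Matrix.cons_val_zero, Matrix.cons_val_one, ofReal_add, ofReal_one]
  rw [show ((x + 1) * τ + y + 1 / 2 + τ / 2 : ℂ) = x * τ + y + 1 / 2 + τ / 2 + τ by ring, h,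
    ← mul_div_assoc, ← mul_assoc, ← mul_assoc, ← Complex.exp_add, ← Complex.exp_add]
  congr 3; ring

lemma klein_add_int_left (x y : ℝ) (k : ℤ) (τ : ℍ) :
    klein ![x + k, y] τ = cexp (-(π * I * (y + 1) * k)) * klein ![x, y] τ := by
  induction k using Int.induction_on with
  | zero => simp
  | succ k ih =>
    push_cast at ih ⊢
    rw [← add_assoc, klein_add_one_left, ih, ← mul_assoc, ← Complex.exp_add]
    congr 2; ring
  | pred k ih =>
    have h := klein_add_one_left (x + ((-k - 1 : ℤ) : ℝ)) y τ
    rw [show x + ((-k - 1 : ℤ) : ℝ) + 1 = x + ((-k : ℤ) : ℝ) by push_cast; ring, ih] at h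
    refine mul_left_cancel₀ (Complex.exp_ne_zero (-(π * I * (y + 1)))) ?_
    rw [← h, ← mul_assoc, ← Complex.exp_add]
    congr 2; push_cast; ring

open Matrix in
-- The row vector `(x, 0)` moves under `γ` by the even integral vector `(2k, 2l)`. Evenness and the
-- integrality of `x l` make both quasi-periodicity factors equal to 1.
lemma klein_slash_of_even {x : ℝ} {γ : SL(2, ℤ)} {k l : ℤ} (hk : x * (γ 0 0 - 1) = 2 * k)
    (hl : x * γ 0 1 = 2 * l) (hxl : ∃ m : ℤ, x * l = m) :
    klein ![x, 0] ∣[(-1 : ℤ)] γ = klein ![x, 0] := by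
  obtain ⟨m, hm⟩ := hxl
  have e : ![x, 0] ᵥ* realMat γ = ![x + (2 * k : ℤ), 0 + (2 * l : ℤ)] := by
    funext i
    fin_cases i
    · simp [realMat, vecMul, dotProduct, Fin.sum_univ_two]; linarith
    · simp [realMat, vecMul, dotProduct, Fin.sum_univ_two]; linarith
  funext τ
  rw [klein_slash, e, klein_add_int_right, klein_add_int_left]
  have hm' : (x : ℂ) * l = m := by exact_mod_cast hm
  have h1 : cexp (π * I * (((x + (2 * k : ℤ) : ℝ) + 1) * (2 * l : ℤ))) = 1 :=
    Complex.exp_eq_one_iff.2 ⟨m + 2 * k * l + l, by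
      push_cast; linear_combination (2 * π * I) * hm'⟩
  have h2 : cexp (-(π * I * ((0 : ℝ) + 1) * (2 * k : ℤ))) = 1 :=
    Complex.exp_eq_one_iff.2 ⟨-k, by push_cast; ring⟩
  rw [h1, h2, one_mul, one_mul]

/-- Conjugation by the multiplication by `5`. -/
lemma exists_conj_five {γ : SL(2, ℤ)} (hγ : γ ∈ Γ(60)) : ∃ δ : SL(2, ℤ), δ ∈ Γ(12) ∧
    (∃ k l : ℤ, δ 0 0 = 1 + 60 * k ∧ δ 0 1 = 300 * l) ∧ ∀ τ, scale 5 (γ • τ) = δ • scale 5 τ := by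
  rw [CongruenceSubgroup.Gamma_mem] at hγ
  obtain ⟨h1, h2, h3, h4⟩ := hγ
  have key : ∀ a b : ℤ, (a : ZMod 60) = b → ∃ k, a = b + 60 * k := fun a b hab => by
    obtain ⟨k, hk⟩ := (ZMod.intCast_eq_intCast_iff_dvd_sub b a 60).1 hab.symm
    exact ⟨k, by push_cast at hk; linarith⟩
  obtain ⟨k, hk⟩ := key _ 1 (by simpa using h1)
  obtain ⟨l, hl⟩ := key _ 0 (by simpa using h2)
  obtain ⟨m, hm⟩ := key _ 0 (by simpa using h3)
  obtain ⟨n, hn⟩ := key _ 1 (by simpa using h4)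
  have hdet := Matrix.det_fin_two (γ : Matrix (Fin 2) (Fin 2) ℤ)
  rw [γ.2] at hdet
  -- Passing from `τ` to `5τ` multiplies the upper right entry by 5 and divides the lower left one
  -- by 5.
  let δ : SL(2, ℤ) := ⟨!![1 + 60 * k, 300 * l; 12 * m, 1 + 60 * n], by
    rw [Matrix.det_fin_two_of]
    rw [hk, hl, hm, hn] at hdet
    linarith⟩
  refine ⟨δ, ?_, ⟨k, l, rfl, rfl⟩, fun τ => ?_⟩
  · rw [CongruenceSubgroup.Gamma_mem]
    have e60 : (60 : ZMod 12) = 0 := by decide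
    have e12 : (12 : ZMod 12) = 0 := by decide
    have e300 : (300 : ZMod 12) = 0 := by decide
    simp [δ, e60, e12, e300]
  · ext1
    rw [coe_scale (by norm_num), UpperHalfPlane.coe_specialLinearGroup_apply,
      UpperHalfPlane.coe_specialLinearGroup_apply, coe_scale (by norm_num)]
    simp only [hk, hl, hm, hn, δ]
    simp
    ring_nf

/-- The weights `-1` and `1` cancel. The conjugated matrix lies in `Γ(12)`, which settles `η²`, and
its first row is so close to `(1, 0)` that the Klein form is fixed too. -/
lemma klein_mul_eta_smul {j : ℤ} {γ : SL(2, ℤ)} (hγ : γ ∈ Γ(60)) (τ : ℍ) :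
    klein ![-(j / 5 : ℝ), 0] (scale 5 (γ • τ)) * dedekindEta (scale 5 (γ • τ)) ^ 2 =
      klein ![-(j / 5 : ℝ), 0] (scale 5 τ) * dedekindEta (scale 5 τ) ^ 2 := by
  obtain ⟨δ, hδ, ⟨k, l, h00, h01⟩, hc⟩ := exists_conj_five hγ
  rw [hc]
  have h1 : klein ![-(j / 5 : ℝ), 0] ∣[(-1 : ℤ)] δ = klein ![-(j / 5 : ℝ), 0] :=
    klein_slash_of_even (k := -(6 * j * k)) (l := -(30 * j * l)) (by rw [h00]; push_cast; ring)
      (by rw [h01]; push_cast; ring) ⟨6 * j ^ 2 * l, by push_cast; ring⟩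
  have h2 := mul_slash_SL2 (-1) 1 δ (klein ![-(j / 5 : ℝ), 0]) (dedekindEta ^ 2)
  rw [h1, eta_sq_slash hδ] at h2
  have h3 := congrFun h2 (scale 5 τ)
  rw [SL_slash_apply] at h3
  simpa using h3

end

section

open ModularGroup ModularForm
open scoped ModularForm

/-! ### The Rogers–Ramanujan functions -/

/-- The product over the residue classes `± j` modulo `5`. -/
def psiProd (j : ℂ) (τ : ℍ) : ℂ :=
  ∏' n : ℕ, (1 - qpow (5 * n + j) τ) * (1 - qpow (5 * n + (5 - j)) τ)

lemma psi1_eq (τ : ℍ) : psi1 τ = qpow (-1 / 60) τ * (psiProd 1 τ)⁻¹ := by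
  rw [psi1, psiProd]; norm_num

lemma psi2_eq (τ : ℍ) : psi2 τ = qpow (11 / 60) τ * (psiProd 2 τ)⁻¹ := by
  rw [psi2, psiProd]; norm_num

lemma nome_scale_five (τ : ℍ) : nome (scale 5 τ) = qpow 5 τ := by
  rw [nome, qpow_scale (by norm_num)]; norm_num

lemma qpow_five_mul_add (j : ℂ) (n : ℕ) (τ : ℍ) :
    qpow (5 * n + j) τ = qpow j τ * nome (scale 5 τ) ^ n := by
  rw [nome_scale_five, ← qpow_nat_mul, ← qpow_add]; congr 1; ring

lemma multipliable_one_sub_qpow (j : ℂ) (τ : ℍ) :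
    Multipliable fun n : ℕ => 1 - qpow (5 * n + j) τ := by
  simp_rw [qpow_five_mul_add]
  exact multipliable_one_sub_mul_pow (norm_nome_lt_one _) _

lemma psiProd_eq_mul (j : ℂ) (τ : ℍ) : psiProd j τ =
    (∏' n : ℕ, (1 - qpow (5 * n + j) τ)) * ∏' n : ℕ, (1 - qpow (5 * n + (5 - j)) τ) :=
  (multipliable_one_sub_qpow j τ).tprod_mul (multipliable_one_sub_qpow (5 - j) τ)

lemma tprod_one_sub_qpow_ne_zero {j : ℝ} (hj : 0 < j) (τ : ℍ) :
    ∏' n : ℕ, (1 - qpow (5 * n + j) τ) ≠ 0 := by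
  simp_rw [qpow_five_mul_add]
  refine tprod_one_sub_mul_pow_ne_zero (norm_nome_lt_one _) fun n h => ?_
  rw [← qpow_five_mul_add] at h
  have h1 := norm_qpow_ofReal (5 * n + j) τ
  push_cast at h1
  rw [h, norm_one, eq_comm, Real.exp_eq_one_iff] at h1
  have h2 : 0 < π * (5 * n + j) * τ.im := by
    have := τ.im_pos
    positivity
  linarith

lemma psiProd_ne_zero {j : ℝ} (hj : 0 < j) (hj5 : j < 5) (τ : ℍ) : psiProd j τ ≠ 0 := by
  rw [psiProd_eq_mul]
  refine mul_ne_zero (tprod_one_sub_qpow_ne_zero hj τ) ?_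
  have := tprod_one_sub_qpow_ne_zero (sub_pos.2 hj5) τ
  push_cast at this
  exact this

lemma jacobiTheta₂_five (j : ℂ) (τ : ℍ) : jacobiTheta₂ (-(j * τ) + 1 / 2 + 5 * τ / 2) (5 * τ) =
    (∏' n : ℕ, (1 - qpow (5 * n + 5) τ)) * psiProd j τ := by
  have h := jacobiTheta₂_eq_tprod (-(j * τ)) (scale 5 τ)
  rw [coe_scale (by norm_num)] at h
  push_cast at h
  have e : cexp (2 * π * I * -(j * τ)) = qpow (-j) τ := by rw [qpow]; congr 1; ring
  rw [h, e, psiProd_eq_mul, mul_comm (∏' n : ℕ, (1 - qpow (5 * n + j) τ))]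
  congr 1
  · refine tprod_congr fun n => ?_
    rw [qpow_five_mul_add, nome_scale_five]
  congr 1
  · refine tprod_congr fun n => ?_
    rw [qpow_five_mul_add, nome_scale_five, ← qpow_add]
    congr 3; ring
  · refine tprod_congr fun n => ?_
    rw [qpow_five_mul_add, ← qpow_neg, neg_neg]

lemma dedekindEta_scale_five (τ : ℍ) :
    dedekindEta (scale 5 τ) = qpow (5 / 24) τ * ∏' n : ℕ, (1 - qpow (5 * n + 5) τ) := by
  rw [dedekindEta_apply, eta_eq, qpow_scale (by norm_num)]
  congr 1
  · congr 1; norm_num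
  · refine tprod_congr fun n => ?_
    rw [qpow_five_mul_add, nome_scale_five, pow_succ']

/-- For `j = 1, 2` the exponent is `1/60` and `-11/60`, so up to the constant `I` these are the
reciprocals of `ψ₁` and `ψ₂`. -/
lemma klein_mul_eta (j : ℝ) (τ : ℍ) :
    klein ![-(j / 5), 0] (scale 5 τ) * dedekindEta (scale 5 τ) ^ 2 =
      I * qpow (j ^ 2 / 10 - j / 2 + 5 / 12) τ * psiProd j τ := by
  have hη := dedekindEta_ne_zero (scale 5 τ)
  have h := jacobiTheta₂_five j τ
  rw [klein, coe_scale (by norm_num)]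
  simp only [Matrix.cons_val_zero, Matrix.cons_val_one]
  push_cast
  rw [show (-((j : ℂ) / 5) * (5 * τ) + 0 + 1 / 2 + 5 * τ / 2) = -(j * τ) + 1 / 2 + 5 * τ / 2 by ring, h]
  have e := dedekindEta_scale_five τ
  have hI : cexp (π * I * (1 / 2)) = I := by
    rw [show (π * I * (1 / 2) : ℂ) = π / 2 * I by ring, Complex.exp_pi_div_two_mul_I]
  have e2 : cexp (π * I * (-((j : ℂ) / 5) * (-((j : ℂ) / 5) * (5 * τ) + 0) +
      (-((j : ℂ) / 5) * (5 * τ) + 0) + 1 / 2 + 5 * τ / 4)) =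
      cexp (π * I * (1 / 2)) * (qpow (j ^ 2 / 10 - j / 2 + 5 / 12) τ * qpow (5 / 24) τ) := by
    rw [qpow, qpow, ← Complex.exp_add, ← Complex.exp_add]; congr 1; ring
  rw [e2, hI]
  have e3 : I * (qpow (j ^ 2 / 10 - j / 2 + 5 / 12) τ * qpow (5 / 24) τ) *
      ((∏' n : ℕ, (1 - qpow (5 * n + 5) τ)) * psiProd j τ) =
      I * qpow (j ^ 2 / 10 - j / 2 + 5 / 12) τ * psiProd j τ * dedekindEta (scale 5 τ) := by
    rw [e]; ring
  rw [e3]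
  field_simp

lemma psi_smul {j : ℤ} {γ : SL(2, ℤ)} (hγ : γ ∈ Γ(60)) (τ : ℍ) :
    qpow ((j : ℝ) ^ 2 / 10 - (j : ℝ) / 2 + 5 / 12) (γ • τ) * psiProd (j : ℝ) (γ • τ) =
    qpow ((j : ℝ) ^ 2 / 10 - (j : ℝ) / 2 + 5 / 12) τ * psiProd (j : ℝ) τ := by
  have h := klein_mul_eta_smul (j := j) hγ τ
  rw [klein_mul_eta, klein_mul_eta, mul_assoc, mul_assoc] at h
  exact mul_left_cancel₀ Complex.I_ne_zero h

lemma psi1_smul {γ : SL(2, ℤ)} (hγ : γ ∈ Γ(60)) (τ : ℍ) : psi1 (γ • τ) = psi1 τ := by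
  have key : ∀ τ, psi1 τ = (qpow (((1 : ℤ) : ℝ) ^ 2 / 10 - ((1 : ℤ) : ℝ) / 2 + 5 / 12) τ *
      psiProd ((1 : ℤ) : ℝ) τ)⁻¹ := fun τ => by
    rw [psi1_eq, mul_inv, ← qpow_neg]; norm_num
  rw [key, key, psi_smul hγ]

lemma psi2_smul {γ : SL(2, ℤ)} (hγ : γ ∈ Γ(60)) (τ : ℍ) : psi2 (γ • τ) = psi2 τ := by
  have key : ∀ τ, psi2 τ = (qpow (((2 : ℤ) : ℝ) ^ 2 / 10 - ((2 : ℤ) : ℝ) / 2 + 5 / 12) τ *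
      psiProd ((2 : ℤ) : ℝ) τ)⁻¹ := fun τ => by
    rw [psi2_eq, mul_inv, ← qpow_neg]; norm_num
  rw [key, key, psi_smul hγ]

/-! ### Theta series of modulus five -/

lemma tprod_one_sub_nome_eq (τ : ℍ) : ∏' n : ℕ, (1 - nome τ ^ (n + 1)) =
    (∏' n : ℕ, (1 - qpow (5 * n + 5) τ)) * (psiProd 1 τ * psiProd 2 τ) := by
  have hm (j : ℂ) : Multipliable fun n : ℕ => (1 - qpow (5 * n + j) τ) * (1 - qpow (5 * n + (5 - j)) τ) :=
    (multipliable_one_sub_qpow j τ).mul (multipliable_one_sub_qpow (5 - j) τ)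
  have h1 : Multipliable fun n : ℕ => 1 - nome τ ^ (n + 1) := by
    simpa only [pow_succ'] using multipliable_one_sub_mul_pow (norm_nome_lt_one τ) (nome τ)
  have t1 := h1.hasProd.tendsto_prod_nat.comp (tendsto_id.const_mul_atTop' (r := 5) (by norm_num))
  have t2 := (multipliable_one_sub_qpow 5 τ).hasProd.tendsto_prod_nat.mul
    ((hm 1).hasProd.tendsto_prod_nat.mul (hm 2).hasProd.tendsto_prod_nat)
  refine tendsto_nhds_unique t1 (t2.congr fun N => ?_)
  simp only [Function.comp_apply, id]
  induction N with
  | zero => simp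
  | succ N ih =>
    rw [show 5 * (N + 1) = 5 * N + 1 + 1 + 1 + 1 + 1 by ring]
    simp only [prod_range_succ]
    rw [← ih]
    have e (k : ℕ) : nome τ ^ (5 * N + k) = qpow (5 * N + k) τ := by
      rw [← qpow_natCast]; push_cast; rfl
    rw [e 1, show 5 * N + 1 + 1 = 5 * N + 2 by ring, e 2, show 5 * N + 2 + 1 = 5 * N + 3 by ring, e 3,
      show 5 * N + 3 + 1 = 5 * N + 4 by ring, e 4, show 5 * N + 4 + 1 = 5 * N + 5 by ring, e 5]
    norm_num
    ring

/-- `∑ₙ (-1)ⁿ q ^ (5 / 2 (n + b / 10) ^ 2)`. -/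
def thetaFive (b : ℂ) (τ : ℍ) : ℂ :=
  qpow (b ^ 2 / 40) τ * jacobiTheta₂ (1 / 2 + b * τ / 2) (5 * τ)

/-- Multiplication by `η` cancels the product over `± 1` modulo 5 and leaves the one over `± 2`,
completed by the multiples of 5 to a triple product. -/
lemma dedekindEta_mul_psi1 (τ : ℍ) : dedekindEta τ * psi1 τ = thetaFive 1 τ := by
  have h0 : psiProd 1 τ ≠ 0 := by
    exact_mod_cast psiProd_ne_zero (j := 1) (by norm_num) (by norm_num) τ
  have h := jacobiTheta₂_five 2 τ
  rw [thetaFive, show (1 / 2 + 1 * (τ : ℂ) / 2) = -(2 * τ) + 1 / 2 + 5 * τ / 2 by ring, h,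
    dedekindEta_apply, eta_eq, psi1_eq, tprod_one_sub_nome_eq,
    show (1 ^ 2 / 40 : ℂ) = 1 / 24 + -1 / 60 by norm_num, qpow_add]
  field_simp

lemma dedekindEta_mul_psi2 (τ : ℍ) : dedekindEta τ * psi2 τ = thetaFive 3 τ := by
  have h0 : psiProd 2 τ ≠ 0 := by
    exact_mod_cast psiProd_ne_zero (j := 2) (by norm_num) (by norm_num) τ
  have h := jacobiTheta₂_five 1 τ
  rw [thetaFive, show (1 / 2 + 3 * (τ : ℂ) / 2) = -(1 * τ) + 1 / 2 + 5 * τ / 2 by ring, h,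
    dedekindEta_apply, eta_eq, psi2_eq, tprod_one_sub_nome_eq,
    show (3 ^ 2 / 40 : ℂ) = 1 / 24 + 11 / 60 by norm_num, qpow_add]
  field_simp

lemma thetaFive_neg (b : ℂ) (τ : ℍ) : thetaFive (-b) τ = thetaFive b τ := by
  rw [thetaFive, thetaFive, neg_sq, ← jacobiTheta₂_neg_left, ← jacobiTheta₂_add_left]
  congr 2; ring

lemma thetaFive_add_ten (b : ℂ) (τ : ℍ) : thetaFive (b + 10) τ = -thetaFive b τ := by
  have h := jacobiTheta₂_add_left' (1 / 2 + b * τ / 2) (5 * τ)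
  rw [thetaFive, thetaFive,
    show (1 / 2 + (b + 10) * τ / 2 : ℂ) = 1 / 2 + b * τ / 2 + 5 * τ by ring, h, ← mul_assoc, qpow, qpow,
    ← Complex.exp_add, show (2 * π * I * ((b + 10) ^ 2 / 40) * τ + -π * I * (5 * τ +
      2 * (1 / 2 + b * τ / 2)) : ℂ) = 2 * π * I * (b ^ 2 / 40) * τ - π * I by ring, Complex.exp_sub,
    Complex.exp_pi_mul_I]
  ring

/-- Evenness in `b` and the sign change under `b ↦ b + 10` contradict each other at `b = 5` unless
the value is zero. -/
lemma thetaFive_five (τ : ℍ) : thetaFive 5 τ = 0 := by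
  have h := thetaFive_add_ten (-5) τ
  rw [thetaFive_neg, show (-5 + 10 : ℂ) = 5 by norm_num] at h
  linear_combination h / 2

lemma thetaFive_seven (τ : ℍ) : thetaFive 7 τ = -thetaFive 3 τ := by
  rw [← thetaFive_neg 3, ← thetaFive_add_ten]; norm_num

lemma thetaFive_nine (τ : ℍ) : thetaFive 9 τ = -thetaFive 1 τ := by
  rw [← thetaFive_neg 1, ← thetaFive_add_ten]; norm_num

end

/-! ### The action of `S` on `ψ₁` and `ψ₂`, and invariant forms of degree ten -/

section

open ModularGroup ModularForm
open scoped ModularForm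

lemma sqrt_five_sq : ((√5 : ℝ) : ℂ) ^ 2 = 5 := by
  rw [← ofReal_pow, Real.sq_sqrt (by norm_num)]; norm_num

lemma sqrt_five_ne_zero : ((√5 : ℝ) : ℂ) ≠ 0 := by
  intro h
  have := sqrt_five_sq
  rw [h] at this
  norm_num at this

/-- `e(x / 20)`. -/
def zeta20 : ℂ := cexp (2 * π * I * (1 / 20))

lemma zeta20_pow_ten : zeta20 ^ 10 = -1 := by
  rw [zeta20, ← Complex.exp_nat_mul, ← Complex.exp_pi_mul_I]; congr 1; push_cast; ring

lemma zeta20_ne_zero : zeta20 ≠ 0 := Complex.exp_ne_zero _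

lemma zeta20_sq_ne : zeta20 ^ 2 + 1 ≠ 0 := by
  intro h
  have h1 : zeta20 ^ 2 = cexp (π * I) := by rw [Complex.exp_pi_mul_I]; linear_combination h
  rw [zeta20, ← Complex.exp_nat_mul, Complex.exp_eq_exp_iff_exists_int] at h1
  obtain ⟨n, hn⟩ := h1
  have hpi : (2 * π * I : ℂ) ≠ 0 := Complex.two_pi_I_ne_zero
  have h2 : (2 * π * I) * ((-2 / 5 : ℂ) - n) = 0 := by
    push_cast at hn
    linear_combination hn
  have h3 := (mul_eq_zero.1 h2).resolve_left hpi
  have h4 : (-2 : ℤ) = 5 * n := by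
    have : (-2 : ℂ) = 5 * n := by linear_combination 5 * h3
    exact_mod_cast this
  omega

lemma zeta20_relation : zeta20 ^ 8 - zeta20 ^ 6 + zeta20 ^ 4 - zeta20 ^ 2 + 1 = 0 := by
  refine mul_left_cancel₀ zeta20_sq_ne ?_
  linear_combination zeta20_pow_ten

lemma exp_neg_eq_zeta20 (n : ℕ) : cexp (-(2 * π * I * (n / 20))) = (zeta20 ^ n)⁻¹ := by
  rw [zeta20, ← Complex.exp_nat_mul, ← Complex.exp_neg]; congr 1; ring

lemma thetaFive_eq_tsum (b : ℂ) (τ : ℍ) : thetaFive b τ =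
    ∑' m : ℤ, cexp (π * I * m + 2 * π * I * (b ^ 2 / 40 + b * m / 2 + 5 * m ^ 2 / 2) * τ) := by
  rw [thetaFive, jacobiTheta₂, ← tsum_mul_left]
  refine tsum_congr fun m => ?_
  rw [jacobiTheta₂_term, qpow, ← Complex.exp_add]
  congr 1; ring

/-- The theta functional equation at `τ/5` gives a series in `q ^ (1/10)`; sorting its terms modulo
5 produces the five theta series. -/
lemma thetaFive_S (k : ℕ) (τ : ℍ) : thetaFive (2 * k + 1) (S • τ) =
    (-I * τ : ℂ) ^ (1 / 2 : ℂ) / √5 * ∑ r : Fin 5,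
      cexp (-(2 * π * I * (((2 * k + 1) * (2 * (r : ℕ) + 1) : ℕ) / 20))) *
        thetaFive (2 * (r : ℕ) + 1) τ := by
  have ht := τ.ne_zero
  have hne : -I * (τ : ℂ) ≠ 0 := mul_ne_zero (neg_ne_zero.2 Complex.I_ne_zero) ht
  obtain ⟨b, hb⟩ : ∃ b : ℂ, b = 2 * k + 1 := ⟨_, rfl⟩
  have hs5 : (-I * (τ / 5) : ℂ) ^ (1 / 2 : ℂ) = (-I * τ : ℂ) ^ (1 / 2 : ℂ) / √5 := by
    rw [eq_div_iff sqrt_five_ne_zero]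
    have h5 : ((√5 : ℝ) : ℂ) = ((5 : ℝ) : ℂ) ^ (1 / 2 : ℂ) := by
      rw [Real.sqrt_eq_rpow, Complex.ofReal_cpow (by norm_num)]; norm_num
    have h50 : ((5 : ℝ) : ℂ) ≠ 0 := by norm_num
    have hd : (-I * (τ / 5) : ℂ) ≠ 0 :=
      mul_ne_zero (neg_ne_zero.2 Complex.I_ne_zero) (div_ne_zero ht (by norm_num))
    rw [h5, show -I * (τ : ℂ) = ((5 : ℝ) : ℂ) * (-I * (τ / 5)) by push_cast; ring,
      Complex.cpow_def_of_ne_zero h50, Complex.cpow_def_of_ne_zero hd,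
      Complex.cpow_def_of_ne_zero (mul_ne_zero h50 hd), Complex.log_ofReal_mul (by norm_num) hd,
      Complex.ofReal_log (by norm_num), ← Complex.exp_add]
    congr 1; ring
  have hs0 : (-I * (τ / 5) : ℂ) ^ (1 / 2 : ℂ) ≠ 0 := by
    rw [Complex.cpow_ne_zero_iff]
    left
    exact mul_ne_zero (neg_ne_zero.2 Complex.I_ne_zero) (div_ne_zero ht (by norm_num))
  have fe := jacobiTheta₂_functional_equation (τ / 10 - b / 10) (τ / 5)
  have e1 : (τ / 10 - b / 10) / (τ / 5) = 1 / 2 + b * ((S • τ : ℍ) : ℂ) / 2 := by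
    rw [coe_S_smul]; field_simp; ring
  have e2 : -1 / (τ / 5 : ℂ) = 5 * ((S • τ : ℍ) : ℂ) := by rw [coe_S_smul]; field_simp
  rw [e1, e2] at fe
  have hz : (π * I * (τ / 10 - b / 10) ^ 2 / (τ / 5) : ℂ) =
      2 * π * I * (τ / 40 - b / 20) - 2 * π * I * (b ^ 2 / 40) * ((S • τ : ℍ) : ℂ) := by
    rw [coe_S_smul]; field_simp; ring
  have key : thetaFive b (S • τ) = (-I * (τ / 5) : ℂ) ^ (1 / 2 : ℂ) *
      (cexp (2 * π * I * (τ / 40 - b / 20)) * jacobiTheta₂ (τ / 10 - b / 10) (τ / 5)) := by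
    rw [fe, thetaFive, qpow, show (-π * I * (τ / 10 - b / 10) ^ 2 / (τ / 5) : ℂ) =
      -(2 * π * I * (τ / 40 - b / 20) - 2 * π * I * (b ^ 2 / 40) * ((S • τ : ℍ) : ℂ)) by
        rw [← hz]; ring, neg_sub, Complex.exp_sub]
    field_simp
  have him : 0 < ((τ : ℂ) / 5).im := by
    rw [show (τ : ℂ) / 5 = ((1 / 5 : ℝ) : ℂ) * τ by push_cast; ring, Complex.im_ofReal_mul]
    exact mul_pos (by norm_num) τ.im_pos
  have hsum : Summable fun n : ℤ => jacobiTheta₂_term n (τ / 10 - b / 10) (τ / 5) :=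
    (hasSum_jacobiTheta₂_term _ him).summable
  rw [← hb, key, hs5, jacobiTheta₂, tsum_int_eq_sum_fin 5 hsum, mul_sum]
  congr 1
  refine sum_congr rfl fun r _ => ?_
  rw [thetaFive_eq_tsum, ← tsum_mul_left, ← tsum_mul_left]
  refine tsum_congr fun m => ?_
  rw [jacobiTheta₂_term, ← Complex.exp_add, ← Complex.exp_add, Complex.exp_eq_exp_iff_exists_int]
  -- The index `5m + r` contributes the phase `-πi (2k + 1) m`, while the target has `πi m`; they
  -- differ by this multiple of `2πi`.
  refine ⟨-m * (k + 1), ?_⟩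
  rw [hb]
  push_cast
  ring

/-- The entries of the matrix by which `S` acts on `ψ₁` and `ψ₂`. -/
def psiCoeff : ℂ := (zeta20 + zeta20⁻¹) / √5

/-- The golden ratio conjugate `2 cos(2π / 5)`, as a quotient of entries of that matrix. -/
def psiRatio : ℂ := zeta20 ^ 2 - 1 + (zeta20 ^ 2)⁻¹

lemma psiRatio_relation : psiRatio ^ 2 + psiRatio - 1 = 0 := by
  have hz := zeta20_ne_zero
  rw [psiRatio]
  field_simp
  linear_combination zeta20_relation

lemma psiCoeff_sq : 5 * psiCoeff ^ 2 = psiRatio + 3 := by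
  have hz := zeta20_ne_zero
  rw [psiRatio, psiCoeff, div_pow, sqrt_five_sq]
  field_simp
  ring

lemma psiCoeff_mul_psiRatio :
    psiCoeff * psiRatio = (zeta20 ^ 3 + (zeta20 ^ 3)⁻¹) / √5 := by
  have hz := zeta20_ne_zero
  have h5 := sqrt_five_ne_zero
  rw [psiRatio, psiCoeff]
  field_simp
  ring

lemma inv_zeta20_pow_add_ten (n : ℕ) : (zeta20 ^ (n + 10))⁻¹ = -(zeta20 ^ n)⁻¹ := by
  rw [pow_add, zeta20_pow_ten, mul_neg_one, inv_neg]

lemma inv_zeta20_pow_ten_sub {m n : ℕ} (h : m + n = 10) : (zeta20 ^ n)⁻¹ = -zeta20 ^ m := by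
  have hz := pow_ne_zero n zeta20_ne_zero
  rw [inv_eq_iff_eq_inv, eq_comm, inv_eq_iff_eq_inv, eq_comm, inv_eq_of_mul_eq_one_left]
  rw [neg_mul, ← pow_add, h, zeta20_pow_ten, neg_neg]

/-- Of the five theta series, the one with `b = 5` vanishes, and those with `b = 7, 9` are the
negatives of those with `b = 3, 1`. After division by `η` a combination of `ψ₁` and `ψ₂` remains. -/
lemma psi1_S (τ : ℍ) : psi1 (S • τ) = psiCoeff * (psi1 τ + psiRatio * psi2 τ) := by
  have h := thetaFive_S 0 τ
  have hη := dedekindEta_S τ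
  have h0 := dedekindEta_ne_zero (S • τ)
  have h0' := dedekindEta_ne_zero τ
  have h5 := sqrt_five_ne_zero
  have hz := zeta20_ne_zero
  generalize S • τ = σ at h hη h0 ⊢
  simp only [Fin.sum_univ_five, exp_neg_eq_zeta20] at h
  norm_num [thetaFive_five, thetaFive_seven, thetaFive_nine, ← dedekindEta_mul_psi1,
    ← dedekindEta_mul_psi2] at h
  rw [← neg_mul] at h
  generalize (-I * (τ : ℂ)) ^ (1 / 2 : ℂ) = s at h hη
  have hs : s ≠ 0 := by rintro rfl; exact h0 (by rw [hη, zero_mul])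
  refine mul_left_cancel₀ h0 (h.trans ?_)
  rw [hη]
  rw [mul_add psiCoeff, ← mul_assoc psiCoeff, psiCoeff_mul_psiRatio, psiCoeff,
    inv_zeta20_pow_ten_sub (m := 3) (n := 7) rfl, inv_zeta20_pow_ten_sub (m := 1) (n := 9) rfl]
  ring

lemma psi2_S (τ : ℍ) : psi2 (S • τ) = psiCoeff * (psiRatio * psi1 τ - psi2 τ) := by
  have h := thetaFive_S 1 τ
  have hη := dedekindEta_S τ
  have h0 := dedekindEta_ne_zero (S • τ)
  have h0' := dedekindEta_ne_zero τ
  have h5 := sqrt_five_ne_zero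
  have hz := zeta20_ne_zero
  generalize S • τ = σ at h hη h0 ⊢
  simp only [Fin.sum_univ_five, exp_neg_eq_zeta20] at h
  norm_num [thetaFive_five, thetaFive_seven, thetaFive_nine, ← dedekindEta_mul_psi1,
    ← dedekindEta_mul_psi2] at h
  rw [← neg_mul] at h
  generalize (-I * (τ : ℂ)) ^ (1 / 2 : ℂ) = s at h hη
  have hs : s ≠ 0 := by rintro rfl; exact h0 (by rw [hη, zero_mul])
  refine mul_left_cancel₀ h0 (h.trans ?_)
  rw [hη]
  rw [mul_sub psiCoeff, ← mul_assoc psiCoeff, psiCoeff_mul_psiRatio, psiCoeff,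
    inv_zeta20_pow_add_ten 17, inv_zeta20_pow_add_ten 7, inv_zeta20_pow_add_ten 11,
    inv_zeta20_pow_add_ten 1, inv_zeta20_pow_ten_sub (m := 3) (n := 7) rfl,
    inv_zeta20_pow_ten_sub (m := 1) (n := 9) rfl]
  ring

section Icosahedral

variable {X Y r p : ℂ}

/-- Powers of `r` are reduced modulo `r² + r - 1`; the certificate is the quotient of the polynomial
division. -/
lemma add_mul_pow_five (hr : r ^ 2 + r - 1 = 0) : (X + r * Y) ^ 5 =
      X ^ 5 + 5 * X ^ 4 * Y * r + (-10) * X ^ 3 * Y ^ 2 * r + 10 * X ^ 3 * Y ^ 2 + 20 * X ^ 2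
      * Y ^ 3 * r + (-10) * X ^ 2 * Y ^ 3 + (-15) * X * Y ^ 4 * r + 10 * X * Y ^ 4 + 5 * Y ^ 5
      * r + (-3) * Y ^ 5 := by
  linear_combination (
    10 * X ^ 3 * Y ^ 2 + 10 * X ^ 2 * Y ^ 3 * r + (-10) * X ^ 2 * Y ^ 3 + 5 * X * Y ^ 4 * r ^
    2 + (-5) * X * Y ^ 4 * r + 10 * X * Y ^ 4 + Y ^ 5 * r ^ 3 + (-1) * Y ^ 5 * r ^ 2 + 2 * Y ^
    5 * r + (-3) * Y ^ 5) * hr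

lemma mul_sub_pow_five (hr : r ^ 2 + r - 1 = 0) : (r * X - Y) ^ 5 =
      5 * X ^ 5 * r + (-3) * X ^ 5 + 15 * X ^ 4 * Y * r + (-10) * X ^ 4 * Y + 20 * X ^ 3 * Y ^
      2 * r + (-10) * X ^ 3 * Y ^ 2 + 10 * X ^ 2 * Y ^ 3 * r + (-10) * X ^ 2 * Y ^ 3 + 5 * X *
      Y ^ 4 * r + (-1) * Y ^ 5 := by
  linear_combination (
    X ^ 5 * r ^ 3 + (-1) * X ^ 5 * r ^ 2 + 2 * X ^ 5 * r + (-3) * X ^ 5 + (-5) * X ^ 4 * Y * r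
    ^ 2 + 5 * X ^ 4 * Y * r + (-10) * X ^ 4 * Y + 10 * X ^ 3 * Y ^ 2 * r + (-10) * X ^ 3 * Y ^
    2 + (-10) * X ^ 2 * Y ^ 3) * hr

lemma add_mul_mul_sub_sq (hr : r ^ 2 + r - 1 = 0) :
    ((X + r * Y) * (r * X - Y)) ^ 2 = (1 - r) * (X ^ 2 - X * Y - Y ^ 2) ^ 2 := by
  linear_combination (
    X ^ 4 + 2 * X ^ 3 * Y * r + (-2) * X ^ 3 * Y + X ^ 2 * Y ^ 2 * r ^ 2 + (-1) * X ^ 2 * Y ^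
    2 * r + (-2) * X ^ 2 * Y ^ 2 + (-2) * X * Y ^ 3 * r + 2 * X * Y ^ 3 + Y ^ 4) * hr

lemma pow_ten_of_sq (hr : r ^ 2 + r - 1 = 0) (hp : 5 * p ^ 2 = r + 3) :
    p ^ 10 = (11 * r + 18) / 125 := by
  rw [show p ^ 10 = (5 * p ^ 2) ^ 5 / 3125 by ring, hp]
  linear_combination ((1/3125) * r ^ 3 + (14/3125) * r ^ 2 + (77/3125) * r + (207/3125)) * hr

/-- The three forms `X¹⁰ + 14 X⁵Y⁵ - Y¹⁰`, `X³Y² (X⁵ + 2Y⁵)` and `X²Y³ (X⁵ - Y⁵/2)` span a space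
stable under the substitution by which `S` acts. Being of degree ten, they involve `p` only through
`p¹⁰`, which lies in the field of `r`. -/
lemma icosahedral_zero (hr : r ^ 2 + r - 1 = 0) (hp : 5 * p ^ 2 = r + 3) :
    (p * (X + r * Y)) ^ 10 + 14 * (p * (X + r * Y)) ^ 5 * (p * (r * X - Y)) ^ 5 -
        (p * (r * X - Y)) ^ 10 =
      (2 * r + 1) / 5 * (X ^ 10 + 14 * X ^ 5 * Y ^ 5 - Y ^ 10) +
      (4 * r + 2) * (X ^ 3 * Y ^ 2 * (X ^ 5 + 2 * Y ^ 5)) +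
      (8 * r + 4) * (X ^ 2 * Y ^ 3 * (X ^ 5 - 1 / 2 * Y ^ 5)) := by
  rw [show (p * (X + r * Y)) ^ 10 + 14 * (p * (X + r * Y)) ^ 5 * (p * (r * X - Y)) ^ 5 -
      (p * (r * X - Y)) ^ 10 = p ^ 10 * (((X + r * Y) ^ 5) ^ 2 +
        14 * (X + r * Y) ^ 5 * (r * X - Y) ^ 5 - ((r * X - Y) ^ 5) ^ 2) by ring,
    pow_ten_of_sq hr hp, add_mul_pow_five hr, mul_sub_pow_five hr]
  linear_combination (
    (-11/5) * X ^ 10 * r + (37/5) * X ^ 10 + (88/5) * X ^ 9 * Y * r + (144/5) * X ^ 9 * Y +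
    (-22/5) * X ^ 8 * Y ^ 2 * r + (514/5) * X ^ 8 * Y ^ 2 + (-44/5) * X ^ 7 * Y ^ 3 * r +
    (1028/5) * X ^ 7 * Y ^ 3 + (264/5) * X ^ 6 * Y ^ 4 * r + (432/5) * X ^ 6 * Y ^ 4 + (286/5)
    * X ^ 5 * Y ^ 5 * r + (1238/5) * X ^ 5 * Y ^ 5 + (-264/5) * X ^ 4 * Y ^ 6 * r + (-432/5) *
    X ^ 4 * Y ^ 6 + (-44/5) * X ^ 3 * Y ^ 7 * r + (1028/5) * X ^ 3 * Y ^ 7 + (22/5) * X ^ 2 *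
    Y ^ 8 * r + (-514/5) * X ^ 2 * Y ^ 8 + (88/5) * X * Y ^ 9 * r + (144/5) * X * Y ^ 9 +
    (11/5) * Y ^ 10 * r + (-37/5) * Y ^ 10) * hr

lemma icosahedral_one (hr : r ^ 2 + r - 1 = 0) (hp : 5 * p ^ 2 = r + 3) :
    (p * (X + r * Y)) ^ 3 * (p * (r * X - Y)) ^ 2 *
        ((p * (X + r * Y)) ^ 5 + 2 * (p * (r * X - Y)) ^ 5) =
      (2 * r + 1) / 25 * (X ^ 10 + 14 * X ^ 5 * Y ^ 5 - Y ^ 10) +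
      (2 - r) / 5 * (X ^ 3 * Y ^ 2 * (X ^ 5 + 2 * Y ^ 5)) +
      (-2 * r - 6) / 5 * (X ^ 2 * Y ^ 3 * (X ^ 5 - 1 / 2 * Y ^ 5)) := by
  rw [show (p * (X + r * Y)) ^ 3 * (p * (r * X - Y)) ^ 2 *
        ((p * (X + r * Y)) ^ 5 + 2 * (p * (r * X - Y)) ^ 5) = p ^ 10 *
        (((X + r * Y) * (r * X - Y)) ^ 2 * (X + r * Y) *
          ((X + r * Y) ^ 5 + 2 * (r * X - Y) ^ 5)) by ring,
    pow_ten_of_sq hr hp, add_mul_pow_five hr, mul_sub_pow_five hr, add_mul_mul_sub_sq hr]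
  linear_combination (
    (-22/25) * X ^ 10 * r + (19/25) * X ^ 10 + (-22/25) * X ^ 9 * Y * r ^ 2 + (-14/25) * X ^ 9
    * Y * r + (36/25) * X ^ 9 * Y + (-33/25) * X ^ 8 * Y ^ 2 * r ^ 2 + (144/25) * X ^ 8 * Y ^
    2 * r + (-116/25) * X ^ 8 * Y ^ 2 + (22/5) * X ^ 7 * Y ^ 3 * r ^ 2 + (-8/5) * X ^ 7 * Y ^
    3 * r + (-6/5) * X ^ 7 * Y ^ 3 + (77/25) * X ^ 6 * Y ^ 4 * r ^ 2 + (49/25) * X ^ 6 * Y ^ 4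
    * r + (-126/25) * X ^ 6 * Y ^ 4 + (77/25) * X ^ 5 * Y ^ 5 * r ^ 2 + (-259/25) * X ^ 5 * Y
    ^ 5 * r + (28/5) * X ^ 5 * Y ^ 5 + (-154/25) * X ^ 4 * Y ^ 6 * r ^ 2 + (-98/25) * X ^ 4 *
    Y ^ 6 * r + (252/25) * X ^ 4 * Y ^ 6 + (-231/25) * X ^ 3 * Y ^ 7 * r ^ 2 + (183/25) * X ^
    3 * Y ^ 7 * r + (38/25) * X ^ 3 * Y ^ 7 + (-11/5) * X ^ 2 * Y ^ 8 * r ^ 2 + (4/5) * X ^ 2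
    * Y ^ 8 * r + (3/5) * X ^ 2 * Y ^ 8 + (-11/25) * X * Y ^ 9 * r ^ 2 + (-7/25) * X * Y ^ 9 *
    r + (18/25) * X * Y ^ 9 + (-11/25) * Y ^ 10 * r ^ 2 + (3/5) * Y ^ 10 * r + (-1/25) * Y ^
    10) * hr

lemma icosahedral_two (hr : r ^ 2 + r - 1 = 0) (hp : 5 * p ^ 2 = r + 3) :
    (p * (X + r * Y)) ^ 2 * (p * (r * X - Y)) ^ 3 *
        ((p * (X + r * Y)) ^ 5 - 1 / 2 * (p * (r * X - Y)) ^ 5) =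
      (2 * r + 1) / 50 * (X ^ 10 + 14 * X ^ 5 * Y ^ 5 - Y ^ 10) +
      (-r - 3) / 10 * (X ^ 3 * Y ^ 2 * (X ^ 5 + 2 * Y ^ 5)) +
      (2 - r) / 5 * (X ^ 2 * Y ^ 3 * (X ^ 5 - 1 / 2 * Y ^ 5)) := by
  rw [show (p * (X + r * Y)) ^ 2 * (p * (r * X - Y)) ^ 3 *
        ((p * (X + r * Y)) ^ 5 - 1 / 2 * (p * (r * X - Y)) ^ 5) = p ^ 10 *
        (((X + r * Y) * (r * X - Y)) ^ 2 * (r * X - Y) *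
          ((X + r * Y) ^ 5 - 1 / 2 * (r * X - Y) ^ 5)) by ring,
    pow_ten_of_sq hr hp, add_mul_pow_five hr, mul_sub_pow_five hr, add_mul_mul_sub_sq hr]
  linear_combination (
    (11/50) * X ^ 10 * r ^ 2 + (-3/10) * X ^ 10 * r + (1/50) * X ^ 10 + (-11/50) * X ^ 9 * Y *
    r ^ 2 + (-7/50) * X ^ 9 * Y * r + (9/25) * X ^ 9 * Y + (11/10) * X ^ 8 * Y ^ 2 * r ^ 2 +
    (-2/5) * X ^ 8 * Y ^ 2 * r + (-3/10) * X ^ 8 * Y ^ 2 + (-231/50) * X ^ 7 * Y ^ 3 * r ^ 2 +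
    (183/50) * X ^ 7 * Y ^ 3 * r + (19/25) * X ^ 7 * Y ^ 3 + (77/25) * X ^ 6 * Y ^ 4 * r ^ 2 +
    (49/25) * X ^ 6 * Y ^ 4 * r + (-126/25) * X ^ 6 * Y ^ 4 + (77/50) * X ^ 5 * Y ^ 5 * r ^ 2
    + (-259/50) * X ^ 5 * Y ^ 5 * r + (14/5) * X ^ 5 * Y ^ 5 + (-77/50) * X ^ 4 * Y ^ 6 * r ^
    2 + (-49/50) * X ^ 4 * Y ^ 6 * r + (63/25) * X ^ 4 * Y ^ 6 + (11/5) * X ^ 3 * Y ^ 7 * r ^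
    2 + (-4/5) * X ^ 3 * Y ^ 7 * r + (-3/5) * X ^ 3 * Y ^ 7 + (33/50) * X ^ 2 * Y ^ 8 * r ^ 2
    + (-72/25) * X ^ 2 * Y ^ 8 * r + (58/25) * X ^ 2 * Y ^ 8 + (-11/25) * X * Y ^ 9 * r ^ 2 +
    (-7/25) * X * Y ^ 9 * r + (18/25) * X * Y ^ 9 + (11/25) * Y ^ 10 * r + (-19/50) * Y ^ 10) * hr

end Icosahedral

end

section

open ModularGroup ModularForm
open scoped ModularForm

/-! ### Nonnegative expansions -/

namespace HasNonnegQExpansion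

variable {f g : ℍ → ℂ} {r s : ℂ}

lemma congr (hf : HasNonnegQExpansion f r) (h : ∀ τ, f τ = g τ) : HasNonnegQExpansion g r :=
  (funext h : f = g) ▸ hf

lemma congr_exponent (hf : HasNonnegQExpansion f r) (h : r = s) : HasNonnegQExpansion f s := h ▸ hf

lemma add (hf : HasNonnegQExpansion f r) (hg : HasNonnegQExpansion g r) :
    HasNonnegQExpansion (f + g) r := by
  obtain ⟨a, ha, hfa⟩ := hf
  obtain ⟨b, hb, hgb⟩ := hg
  exact ⟨fun n => a n + b n, fun n => add_nonneg (ha n) (hb n),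
    (hfa.add hgb).congr_coeff fun n => by simp⟩

lemma smul (hf : HasNonnegQExpansion f r) {c : ℝ} (hc : 0 ≤ c) :
    HasNonnegQExpansion ((c : ℂ) • f) r := by
  obtain ⟨a, ha, hfa⟩ := hf
  exact ⟨fun n => c * a n, fun n => mul_nonneg hc (ha n), (hfa.smul c).congr_coeff fun n => by simp⟩

lemma mul (hf : HasNonnegQExpansion f r) (hg : HasNonnegQExpansion g s) :
    HasNonnegQExpansion (f * g) (r + s) := by
  obtain ⟨a, ha, hfa⟩ := hf
  obtain ⟨b, hb, hgb⟩ := hg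
  exact ⟨fun n => ∑ p ∈ antidiagonal n, a p.1 * b p.2,
    fun n => sum_nonneg fun p _ => mul_nonneg (ha _) (hb _),
    (hfa.mul hgb).congr_coeff fun n => by push_cast; rfl⟩

lemma mul_zero_exponent (hf : HasNonnegQExpansion f 0) (hg : HasNonnegQExpansion g 0) :
    HasNonnegQExpansion (f * g) 0 := (hf.mul hg).congr_exponent (by simp)

lemma one : HasNonnegQExpansion (1 : ℍ → ℂ) 0 := by
  refine ⟨fun n => if n = 0 then 1 else 0, fun n => by dsimp only; split_ifs <;> norm_num, fun τ => ?_⟩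
  refine (hasSum_ite_eq (0 : ℕ) (1 : ℂ)).congr_fun fun n => ?_
  dsimp only
  split_ifs with h <;> simp [h]

lemma pow (hf : HasNonnegQExpansion f 0) (n : ℕ) : HasNonnegQExpansion (f ^ n) 0 := by
  induction n with
  | zero => rw [pow_zero]; exact one
  | succ n ih => rw [pow_succ]; exact ih.mul_zero_exponent hf

lemma qpow_mul (hf : HasNonnegQExpansion f s) (r : ℂ) :
    HasNonnegQExpansion (fun τ => qpow r τ * f τ) (r + s) := by
  obtain ⟨a, ha, hfa⟩ := hf
  refine ⟨a, ha, fun τ => ?_⟩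
  refine ((hfa τ).mul_left (qpow r τ)).congr_fun fun n => ?_
  dsimp only
  rw [add_assoc, qpow_add]; ring

end HasNonnegQExpansion

/-- `(1 - qᵐ)⁻¹`. -/
def geom (m : ℕ) (τ : ℍ) : ℂ := (1 - nome τ ^ m)⁻¹

lemma one_sub_nome_pow_ne_zero {m : ℕ} (hm : m ≠ 0) (τ : ℍ) : 1 - nome τ ^ m ≠ 0 := by
  obtain ⟨k, rfl⟩ := Nat.exists_eq_succ_of_ne_zero hm
  exact one_sub_pow_ne_zero (norm_nome_lt_one τ) k

lemma hasNonnegQExpansion_geom {m : ℕ} (hm : m ≠ 0) : HasNonnegQExpansion (geom m) 0 := by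
  refine ⟨fun n => if m ∣ n then 1 else 0, fun n => by dsimp only; split_ifs <;> norm_num, fun τ => ?_⟩
  have hlt : ‖nome τ ^ m‖ < 1 := by
    rw [norm_pow]; exact pow_lt_one₀ (norm_nonneg _) (norm_nome_lt_one τ) hm
  have h := hasSum_geometric_of_norm_lt_one hlt
  have hinj : Function.Injective fun k : ℕ => m * k := fun a b hab =>
    Nat.eq_of_mul_eq_mul_left (Nat.pos_of_ne_zero hm) hab
  rw [geom]
  refine (hinj.hasSum_iff (fun n hn => ?_)).1 (h.congr_fun fun n => ?_)
  · have : ¬ m ∣ n := fun ⟨k, hk⟩ => hn ⟨k, hk.symm⟩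
    simp [this]
  · simp only [Function.comp_apply, dvd_mul_right, if_true, zero_add]
    rw [qpow_natCast, pow_mul]; simp

lemma hasNonnegQExpansion_nome_pow (m : ℕ) : HasNonnegQExpansion (nome ^ m) 0 := by
  refine ⟨fun n => if n = m then 1 else 0, fun n => by dsimp only; split_ifs <;> norm_num,
    fun τ => ?_⟩
  refine (hasSum_ite_eq m (nome τ ^ m)).congr_fun fun n => ?_
  dsimp only
  split_ifs with h
  · subst h; simp [qpow_natCast]
  · simp

/-- The point on the imaginary axis with the same imaginary part. -/
lemma exists_nome_eq_norm (τ : ℍ) : ∃ σ : ℍ, ∀ n : ℕ, qpow (0 + n) σ = ((‖nome τ‖ ^ n : ℝ) : ℂ) := by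
  obtain ⟨σ, hσ⟩ := exists_nome_eq (z := ((‖nome τ‖ : ℝ) : ℂ))
    (by simpa using nome_ne_zero τ) (by simpa using norm_nome_lt_one τ)
  exact ⟨σ, fun n => by rw [zero_add, qpow_natCast, hσ]; push_cast; rfl⟩

/-- A convergent series of functions with nonnegative expansions has a nonnegative expansion. -/
lemma HasNonnegQExpansion.of_tendsto_sum {G : ℕ → ℍ → ℂ} {F : ℍ → ℂ}
    (hG : ∀ N, HasNonnegQExpansion (G N) 0)
    (hF : ∀ τ, Tendsto (fun K => ∑ N ∈ range K, G N τ) atTop (𝓝 (F τ))) :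
    HasNonnegQExpansion F 0 := by
  choose g hg hGg using hG
  -- At the point with nome `‖q‖` all terms are nonnegative, so convergence of the partial sums
  -- bounds them and gives summability of the double series; the order of summation may then be
  -- exchanged at every `τ`.
  have hsum : ∀ τ : ℍ, Summable fun p : ℕ × ℕ => g p.1 p.2 * ‖nome τ‖ ^ p.2 := by
    intro τ
    obtain ⟨σ, hσ⟩ := exists_nome_eq_norm τ
    have h0 : ∀ N n, 0 ≤ g N n * ‖nome τ‖ ^ n := fun N n => mul_nonneg (hg N n) (by positivity)
    have h1 : ∀ N, HasSum (fun n => ((g N n * ‖nome τ‖ ^ n : ℝ) : ℂ)) (G N σ) := fun N =>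
      (hGg N σ).congr_fun fun n => by rw [hσ]; push_cast; rfl
    have h2 : ∀ N, Summable fun n => g N n * ‖nome τ‖ ^ n := fun N =>
      Complex.summable_ofReal.1 (h1 N).summable
    have h3 : ∀ N, G N σ = ((∑' n, g N n * ‖nome τ‖ ^ n : ℝ) : ℂ) := fun N => by
      rw [← (h1 N).tsum_eq, Complex.ofReal_tsum]
    rw [summable_prod_of_nonneg fun p => h0 p.1 p.2]
    refine ⟨h2, ?_⟩
    have ht : Tendsto (fun K => ∑ N ∈ range K, ∑' n, g N n * ‖nome τ‖ ^ n) atTop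
        (𝓝 (F σ).re) := by
      refine ((Complex.continuous_re.tendsto _).comp (hF σ)).congr fun K => ?_
      simp only [Function.comp_apply, h3]
      rw [← Complex.ofReal_sum, Complex.ofReal_re]
    obtain ⟨C, hC⟩ := ht.bddAbove_range
    exact summable_of_sum_range_le (fun N => tsum_nonneg (h0 N)) fun K => hC ⟨K, rfl⟩
  refine ⟨fun n => ∑' N, g N n, fun n => tsum_nonneg fun N => hg N n, fun τ => ?_⟩
  have hs : Summable fun p : ℕ × ℕ => (g p.1 p.2 : ℂ) * qpow (0 + p.2) τ := by
    refine Summable.of_norm ((hsum τ).congr fun p => ?_)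
    rw [norm_mul, zero_add, qpow_natCast, norm_pow, Complex.norm_real,
      Real.norm_of_nonneg (hg _ _)]
  have hS1 : HasSum (fun N => G N τ) (∑' p : ℕ × ℕ, (g p.1 p.2 : ℂ) * qpow (0 + p.2) τ) :=
    hs.hasSum.prod_fiberwise fun N => hGg N τ
  have hS := tendsto_nhds_unique hS1.tendsto_sum_nat (hF τ)
  have hs' := hs.prod_symm
  have hS2 := hs'.hasSum.prod_fiberwise fun n => (hs'.prod_factor n).hasSum
  have e : ∑' p : ℕ × ℕ, (g p.swap.1 p.swap.2 : ℂ) * qpow (0 + p.swap.2) τ =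
      ∑' p : ℕ × ℕ, (g p.1 p.2 : ℂ) * qpow (0 + p.2) τ :=
    (Equiv.prodComm ℕ ℕ).tsum_eq fun p : ℕ × ℕ => (g p.1 p.2 : ℂ) * qpow (0 + p.2) τ
  rw [e, hS] at hS2
  refine hS2.congr_fun fun n => ?_
  dsimp only
  rw [Complex.ofReal_tsum, ← tsum_mul_right]
  rfl

end

/-! ### Nonnegativity of `ψ₁`, `ψ₂` and `ψ₁⁵ - ψ₂⁵` -/

section

open ModularGroup ModularForm
open scoped ModularForm

/-- The factors of the product for `ψ₁`. -/
def factorOne (n : ℕ) : ℍ → ℂ := geom (5 * n + 1) * geom (5 * n + 4)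

/-- The factors of the product for `ψ₂`. -/
def factorTwo (n : ℕ) : ℍ → ℂ := geom (5 * n + 2) * geom (5 * n + 3)

section

variable {f g : ℍ → ℂ}

lemma hasNonnegQExpansion_geom_sub_one {m : ℕ} (hm : m ≠ 0) :
    HasNonnegQExpansion (geom m - 1) 0 := by
  refine ((hasNonnegQExpansion_nome_pow m).mul_zero_exponent (hasNonnegQExpansion_geom hm)).congr
    fun τ => ?_
  have := one_sub_nome_pow_ne_zero hm τ
  simp only [Pi.mul_apply, Pi.pow_apply, Pi.sub_apply, Pi.one_apply, geom]
  field_simp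
  ring

lemma HasNonnegQExpansion.mul_sub_one (hf : HasNonnegQExpansion f 0)
    (hf1 : HasNonnegQExpansion (f - 1) 0) (hg1 : HasNonnegQExpansion (g - 1) 0) :
    HasNonnegQExpansion (f * g - 1) 0 :=
  ((hf.mul_zero_exponent hg1).add hf1).congr fun τ => by
    simp only [Pi.add_apply, Pi.mul_apply, Pi.sub_apply, Pi.one_apply]; ring

lemma HasNonnegQExpansion.pow_five_sub_pow_five {h : ℍ → ℂ} (hf : HasNonnegQExpansion f 0)
    (hg : HasNonnegQExpansion g 0) (hfg : HasNonnegQExpansion (h * (f - g)) 0) :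
    HasNonnegQExpansion (h * (f ^ 5 - g ^ 5)) 0 :=
  (hfg.mul_zero_exponent (((((hf.pow 4).add ((hf.pow 3).mul_zero_exponent hg)).add
    ((hf.pow 2).mul_zero_exponent (hg.pow 2))).add (hf.mul_zero_exponent (hg.pow 3))).add
    (hg.pow 4))).congr fun τ => by
      simp only [Pi.add_apply, Pi.mul_apply, Pi.sub_apply, Pi.pow_apply]; ring

lemma HasNonnegQExpansion.pow_five_sub_one (hf : HasNonnegQExpansion f 0)
    (hf1 : HasNonnegQExpansion (f - 1) 0) : HasNonnegQExpansion (f ^ 5 - 1) 0 :=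
  (HasNonnegQExpansion.pow_five_sub_pow_five (h := 1) hf one
    (hf1.congr fun τ => by simp)).congr fun τ => by simp

end

lemma hasNonnegQExpansion_factorOne (n : ℕ) : HasNonnegQExpansion (factorOne n) 0 :=
  (hasNonnegQExpansion_geom (by omega)).mul_zero_exponent (hasNonnegQExpansion_geom (by omega))

lemma hasNonnegQExpansion_factorTwo (n : ℕ) : HasNonnegQExpansion (factorTwo n) 0 :=
  (hasNonnegQExpansion_geom (by omega)).mul_zero_exponent (hasNonnegQExpansion_geom (by omega))

lemma hasNonnegQExpansion_factorOne_sub_one (n : ℕ) : HasNonnegQExpansion (factorOne n - 1) 0 :=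
  (hasNonnegQExpansion_geom (by omega)).mul_sub_one (hasNonnegQExpansion_geom_sub_one (by omega))
    (hasNonnegQExpansion_geom_sub_one (by omega))

lemma hasNonnegQExpansion_factorTwo_sub_one (n : ℕ) : HasNonnegQExpansion (factorTwo n - 1) 0 :=
  (hasNonnegQExpansion_geom (by omega)).mul_sub_one (hasNonnegQExpansion_geom_sub_one (by omega))
    (hasNonnegQExpansion_geom_sub_one (by omega))

lemma hasNonnegQExpansion_prod {a : ℕ → ℍ → ℂ} (h : ∀ n, HasNonnegQExpansion (a n) 0) (N : ℕ) :
    HasNonnegQExpansion (∏ n ∈ range N, a n) 0 := by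
  induction N with
  | zero => exact HasNonnegQExpansion.one
  | succ N ih => rw [prod_range_succ]; exact ih.mul_zero_exponent (h N)

/-- An infinite product is the sum of the increments `P_N (a_N - 1)` of its partial products, and
these are nonnegative. -/
lemma hasNonnegQExpansion_of_tendsto_prod {a : ℕ → ℍ → ℂ} {F : ℍ → ℂ}
    (h : ∀ n, HasNonnegQExpansion (a n) 0) (h1 : ∀ n, HasNonnegQExpansion (a n - 1) 0)
    (hF : ∀ τ, Tendsto (fun N => (∏ n ∈ range N, a n) τ) atTop (𝓝 (F τ))) :
    HasNonnegQExpansion F 0 := by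
  refine HasNonnegQExpansion.of_tendsto_sum
    (G := fun N => Nat.casesOn N 1 fun N => (∏ n ∈ range N, a n) * (a N - 1)) (fun N => ?_)
    fun τ => ?_
  · cases N with
    | zero => exact HasNonnegQExpansion.one
    | succ N => exact (hasNonnegQExpansion_prod h N).mul_zero_exponent (h1 N)
  · refine (tendsto_add_atTop_iff_nat 1).1 ((hF τ).congr fun K => ?_)
    induction K with
    | zero => simp
    | succ K ih =>
      rw [sum_range_succ, ← ih, prod_range_succ]
      simp only [Pi.mul_apply, Pi.sub_apply, Pi.one_apply]
      ring

lemma tendsto_prod_factorOne (τ : ℍ) :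
    Tendsto (fun N => (∏ n ∈ range N, factorOne n) τ) atTop (𝓝 (psiProd 1 τ)⁻¹) := by
  have hm := (multipliable_one_sub_qpow 1 τ).mul (multipliable_one_sub_qpow (5 - 1) τ)
  have h0 : psiProd 1 τ ≠ 0 := by
    exact_mod_cast psiProd_ne_zero (j := 1) (by norm_num) (by norm_num) τ
  refine (hm.hasProd.tendsto_prod_nat.inv₀ h0).congr fun N => ?_
  rw [Finset.prod_apply, ← prod_inv_distrib]
  refine prod_congr rfl fun n _ => ?_
  rw [factorOne, Pi.mul_apply, geom, geom, mul_inv, ← qpow_natCast, ← qpow_natCast]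
  push_cast
  norm_num

lemma tendsto_prod_factorTwo (τ : ℍ) :
    Tendsto (fun N => (∏ n ∈ range N, factorTwo n) τ) atTop (𝓝 (psiProd 2 τ)⁻¹) := by
  have hm := (multipliable_one_sub_qpow 2 τ).mul (multipliable_one_sub_qpow (5 - 2) τ)
  have h0 : psiProd 2 τ ≠ 0 := by
    exact_mod_cast psiProd_ne_zero (j := 2) (by norm_num) (by norm_num) τ
  refine (hm.hasProd.tendsto_prod_nat.inv₀ h0).congr fun N => ?_
  rw [Finset.prod_apply, ← prod_inv_distrib]
  refine prod_congr rfl fun n _ => ?_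
  rw [factorTwo, Pi.mul_apply, geom, geom, mul_inv, ← qpow_natCast, ← qpow_natCast]
  push_cast
  norm_num

lemma hasNonnegQExpansion_psiProd_one : HasNonnegQExpansion (fun τ => (psiProd 1 τ)⁻¹) 0 :=
  hasNonnegQExpansion_of_tendsto_prod hasNonnegQExpansion_factorOne
    hasNonnegQExpansion_factorOne_sub_one tendsto_prod_factorOne

lemma hasNonnegQExpansion_psiProd_two : HasNonnegQExpansion (fun τ => (psiProd 2 τ)⁻¹) 0 :=
  hasNonnegQExpansion_of_tendsto_prod hasNonnegQExpansion_factorTwo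
    hasNonnegQExpansion_factorTwo_sub_one tendsto_prod_factorTwo

/-! ### The difference of the fifth powers -/

/-- With `x = q ^ (5n)`, the difference has the numerator `x q (1 - q)² (1 + q)` over the common
denominator. The negative signs sit in `(1 - q)²`, which the square of the first factor of the
product for `ψ₁` cancels. -/
lemma factorOne_sub_factorTwo (n : ℕ) (τ : ℍ) :
    factorOne 0 τ ^ 2 * (factorOne n τ - factorTwo n τ) = nome τ ^ (5 * n + 1) * (1 + nome τ) *
      geom 4 τ ^ 2 * (factorOne n τ * factorTwo n τ) := by
  have h1 := one_sub_nome_pow_ne_zero (m := 1) (by norm_num) τ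
  have h4 := one_sub_nome_pow_ne_zero (m := 4) (by norm_num) τ
  have k1 := one_sub_nome_pow_ne_zero (m := 5 * n + 1) (by omega) τ
  have k2 := one_sub_nome_pow_ne_zero (m := 5 * n + 2) (by omega) τ
  have k3 := one_sub_nome_pow_ne_zero (m := 5 * n + 3) (by omega) τ
  have k4 := one_sub_nome_pow_ne_zero (m := 5 * n + 4) (by omega) τ
  simp only [factorOne, factorTwo, Pi.mul_apply, geom, Nat.mul_zero, Nat.zero_add]
  rw [pow_one] at h1 ⊢
  simp only [pow_add _ (5 * n), pow_one] at k1 k2 k3 k4 ⊢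
  generalize nome τ ^ (5 * n) = x at k1 k2 k3 k4 ⊢
  generalize nome τ = w at h1 h4 k1 k2 k3 k4 ⊢
  obtain ⟨u1, e1⟩ : ∃ u, u = 1 - x * w := ⟨_, rfl⟩
  obtain ⟨u2, e2⟩ : ∃ u, u = 1 - x * w ^ 2 := ⟨_, rfl⟩
  obtain ⟨u3, e3⟩ : ∃ u, u = 1 - x * w ^ 3 := ⟨_, rfl⟩
  obtain ⟨u4, e4⟩ : ∃ u, u = 1 - x * w ^ 4 := ⟨_, rfl⟩
  rw [← e1] at k1 ⊢
  rw [← e2] at k2 ⊢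
  rw [← e3] at k3 ⊢
  rw [← e4] at k4 ⊢
  field_simp
  rw [e1, e2, e3, e4]
  ring

lemma factorOne_zero_sub (τ : ℍ) :
    factorOne 0 τ - factorTwo 0 τ = nome τ * geom 3 τ * geom 4 τ := by
  have h1 := one_sub_nome_pow_ne_zero (m := 1) (by norm_num) τ
  have h2 := one_sub_nome_pow_ne_zero (m := 2) (by norm_num) τ
  have h3 := one_sub_nome_pow_ne_zero (m := 3) (by norm_num) τ
  have h4 := one_sub_nome_pow_ne_zero (m := 4) (by norm_num) τ
  simp only [factorOne, factorTwo, Pi.mul_apply, geom, Nat.mul_zero, Nat.zero_add]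
  rw [pow_one] at h1 ⊢
  generalize nome τ = w at h1 h2 h3 h4 ⊢
  field_simp
  ring

lemma hasNonnegQExpansion_one_add_nome : HasNonnegQExpansion (1 + nome ^ 1) 0 :=
  HasNonnegQExpansion.one.add (hasNonnegQExpansion_nome_pow 1)

lemma hasNonnegQExpansion_factor_sub (n : ℕ) :
    HasNonnegQExpansion (factorOne 0 ^ 5 * (factorOne n ^ 5 - factorTwo n ^ 5)) 0 := by
  refine HasNonnegQExpansion.pow_five_sub_pow_five (hasNonnegQExpansion_factorOne n)
    (hasNonnegQExpansion_factorTwo n) ?_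
  refine (((hasNonnegQExpansion_factorOne 0).pow 3).mul_zero_exponent
    ((((hasNonnegQExpansion_nome_pow (5 * n + 1)).mul_zero_exponent
      hasNonnegQExpansion_one_add_nome).mul_zero_exponent
      ((hasNonnegQExpansion_geom (m := 4) (by norm_num)).pow 2)).mul_zero_exponent
      ((hasNonnegQExpansion_factorOne n).mul_zero_exponent (hasNonnegQExpansion_factorTwo n)))).congr
    fun τ => ?_
  have h := factorOne_sub_factorTwo n τ
  simp only [Pi.mul_apply, Pi.pow_apply, Pi.add_apply, Pi.one_apply, Pi.sub_apply, pow_one]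
  linear_combination -factorOne 0 τ ^ 3 * h

/-- With `A`, `B` the first factors, `A⁵ - q B⁵ = (1 - q) A · A⁴ + q (A⁵ - B⁵)`, and `(1 - q) A = (1
- q⁴)⁻¹`. -/
lemma hasNonnegQExpansion_factor_zero :
    HasNonnegQExpansion (factorOne 0 ^ 5 - nome * factorTwo 0 ^ 5) 0 := by
  have h1 : HasNonnegQExpansion (1 * (factorOne 0 ^ 5 - factorTwo 0 ^ 5)) 0 :=
    HasNonnegQExpansion.pow_five_sub_pow_five (hasNonnegQExpansion_factorOne 0)
      (hasNonnegQExpansion_factorTwo 0)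
      ((((hasNonnegQExpansion_nome_pow 1).mul_zero_exponent
        (hasNonnegQExpansion_geom (m := 3) (by norm_num))).mul_zero_exponent
        (hasNonnegQExpansion_geom (m := 4) (by norm_num))).congr fun τ => by
          have h := factorOne_zero_sub τ
          simp only [Pi.mul_apply, Pi.one_apply, Pi.sub_apply, pow_one, one_mul]
          exact h.symm)
  refine (((hasNonnegQExpansion_geom (m := 4) (by norm_num)).mul_zero_exponent
    ((hasNonnegQExpansion_factorOne 0).pow 4)).add
    ((hasNonnegQExpansion_nome_pow 1).mul_zero_exponent h1)).congr fun τ => ?_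
  have h : (1 - nome τ) * factorOne 0 τ = geom 4 τ := by
    have h1 := one_sub_nome_pow_ne_zero (m := 1) (by norm_num) τ
    simp only [factorOne, Pi.mul_apply, geom, Nat.mul_zero, Nat.zero_add, pow_one] at h1 ⊢
    rw [← mul_assoc, mul_inv_cancel₀ h1, one_mul]
  simp only [Pi.mul_apply, Pi.pow_apply, Pi.add_apply, Pi.one_apply, Pi.sub_apply, pow_one]
  linear_combination -factorOne 0 τ ^ 4 * h

/-- The difference of fifth powers of the shifted partial products, multiplied by the first
factor. -/
def shiftedDiff (N : ℕ) : ℍ → ℂ := factorOne 0 ^ 5 *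
  ((∏ n ∈ range N, factorOne (n + 1)) ^ 5 - (∏ n ∈ range N, factorTwo (n + 1)) ^ 5)

lemma shiftedDiff_succ (N : ℕ) : shiftedDiff (N + 1) = factorOne (N + 1) ^ 5 * shiftedDiff N +
    (factorOne 0 ^ 5 * (factorOne (N + 1) ^ 5 - factorTwo (N + 1) ^ 5)) *
      (∏ n ∈ range N, factorTwo (n + 1)) ^ 5 := by
  simp only [shiftedDiff, prod_range_succ]; ring

/-- In the step from `N` to `N + 1` a difference of products becomes a nonnegative multiple of the
old difference plus a difference of single factors; the extra `factorOne 0 ^ 5` makes the latter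
nonnegative. -/
lemma hasNonnegQExpansion_shiftedDiff (N : ℕ) : HasNonnegQExpansion (shiftedDiff N) 0 := by
  have hB := fun N => hasNonnegQExpansion_prod (fun n => hasNonnegQExpansion_factorTwo (n + 1)) N
  induction N with
  | zero =>
    have h0 : shiftedDiff 0 = 0 := by simp [shiftedDiff]
    exact ⟨0, fun _ => le_rfl, h0 ▸ (HasQExpansion.zero 0).congr_coeff fun n => by simp⟩
  | succ N ih =>
    rw [shiftedDiff_succ]
    exact (((hasNonnegQExpansion_factorOne _).pow 5).mul_zero_exponent ih).add
      ((hasNonnegQExpansion_factor_sub _).mul_zero_exponent ((hB N).pow 5))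

/-- The increments of the differences of fifth powers of the partial products. -/
def diffIncrement (N : ℕ) : ℍ → ℂ :=
  (factorOne (N + 1) ^ 5 - 1) * shiftedDiff N +
    (factorOne 0 ^ 5 * (factorOne (N + 1) ^ 5 - factorTwo (N + 1) ^ 5)) *
      (∏ n ∈ range N, factorTwo (n + 1)) ^ 5 +
    (factorOne 0 ^ 5 - nome * factorTwo 0 ^ 5) * ((∏ n ∈ range N, factorTwo (n + 1)) ^ 5 *
      (factorTwo (N + 1) ^ 5 - 1))

lemma hasNonnegQExpansion_diffIncrement (N : ℕ) : HasNonnegQExpansion (diffIncrement N) 0 := by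
  have hB := fun N => hasNonnegQExpansion_prod (fun n => hasNonnegQExpansion_factorTwo (n + 1)) N
  exact (((((hasNonnegQExpansion_factorOne _).pow_five_sub_one
    (hasNonnegQExpansion_factorOne_sub_one _)).mul_zero_exponent
    (hasNonnegQExpansion_shiftedDiff N)).add
    ((hasNonnegQExpansion_factor_sub _).mul_zero_exponent ((hB N).pow 5))).add
    (hasNonnegQExpansion_factor_zero.mul_zero_exponent (((hB N).pow 5).mul_zero_exponent
      ((hasNonnegQExpansion_factorTwo _).pow_five_sub_one
        (hasNonnegQExpansion_factorTwo_sub_one _)))))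

lemma sum_diffIncrement (N : ℕ) : factorOne 0 ^ 5 - nome * factorTwo 0 ^ 5 +
    ∑ K ∈ range N, diffIncrement K = (∏ n ∈ range (N + 1), factorOne n) ^ 5 -
      nome * (∏ n ∈ range (N + 1), factorTwo n) ^ 5 := by
  induction N with
  | zero => simp
  | succ N ih =>
    rw [sum_range_succ, ← add_assoc, ih]
    rw [prod_range_succ' factorOne (N + 1), prod_range_succ' factorTwo (N + 1),
      prod_range_succ' factorOne N, prod_range_succ' factorTwo N, diffIncrement, shiftedDiff,
      prod_range_succ (fun n => factorOne (n + 1)), prod_range_succ (fun n => factorTwo (n + 1))]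
    ring

/-- The difference of fifth powers is the limit of the same expression for partial products, hence
the sum of its nonnegative increments. -/
lemma hasNonnegQExpansion_psi_diff :
    HasNonnegQExpansion (fun τ => (psiProd 1 τ)⁻¹ ^ 5 - nome τ * (psiProd 2 τ)⁻¹ ^ 5) 0 := by
  refine HasNonnegQExpansion.of_tendsto_sum
    (G := fun N => Nat.casesOn N (factorOne 0 ^ 5 - nome * factorTwo 0 ^ 5) diffIncrement)
    (fun N => ?_) fun τ => ?_
  · cases N with
    | zero => exact hasNonnegQExpansion_factor_zero
    | succ N => exact hasNonnegQExpansion_diffIncrement N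
  · refine (tendsto_add_atTop_iff_nat 1).1 (Tendsto.congr (fun K => ?_)
      ((tendsto_add_atTop_iff_nat 1).2 (((tendsto_prod_factorOne τ).pow 5).sub
        (((tendsto_prod_factorTwo τ).pow 5).const_mul (nome τ)))))
    rw [sum_range_succ']
    have := congrFun (sum_diffIncrement K) τ
    simp only [Pi.add_apply, Pi.sub_apply, Pi.mul_apply, Pi.pow_apply, Finset.sum_apply] at this ⊢
    exact this.symm.trans (add_comm _ _)

end

/-! ### `ψ₁`, `ψ₂` as modular functions and the candidates for `m₁ = 24` -/

section

open ModularGroup ModularForm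
open scoped ModularForm

lemma tendsto_tprod_one_sub_qpow {j : ℝ} (hj : 0 < j) :
    Tendsto (fun τ : ℍ => ∏' n : ℕ, (1 - qpow (5 * n + j) τ)) atImInfty (𝓝 1) := by
  have key (n : ℕ) (τ : ℍ) : qpow (5 * n + j) τ = qpow ((5 * n + j : ℝ) : ℂ) τ := by push_cast; rfl
  have h := tendsto_tprod_one_add_of_dominated_convergence (𝓕 := atImInfty)
    (f := fun (τ : ℍ) (n : ℕ) => -qpow (5 * n + j) τ) (g := fun _ => (0 : ℂ))
    (bound := fun n : ℕ => Real.exp (-1) ^ n) ?_ (fun n => ?_) ?_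
  · simpa [← sub_eq_add_neg] using h
  · exact summable_geometric_of_lt_one (Real.exp_nonneg _) (by simp)
  · rw [show (0 : ℂ) = -0 by simp]
    simp_rw [key]
    exact (tendsto_qpow_of_pos (by positivity)).neg
  · have h1 : ∀ᶠ τ : ℍ in atImInfty, 1 ≤ τ.im :=
      (tendsto_comap (f := UpperHalfPlane.im) (x := atTop)).eventually (eventually_ge_atTop 1)
    filter_upwards [h1] with τ hτ n
    rw [norm_neg, key, norm_qpow_ofReal, ← Real.exp_nat_mul]
    refine Real.exp_le_exp.2 ?_
    have h2 : (n : ℝ) * 1 ≤ (2 * π * (5 * n + j)) * τ.im :=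
      mul_le_mul (by nlinarith [Real.pi_gt_three, hj, (Nat.cast_nonneg n : (0 : ℝ) ≤ n)]) hτ
        (by norm_num) (by positivity)
    linarith

lemma tendsto_psiProd {j : ℝ} (hj : 0 < j) (hj5 : j < 5) :
    Tendsto (psiProd j) atImInfty (𝓝 1) := by
  have h := (tendsto_tprod_one_sub_qpow hj).mul (tendsto_tprod_one_sub_qpow (sub_pos.2 hj5))
  refine tendsto_of_eq h (fun τ => ?_) (one_mul 1)
  rw [psiProd_eq_mul]; push_cast; rfl

lemma HasNonnegQExpansion.hasMonicQExpansion {f : ℍ → ℂ} {r : ℂ} (hf : HasNonnegQExpansion f r)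
    (h : Tendsto (fun τ => qpow (-r) τ * f τ) atImInfty (𝓝 1)) : HasMonicQExpansion f r := by
  obtain ⟨a, -, ha⟩ := hf
  exact ⟨_, ha, tendsto_nhds_unique ha.tendsto h⟩

lemma hasMonicQExpansion_psi1 : HasMonicQExpansion psi1 (-1 / 60) := by
  have h := (hasNonnegQExpansion_psiProd_one.qpow_mul (-1 / 60)).congr
    (g := psi1) fun τ => (psi1_eq τ).symm
  rw [add_zero] at h
  refine h.hasMonicQExpansion ?_
  have h1 := (tendsto_psiProd (j := 1) (by norm_num) (by norm_num)).inv₀ one_ne_zero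
  refine tendsto_of_eq h1 (fun τ => ?_) inv_one
  rw [psi1_eq, ← mul_assoc, ← qpow_add]; simp

lemma hasMonicQExpansion_psi2 : HasMonicQExpansion psi2 (11 / 60) := by
  have h := (hasNonnegQExpansion_psiProd_two.qpow_mul (11 / 60)).congr
    (g := psi2) fun τ => (psi2_eq τ).symm
  rw [add_zero] at h
  refine h.hasMonicQExpansion ?_
  have h1 := (tendsto_psiProd (j := 2) (by norm_num) (by norm_num)).inv₀ one_ne_zero
  refine tendsto_of_eq h1 (fun τ => ?_) inv_one
  rw [psi2_eq, ← mul_assoc, ← qpow_add]; simp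

lemma isModularFunction_psi (i : Fin 2) : IsModularFunction 60 ((![psi1, psi2] : Fin 2 → ℍ → ℂ) i) := by
  obtain ⟨a, ha, -⟩ := exists_hasQExpansion_family (f := ![psi1, psi2])
    (r := ![-1 / 60, 11 / 60]) fun i => by
      fin_cases i
      · exact hasMonicQExpansion_psi1.congr_exponent (by simp)
      · exact hasMonicQExpansion_psi2.congr_exponent (by simp)
  refine isModularFunction_of_hasQExpansion
    (M := !![psiCoeff, psiCoeff * psiRatio; psiCoeff * psiRatio, -psiCoeff]) ha (fun i τ => ?_)
    (fun γ hγ i τ => ?_) i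
  · rw [Fin.sum_univ_two]
    fin_cases i
    · refine (psi1_S τ).trans ?_
      simp; ring
    · refine (psi2_S τ).trans ?_
      simp; ring
  · fin_cases i
    · exact psi1_smul hγ τ
    · exact psi2_smul hγ τ

theorem isModularFunction_psi1 : IsModularFunction 60 psi1 := isModularFunction_psi 0

theorem isModularFunction_psi2 : IsModularFunction 60 psi2 := isModularFunction_psi 1

/-- The three solutions for `m₁ = 24`. -/
def basisFive : Fin 3 → ℍ → ℂ :=
  ![psi1 ^ 10 + 14 * psi1 ^ 5 * psi2 ^ 5 - psi2 ^ 10,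
    psi1 ^ 3 * psi2 ^ 2 * (psi1 ^ 5 + 2 * psi2 ^ 5),
    psi1 ^ 2 * psi2 ^ 3 * (psi1 ^ 5 - (1 / 2 : ℂ) • psi2 ^ 5)]

lemma hasMonicQExpansion_basisFive (i : Fin 3) : HasMonicQExpansion (basisFive i)
    (((![-1 / 6, 7 / 30, 13 / 30] : Fin 3 → ℝ) i : ℝ) : ℂ) := by
  have hu := hasMonicQExpansion_psi1
  have hv := hasMonicQExpansion_psi2
  have u5 := hu.pow (n := 5) (by norm_num)
  have v5 := hv.pow (n := 5) (by norm_num)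
  have e0 : basisFive 0 = psi1 ^ 10 + (14 : ℂ) • (psi1 ^ 5 * psi2 ^ 5) + (-1 : ℂ) • psi2 ^ 10 := by
    funext τ
    simp only [basisFive, Matrix.cons_val_zero, Pi.mul_apply, Pi.add_apply, Pi.sub_apply,
      Pi.smul_apply, Pi.pow_apply, Pi.ofNat_apply, smul_eq_mul]
    ring
  have e1 : basisFive 1 = psi1 ^ 3 * psi2 ^ 2 * (psi1 ^ 5 + (2 : ℂ) • psi2 ^ 5) := by
    funext τ
    simp only [basisFive, Matrix.cons_val_one, Matrix.cons_val_zero, Pi.mul_apply, Pi.add_apply,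
      Pi.smul_apply, Pi.pow_apply, Pi.ofNat_apply, smul_eq_mul]
  have e2 : basisFive 2 = psi1 ^ 2 * psi2 ^ 3 * (psi1 ^ 5 + (-1 / 2 : ℂ) • psi2 ^ 5) := by
    funext τ
    simp only [basisFive, Matrix.cons_val, Pi.mul_apply, Pi.add_apply, Pi.sub_apply,
      Pi.smul_apply, Pi.pow_apply, smul_eq_mul]
    ring
  fin_cases i
  · exact e0 ▸ (((hu.pow (n := 10) (by norm_num)).add_smul (u5.mul v5) 0 (by norm_num) 14).add_smul
      (hv.pow (n := 10) (by norm_num)) 1 (by norm_num) (-1)).congr_exponent (by norm_num)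
  · exact e1 ▸ (((hu.pow (n := 3) (by norm_num)).mul (hv.pow (n := 2) (by norm_num))).mul
      (u5.add_smul v5 0 (by norm_num) 2)).congr_exponent (by norm_num)
  · exact e2 ▸ (((hu.pow (n := 2) (by norm_num)).mul (hv.pow (n := 3) (by norm_num))).mul
      (u5.add_smul v5 0 (by norm_num) (-1 / 2))).congr_exponent (by norm_num)

lemma basisFive_S (i : Fin 3) (τ : ℍ) : basisFive i (S • τ) = ∑ j,
    (!![(2 * psiRatio + 1) / 5, 4 * psiRatio + 2, 8 * psiRatio + 4;
      (2 * psiRatio + 1) / 25, (2 - psiRatio) / 5, (-2 * psiRatio - 6) / 5;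
      (2 * psiRatio + 1) / 50, (-psiRatio - 3) / 10, (2 - psiRatio) / 5] :
      Matrix (Fin 3) (Fin 3) ℂ) i j * basisFive j τ := by
  have f0 (τ) : basisFive 0 τ = psi1 τ ^ 10 + 14 * psi1 τ ^ 5 * psi2 τ ^ 5 - psi2 τ ^ 10 := rfl
  have f1 (τ) : basisFive 1 τ = psi1 τ ^ 3 * psi2 τ ^ 2 * (psi1 τ ^ 5 + 2 * psi2 τ ^ 5) := rfl
  have f2 (τ) : basisFive 2 τ = psi1 τ ^ 2 * psi2 τ ^ 3 * (psi1 τ ^ 5 - 1 / 2 * psi2 τ ^ 5) := rfl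
  rw [Fin.sum_univ_three]
  fin_cases i <;>
  simp only [Fin.mk_zero, Fin.mk_one, Fin.reduceFinMk, Fin.isValue, Matrix.of_apply,
    Matrix.cons_val', Matrix.cons_val_zero, Matrix.cons_val_one, Matrix.cons_val,
    f0, f1, f2, psi1_S, psi2_S]
  · exact icosahedral_zero psiRatio_relation psiCoeff_sq
  · exact icosahedral_one psiRatio_relation psiCoeff_sq
  · exact icosahedral_two psiRatio_relation psiCoeff_sq

end

/-! ### Nonnegative expansions and the basis for `m₁ = 24` -/

section

open ModularGroup ModularForm
open scoped ModularForm

theorem hasNonnegQExpansion_psi_pow_five_sub :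
    HasNonnegQExpansion (psi1 ^ 5 - psi2 ^ 5) (-1 / 12) := by
  refine ((hasNonnegQExpansion_psi_diff.qpow_mul (-1 / 12)).congr_exponent (by simp)).congr
    fun τ => ?_
  simp only [Pi.sub_apply, Pi.pow_apply, psi1_eq, psi2_eq, mul_pow, ← qpow_nat_mul]
  -- The exponents of `ψ₁⁵` and `ψ₂⁵` differ by exactly 1, which accounts for the factor `nome τ` in
  -- the product form.
  rw [show ((5 : ℕ) * (11 / 60) : ℂ) = -1 / 12 + 1 by norm_num, qpow_add,
    show ((5 : ℕ) * (-1 / 60) : ℂ) = -1 / 12 by norm_num]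
  ring

lemma hasNonnegQExpansion_psi1 : HasNonnegQExpansion psi1 (-1 / 60) :=
  ((hasNonnegQExpansion_psiProd_one.qpow_mul (-1 / 60)).congr_exponent (by simp)).congr
    fun τ => (psi1_eq τ).symm

lemma hasNonnegQExpansion_psi2 : HasNonnegQExpansion psi2 (11 / 60) :=
  ((hasNonnegQExpansion_psiProd_two.qpow_mul (11 / 60)).congr_exponent (by simp)).congr
    fun τ => (psi2_eq τ).symm

lemma HasNonnegQExpansion.unshift {f : ℍ → ℂ} {r : ℂ} (hf : HasNonnegQExpansion f (r + 1)) :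
    HasNonnegQExpansion f r := by
  refine (((hasNonnegQExpansion_nome_pow 1).mul (hf.qpow_mul (-1))).congr_exponent (by ring)).congr
    fun τ => ?_
  simp only [Pi.mul_apply, pow_one]
  rw [← mul_assoc, ← qpow_add]
  simp

lemma HasNonnegQExpansion.pow_succ {f : ℍ → ℂ} {r : ℂ} (hf : HasNonnegQExpansion f r) (n : ℕ) :
    HasNonnegQExpansion (f ^ (n + 1)) ((n + 1) * r) := by
  induction n with
  | zero => simpa using hf
  | succ n ih =>
    rw [_root_.pow_succ]
    exact (ih.mul hf).congr_exponent (by push_cast; ring)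

/-- The minus signs are absorbed by the nonnegative difference `ψ₁⁵ - ψ₂⁵`: with `X = ψ₁⁵` and `Y =
ψ₂⁵`, `X² + 14 X Y - Y² = (X - Y)(X + Y) + 14 X Y` and `X - Y/2 = (X - Y) + Y/2`. -/
lemma hasNonnegQExpansion_basisFive (i : Fin 3) : HasNonnegQExpansion (basisFive i)
    (((![-1 / 6, 7 / 30, 13 / 30] : Fin 3 → ℝ) i : ℝ) : ℂ) := by
  have hu := hasNonnegQExpansion_psi1
  have hv := hasNonnegQExpansion_psi2
  have hd := hasNonnegQExpansion_psi_pow_five_sub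
  have hu5 : HasNonnegQExpansion (psi1 ^ 5) (-1 / 12) :=
    (hu.pow_succ 4).congr_exponent (by norm_num)
  have hv5 : HasNonnegQExpansion (psi2 ^ 5) (-1 / 12) :=
    ((hv.pow_succ 4).congr_exponent (s := -1 / 12 + 1) (by norm_num)).unshift
  fin_cases i
  · refine (((hd.mul (hu5.add hv5)).add ((hu5.mul hv5).smul (c := 14) (by norm_num))).congr
      fun τ => ?_).congr_exponent (by norm_num)
    simp only [basisFive, Fin.zero_eta, Matrix.cons_val_zero, Pi.mul_apply, Pi.add_apply,
      Pi.sub_apply, Pi.smul_apply, Pi.pow_apply, Pi.ofNat_apply, smul_eq_mul]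
    push_cast
    ring
  · refine ((((hu.pow_succ 2).mul (hv.pow_succ 1)).mul
      (hu5.add (hv5.smul (c := 2) (by norm_num)))).congr fun τ => ?_).congr_exponent (by norm_num)
    simp only [basisFive, Fin.mk_one, Matrix.cons_val_one, Matrix.cons_val_zero, Pi.mul_apply,
      Pi.add_apply, Pi.smul_apply, Pi.pow_apply, Pi.ofNat_apply, smul_eq_mul]
    push_cast
    ring
  · refine ((((hu.pow_succ 1).mul (hv.pow_succ 2)).mul
      (hd.add (hv5.smul (c := 1 / 2) (by norm_num)))).congr fun τ => ?_).congr_exponent (by norm_num)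
    simp only [basisFive, Fin.reduceFinMk, Matrix.cons_val, Pi.mul_apply, Pi.add_apply,
      Pi.sub_apply, Pi.smul_apply, Pi.pow_apply, smul_eq_mul]
    push_cast
    ring

theorem exists_basis_levelFive : ∃ f : Fin 3 → ℍ → ℂ, IsBasisOfSolutions (-1 / 100) (91 / 5400) f ∧
      f 0 = psi1 ^ 10 + 14 * psi1 ^ 5 * psi2 ^ 5 - psi2 ^ 10 ∧
      f 1 = psi1 ^ 3 * psi2 ^ 2 * (psi1 ^ 5 + 2 * psi2 ^ 5) ∧
      f 2 = psi1 ^ 2 * psi2 ^ 3 * (psi1 ^ 5 - (1 / 2 : ℂ) • psi2 ^ 5) ∧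
      QExpansionStarts (f 0) (-1 / 6) [1, 24, 124, 500, 1625, 4752] ∧
      QExpansionStarts (f 1) (7 / 30) [1, 10, 44, 164, 505, 1414] ∧
      QExpansionStarts (f 2) (13 / 30) [1, 13 / 2, 30, 205 / 2, 314, 1713 / 2] ∧
      HasNonnegQExpansion (psi1 ^ 5 - psi2 ^ 5) (-1 / 12) ∧
      HasNonnegQExpansion (f 0) (-1 / 6) ∧ HasNonnegQExpansion (f 1) (7 / 30) ∧
      HasNonnegQExpansion (f 2) (13 / 30) := by
  obtain ⟨a, ha, a0⟩ := exists_hasQExpansion_family hasMonicQExpansion_basisFive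
  have hB : IsBasisOfSolutions (-1 / 100) (91 / 5400) basisFive := by
    refine isBasisOfSolutions_of_modular ha (fun i => by simp [a0]) ?_ ?_ ?_ basisFive_S
    · intro i j h; fin_cases i <;> fin_cases j <;> first | rfl | (exfalso; revert h; norm_num)
    · simp; norm_num
    · intro i; fin_cases i <;> norm_num [ind]
  have hs : ∀ i, basisFive i ∈ solutions (-1 / 100) (91 / 5400) := fun i =>
    hB.2 ▸ Submodule.subset_span ⟨i, rfl⟩
  refine ⟨basisFive, hB, rfl, rfl, rfl, ?_, ?_, ?_, hasNonnegQExpansion_psi_pow_five_sub,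
    (hasNonnegQExpansion_basisFive 0).congr_exponent (by simp),
    (hasNonnegQExpansion_basisFive 1).congr_exponent (by simp),
    (hasNonnegQExpansion_basisFive 2).congr_exponent (by simp)⟩
  · refine ((ha 0).congr_exponent (s := -1 / 6) (by norm_num)).qExpansionStarts (hs 0) _ (a0 0) ?_
    intro n hn h0; simp only [List.length_cons, List.length_nil] at hn
    interval_cases n <;> simp [opCoeff_eq, sum_range_succ, opKernel_one, opKernel_two,
      opKernel_three, opKernel_four, opKernel_five, ind] at h0 ⊢ <;> norm_num
  · refine ((ha 1).congr_exponent (s := 7 / 30) (by norm_num)).qExpansionStarts (hs 1) _ (a0 1) ?_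
    intro n hn h0; simp only [List.length_cons, List.length_nil] at hn
    interval_cases n <;> simp [opCoeff_eq, sum_range_succ, opKernel_one, opKernel_two,
      opKernel_three, opKernel_four, opKernel_five, ind] at h0 ⊢ <;> norm_num
  · refine ((ha 2).congr_exponent (s := 13 / 30) (by simp)).qExpansionStarts (hs 2) _ (a0 2) ?_
    intro n hn h0; simp only [List.length_cons, List.length_nil] at hn
    interval_cases n <;> simp [opCoeff_eq, sum_range_succ, opKernel_one, opKernel_two,
      opKernel_three, opKernel_four, opKernel_five, ind] at h0 ⊢ <;> norm_num

end

end MLDE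

end

/-! ### The main theorem, assembled from its cases -/

theorem mainTheorem4 :
    -- the classification
    (∀ (x y : ℂ) (f : ℍ → ℂ) (a : ℕ → ℂ), f ∈ solutions x y → HasQExpansion f (-1 / 6) a →
      a 0 = 1 → (∃ m₁ : ℕ, a 1 = m₁) → (∃ m₂ : ℕ, a 2 = m₂) →
      (∀ t ∈ (indicial x y).roots, ∃ r : ℚ, t = r) →
      (a 1 = 16 ∧ a 2 = 98 ∧ x = -1 / 36 ∧ y = 1 / 72 ∧
          (indicial x y).roots = {-1 / 6, 1 / 6, 1 / 2}) ∨
      (a 1 = 24 ∧ a 2 = 124 ∧ x = -1 / 100 ∧ y = 91 / 5400 ∧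
          (indicial x y).roots = {-1 / 6, 7 / 30, 13 / 30}) ∨
      (a 1 = 28 ∧ a 2 = 134 ∧ x = 0 ∧ y = 1 / 54 ∧
          (indicial x y).roots = {-1 / 6, 1 / 3, 1 / 3}) ∨
      (a 1 = 156 ∧ a 2 = 6790 ∧ x = -1 ∧ y = -4 / 27 ∧
          (indicial x y).roots = {-2 / 3, -1 / 6, 4 / 3}) ∨
      (a 1 = 178 ∧ a 2 = 4634 ∧ x = -25 / 36 ∧ y = -7 / 72 ∧
          (indicial x y).roots = {-1 / 2, -1 / 6, 7 / 6}) ∨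
      (a 1 = 271 ∧ a 2 = 4076 ∧ x = -81 / 196 ∧ y = -533 / 10584 ∧
          (indicial x y).roots = {-13 / 42, -1 / 6, 41 / 42})) ∧
    -- modularity of the functions used to describe the solutions
    ((∃ F : ModularForm Γ(2) 2, ⇑F = H2) ∧ (∃ F : ModularForm Γ(2) 2, ⇑F = Delta2) ∧
      (∃ F : ModularForm Γ(3) 1, ⇑F = I3) ∧ (∃ F : ModularForm Γ(3) 1, ⇑F = Delta3) ∧
      (∃ F : ModularForm Γ(6) 2, ⇑F = dedekindEta ^ 4) ∧
      (∃ F : CuspForm (CongruenceSubgroup.Gamma0 2) 8, ⇑F = Delta2A) ∧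
      (∃ F : CuspForm (CongruenceSubgroup.Gamma0 3) 6, ⇑F = Delta3A) ∧
      IsModularFunction 60 psi1 ∧ IsModularFunction 60 psi2) ∧
    -- `m₁ = 16`
    (∃ f : Fin 3 → ℍ → ℂ, IsBasisOfSolutions (-1 / 36) (1 / 72) f ∧
      f 0 = I3 ^ 2 / dedekindEta ^ 4 ∧ f 1 = I3 * Delta3 / dedekindEta ^ 4 ∧ f 2 = Delta3 ^ 2 / dedekindEta ^ 4 ∧
      QExpansionStarts (f 0) (-1 / 6) [1, 16, 98, 364, 1221] ∧
      QExpansionStarts (f 1) (1 / 6) [1, 11, 50, 188, 583] ∧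
      QExpansionStarts (f 2) (1 / 2) [1, 6, 27, 92, 279] ∧
      ∀ i, IsModularFunction 6 (f i)) ∧
    -- `m₁ = 24`
    (∃ f : Fin 3 → ℍ → ℂ, IsBasisOfSolutions (-1 / 100) (91 / 5400) f ∧
      f 0 = psi1 ^ 10 + 14 * psi1 ^ 5 * psi2 ^ 5 - psi2 ^ 10 ∧
      f 1 = psi1 ^ 3 * psi2 ^ 2 * (psi1 ^ 5 + 2 * psi2 ^ 5) ∧
      f 2 = psi1 ^ 2 * psi2 ^ 3 * (psi1 ^ 5 - (1 / 2 : ℂ) • psi2 ^ 5) ∧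
      QExpansionStarts (f 0) (-1 / 6) [1, 24, 124, 500, 1625, 4752] ∧
      QExpansionStarts (f 1) (7 / 30) [1, 10, 44, 164, 505, 1414] ∧
      QExpansionStarts (f 2) (13 / 30) [1, 13 / 2, 30, 205 / 2, 314, 1713 / 2] ∧
      HasNonnegQExpansion (psi1 ^ 5 - psi2 ^ 5) (-1 / 12) ∧
      HasNonnegQExpansion (f 0) (-1 / 6) ∧ HasNonnegQExpansion (f 1) (7 / 30) ∧
      HasNonnegQExpansion (f 2) (13 / 30)) ∧
    -- `m₁ = 28`
    ((∃ f : Fin 3 → ℍ → ℂ, IsBasisOfSolutions 0 (1 / 54) f ∧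
        f 0 = H2 / dedekindEta ^ 4 ∧ f 1 = Delta2 / dedekindEta ^ 4 ∧
        f 2 = (16 : ℂ) • (Delta2 / dedekindEta ^ 4 * qPrimitive 1 H2 - H2 / dedekindEta ^ 4 * qPrimitive 0 Delta2) ∧
        QExpansionStarts (f 0) (-1 / 6) [1, 28, 134, 568, 1809] ∧
        QExpansionStarts (f 1) (1 / 3) [1, 8, 36, 128, 394] ∧
        QExpansionStarts (fun τ => f 2 τ - 16 * (2 * π * I * τ) * f 1 τ) (1 / 3)
          [-32, -1664 / 3, -33856 / 15]) ∧
      (¬ ∃ f : Fin 3 → ℍ → ℂ, IsBasisOfSolutions 0 (1 / 54) f ∧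
        ∀ i, ∃ (r : ℂ) (a : ℕ → ℂ), HasQExpansion (f i) r a) ∧
      ∀ (V : Type u) [AddCommGroup V] [Module ℂ V] (A : VOA V),
        Submodule.span ℂ A.simpleCharacters ≠ solutions 0 (1 / 54)) ∧
    -- `m₁ = 156`
    (∃ f : Fin 3 → ℍ → ℂ, IsBasisOfSolutions (-1) (-4 / 27) f ∧
      f 0 = H2 * Delta2 * (H2 ^ 2 + 64 * Delta2 ^ 2) / dedekindEta ^ 16 ∧
      f 1 = (H2 ^ 4 + 384 * Delta2A + 14304 * Delta2 ^ 4) / dedekindEta ^ 16 ∧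
      f 2 = Delta2 ^ 4 / dedekindEta ^ 16 ∧
      QExpansionStarts (f 0) (-1 / 6) [1, 156, 6790, 142136, 1897233] ∧
      QExpansionStarts (f 1) (-2 / 3) [1, 496, 22616, 606656, 9782812] ∧
      QExpansionStarts (f 2) (4 / 3) [1, 32, 528, 6016, 53384]) ∧
    -- `m₁ = 178`
    (∃ f : Fin 3 → ℍ → ℂ, IsBasisOfSolutions (-25 / 36) (-7 / 72) f ∧
      f 0 = I3 ^ 2 * Delta3 * (I3 ^ 3 + 135 * Delta3 ^ 3) / dedekindEta ^ 12 ∧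
      f 1 = (I3 ^ 6 + 270 * Delta3A + 5832 * Delta3 ^ 6) / dedekindEta ^ 12 ∧
      f 2 = I3 * Delta3 ^ 5 / dedekindEta ^ 12 ∧
      QExpansionStarts (f 0) (-1 / 6) [1, 178, 4634, 61924, 566277] ∧
      QExpansionStarts (f 1) (-1 / 2) [1, 318, 8514, 126862, 1269771] ∧
      QExpansionStarts (f 2) (7 / 6) [1, 23, 272, 2286, 15318]) ∧
    -- `m₁ = 271`
    ((∃ f : Fin 3 → ℍ → ℂ, IsBasisOfSolutions (-81 / 196) (-533 / 10584) f ∧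
        QExpansionStarts (f 0) (-1 / 6) [1, 271, 4076, 30862, 5029533 / 29] ∧
        QExpansionStarts (f 1) (-13 / 42) [1, 1742 / 7, 188850 / 49, 10279088 / 343] ∧
        QExpansionStarts (f 2) (41 / 42)
          [1, 205 / 14, 5289 / 49, 5921425 / 9947, 186843109 / 69629]) ∧
      (¬ ∃ f ∈ solutions (-81 / 196) (-533 / 10584), IsOfVacuumCharacterType f) ∧
      ∀ (V : Type u) [AddCommGroup V] [Module ℂ V] (A : VOA V), A.IsCFTType →
        ∀ f : ℍ → ℂ, A.IsVacuumCharacter f → f ∉ solutions (-81 / 196) (-533 / 10584)) := by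
  exact ⟨classification,
    ⟨exists_modularForm_H2, exists_modularForm_Delta2, exists_modularForm_I3,
      exists_modularForm_Delta3, exists_modularForm_eta_pow_four, exists_cuspForm_Delta2A,
      exists_cuspForm_Delta3A, isModularFunction_psi1, isModularFunction_psi2⟩,
    exists_basis_levelThree_sixteen, exists_basis_levelFive,
    ⟨exists_basis_log, not_exists_qSeries_basis_log,
      fun V _ _ A => span_simpleCharacters_ne_log V A⟩,
    exists_basis_levelTwo, exists_basis_levelThree,
    ⟨exists_basis_nonintegral, fun ⟨_, hf, h⟩ => not_isOfVacuumCharacterType_nonintegral hf h,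
      fun _ _ _ _ hA _ hf hs =>
        not_isOfVacuumCharacterType_nonintegral hs (hf.isOfVacuumCharacterType hA)⟩⟩
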